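/- Let $d\in\{2,3\}$. **Scattering data.** Let $v:\mathbb R^d\to[0,\infty)$ be radial, in $L^2(\mathbb R^d)$, supported in the ball $\{|x|\le R\}$, with scattering length $a>0$; that is, for every $\widetilde R>R$ the infimum of $\int_{B(0,\widetilde R)}(|\nabla\varphi|^2+\frac12v\varphi^2)$ over $\varphi\in H^1(B(0,\widetilde R))$ with $\varphi=1$ on $\partial B(0,\widetilde R)$ equals $\frac{2\pi}{\log(\widetilde R/a)}$ if $d=2$ and $\frac{4\pi a}{1-a/\widetilde R}$ if $d=3$. Let $\varphi^0\in H^1_{\rm loc}$ be the solution of $-\Delta\varphi^0+\frac12v\varphi^0=0$ (in the sense of distributions) with $\varphi^0(x)=\log(|x|/a)$ ($d=2$), resp. $\varphi^0(x)=1-a/|x|$ ($d=3$), for $|x|\ge R$. For $\rho>0$ put $\delta=|\log(\rho a^2|\log(\rho a^2)|^{-1})|^{-1}$; $\varphi=2\delta\varphi^0$ if $d=2$ and $\varphi=\varphi^0$ if $d=3$; $\omega=1-\varphi$, $g=v\varphi$. For $K_\ell>0$ let $\ell=K_\ell(\rho\int_{\mathbb R^d} g)^{-1/2}$, $\Lambda=[-\ell/2,\ell/2]^d$,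 $\Lambda^*=\frac{2\pi}\ell\mathbb Z^d$, $N=\rho\ell^d$, and let $\widehat f(k)=\int_\Lambda f(x)e^{-ikx}dx$ be the Fourier coefficients at $k\in\Lambda^*$. Set $\lambda_2(\rho')=\delta$, $\lambda_3(\rho')=\sqrt{\rho'a^3}$, and, $\Gamma$ being the Euler–Mascheroni constant, $$E^{\rm LHY}_d(\rho')=\tfrac{(\rho')^2}{2}|\Lambda|\,\widehat g(0)\,\lambda_d(\rho')\,I_d,$$ $$I_d=\Big(\frac2\pi\Big)^{d/2}\int_{\mathbb R^d}\Big(\sqrt{(t^2+1)^2-1}-t^2-1+\frac{1}{2t^2}\big(1-\mathbb 1_d(\sqrt{2\pi}e^{\Gamma}|t|)\big)\Big)dt,$$ where $\mathbb 1_2(s)=\mathbb 1_{\{|s|\le1\}}$ and $\mathbb 1_3=0$. **Parameters.** Let $\sigma=\delta$ if $d=2$ and $\sigma=\rho a^3$ if $d=3$. For fixed constants $C_0,\zeta>0$, $A\ll B$ means $A\le C_0\sigma^\zeta B$. Let $\lambda_d=\lambda_d(\rho)$, $\ell_\delta=\frac a2e^{1/(2\delta)}e^\Gamma$, and $\mathcal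 E_2=R^2\ell_\delta^{-2}\widehat g(0)^2+\widehat g(0)^2|\log(K_H\ell_\delta\ell^{-1})|$, $\mathcal E_3=\widehat g(0)^2K_H\ell^{-1}$. The positive parameters $K_\ell,K_L,K_H,\mathcal M,\varepsilon_K,\varepsilon_{\rm gap}$ are assumed to satisfy $R\le\ell/4$ and - $\varepsilon_K,\varepsilon_{\rm gap}\ll1\ll\mathcal M,K_\ell,K_L,K_H$; $K_\ell\ll K_\ell^4\ll K_L\ll K_H$; - $\ell\rho^{1/2}K_H^{1/2}\|v\|_1^{1/2}\ll\mathcal M$; $\ell^2\rho^2|\Lambda|\widehat g(0)\lambda_d\ll\mathcal M$; $\mathcal M/N\ll(K_\ell/K_L)^4$; $\frac{\mathcal M}NK_H^d\ll1$; - $\ell^{8-d}\rho^3\widehat g(0)^4K_H^{-8}K_L^d\mathcal M\ll\varepsilon_K^2$; $\ell^{4-d}\rho\widehat g(0)^2K_H^{-2}K_L^d\mathcal M\ll K_\ell^2$; - $\rho^3\widehat g(0)^4\ell^{8-d}K_H^{d-6}\ll\varepsilon_{\rm gap}$; $\varepsilon_K\ell^2\rho\widehat g(0)+\mathcal E_d\ell^2\rho+K_\ell^2K_H^{-1}\ll\varepsilon_{\rm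 gap}$; $\frac R\ell K_L\ell^2\rho\widehat g(0)\ll\varepsilon_{\rm gap}$; - $K_\ell\ll\delta^{-1/26}$ if $d=2$; $K_\ell\ll(\rho a^3)^{-1/28}$ if $d=3$. Let $\varepsilon_+=\max\{K_\ell^2K_L^{-1},\lambda_d^{1/2}\}$. **Operators.** Let $a_k,a_k^\dagger$ be the annihilation and creation operators of the plane waves of momentum $k\in\Lambda^*\setminus\{0\}$ on the bosonic Fock space over the orthogonal complement of the constants in $L^2(\Lambda)$. For $z\in\mathbb C$ let $\rho_z=|z|^2/|\Lambda|$, $\mathcal A_k=k^2+\rho_z\widehat g(k)$, $\mathcal B_k=\rho_z\widehat g(k)$, $$\mathcal Q(z)=\tfrac12\rho_z^2|\Lambda|\big(\widehat g(0)+\widehat{g\omega}(0)\big)+\tfrac12\sum_{k\ne0}\mathcal A_k\big(a_k^\dagger a_k+a_{-k}^\dagger a_{-k}\big)+\tfrac12\sum_{k\neq0}\mathcal B_k\big(a_k^\dagger a_{-k}^\dagger+a_ka_{-k}\big),$$ $$\mathcal D_k=\sqrt{k^4+2k^2\rho_z\widehat g(k)},\qquad \alpha_k=\frac{k^2+\rho_z\widehat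 g(k)-\mathcal D_k}{\rho_z\widehat g(k)},\qquad b_k=\frac{a_k+\alpha_ka_{-k}^\dagger}{\sqrt{1-\alpha_k^2}}$$ ($\alpha_k=0$ if $\widehat g(k)=0$). **Proposition.** There is a $c>0$, depending only on $d,C_0,\zeta$, and for every $M$ there is a $C>0$, depending only on $d,C_0,\zeta,M$, such that, whenever $\|v\|_{L^1},\|v\|_{L^2}\le M$, $\rho a^d\le c$ and the relations between the parameters hold, there is a real function $\mathcal R_1$ of the density with the following properties for all $z\in\mathbb C$ with $|\rho-\rho_z|\le\rho\varepsilon_+$. For all $k\in\Lambda^*\setminus\{0\}$, $k^4+2k^2\rho_z\widehat g(k)>0$ and $|\alpha_k|<1$. As an identity of forms on the form domain of the kinetic energy $\sum_{k\ne0}k^2a_k^\dagger a_k$ (on which all the series converge absolutely), $$\mathcal Q(z)=\tfrac12\rho_z^2|\Lambda|\widehat g(0)+E^{\rm LHY}_d(\rho_z)+\sum_{k\neq0}\mathcal D_kb_k^\dagger b_k+\mathcal R_1(\rho_z),$$ and $$|\mathcal R_1(\rho_z)|\le\begin{cases}C|\Lambda|\rho_z^2\delta^2K_\ell^{-1},&d=2,\\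 C|\Lambda|\rho_z^2a(\rho_za^3)^{1/2}\max\{1,|\log\rho_z|\}K_\ell^{-1},&d=3.\end{cases}$$ -/

import Mathlib

open MeasureTheory
open scoped ENNReal ContDiff ComplexConjugate

noncomputable section

namespace BoseGas

/-- Euclidean space `ℝ^d`. -/
abbrev Space (d : ℕ) := EuclideanSpace ℝ (Fin d)

/-! ### Weak gradients, scattering length and scattering solution -/

/-- `G` is the weak (distributional) gradient of `φ` on `ℝ^d`. -/
def HasWeakGradient {d : ℕ} (φ : Space d → ℝ) (G : Space d → Space d) : Prop :=
  LocallyIntegrable φ volume ∧ LocallyIntegrable G volume ∧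
    ∀ η : Space d → ℝ, ContDiff ℝ ∞ η → HasCompactSupport η →
      ∫ x, φ x • gradient η x = - ∫ x, η x • G x

/-- `φ`, with weak gradient `G`, is in `H¹` of the ball of radius `r` and equals `1` on its
boundary.  Such `φ` is extended by `1`: a function in `H¹` of a ball has trace `1` on the boundary
if and only if its extension by `1` has a square integrable weak gradient on `ℝ^d`. -/
def IsTrial {d : ℕ} (r : ℝ) (φ : Space d → ℝ) (G : Space d → Space d) : Prop :=
  HasWeakGradient φ G ∧ MemLp (fun x => φ x - 1) 2 volume ∧ MemLp G 2 volume ∧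
    ∀ x, x ∉ Metric.ball (0 : Space d) r → φ x = 1

/-- The infimum over trial functions of `∫ (|∇φ|² + v φ² / 2)` over the ball of radius `r`. -/
def scatteringEnergy {d : ℕ} (v : Space d → ℝ) (r : ℝ) : ℝ≥0∞ :=
  ⨅ (φ : Space d → ℝ) (G : Space d → Space d) (_ : IsTrial r φ G),
    ∫⁻ x in Metric.ball (0 : Space d) r, ENNReal.ofReal (‖G x‖ ^ 2 + 1 / 2 * v x * φ x ^ 2)

/-- `a > 0` is the scattering length of `v`, whose support lies in the ball of radius `R`
(dimensions `2` and `3`). -/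
def IsScatteringLength {d : ℕ} (v : Space d → ℝ) (R a : ℝ) : Prop :=
  0 < a ∧ ∀ r : ℝ, R < r →
    scatteringEnergy v r =
      ENNReal.ofReal (if d = 2 then 2 * Real.pi / Real.log (r / a)
        else 4 * Real.pi * a / (1 - a / r))

/-- `φ₀` is the scattering solution: it lies in `H¹_loc`, it solves `-Δφ₀ + v φ₀ / 2 = 0` in the
sense of distributions, and outside the ball of radius `R` it is `log (|x| / a)` if `d = 2` and
`1 - a / |x|` if `d = 3`. -/
def IsScatteringSolution {d : ℕ} (v : Space d → ℝ) (R a : ℝ) (φ₀ : Space d → ℝ) : Prop :=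
  (∃ G : Space d → Space d, HasWeakGradient φ₀ G ∧
    ∀ r : ℝ, MemLp φ₀ 2 (volume.restrict (Metric.ball (0 : Space d) r)) ∧
      MemLp G 2 (volume.restrict (Metric.ball (0 : Space d) r))) ∧
  (∀ η : Space d → ℝ, ContDiff ℝ ∞ η → HasCompactSupport η →
    - (∫ x, φ₀ x * Laplacian.laplacian η x) + 1 / 2 * ∫ x, v x * φ₀ x * η x = 0) ∧
  ∀ x : Space d, R ≤ ‖x‖ → φ₀ x = if d = 2 then Real.log (‖x‖ / a) else 1 - a / ‖x‖

/-- A nonnegative, radially symmetric, square integrable potential supported in the ball of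
radius `R`. -/
def IsPotential {d : ℕ} (v : Space d → ℝ) (R : ℝ) : Prop :=
  0 < R ∧ (∀ x, 0 ≤ v x) ∧ (∀ x y, ‖x‖ = ‖y‖ → v x = v y) ∧ MemLp v 2 volume ∧
    Function.support v ⊆ Metric.closedBall (0 : Space d) R

/-- The cut-off `𝟙_d(t)`: the indicator of `|t| ≤ 1` if `d = 2`, and `0` otherwise. -/
def cutoff (d : ℕ) (t : ℝ) : ℝ := if d = 2 ∧ |t| ≤ 1 then 1 else 0

/-- The Bogoliubov integral in dimension `d`. -/
def bogoliubovIntegral (d : ℕ) : ℝ :=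
  (2 / Real.pi) ^ ((d : ℝ) / 2) *
    ∫ t : Space d, (Real.sqrt ((‖t‖ ^ 2 + 1) ^ 2 - 1) - ‖t‖ ^ 2 - 1 +
      1 / (2 * ‖t‖ ^ 2) *
        (1 - cutoff d (Real.sqrt (2 * Real.pi) * Real.exp Real.eulerMascheroniConstant * ‖t‖)))

/-! ### The box, the parameters and the interaction -/

/-- The data: potential, scattering solution, density, scattering length, radius of the support,
and the parameters `K_ℓ, K_L, K_H, 𝓜, ε_K, ε_gap`. -/
structure Setup (d : ℕ) where
  v : Space d → ℝ
  φ₀ : Space d → ℝ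
  ρ : ℝ
  a : ℝ
  R : ℝ
  Kl : ℝ
  KL : ℝ
  KH : ℝ
  Mexc : ℝ
  εK : ℝ
  εgap : ℝ

namespace Setup

variable {d : ℕ} (S : Setup d)

/-- The logarithmic small parameter `δ = 1 / |log (ρ a² |log (ρ a²)|⁻¹)|` of dimension `2`. -/
def δ : ℝ := 1 / |Real.log (S.ρ * S.a ^ 2 * |Real.log (S.ρ * S.a ^ 2)|⁻¹)|

/-- The normalized scattering solution: `2 δ φ₀` if `d = 2`, and `φ₀` if `d = 3`. -/
def φ (x : Space d) : ℝ := if d = 2 then 2 * S.δ * S.φ₀ x else S.φ₀ x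

/-- `ω = 1 - φ`. -/
def om (x : Space d) : ℝ := 1 - S.φ x

/-- `g = v (1 - ω) = v φ`. -/
def g (x : Space d) : ℝ := S.v x * S.φ x

/-- `ĝ(0)`, as the integral of `g` over `ℝ^d`. -/
def g0 : ℝ := ∫ x, S.g x

/-- The side length `ℓ = K_ℓ / √(ρ ĝ(0))` of the box. -/
def ell : ℝ := S.Kl / Real.sqrt (S.ρ * S.g0)

/-- The box `Λ = [-ℓ/2, ℓ/2]^d`. -/
def box : Set (Space d) := {x | ∀ i, |x i| ≤ S.ell / 2}

/-- The volume `|Λ| = ℓ^d`. -/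
def vol : ℝ := S.ell ^ d

/-- The number of particles `N = ρ ℓ^d`. -/
def N : ℝ := S.ρ * S.ell ^ d

/-- The Fourier coefficient `f̂(k) = ∫_Λ f(x) e^{-i k·x} dx` of (the periodization of) a radial
function `f`; it is real by symmetry, hence the real part.  On the unit cell `Λ` the distance of `x`
to the lattice `ℓ ℤ^d` is `|x|`, so that there the periodization of `f` is `f` itself. -/
def fourier (f : Space d → ℝ) (k : Space d) : ℝ :=
  (∫ x in S.box, (f x : ℂ) * Complex.exp (-Complex.I * ((inner ℝ k x : ℝ) : ℂ))).re

def gHat (k : Space d) : ℝ := S.fourier S.g k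

/-- The Fourier coefficient of `g ω`. -/
def gomHat (k : Space d) : ℝ := S.fourier (fun x => S.g x * S.om x) k

/-- The order `λ^LHY` of the Lee-Huang-Yang correction at density `ρ'`: `δ` if `d = 2`, and
`√(ρ' a³)` if `d = 3`. -/
def lhyOrder (ρ' : ℝ) : ℝ := if d = 2 then S.δ else Real.sqrt (ρ' * S.a ^ 3)

/-- The Lee-Huang-Yang energy of the box at density `ρ'`. -/
def lhyEnergy (ρ' : ℝ) : ℝ :=
  ρ' ^ 2 / 2 * S.vol * S.gHat 0 * S.lhyOrder ρ' * bogoliubovIntegral d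

/-- The threshold `ε_+`. -/
def εplus : ℝ := max (S.Kl ^ 2 * S.KL⁻¹) (Real.sqrt (S.lhyOrder S.ρ))

/-- The length `ℓ_δ = (a/2) e^{1/(2δ)} e^Γ`. -/
def ellδ : ℝ :=
  S.a / 2 * Real.exp (1 / (2 * S.δ)) * Real.exp Real.eulerMascheroniConstant

/-- The small parameter of the dilute regime: `δ` if `d = 2`, and `ρ a³` if `d = 3`. -/
def small : ℝ := if d = 2 then S.δ else S.ρ * S.a ^ 3

/-- `A ≪ B`, with constant `C₀` and exponent `ζ`: `A ≤ C₀ δ^ζ B` if `d = 2`, and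
`A ≤ C₀ (ρ a³)^ζ B` if `d = 3`. -/
def MuchLess (C₀ ζ A B : ℝ) : Prop := A ≤ C₀ * S.small ^ ζ * B

/-- The error in the approximation of the Fourier coefficient of `g ω` at `0` by a sum over high
momenta. -/
def errHigh : ℝ :=
  if d = 2 then
    S.R ^ 2 * S.ellδ⁻¹ ^ 2 * S.gHat 0 ^ 2 +
      S.gHat 0 ^ 2 * |Real.log (S.KH * S.ellδ * S.ell⁻¹)|
  else S.gHat 0 ^ 2 * S.KH * S.ell⁻¹

/-- The relations between the parameters, `≪` being understood with the constants `C₀, ζ`. -/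
structure ParameterRelations (C₀ ζ : ℝ) : Prop where
  R_le : S.R ≤ S.ell / 4
  Kl_pos : 0 < S.Kl
  KL_pos : 0 < S.KL
  KH_pos : 0 < S.KH
  Mexc_pos : 0 < S.Mexc
  εK_pos : 0 < S.εK
  εgap_pos : 0 < S.εgap
  εK_small : S.MuchLess C₀ ζ S.εK 1
  εgap_small : S.MuchLess C₀ ζ S.εgap 1
  Mexc_large : S.MuchLess C₀ ζ 1 S.Mexc
  Kl_large : S.MuchLess C₀ ζ 1 S.Kl
  KL_large : S.MuchLess C₀ ζ 1 S.KL
  KH_large : S.MuchLess C₀ ζ 1 S.KH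
  Kl_Kl4 : S.MuchLess C₀ ζ S.Kl (S.Kl ^ 4)
  Kl4_KL : S.MuchLess C₀ ζ (S.Kl ^ 4) S.KL
  KL_KH : S.MuchLess C₀ ζ S.KL S.KH
  M_lower₁ : S.MuchLess C₀ ζ
    (S.ell * S.ρ ^ (1 / 2 : ℝ) * S.KH ^ (1 / 2 : ℝ) * (eLpNorm S.v 1 volume).toReal ^ (1 / 2 : ℝ))
    S.Mexc
  M_lower₂ : S.MuchLess C₀ ζ (S.ell ^ 2 * S.ρ ^ 2 * S.vol * S.gHat 0 * S.lhyOrder S.ρ) S.Mexc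
  M_upper₁ : S.MuchLess C₀ ζ (S.Mexc / S.N) ((S.Kl / S.KL) ^ 4)
  M_upper₂ : S.MuchLess C₀ ζ (S.Mexc / S.N * S.KH ^ d) 1
  εK_lower : S.MuchLess C₀ ζ
    (S.ell ^ (8 - (d : ℤ)) * S.ρ ^ 3 * S.gHat 0 ^ 4 * S.KH ^ (-8 : ℤ) * S.KL ^ d * S.Mexc)
    (S.εK ^ 2)
  Kl_lower : S.MuchLess C₀ ζ
    (S.ell ^ (4 - (d : ℤ)) * S.ρ * S.gHat 0 ^ 2 * S.KH ^ (-2 : ℤ) * S.KL ^ d * S.Mexc)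
    (S.Kl ^ 2)
  gap₁ : S.MuchLess C₀ ζ
    (S.ρ ^ 3 * S.gHat 0 ^ 4 * S.ell ^ (8 - (d : ℤ)) * S.KH ^ ((d : ℤ) - 6)) S.εgap
  gap₂ : S.MuchLess C₀ ζ
    (S.εK * S.ell ^ 2 * S.ρ * S.gHat 0 + S.errHigh * S.ell ^ 2 * S.ρ + S.Kl ^ 2 * S.KH⁻¹) S.εgap
  gap₃ : S.MuchLess C₀ ζ (S.R / S.ell * S.KL * S.ell ^ 2 * S.ρ * S.gHat 0) S.εgap
  Kl_upper : S.MuchLess C₀ ζ S.Kl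
    (if d = 2 then S.δ ^ (-(1 / 26) : ℝ) else (S.ρ * S.a ^ 3) ^ (-(1 / 28) : ℝ))

end Setup

/-! ### The bosonic Fock space over the excitations

The plane waves of nonzero momenta in `(2π/ℓ) ℤ^d` are an orthonormal basis of the range of `Q`, so
the bosonic Fock space over it is realized by square summable functions of the occupation
numbers. -/

/-- Labels `m ≠ 0` of the nonzero momenta `k = (2π/ℓ) m`, `m ∈ ℤ^d`. -/
abbrev Mode (d : ℕ) := {m : Fin d → ℤ // m ≠ 0}

/-- The label of `-k`. -/
def Mode.opp {d : ℕ} (k : Mode d) : Mode d := ⟨-k.1, neg_ne_zero.mpr k.2⟩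

/-- Occupation numbers of the excited modes. -/
abbrev Config (d : ℕ) := Mode d →₀ ℕ

/-- The bosonic Fock space over the range of `Q`. -/
abbrev Fock (d : ℕ) := lp (fun _ : Config d => ℂ) 2

/-- The annihilation operator `a_k`. -/
def annihilate {d : ℕ} (k : Mode d) (Ψ : Config d → ℂ) : Config d → ℂ :=
  fun n => (Real.sqrt ((n k : ℝ) + 1) : ℂ) * Ψ (n + Finsupp.single k 1)

/-- The creation operator `a_k†`. -/
def create {d : ℕ} (k : Mode d) (Ψ : Config d → ℂ) : Config d → ℂ :=
  fun n => (Real.sqrt (n k : ℝ) : ℂ) * Ψ (n - Finsupp.single k 1)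

/-- The inner product `⟨f, h⟩ = ∑ₙ conj (f n) h n`. -/
def pairing {d : ℕ} (f h : Config d → ℂ) : ℂ := ∑' n, conj (f n) * h n

namespace Setup

variable {d : ℕ} (S : Setup d)

/-- The momentum `k = (2π/ℓ) m`. -/
def momentum (k : Mode d) : Space d :=
  WithLp.toLp 2 (fun i => 2 * Real.pi / S.ell * (k.1 i : ℝ))

/-- The form domain of the kinetic energy `∑_k k² a_k† a_k`. -/
def FiniteKinetic (Ψ : Fock d) : Prop :=
  Summable fun n : Config d =>
    (n.sum fun k j => (j : ℝ) * ‖S.momentum k‖ ^ 2) * ‖Ψ n‖ ^ 2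

/-- The condensate density `ρ_z = |z|² / |Λ|`. -/
def ρz (z : ℂ) : ℝ := ‖z‖ ^ 2 / S.vol

/-- `𝒜_k = k² + ρ_z ĝ(k)`. -/
def A (z : ℂ) (k : Mode d) : ℝ := ‖S.momentum k‖ ^ 2 + S.ρz z * S.gHat (S.momentum k)

/-- `ℬ_k = ρ_z ĝ(k)`. -/
def B (z : ℂ) (k : Mode d) : ℝ := S.ρz z * S.gHat (S.momentum k)

/-- `k⁴ + 2 k² ρ_z ĝ(k)`. -/
def Dsq (z : ℂ) (k : Mode d) : ℝ :=
  ‖S.momentum k‖ ^ 4 + 2 * ‖S.momentum k‖ ^ 2 * S.ρz z * S.gHat (S.momentum k)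

/-- `𝒟_k = √(k⁴ + 2 k² ρ_z ĝ(k))`. -/
def D (z : ℂ) (k : Mode d) : ℝ := Real.sqrt (S.Dsq z k)

/-- `α_k = (k² + ρ_z ĝ(k) - 𝒟_k) / (ρ_z ĝ(k))`; it is `0` (the limiting value) if `ĝ(k) = 0`. -/
def α (z : ℂ) (k : Mode d) : ℝ :=
  (‖S.momentum k‖ ^ 2 + S.ρz z * S.gHat (S.momentum k) - S.D z k) /
    (S.ρz z * S.gHat (S.momentum k))

/-- `b_k = (a_k + α_k a_{-k}†) / √(1 - α_k²)`. -/
def b (z : ℂ) (k : Mode d) (Ψ : Config d → ℂ) : Config d → ℂ :=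
  fun n => ((1 / Real.sqrt (1 - S.α z k ^ 2) : ℝ) : ℂ) *
    (annihilate k Ψ n + (S.α z k : ℂ) * create k.opp Ψ n)

/-- `⟨Φ, 𝒜_k (a_k† a_k + a_{-k}† a_{-k}) Ψ⟩`. -/
def termA (z : ℂ) (Φ Ψ : Config d → ℂ) (k : Mode d) : ℂ :=
  (S.A z k : ℂ) * (pairing (annihilate k Φ) (annihilate k Ψ) +
    pairing (annihilate k.opp Φ) (annihilate k.opp Ψ))

/-- `⟨Φ, ℬ_k (a_k† a_{-k}† + a_k a_{-k}) Ψ⟩`. -/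
def termB (z : ℂ) (Φ Ψ : Config d → ℂ) (k : Mode d) : ℂ :=
  (S.B z k : ℂ) * (pairing (annihilate k Φ) (create k.opp Ψ) +
    pairing (create k Φ) (annihilate k.opp Ψ))

/-- `⟨Φ, 𝒟_k b_k† b_k Ψ⟩`. -/
def termD (z : ℂ) (Φ Ψ : Config d → ℂ) (k : Mode d) : ℂ :=
  (S.D z k : ℂ) * pairing (S.b z k Φ) (S.b z k Ψ)

/-- `⟨Φ, 𝒦^Bog Ψ⟩`. -/
def kBog (z : ℂ) (Φ Ψ : Config d → ℂ) : ℂ :=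
  1 / 2 * ∑' k, S.termA z Φ Ψ k + 1 / 2 * ∑' k, S.termB z Φ Ψ k

/-- `⟨Φ, 𝒬(z) Ψ⟩`. -/
def qForm (z : ℂ) (Φ Ψ : Fock d) : ℂ :=
  ((1 / 2 * S.ρz z ^ 2 * S.vol * (S.gHat 0 + S.gomHat 0) : ℝ) : ℂ) * inner ℂ Φ Ψ + S.kBog z Φ Ψ

/-- `⟨Φ, 𝒦^diag Ψ⟩`. -/
def kDiag (z : ℂ) (Φ Ψ : Config d → ℂ) : ℂ := ∑' k, S.termD z Φ Ψ k

/-- The size of the error at density `ρ'`, up to the constant. -/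
def errorSize (ρ' : ℝ) : ℝ :=
  if d = 2 then S.vol * ρ' ^ 2 * S.δ ^ 2 * S.Kl⁻¹
  else S.vol * ρ' ^ 2 * S.a * (ρ' * S.a ^ 3) ^ (1 / 2 : ℝ) * max 1 |Real.log ρ'| * S.Kl⁻¹

end Setup

end BoseGas

end

namespace BoseGas

/-! ### Creation and annihilation operators in the occupation number representation -/

section Fock

variable {d : ℕ}

/-! Two things have to be shown: an algebraic diagonalization, and an asymptotic evaluation of the
constant it produces.

Algebra. Write `x = k²`, `y = ρ_z ĝ(k)`, `D = √(x² + 2xy)`. Expanding `D b† b` and commuting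
`a_{-k}` past its adjoint reproduces the quadratic form plus the constant `(x + y - D) / 2` for each
mode. In the occupation representation this is an identity between absolutely convergent series
(`kBog_eq_kDiag`), once `y ≥ -x / 4` for every mode and `∑ y² / x` converges. The function `R₁` is
then the explicit number `remainder`: half of `r² |Λ|` times the zeroth coefficient of `g ω`, minus
half the sum of the gaps `x + y - D`, minus the Lee-Huang-Yang energy.

Asymptotics. The quadratic part `y² / (2x)` of the gap contains the short-distance contribution that
has to cancel `ĝω(0)`. It is regularized at heat time `T = 1 / y₀`, where `y₀ = r ĝ(0)`: `y² / (2x)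
· (1 - e^{-Tx})` is half the integral over `0 < t < T` of `y² e^{-tx}`.

What is left of the gap after this subtraction is of third order, so `y` may be frozen at `y₀`
(`abs_reducedGap_sub_le`). By scaling, its sum is a Riemann sum of one universal profile, whose
integral is the Bogoliubov integral up to an explicit Gaussian correction
(`exists_bogoliubov_riemann_sum_bound`, `cutoffProfile_two`, `cutoffProfile_three`).

The subtracted part is summed by Poisson summation: on the box the torus heat kernel differs from
that of `ℝ^d` by a bounded amount, so the sum is `ℓ^d ∫₀ᵀ ∬ g(x) g(y) p_t(x - y)` up to an
admissible error (`abs_lattice_sum_sub_heatEnergy_le`).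

The time integral is computed from the scattering equation. The pairing of `q = v φ₀` with the heat
flow of `φ₀` has time derivative `½ ∬ q q p_t`. It starts at `∫ v φ₀²`, which is `ĝω(0)` in
disguise, and at time `T` it is the explicit far-field value `heatLimit` times the total flux, up to
order `R² / T` (`IsScatteringSolution.heatEnergy_integral`). So the heat energy cancels between
`ĝω(0)` and the gaps, and only `mainTerm` survives. It is exactly zero in dimension three. In
dimension two it is a multiple of `log (δ |log ρa²|) + log (r / ρ)`, small because `δ⁻¹ = X + log X`
with `X = |log ρa²|`.

The argument needs `φ₀` to be nonnegative, locally bounded and even almost everywhere. For a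
distributional solution these follow from Kato's inequality by a maximum principle
(`ae_le_of_weak_solution`). -/

lemma Mode.opp_opp (k : Mode d) : k.opp.opp = k := Subtype.ext (neg_neg _)

/-- The reflection `k ↦ -k` as a permutation of the modes. -/
def Mode.oppEquiv : Mode d ≃ Mode d := ⟨Mode.opp, Mode.opp, Mode.opp_opp, Mode.opp_opp⟩

lemma injective_add_single (k : Mode d) :
    Function.Injective fun n : Config d => n + Finsupp.single k 1 :=
  fun _ _ h => add_right_cancel h

/-- Reindexing by this shift loses nothing: the sums below carry a factor vanishing where mode `k`
is empty, so only configurations in its range contribute. -/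
lemma mem_range_add_single {k : Mode d} {n : Config d} (h : n k ≠ 0) :
    n ∈ Set.range fun n : Config d => n + Finsupp.single k 1 := by
  refine ⟨n - Finsupp.single k 1, ?_⟩
  ext j
  by_cases hj : k = j
  · subst hj; simp; omega
  · simp [hj]

lemma conj_annihilate_mul (k : Mode d) (Φ Ψ : Config d → ℂ) (n : Config d) :
    conj (annihilate k Φ n) * annihilate k Ψ n =
      (fun n : Config d => ((n k : ℝ) : ℂ) * (conj (Φ n) * Ψ n)) (n + Finsupp.single k 1) := by
  have h : (Real.sqrt ((n k : ℝ) + 1) : ℂ) * (Real.sqrt ((n k : ℝ) + 1) : ℂ) =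
      (((n k : ℝ) + 1 : ℝ) : ℂ) := by
    rw [← Complex.ofReal_mul, Real.mul_self_sqrt (by positivity)]
  simp only [annihilate, map_mul, Complex.conj_ofReal, Finsupp.add_apply, Finsupp.single_eq_same]
  push_cast at h ⊢
  rw [← h]; ring

lemma conj_create_mul (k : Mode d) (Φ Ψ : Config d → ℂ) (n : Config d) :
    (fun n => conj (create k Φ n) * create k Ψ n) (n + Finsupp.single k 1) =
      (((n k : ℝ) + 1 : ℝ) : ℂ) * (conj (Φ n) * Ψ n) := by
  have h : (Real.sqrt ((n k : ℝ) + 1) : ℂ) * (Real.sqrt ((n k : ℝ) + 1) : ℂ) =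
      (((n k : ℝ) + 1 : ℝ) : ℂ) := by
    rw [← Complex.ofReal_mul, Real.mul_self_sqrt (by positivity)]
  simp only [create, map_mul, Complex.conj_ofReal, Finsupp.add_apply, Finsupp.single_eq_same,
    add_tsub_cancel_right, Nat.cast_add, Nat.cast_one]
  rw [← h]; ring

lemma pairing_annihilate (k : Mode d) (Φ Ψ : Config d → ℂ) :
    pairing (annihilate k Φ) (annihilate k Ψ) =
      ∑' n : Config d, ((n k : ℝ) : ℂ) * (conj (Φ n) * Ψ n) := by
  unfold pairing
  simp_rw [conj_annihilate_mul]
  refine (injective_add_single k).tsum_eq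
    (f := fun n : Config d => ((n k : ℝ) : ℂ) * (conj (Φ n) * Ψ n))
    fun n hn => mem_range_add_single fun h => ?_
  simp [h] at hn

/-- Next to `pairing_annihilate` this is the canonical commutation relation: the weights `n k + 1`
and `n k` differ by the inner product, the source of the zero-point constant. -/
lemma pairing_create (k : Mode d) (Φ Ψ : Config d → ℂ) :
    pairing (create k Φ) (create k Ψ) =
      ∑' n : Config d, (((n k : ℝ) + 1 : ℝ) : ℂ) * (conj (Φ n) * Ψ n) := by
  unfold pairing
  rw [← (injective_add_single k).tsum_eq]
  · exact tsum_congr fun n => conj_create_mul k Φ Ψ n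
  · refine fun n hn => mem_range_add_single fun h => ?_
    simp [create, h] at hn

lemma normSq_annihilate (k : Mode d) (Ψ : Config d → ℂ) (n : Config d) :
    ‖annihilate k Ψ n‖ ^ 2 =
      (fun n : Config d => (n k : ℝ) * ‖Ψ n‖ ^ 2) (n + Finsupp.single k 1) := by
  simp only [annihilate, norm_mul, mul_pow, Complex.norm_real, Real.norm_eq_abs, sq_abs,
    Finsupp.add_apply, Finsupp.single_eq_same, Nat.cast_add, Nat.cast_one]
  rw [Real.sq_sqrt (by positivity)]

lemma normSq_create (k : Mode d) (Ψ : Config d → ℂ) (n : Config d) :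
    (fun n => ‖create k Ψ n‖ ^ 2) (n + Finsupp.single k 1) = ((n k : ℝ) + 1) * ‖Ψ n‖ ^ 2 := by
  simp only [create, norm_mul, mul_pow, Complex.norm_real, Real.norm_eq_abs, sq_abs,
    Finsupp.add_apply, Finsupp.single_eq_same, Nat.cast_add, Nat.cast_one, add_tsub_cancel_right]
  rw [Real.sq_sqrt (by positivity)]

lemma hasSum_normSq_annihilate {k : Mode d} {Ψ : Config d → ℂ}
    (h : Summable fun n : Config d => (n k : ℝ) * ‖Ψ n‖ ^ 2) :
    HasSum (fun n => ‖annihilate k Ψ n‖ ^ 2) (∑' n : Config d, (n k : ℝ) * ‖Ψ n‖ ^ 2) := by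
  simp_rw [normSq_annihilate]
  refine ((injective_add_single k).hasSum_iff (f := fun n : Config d => (n k : ℝ) * ‖Ψ n‖ ^ 2)
    fun n hn => ?_).mpr h.hasSum
  by_contra h0
  exact hn (mem_range_add_single fun h => h0 (by simp [h]))

lemma hasSum_normSq_create {k : Mode d} {Ψ : Config d → ℂ}
    (h : Summable fun n : Config d => (n k : ℝ) * ‖Ψ n‖ ^ 2)
    (h0 : Summable fun n : Config d => ‖Ψ n‖ ^ 2) :
    HasSum (fun n => ‖create k Ψ n‖ ^ 2)
      (∑' n : Config d, (n k : ℝ) * ‖Ψ n‖ ^ 2 + ∑' n : Config d, ‖Ψ n‖ ^ 2) := by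
  refine ((injective_add_single k).hasSum_iff (f := fun n => ‖create k Ψ n‖ ^ 2)
    fun n hn => ?_).mp ?_
  · by_contra h1
    exact hn (mem_range_add_single fun h => h1 (by simp [create, h]))
  · convert! h.hasSum.add h0.hasSum using 2 with n
    have := normSq_create k Ψ n
    simp only [Function.comp_apply] at this ⊢
    rw [this]; ring

lemma summable_normSq (Ψ : Fock d) : Summable fun n : Config d => ‖Ψ n‖ ^ 2 := by
  have := lp.memℓp Ψ
  simpa using (memℓp_gen_iff (by norm_num)).mp this

lemma memℓp_two_of_summable {f : Config d → ℂ} (h : Summable fun n => ‖f n‖ ^ 2) : Memℓp f 2 :=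
  (memℓp_gen_iff (by norm_num)).mpr (by simpa using h)

lemma inner_eq_pairing (Φ Ψ : Fock d) : inner ℂ Φ Ψ = pairing Φ Ψ := by
  rw [lp.inner_eq_tsum]
  exact tsum_congr fun n => by simp [mul_comm]

lemma norm_conj_mul_le {c : ℝ} (hc : 0 < c) (a b : ℂ) :
    ‖conj a * b‖ ≤ c / 2 * ‖a‖ ^ 2 + 1 / (2 * c) * ‖b‖ ^ 2 := by
  rw [norm_mul, RCLike.norm_conj]
  have : c / 2 * ‖a‖ ^ 2 + 1 / (2 * c) * ‖b‖ ^ 2 - ‖a‖ * ‖b‖ =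
      1 / (2 * c) * (c * ‖a‖ - ‖b‖) ^ 2 := by field_simp; ring
  nlinarith [show 0 ≤ 1 / (2 * c) * (c * ‖a‖ - ‖b‖) ^ 2 by positivity]

lemma summable_conj_mul {f h : Config d → ℂ} (hf : Summable fun n => ‖f n‖ ^ 2)
    (hh : Summable fun n => ‖h n‖ ^ 2) : Summable fun n => conj (f n) * h n :=
  Summable.of_norm_bounded ((hf.mul_left (1 / 2)).add (hh.mul_left (1 / (2 * 1))))
    fun n => norm_conj_mul_le one_pos _ _

/-- Young's inequality with a free weight. For the pair terms the weight is `x / |B|` or its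
inverse, so that the annihilated side costs kinetic energy and the created side costs the summable
`B² / x`. -/
lemma norm_pairing_le {f h : Config d → ℂ} {F H c : ℝ} (hc : 0 < c)
    (hf : HasSum (fun n => ‖f n‖ ^ 2) F) (hh : HasSum (fun n => ‖h n‖ ^ 2) H) :
    ‖pairing f h‖ ≤ c / 2 * F + 1 / (2 * c) * H :=
  tsum_of_norm_bounded ((hf.mul_left (c / 2)).add (hh.mul_left (1 / (2 * c))))
    fun n => norm_conj_mul_le hc _ _

end Fock

/-! ### The algebra of the Bogoliubov transformation -/

section Algebra

variable {x y : ℝ}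

/-- In this section `x` stands for `k²` and `y` for `ρ_z ĝ(k)`. Since `ĝ(k)` may be negative at high
momenta, positivity of the interaction is replaced by `y ≥ -x / 4`. -/
lemma dispersion_sq_pos (hx : 0 < x) (hxy : x / 2 ≤ x + 2 * y) : 0 < x ^ 2 + 2 * x * y := by
  nlinarith

lemma dispersion_lt (hx : 0 < x) (hxy : x / 2 ≤ x + 2 * y) (hy : y ≠ 0) :
    Real.sqrt (x ^ 2 + 2 * x * y) < x + y := by
  rw [Real.sqrt_lt' (by linarith)]
  nlinarith [sq_pos_of_ne_zero hy]

/-- The definition of `D` gives `y² = (x + y - D) (x + y + D)`; subtracting `(x + y - D)²` leaves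
the factor `2 D`. -/
lemma one_sub_angle_sq (hx : 0 < x) (hxy : x / 2 ≤ x + 2 * y) (hy : y ≠ 0) :
    1 - ((x + y - Real.sqrt (x ^ 2 + 2 * x * y)) / y) ^ 2 =
      (x + y - Real.sqrt (x ^ 2 + 2 * x * y)) * (2 * Real.sqrt (x ^ 2 + 2 * x * y)) / y ^ 2 := by
  have h := Real.sq_sqrt (dispersion_sq_pos hx hxy).le
  set D := Real.sqrt (x ^ 2 + 2 * x * y)
  field_simp
  linear_combination h

lemma angle_sq_lt_one (hx : 0 < x) (hxy : x / 2 ≤ x + 2 * y) :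
    ((x + y - Real.sqrt (x ^ 2 + 2 * x * y)) / y) ^ 2 < 1 := by
  by_cases hy : y = 0
  · simp [hy]
  have h1 := one_sub_angle_sq hx hxy hy
  have h2 := dispersion_lt hx hxy hy
  have h3 := Real.sqrt_pos.mpr (dispersion_sq_pos hx hxy)
  have : 0 < (x + y - Real.sqrt (x ^ 2 + 2 * x * y)) *
    (2 * Real.sqrt (x ^ 2 + 2 * x * y)) / y ^ 2 := by
    have : 0 < x + y - Real.sqrt (x ^ 2 + 2 * x * y) := by linarith
    positivity
  linarith

/-- The three coefficients that occur when `D b† b` is expanded: those of the number operators, of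
the pair terms, and of the constant left by the commutator. -/
lemma bogoliubov_coefficients (hx : 0 < x) (hxy : x / 2 ≤ x + 2 * y) {D α : ℝ}
    (hD : D = Real.sqrt (x ^ 2 + 2 * x * y)) (hα : α = (x + y - D) / y) :
    D * (1 / (1 - α ^ 2)) * (1 + α ^ 2) = x + y ∧ D * (1 / (1 - α ^ 2)) * α = y / 2 ∧
      D * (1 / (1 - α ^ 2)) * α ^ 2 = (x + y - D) / 2 := by
  -- Division by zero makes the angle `0`, which is also its limiting value, and `D = x`, so the
  -- identities survive.
  by_cases hy : y = 0
  · subst hy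
    have : D = x := by rw [hD]; simp [Real.sqrt_sq hx.le]
    simp [hα, this]
  have h1 := one_sub_angle_sq hx hxy hy
  have h2 := dispersion_lt hx hxy hy
  have h3 := Real.sqrt_pos.mpr (dispersion_sq_pos hx hxy)
  have h4 := Real.sq_sqrt (dispersion_sq_pos hx hxy).le
  rw [← hD] at h1 h2 h3 h4
  have h5 : x + y - D ≠ 0 := by linarith
  rw [← hα] at h1
  rw [h1, hα]
  refine ⟨?_, ?_, ?_⟩
  · field_simp
    nlinarith
  · field_simp
  · field_simp

/-- Rationalize: `x + y - D = y² / (x + y + D)` with denominator at least `x / 2`. The gaps are thus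
summable as soon as `y² / x` is. -/
lemma abs_gap_le (hx : 0 < x) (hxy : x / 2 ≤ x + 2 * y) :
    |x + y - Real.sqrt (x ^ 2 + 2 * x * y)| ≤ 2 * (y ^ 2 / x) := by
  have h4 := Real.sq_sqrt (dispersion_sq_pos hx hxy).le
  have h3 := Real.sqrt_nonneg (x ^ 2 + 2 * x * y)
  set D := Real.sqrt (x ^ 2 + 2 * x * y)
  have h5 : (x + y - D) * (x + y + D) = y ^ 2 := by nlinarith
  have h6 : x / 2 ≤ x + y + D := by linarith
  have h7 : x + y - D = y ^ 2 / (x + y + D) := by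
    rw [eq_div_iff (by linarith)]; exact h5
  rw [h7, abs_of_nonneg (by apply div_nonneg (sq_nonneg y); linarith)]
  rw [div_le_iff₀ (by linarith)]
  calc y ^ 2 = 2 * (y ^ 2 / x) * (x / 2) := by field_simp
    _ ≤ _ := by gcongr

end Algebra

/-! ### Diagonalization of the quadratic Hamiltonian -/

namespace Setup

variable {d : ℕ} (S : Setup d)

/-- `⟨Ψ, a_k† a_k Ψ⟩`. -/
noncomputable def occupation (k : Mode d) (Ψ : Config d → ℂ) : ℝ := ∑' n : Config d, (n k : ℝ) * ‖Ψ n‖ ^ 2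

lemma momentum_opp (k : Mode d) : S.momentum k.opp = -S.momentum k := by
  ext i; simp [momentum, Mode.opp]

lemma gHat_neg (k : Space d) : S.gHat (-k) = S.gHat k := by
  unfold gHat fourier
  rw [← Complex.conj_re, ← integral_conj]
  congr 1
  apply integral_congr_ae
  refine Filter.Eventually.of_forall fun x => ?_
  simp only [map_mul, Complex.conj_ofReal, ← Complex.exp_conj, map_neg, Complex.conj_I,
    inner_neg_left, Complex.ofReal_neg]
  ring_nf

/-- Tonelli for a nonnegative family on configurations times modes. Summing over modes first is a
finite sum and gives the kinetic energy; summing over configurations first gives the occupation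
numbers. -/
lemma kinetic_summable {Ψ : Fock d} (h : S.FiniteKinetic Ψ)
    (hx : ∀ k : Mode d, 0 < ‖S.momentum k‖ ^ 2) :
    (∀ k : Mode d, Summable fun n : Config d => (n k : ℝ) * ‖Ψ n‖ ^ 2) ∧
      Summable fun k : Mode d => ‖S.momentum k‖ ^ 2 * occupation k Ψ := by
  have hF : Summable fun p : Config d × Mode d =>
      ‖S.momentum p.2‖ ^ 2 * ((p.1 p.2 : ℝ) * ‖Ψ p.1‖ ^ 2) := by
    have key : ∀ n : Config d, HasSum (fun k : Mode d =>
        ‖S.momentum k‖ ^ 2 * ((n k : ℝ) * ‖Ψ n‖ ^ 2))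
        ((n.sum fun k j => (j : ℝ) * ‖S.momentum k‖ ^ 2) * ‖Ψ n‖ ^ 2) := by
      intro n
      rw [Finsupp.sum, Finset.sum_mul]
      have := hasSum_sum_of_ne_finset_zero (L := .unconditional _) (s := n.support)
        (f := fun k : Mode d => ‖S.momentum k‖ ^ 2 * ((n k : ℝ) * ‖Ψ n‖ ^ 2))
        (fun k hk => by simp [Finsupp.notMem_support_iff.mp hk])
      convert! this using 2 with k
      ring
    rw [summable_prod_of_nonneg (fun p => by positivity)]
    refine ⟨fun n => (key n).summable, ?_⟩
    exact h.congr fun n => ((key n).tsum_eq).symm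
  have hF' := hF.prod_symm
  refine ⟨fun k => ?_, ?_⟩
  · have := (hF'.prod_factor k).mul_left (‖S.momentum k‖ ^ 2)⁻¹
    refine this.congr fun n => ?_
    simp only [Prod.swap_prod_mk]
    rw [inv_mul_cancel_left₀ (hx k).ne']
  · have := hF'.prod
    refine this.congr fun k => ?_
    simp only [Prod.swap_prod_mk, tsum_mul_left]
    rfl

/-- The diagonalization of the Bogoliubov Hamiltonian, as an identity of quadratic forms. -/
theorem kBog_eq_kDiag (z : ℂ) {x₀ : ℝ} (hx₀ : 0 < x₀)
    (hx : ∀ k : Mode d, x₀ ≤ ‖S.momentum k‖ ^ 2)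
    (hxy : ∀ k : Mode d, ‖S.momentum k‖ ^ 2 / 2 ≤ ‖S.momentum k‖ ^ 2 + 2 * S.B z k)
    (hs : Summable fun k : Mode d => S.B z k ^ 2 / ‖S.momentum k‖ ^ 2)
    {Φ Ψ : Fock d} (hΦ : S.FiniteKinetic Φ) (hΨ : S.FiniteKinetic Ψ) :
    Summable (S.termA z Φ Ψ) ∧ Summable (S.termB z Φ Ψ) ∧ Summable (S.termD z Φ Ψ) ∧
      S.kBog z Φ Ψ = S.kDiag z Φ Ψ -
        ((1 / 2 * ∑' k : Mode d, (S.A z k - S.D z k) : ℝ) : ℂ) * inner ℂ Φ Ψ := by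
  have hxpos : ∀ k : Mode d, 0 < ‖S.momentum k‖ ^ 2 := fun k => hx₀.trans_le (hx k)
  obtain ⟨hΦ1, hΦ2⟩ := S.kinetic_summable hΦ hxpos
  obtain ⟨hΨ1, hΨ2⟩ := S.kinetic_summable hΨ hxpos
  have hΦ0 := summable_normSq Φ
  have hΨ0 := summable_normSq Ψ
  obtain ⟨x, hxdef⟩ : ∃ x : Mode d → ℝ, ∀ k, ‖S.momentum k‖ ^ 2 = x k := ⟨_, fun _ => rfl⟩
  simp only [hxdef] at hx hxy hs hxpos hΦ2 hΨ2
  have hBopp : ∀ k : Mode d, S.B z k.opp = S.B z k := fun k => by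
    simp only [B, momentum_opp, gHat_neg]
  have hAopp : ∀ k : Mode d, S.A z k.opp = S.A z k := fun k => by
    simp only [A, momentum_opp, gHat_neg, norm_neg]
  have hA : ∀ k, S.A z k = x k + S.B z k := fun k => by rw [← hxdef]; rfl
  have hD : ∀ k, S.D z k = Real.sqrt (x k ^ 2 + 2 * x k * S.B z k) := fun k => by
    simp only [D, Dsq, B, ← hxdef]; congr 1; ring
  have hα : ∀ k, S.α z k = (x k + S.B z k - S.D z k) / S.B z k := fun k => by
    rw [← hxdef]; rfl
  have coef := fun k => bogoliubov_coefficients (hxpos k) (hxy k) (hD k) (hα k)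
  have hα1 : ∀ k, S.α z k ^ 2 < 1 := fun k => by
    rw [hα, hD]; exact angle_sq_lt_one (hxpos k) (hxy k)
  have nn : ∀ (k : Mode d) (Ψ : Fock d), 0 ≤ occupation k Ψ := fun k Ψ =>
    tsum_nonneg fun n => by positivity
  -- the occupation numbers are summable
  have occ : ∀ Ψ : Fock d, (Summable fun k : Mode d => x k * occupation k Ψ) →
      Summable fun k : Mode d => occupation k Ψ := fun Ψ h => by
    refine Summable.of_nonneg_of_le (fun k => nn k Ψ) (fun k => ?_) (h.mul_left x₀⁻¹)
    calc occupation k Ψ = x₀⁻¹ * (x₀ * occupation k Ψ) := by field_simp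
      _ ≤ _ := by
        have := nn k Ψ
        have := hx k
        gcongr
  -- the boundedness of `B`
  have hB1 : ∀ k, |S.B z k| ≤ x k + S.B z k ^ 2 / x k := fun k => by
    have hxk := hxpos k
    have : x k + S.B z k ^ 2 / x k - |S.B z k| =
        ((x k - |S.B z k| / 2) ^ 2 + 3 / 4 * |S.B z k| ^ 2) / x k := by
      field_simp; rw [← sq_abs (S.B z k)]; ring
    have h2 : 0 ≤ ((x k - |S.B z k| / 2) ^ 2 + 3 / 4 * |S.B z k| ^ 2) / x k := by positivity
    linarith
  -- `termA` and `termB` are combinations of these pairings at `k` and at `-k`. Reindexing by the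
  -- reflection, under which `A` and `B` are invariant, brings every series back to `k`.
  set p : Mode d → ℂ := fun k => pairing (annihilate k Φ) (create k.opp Ψ) with hp
  set q : Mode d → ℂ := fun k => pairing (create k.opp Φ) (annihilate k Ψ) with hq
  set N : Mode d → ℂ := fun k => pairing (annihilate k Φ) (annihilate k Ψ) with hN
  have bprod : ∀ Ψ : Fock d, (Summable fun k : Mode d => occupation k Ψ) →
      Summable fun k : Mode d => S.B z k ^ 2 / x k * occupation k Ψ := fun Ψ h => by
    refine Summable.of_nonneg_of_le (fun k => ?_) (fun k => ?_)
      (hs.mul_right (∑' k : Mode d, occupation k Ψ))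
    · have := hxpos k
      have := nn k Ψ
      positivity
    · have := hxpos k
      have := h.le_tsum k fun j _ => nn j Ψ
      gcongr
  have oppS : ∀ {f : Mode d → ℝ}, Summable f → Summable fun k : Mode d => f k.opp := fun h =>
    (Mode.oppEquiv.summable_iff).mpr h
  have hoppx : ∀ k : Mode d, x k.opp = x k := fun k => by
    simp [← hxdef, momentum_opp]
  have hNs : Summable fun k => (S.A z k : ℂ) * N k := by
    have h1 := ((hΦ2.mul_left 2).add (hΨ2.mul_left 2)).add
      ((bprod Φ (occ Φ hΦ2)).add (bprod Ψ (occ Ψ hΨ2)))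
    refine Summable.of_norm_bounded h1 fun k => ?_
    have h2 := norm_pairing_le one_pos (hasSum_normSq_annihilate (hΦ1 k))
      (hasSum_normSq_annihilate (hΨ1 k))
    have h3 : |S.A z k| ≤ 2 * x k + S.B z k ^ 2 / x k := by
      rw [hA]
      calc _ ≤ |x k| + |S.B z k| := abs_add_le _ _
        _ ≤ _ := by rw [abs_of_pos (hxpos k)]; linarith [hB1 k]
    rw [norm_mul, Complex.norm_real, Real.norm_eq_abs]
    change ‖N k‖ ≤ 1 / 2 * occupation k Φ + 1 / (2 * 1) * occupation k Ψ at h2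
    have h4 : ‖N k‖ ≤ occupation k Φ + occupation k Ψ := by
      linarith [nn k Φ, nn k Ψ]
    calc _ ≤ (2 * x k + S.B z k ^ 2 / x k) * (occupation k Φ + occupation k Ψ) := by
          have := hxpos k
          gcongr
      _ = _ := by ring
  have hps : Summable fun k => (S.B z k : ℂ) * p k := by
    have h1 := (hΦ2.mul_left (1 / 2)).add
      (((oppS (bprod Ψ (occ Ψ hΨ2))).add (hs.mul_right (∑' n : Config d, ‖Ψ n‖ ^ 2))).mul_left
        (1 / 2))
    refine Summable.of_norm_bounded h1 fun k => ?_
    -- The Young weight `x / |B|` degenerates when `B = 0`, but then the term itself vanishes.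
    by_cases hB : S.B z k = 0
    · simp only [hB, Complex.ofReal_zero, zero_mul, norm_zero, hBopp]
      have := mul_nonneg (hxpos k).le (nn k Φ)
      simp only [ne_eq, OfNat.ofNat_ne_zero, not_false_eq_true, zero_pow, zero_div, zero_mul]
      linarith
    have hxk := hxpos k
    have hBk := abs_pos.mpr hB
    have h2 := norm_pairing_le (div_pos hxk hBk) (hasSum_normSq_annihilate (hΦ1 k))
      (hasSum_normSq_create (hΨ1 k.opp) hΨ0)
    rw [norm_mul, Complex.norm_real, Real.norm_eq_abs]
    calc _ ≤ |S.B z k| * _ := mul_le_mul_of_nonneg_left h2 (abs_nonneg _)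
      _ = _ := by
        simp only [hBopp, hoppx]
        rw [← sq_abs (S.B z k)]
        change _ = 1 / 2 * (x k * ∑' n : Config d, (n k : ℝ) * ‖Φ n‖ ^ 2) +
          1 / 2 * (|S.B z k| ^ 2 / x k * ∑' n : Config d, (n k.opp : ℝ) * ‖Ψ n‖ ^ 2 + _)
        field_simp
  have hqs : Summable fun k => (S.B z k : ℂ) * q k := by
    have h1 := (hΨ2.mul_left (1 / 2)).add
      (((oppS (bprod Φ (occ Φ hΦ2))).add (hs.mul_right (∑' n : Config d, ‖Φ n‖ ^ 2))).mul_left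
        (1 / 2))
    refine Summable.of_norm_bounded h1 fun k => ?_
    by_cases hB : S.B z k = 0
    · simp only [hB, Complex.ofReal_zero, zero_mul, norm_zero, hBopp]
      have := mul_nonneg (hxpos k).le (nn k Ψ)
      simp only [ne_eq, OfNat.ofNat_ne_zero, not_false_eq_true, zero_pow, zero_div, zero_mul]
      linarith
    have hxk := hxpos k
    have hBk := abs_pos.mpr hB
    have h2 := norm_pairing_le (div_pos hBk hxk)
      (hasSum_normSq_create (hΦ1 k.opp) hΦ0) (hasSum_normSq_annihilate (hΨ1 k))
    rw [norm_mul, Complex.norm_real, Real.norm_eq_abs]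
    calc _ ≤ |S.B z k| * _ := mul_le_mul_of_nonneg_left h2 (abs_nonneg _)
      _ = _ := by
        simp only [hBopp, hoppx]
        rw [← sq_abs (S.B z k)]
        change _ = 1 / 2 * (x k * ∑' n : Config d, (n k : ℝ) * ‖Ψ n‖ ^ 2) +
          1 / 2 * (|S.B z k| ^ 2 / x k * ∑' n : Config d, (n k.opp : ℝ) * ‖Φ n‖ ^ 2 + _)
        field_simp
        ring
  have oppC : ∀ {f : Mode d → ℂ}, Summable f → Summable fun k : Mode d => f k.opp := fun h =>
    (Mode.oppEquiv.summable_iff).mpr h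
  have oppT : ∀ f : Mode d → ℂ, ∑' k : Mode d, f k.opp = ∑' k, f k := fun f =>
    Mode.oppEquiv.tsum_eq f
  have tA : S.termA z Φ Ψ = fun k => (S.A z k : ℂ) * N k + (S.A z k.opp : ℂ) * N k.opp := by
    funext k; simp only [termA, hAopp, hN]; ring
  have tB : S.termB z Φ Ψ = fun k => (S.B z k : ℂ) * p k + (S.B z k.opp : ℂ) * q k.opp := by
    funext k; simp only [termB, hBopp, hp, hq, Mode.opp_opp]; ring
  have gapS : Summable fun k => S.A z k - S.D z k := by
    refine Summable.of_norm_bounded (hs.mul_left 2) fun k => ?_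
    rw [hA, hD]; exact abs_gap_le (hxpos k) (hxy k)
  -- The commutator turns `a_{-k} a_{-k}†` into the number operator of `-k` plus one. The number
  -- part is written relative to `N k`, so the difference `N k.opp - N k` carries an even
  -- coefficient and sums to zero; the last term is the zero-point constant.
  have tD : S.termD z Φ Ψ = fun k => (S.A z k : ℂ) * N k +
      (1 / 2 * ((S.B z k : ℂ) * p k) + 1 / 2 * ((S.B z k : ℂ) * q k)) +
      (((S.A z k - S.D z k) / 2 : ℝ) : ℂ) * (N k.opp - N k) +
      (((S.A z k - S.D z k) / 2 : ℝ) : ℂ) * inner ℂ Φ Ψ := by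
    funext k
    have e1 := (hasSum_normSq_annihilate (hΦ1 k)).summable
    have e2 := (hasSum_normSq_annihilate (hΨ1 k)).summable
    have e3 := (hasSum_normSq_create (hΦ1 k.opp) hΦ0).summable
    have e4 := (hasSum_normSq_create (hΨ1 k.opp) hΨ0).summable
    have f1 : pairing (S.b z k Φ) (S.b z k Ψ) = ((1 / (1 - S.α z k ^ 2) : ℝ) : ℂ) *
        (N k + (S.α z k : ℂ) * p k + (S.α z k : ℂ) * q k + (S.α z k : ℂ) ^ 2 *
          pairing (create k.opp Φ) (create k.opp Ψ)) := by
      simp only [hN, hp, hq]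
      unfold pairing
      rw [← tsum_mul_left, ← tsum_mul_left, ← tsum_mul_left,
        ← Summable.tsum_add (summable_conj_mul e1 e2) ((summable_conj_mul e1 e4).mul_left _),
        ← Summable.tsum_add ((summable_conj_mul e1 e2).add ((summable_conj_mul e1 e4).mul_left _))
          ((summable_conj_mul e3 e2).mul_left _),
        ← Summable.tsum_add (((summable_conj_mul e1 e2).add
          ((summable_conj_mul e1 e4).mul_left _)).add ((summable_conj_mul e3 e2).mul_left _))
          ((summable_conj_mul e3 e4).mul_left _), ← tsum_mul_left]
      refine tsum_congr fun n => ?_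
      have hs : ((1 / Real.sqrt (1 - S.α z k ^ 2) : ℝ) : ℂ) *
          ((1 / Real.sqrt (1 - S.α z k ^ 2) : ℝ) : ℂ) = ((1 / (1 - S.α z k ^ 2) : ℝ) : ℂ) := by
        rw [← Complex.ofReal_mul, div_mul_div_comm, one_mul,
          Real.mul_self_sqrt (by linarith [hα1 k])]
      simp only [b, map_mul, map_add, Complex.conj_ofReal]
      rw [← hs]; ring
    have f2 : pairing (create k.opp Φ) (create k.opp Ψ) = N k.opp + inner ℂ Φ Ψ := by
      have g1 : Summable fun n : Config d => ((n k.opp : ℝ) : ℂ) * (conj (Φ n) * Ψ n) := by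
        refine Summable.of_norm_bounded (((hΦ1 k.opp).mul_left (1 / 2)).add
          ((hΨ1 k.opp).mul_left (1 / (2 * 1)))) fun n => ?_
        have := norm_conj_mul_le one_pos (Φ n) (Ψ n)
        rw [norm_mul, Complex.norm_real, Real.norm_eq_abs, abs_of_nonneg (by positivity)]
        calc _ ≤ (n k.opp : ℝ) * _ := mul_le_mul_of_nonneg_left this (by positivity)
          _ = _ := by ring
      rw [pairing_create, inner_eq_pairing]
      simp only [hN]
      rw [pairing_annihilate]
      unfold pairing
      rw [← Summable.tsum_add g1 (summable_conj_mul hΦ0 hΨ0)]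
      refine tsum_congr fun n => ?_
      push_cast; ring
    obtain ⟨c1, c2, c3⟩ := coef k
    rw [← hA] at c1 c3
    have c1' : (S.D z k : ℂ) * ((1 / (1 - S.α z k ^ 2) : ℝ) : ℂ) * (1 + (S.α z k : ℂ) ^ 2) =
      (S.A z k : ℂ) := by exact_mod_cast congrArg (Complex.ofReal) c1
    have c2' : (S.D z k : ℂ) * ((1 / (1 - S.α z k ^ 2) : ℝ) : ℂ) * (S.α z k : ℂ) =
      (S.B z k : ℂ) / 2 := by exact_mod_cast congrArg (Complex.ofReal) c2
    have c3' : (S.D z k : ℂ) * ((1 / (1 - S.α z k ^ 2) : ℝ) : ℂ) * (S.α z k : ℂ) ^ 2 =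
      (((S.A z k - S.D z k) / 2 : ℝ) : ℂ) := by exact_mod_cast congrArg (Complex.ofReal) c3
    simp only [termD]
    rw [f1, f2, ← c1', ← c3']
    linear_combination (p k + q k) * c2'
  have gapN : Summable fun k : Mode d => (((S.A z k - S.D z k) / 2 : ℝ) : ℂ) * N k := by
    refine Summable.of_norm_bounded ((bprod Φ (occ Φ hΦ2)).add (bprod Ψ (occ Ψ hΨ2))) fun k => ?_
    have h2 := norm_pairing_le one_pos (hasSum_normSq_annihilate (hΦ1 k))
      (hasSum_normSq_annihilate (hΨ1 k))
    change ‖N k‖ ≤ 1 / 2 * occupation k Φ + 1 / (2 * 1) * occupation k Ψ at h2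
    have h3 := abs_gap_le (hxpos k) (hxy k)
    rw [← hD, ← hA] at h3
    rw [norm_mul, Complex.norm_real, Real.norm_eq_abs, abs_div, abs_two]
    have hxk := hxpos k
    calc _ ≤ (2 * (S.B z k ^ 2 / x k)) / 2 * (occupation k Φ + occupation k Ψ) := by
          gcongr
          linarith [nn k Φ, nn k Ψ]
      _ = _ := by ring
  have gapN' := oppC gapN
  have hDopp : ∀ k : Mode d, S.D z k.opp = S.D z k := fun k => by rw [hD, hD, hoppx, hBopp]
  have gapE : (fun k : Mode d => (((S.A z k - S.D z k) / 2 : ℝ) : ℂ) * (N k.opp - N k)) =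
      fun k => (((S.A z k.opp - S.D z k.opp) / 2 : ℝ) : ℂ) * N k.opp -
        (((S.A z k - S.D z k) / 2 : ℝ) : ℂ) * N k := by
    funext k; rw [hAopp, hDopp]; ring
  have gapE0 : ∑' k : Mode d, (((S.A z k - S.D z k) / 2 : ℝ) : ℂ) * (N k.opp - N k) = 0 := by
    rw [gapE, Summable.tsum_sub gapN' gapN,
      oppT (fun k => (((S.A z k - S.D z k) / 2 : ℝ) : ℂ) * N k), sub_self]
  have gapES : Summable fun k : Mode d =>
      (((S.A z k - S.D z k) / 2 : ℝ) : ℂ) * (N k.opp - N k) := by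
    rw [gapE]; exact gapN'.sub gapN
  have gapC : Summable fun k : Mode d => (((S.A z k - S.D z k) / 2 : ℝ) : ℂ) :=
    Complex.ofRealCLM.summable (gapS.div_const 2)
  have pqS := (hps.mul_left (1 / 2)).add (hqs.mul_left (1 / 2))
  refine ⟨tA ▸ hNs.add (oppC hNs), tB ▸ hps.add (oppC hqs),
    tD ▸ ((hNs.add pqS).add gapES).add (gapC.mul_right _), ?_⟩
  unfold kBog kDiag
  rw [tA, tB, tD, Summable.tsum_add hNs (oppC hNs), oppT (fun k => (S.A z k : ℂ) * N k),
    Summable.tsum_add hps (oppC hqs), oppT (fun k => (S.B z k : ℂ) * q k),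
    Summable.tsum_add ((hNs.add pqS).add gapES) (gapC.mul_right _),
    Summable.tsum_add (hNs.add pqS) gapES, Summable.tsum_add hNs pqS, gapE0,
    Summable.tsum_add (hps.mul_left (1 / 2)) (hqs.mul_left (1 / 2)), tsum_mul_left, tsum_mul_left,
    tsum_mul_right]
  have : ∑' k : Mode d, (((S.A z k - S.D z k) / 2 : ℝ) : ℂ) =
      ((1 / 2 * ∑' k : Mode d, (S.A z k - S.D z k) : ℝ) : ℂ) := by
    rw [← Complex.ofReal_tsum, tsum_div_const]; congr 1; ring
  rw [this]; ring

end Setup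

/-! ### The regularized Bogoliubov integrand -/

section Integrand

/-- The Bogoliubov integrand with the subtraction `1 / (2 s²)` regularized by a Gaussian. -/
noncomputable def bogoliubovProfile (s : ℝ) : ℝ :=
  Real.sqrt ((s ^ 2 + 1) ^ 2 - 1) - s ^ 2 - 1 + (1 - Real.exp (-s ^ 2)) / (2 * s ^ 2)

lemma sqrt_dispersion_eq {s : ℝ} (hs : 0 ≤ s) :
    Real.sqrt ((s ^ 2 + 1) ^ 2 - 1) = s * Real.sqrt (s ^ 2 + 2) := by
  rw [show (s ^ 2 + 1) ^ 2 - 1 = s ^ 2 * (s ^ 2 + 2) by ring, Real.sqrt_mul (sq_nonneg s),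
    Real.sqrt_sq hs]

lemma abs_bogoliubovProfile_le (s : ℝ) : |bogoliubovProfile s| ≤ 2 := by
  unfold bogoliubovProfile
  have h0 : 0 ≤ (s ^ 2 + 1) ^ 2 - 1 := by nlinarith [sq_nonneg s, sq_nonneg (s ^ 2)]
  have h1 := Real.sq_sqrt h0
  have h2 := Real.sqrt_nonneg ((s ^ 2 + 1) ^ 2 - 1)
  set q := Real.sqrt ((s ^ 2 + 1) ^ 2 - 1)
  have h3 : q ≤ s ^ 2 + 1 := by nlinarith [sq_nonneg s]
  have h4 : s ^ 2 ≤ q := by nlinarith [sq_nonneg s]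
  have h5 : (1 - Real.exp (-s ^ 2)) / (2 * s ^ 2) ≤ 1 / 2 := by
    by_cases hs : s = 0
    · simp [hs]
    have hs2 : 0 < s ^ 2 := by positivity
    rw [div_le_div_iff₀ (by positivity) (by norm_num)]
    nlinarith [Real.add_one_le_exp (-s ^ 2)]
  have h6 : 0 ≤ (1 - Real.exp (-s ^ 2)) / (2 * s ^ 2) := by
    apply div_nonneg _ (by positivity)
    have : Real.exp (-s ^ 2) ≤ 1 := Real.exp_le_one_iff.mpr (by nlinarith [sq_nonneg s])
    linarith
  rw [abs_le]; constructor <;> linarith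

lemma hasDerivAt_bogoliubovProfile {s : ℝ} (hs : 0 < s) :
    HasDerivAt bogoliubovProfile (2 * (s ^ 2 + 1) / Real.sqrt (s ^ 2 + 2) - 2 * s +
      ((s ^ 2 * Real.exp (-s ^ 2) - 1 + Real.exp (-s ^ 2)) / s ^ 3)) s := by
  have h2 : (0 : ℝ) < s ^ 2 + 2 := by positivity
  have e1 : HasDerivAt (fun s : ℝ => s ^ 2) (2 * s) s := by simpa using hasDerivAt_pow 2 s
  have e2 := (e1.add_const 2).sqrt h2.ne'
  have e3 := (hasDerivAt_id' s).mul e2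
  have e4 : HasDerivAt (fun s : ℝ => Real.exp (-s ^ 2)) (Real.exp (-s ^ 2) * (-(2 * s))) s :=
    e1.neg.exp
  have e5 := (e4.const_sub 1).div (e1.const_mul 2) (by positivity)
  have e6 := ((e3.sub e1).sub_const 1).add e5
  have heq : bogoliubovProfile =ᶠ[nhds s] fun s : ℝ => (s * Real.sqrt (s ^ 2 + 2) - s ^ 2 - 1 +
      (1 - Real.exp (-s ^ 2)) / (2 * s ^ 2)) := by
    filter_upwards [lt_mem_nhds hs] with t ht
    rw [bogoliubovProfile, sqrt_dispersion_eq ht.le]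
  refine (e6.congr_of_eventuallyEq heq).congr_deriv ?_
  have h3 := Real.sq_sqrt h2.le
  have h4 := Real.sqrt_pos.mpr h2
  set q := Real.sqrt (s ^ 2 + 2)
  set e := Real.exp (-s ^ 2)
  have : q ^ 2 / q = q := by field_simp
  have t1 : 1 * q + s * (2 * s / (2 * q)) - 2 * s = 2 * (s ^ 2 + 1) / q - 2 * s := by
    field_simp
    linear_combination h3
  have t2 : (-(e * -(2 * s)) * (2 * s ^ 2) - (1 - e) * (2 * (2 * s))) / (2 * s ^ 2) ^ 2 =
      (s ^ 2 * e - 1 + e) / s ^ 3 := by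
    field_simp
    ring
  rw [t1, t2]

lemma exp_neg_le_two_div_sq {u : ℝ} (hu : 0 < u) : Real.exp (-u) ≤ 2 / u ^ 2 := by
  rw [Real.exp_neg, inv_eq_one_div, div_le_div_iff₀ (Real.exp_pos u) (by positivity)]
  nlinarith [Real.quadratic_le_exp_of_nonneg hu.le]

lemma exp_neg_le_quadratic {u : ℝ} (hu : 0 ≤ u) : Real.exp (-u) ≤ 1 - u + u ^ 2 := by
  have h1 := Real.quadratic_le_exp_of_nonneg hu
  rw [Real.exp_neg, inv_le_iff_one_le_mul₀ (Real.exp_pos u)]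
  have : 0 < 1 - u + u ^ 2 := by nlinarith [sq_nonneg (u - 1 / 2)]
  nlinarith [mul_le_mul_of_nonneg_left h1 this.le, mul_nonneg hu (sq_nonneg u),
    mul_nonneg hu (sq_nonneg (u - 1)), mul_nonneg (mul_nonneg hu hu) (sq_nonneg (u - 1)),
    mul_nonneg (sq_nonneg u) (sq_nonneg u), sq_nonneg u]

/-- For `s ≤ 1` each piece is bounded by a constant. For `s ≥ 1` the leading `1 / s³` of the
square-root part cancels against the regularized subtraction, leaving `7 / s⁴`. The constant is `112
= 7 · 16`, since `(1 + s)⁴` is at most `16` or `16 s⁴` respectively. -/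
lemma abs_deriv_bogoliubovProfile_le {s : ℝ} (hs : 0 < s) :
    |2 * (s ^ 2 + 1) / Real.sqrt (s ^ 2 + 2) - 2 * s +
      ((s ^ 2 * Real.exp (-s ^ 2) - 1 + Real.exp (-s ^ 2)) / s ^ 3)| ≤ 112 / (1 + s) ^ 4 := by
  have h2 : (0 : ℝ) < s ^ 2 + 2 := by positivity
  have h3 := Real.sq_sqrt h2.le
  have h4 := Real.sqrt_pos.mpr h2
  set q := Real.sqrt (s ^ 2 + 2)
  have hsq : s ≤ q := by nlinarith
  have he0 := Real.exp_pos (-s ^ 2)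
  have he1 : Real.exp (-s ^ 2) ≤ 1 := Real.exp_le_one_iff.mpr (by nlinarith [sq_nonneg s])
  have he2 : 1 - s ^ 2 ≤ Real.exp (-s ^ 2) := by linarith [Real.add_one_le_exp (-s ^ 2)]
  have he3 := exp_neg_le_quadratic (sq_nonneg s)
  have he4 := exp_neg_le_two_div_sq (show 0 < s ^ 2 by positivity)
  set e := Real.exp (-s ^ 2)
  rcases le_total s 1 with h1 | h1
  · have hq1 : 1 ≤ q := by nlinarith
    have a1 : 2 * (s ^ 2 + 1) / q ≤ 4 := by
      rw [div_le_iff₀ h4]; nlinarith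
    have a2 : 0 ≤ 2 * (s ^ 2 + 1) / q - 2 * s := by
      rw [sub_nonneg, le_div_iff₀ h4]; nlinarith [sq_nonneg (s - q), sq_nonneg s]
    have a3 : (s ^ 2 * e - 1 + e) / s ^ 3 ≤ 1 := by
      rw [div_le_one (by positivity)]
      have : s ^ 2 * e ≤ s ^ 2 * (1 - s ^ 2 + (s ^ 2) ^ 2) := by gcongr
      have h6 : s ^ 6 ≤ s ^ 3 := pow_le_pow_of_le_one hs.le h1 (by norm_num)
      nlinarith
    have a4 : -1 ≤ (s ^ 2 * e - 1 + e) / s ^ 3 := by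
      rw [le_div_iff₀ (by positivity)]
      have : s ^ 2 * (1 - s ^ 2) ≤ s ^ 2 * e := by gcongr
      have h6 : s ^ 4 ≤ s ^ 3 := pow_le_pow_of_le_one hs.le h1 (by norm_num)
      nlinarith
    have a5 : (1 + s) ^ 4 ≤ 16 := by
      calc (1 + s) ^ 4 ≤ (1 + 1) ^ 4 := by gcongr
        _ = 16 := by norm_num
    have a6 : 7 ≤ 112 / (1 + s) ^ 4 := by
      rw [le_div_iff₀ (by positivity)]; linarith
    rw [abs_le]; constructor <;> linarith
  · have b1 : 2 * (s ^ 2 + 1) / q - 2 * s = 2 / (q * (s ^ 2 + 1 + s * q)) := by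
      field_simp
      nlinarith
    have b2 : 2 / (q * (s ^ 2 + 1 + s * q)) ≤ 1 / s ^ 3 := by
      rw [div_le_div_iff₀ (by positivity) (by positivity)]
      have : s * (s ^ 2 + s * s) ≤ q * (s ^ 2 + 1 + s * q) := by gcongr <;> linarith
      nlinarith
    have hqs : q * s ≤ s ^ 2 + 1 := by
      nlinarith [sq_nonneg (q - s)]
    have b3 : s / (s ^ 2 + 1) ^ 2 ≤ 2 / (q * (s ^ 2 + 1 + s * q)) := by
      rw [div_le_div_iff₀ (by positivity) (by positivity)]
      have : (s * q) * (s ^ 2 + 1 + s * q) ≤ (s ^ 2 + 1) * (s ^ 2 + 1 + (s ^ 2 + 1)) := by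
        gcongr <;> linarith
      nlinarith
    have b4 : 1 / s ^ 3 - s / (s ^ 2 + 1) ^ 2 ≤ 3 / s ^ 4 := by
      rw [div_sub_div _ _ (by positivity) (by positivity), div_le_div_iff₀ (by positivity)
        (by positivity)]
      have h5 : 2 * s ^ 2 + 1 ≤ 3 * s ^ 2 := by nlinarith
      have h6 : s ^ 4 ≤ (s ^ 2 + 1) ^ 2 := by nlinarith [sq_nonneg s]
      have h7 : (2 * s ^ 2 + 1) * s ^ 4 ≤ 3 * s ^ 2 * (s ^ 2 + 1) ^ 2 := by gcongr
      have h8 : 3 * s ^ 2 * (s ^ 2 + 1) ^ 2 ≤ 3 * s ^ 3 * (s ^ 2 + 1) ^ 2 := by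
        gcongr 3 * ?_ * _
        exact pow_le_pow_right₀ h1 (by norm_num)
      nlinarith
    have b5 : e / s ≤ 2 / s ^ 4 := by
      have : e ≤ 2 / s ^ 4 := by rw [← pow_mul] at he4; exact he4
      calc e / s ≤ e / 1 := by gcongr
        _ ≤ _ := by simpa using this
    have b6 : e / s ^ 3 ≤ 2 / s ^ 4 := by
      have : e ≤ 2 / s ^ 4 := by rw [← pow_mul] at he4; exact he4
      calc e / s ^ 3 ≤ e / 1 := by gcongr; exact one_le_pow₀ h1
        _ ≤ _ := by simpa using this
    have b7 : (s ^ 2 * e - 1 + e) / s ^ 3 = e / s - 1 / s ^ 3 + e / s ^ 3 := by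
      field_simp
    have b8 : 7 / s ^ 4 ≤ 112 / (1 + s) ^ 4 := by
      rw [div_le_div_iff₀ (by positivity) (by positivity)]
      have : (1 + s) ^ 4 ≤ (2 * s) ^ 4 := by gcongr; linarith
      nlinarith
    have b9 : 7 / s ^ 4 = 3 / s ^ 4 + 2 / s ^ 4 + 2 / s ^ 4 := by ring
    have c1 : 0 ≤ e / s := by positivity
    have c2 : 0 ≤ e / s ^ 3 := by positivity
    have c3 : 0 ≤ 2 / s ^ 4 := by positivity
    rw [b1, b7, abs_le]; constructor <;> linarith

lemma abs_bogoliubovProfile_sub_le {s t r : ℝ} (hr : 0 < r) (hs : r ≤ s) (ht : r ≤ t) :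
    |bogoliubovProfile s - bogoliubovProfile t| ≤ 112 / (1 + r) ^ 4 * |s - t| := by
  refine (convex_Ici r).norm_image_sub_le_of_norm_hasDerivWithin_le
    (fun x hx => (hasDerivAt_bogoliubovProfile (hr.trans_le hx)).hasDerivWithinAt)
    (fun x hx => (abs_deriv_bogoliubovProfile_le (hr.trans_le hx)).trans ?_) ht hs
  have : r ≤ x := hx
  gcongr

end Integrand

/-! ### The gap function with its quadratic part subtracted -/

section Gap

/-- The contribution `𝒜 - 𝒟` of a mode, with its regularized quadratic part subtracted. -/
noncomputable def reducedGap (y₀ x y : ℝ) : ℝ :=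
  x + y - Real.sqrt (x ^ 2 + 2 * x * y) - y ^ 2 / (2 * x) * (1 - Real.exp (-(x / y₀)))

lemma hasDerivAt_sqrt_expansion {u : ℝ} (hu : -(1 / 4) ≤ u) :
    HasDerivAt (fun u : ℝ => 1 + u - Real.sqrt (1 + 2 * u) - u ^ 2 / 2)
      (1 - 1 / Real.sqrt (1 + 2 * u) - u) u := by
  have h0 : 0 < 1 + 2 * u := by linarith
  have e1 : HasDerivAt (fun u : ℝ => 1 + 2 * u) 2 u := by
    simpa using ((hasDerivAt_id' u).const_mul 2).const_add 1
  have e2 := e1.sqrt h0.ne'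
  have e3 := (((hasDerivAt_id' u).const_add 1).sub e2).sub ((hasDerivAt_pow 2 u).div_const 2)
  refine e3.congr_deriv ?_
  have := Real.sqrt_pos.mpr h0
  field_simp
  norm_num
  ring

/-- With `r = √(1 + 2u)` the left side is `(r - 1)² (r + 2) / (2r)`, while `u² = (r - 1)² (r + 1)² /
4`; the common factor drops out, and `r ≥ 7 / 10` bounds the rest. -/
lemma abs_deriv_sqrt_expansion_le {u : ℝ} (hu : -(1 / 4) ≤ u) :
    |1 - 1 / Real.sqrt (1 + 2 * u) - u| ≤ 3 * u ^ 2 := by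
  have h0 : 0 < 1 + 2 * u := by linarith
  have h1 := Real.sq_sqrt h0.le
  have h2 := Real.sqrt_pos.mpr h0
  set r := Real.sqrt (1 + 2 * u)
  have hr : 7 / 10 ≤ r := by nlinarith
  have hu' : u = (r ^ 2 - 1) / 2 := by linarith
  have e : 1 - 1 / r - u = -((r - 1) ^ 2 * (r + 2) / (2 * r)) := by
    rw [hu']; field_simp; ring
  rw [e, abs_neg, abs_of_nonneg (by positivity), hu', div_le_iff₀ (by positivity)]
  have : (r + 2) ≤ 3 / 4 * (r + 1) ^ 2 * (2 * r) := by nlinarith [sq_nonneg (r - 7 / 10)]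
  calc _ ≤ (r - 1) ^ 2 * (3 / 4 * (r + 1) ^ 2 * (2 * r)) := by gcongr
    _ = _ := by ring

/-- In the variable `u = y / x` the gap without its full quadratic part has derivative of order
`u²`; the Gaussian piece put back is controlled by `e^{-x / y₀} ≤ y₀ / x`. The second power of `y₀ /
x` leaves room in the later lattice sum for a growing bound on `|y - y₀|`. -/
lemma abs_reducedGap_sub_le {x y y₀ : ℝ} (hx : 0 < x) (hy₀ : 0 < y₀) (hy : |y| ≤ y₀)
    (hxy : x / 2 ≤ x + 2 * y) :
    |reducedGap y₀ x y - reducedGap y₀ x y₀| ≤ 4 * (y₀ / x) ^ 2 * |y - y₀| := by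
  obtain ⟨hy1, hy2⟩ := abs_le.mp hy
  have hexp : Real.exp (-(x / y₀)) ≤ y₀ / x := by
    rw [Real.exp_neg, inv_le_comm₀ (Real.exp_pos _) (by positivity), inv_div]
    linarith [Real.add_one_le_exp (x / y₀)]
  have key : ∀ y, x / 2 ≤ x + 2 * y → reducedGap y₀ x y =
      x * (1 + y / x - Real.sqrt (1 + 2 * (y / x)) - (y / x) ^ 2 / 2) +
        y ^ 2 / (2 * x) * Real.exp (-(x / y₀)) := by
    intro y h
    have : x ^ 2 + 2 * x * y = x ^ 2 * (1 + 2 * (y / x)) := by field_simp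
    rw [reducedGap, this, Real.sqrt_mul (sq_nonneg x), Real.sqrt_sq hx.le]
    field_simp
    ring
  have hlow : ∀ y, x / 2 ≤ x + 2 * y → -(1 / 4) ≤ y / x := fun y h => by
    rw [le_div_iff₀ hx]; linarith
  have hxy₀ : x / 2 ≤ x + 2 * y₀ := by linarith
  have hconv : Convex ℝ (Set.Ici (-(1 / 4) : ℝ) ∩ Set.Icc (-(y₀ / x)) (y₀ / x)) :=
    (convex_Ici _).inter (convex_Icc _ _)
  have hmv := hconv.norm_image_sub_le_of_norm_hasDerivWithin_le
    (f := fun u : ℝ => 1 + u - Real.sqrt (1 + 2 * u) - u ^ 2 / 2)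
    (C := 3 * (y₀ / x) ^ 2) (x := y₀ / x) (y := y / x)
    (fun u hu => (hasDerivAt_sqrt_expansion hu.1).hasDerivWithinAt)
    (fun u hu => (abs_deriv_sqrt_expansion_le hu.1).trans (by
      have := abs_le.mpr hu.2
      have h3 : |u| ^ 2 ≤ (y₀ / x) ^ 2 := by gcongr
      rw [sq_abs] at h3
      linarith))
    ⟨hlow y₀ hxy₀, by have : 0 < y₀ / x := by positivity
                      constructor <;> linarith⟩
    ⟨hlow y hxy, by rw [← neg_div]; gcongr, by gcongr⟩
  simp only [Real.norm_eq_abs] at hmv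
  rw [key y hxy, key y₀ hxy₀]
  have t1 : |y / x - y₀ / x| = |y - y₀| / x := by
    rw [← sub_div, abs_div, abs_of_pos hx]
  rw [t1] at hmv
  have t2 : |y ^ 2 / (2 * x) * Real.exp (-(x / y₀)) - y₀ ^ 2 / (2 * x) * Real.exp (-(x / y₀))| ≤
      (y₀ / x) ^ 2 * |y - y₀| := by
    rw [← sub_mul, ← sub_div, abs_mul, abs_div, Real.abs_exp, abs_of_pos (by positivity : 0 < 2 * x),
      show y ^ 2 - y₀ ^ 2 = (y + y₀) * (y - y₀) by ring, abs_mul]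
    have : |y + y₀| ≤ 2 * y₀ := by rw [abs_le]; constructor <;> linarith
    calc _ ≤ (2 * y₀) * |y - y₀| / (2 * x) * (y₀ / x) := by gcongr
      _ = _ := by field_simp
  set A := 1 + y / x - Real.sqrt (1 + 2 * (y / x)) - (y / x) ^ 2 / 2
  set A₀ := 1 + y₀ / x - Real.sqrt (1 + 2 * (y₀ / x)) - (y₀ / x) ^ 2 / 2
  set B := y ^ 2 / (2 * x) * Real.exp (-(x / y₀))
  set B₀ := y₀ ^ 2 / (2 * x) * Real.exp (-(x / y₀))
  calc |x * A + B - (x * A₀ + B₀)| = |x * (A - A₀) + (B - B₀)| := by congr 1; ring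
    _ ≤ x * |A - A₀| + |B - B₀| := by
      rw [← abs_of_pos hx, ← abs_mul, abs_of_pos hx]; exact abs_add_le _ _
    _ ≤ x * (3 * (y₀ / x) ^ 2 * (|y - y₀| / x)) + (y₀ / x) ^ 2 * |y - y₀| := by gcongr
    _ = _ := by field_simp; ring

/-- With the interaction frozen at `y₀`, only `s = |k| / √y₀` matters, so the lattice sum becomes a
Riemann sum of one universal profile with mesh `2π / (ℓ √y₀)`. -/
lemma reducedGap_self {y₀ s : ℝ} (hy₀ : 0 < y₀) (hs : 0 < s) :
    reducedGap y₀ (y₀ * s ^ 2) y₀ = -(y₀ * bogoliubovProfile s) := by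
  have e1 : (y₀ * s ^ 2) ^ 2 + 2 * (y₀ * s ^ 2) * y₀ = y₀ ^ 2 * ((s ^ 2 + 1) ^ 2 - 1) := by ring
  have e2 : y₀ * s ^ 2 / y₀ = s ^ 2 := by field_simp
  rw [reducedGap, bogoliubovProfile, e1, e2, Real.sqrt_mul (sq_nonneg _), Real.sqrt_sq hy₀.le]
  field_simp
  ring

end Gap

/-! ### The Euler-Mascheroni constant as an exponential integral -/

section ExpIntegral

open Set Filter Topology

lemma expIntegrand_bound {u : ℝ} (hu : 0 < u) :
    |Real.exp (-u) - (Iic (1 : ℝ)).indicator 1 u| / u ≤ Real.exp 1 * Real.exp (-u) := by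
  rw [div_le_iff₀ hu]
  by_cases h : u ≤ 1
  · rw [indicator_of_mem (by exact h), Pi.one_apply, abs_sub_comm, abs_of_nonneg
      (by linarith [Real.exp_le_one_iff.mpr (by linarith : -u ≤ 0)])]
    have : 1 ≤ Real.exp 1 * Real.exp (-u) := by
      rw [← Real.exp_add]; exact Real.one_le_exp (by linarith)
    nlinarith [Real.add_one_le_exp (-u)]
  · rw [indicator_of_notMem (by exact h), sub_zero, Real.abs_exp]
    have h1 : 1 ≤ Real.exp 1 := Real.one_le_exp (by norm_num)
    have := Real.exp_pos (-u)
    push Not at h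
    nlinarith [mul_le_mul h1 h.le (by norm_num) (by positivity)]

lemma integrableOn_expIntegrand :
    IntegrableOn (fun u : ℝ => (Real.exp (-u) - (Iic (1 : ℝ)).indicator 1 u) / u) (Ioi 0) := by
  refine Integrable.mono' ((integrableOn_exp_neg_Ioi 0).const_mul (Real.exp 1)) ?_ ?_
  · apply Measurable.aestronglyMeasurable
    apply Measurable.div _ measurable_id
    exact (Real.measurable_exp.comp measurable_neg).sub
      (measurable_one.indicator measurableSet_Iic)
  · refine (ae_restrict_mem measurableSet_Ioi).mono fun u hu => ?_
    rw [Real.norm_eq_abs, abs_div, abs_of_pos (show 0 < u from hu)]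
    exact expIntegrand_bound hu

/-- This is `Γ'(1) = -γ`. For `ε > 0` the difference quotient at `1` is `Γ(ε) - 1 / ε`, the integral
of `u^(ε - 1)` against `e^{-u}` minus the indicator of `u ≤ 1`; dominated convergence lets `ε` tend
to `0`. -/
lemma integral_expIntegrand :
    ∫ u in Ioi (0 : ℝ), (Real.exp (-u) - (Iic (1 : ℝ)).indicator 1 u) / u =
      -Real.eulerMascheroniConstant := by
  have hderiv := Real.hasDerivAt_Gamma_one
  have hslope := (hasDerivAt_iff_tendsto_slope_zero.mp hderiv).mono_left
    (nhdsWithin_mono 0 (fun x (hx : x ∈ Ioi (0 : ℝ)) => ne_of_gt hx))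
  have hdct : Tendsto (fun ε : ℝ => ∫ u in Ioi (0 : ℝ),
      u ^ ε * ((Real.exp (-u) - (Iic (1 : ℝ)).indicator 1 u) / u)) (𝓝[>] 0)
      (𝓝 (∫ u in Ioi (0 : ℝ), (Real.exp (-u) - (Iic (1 : ℝ)).indicator 1 u) / u)) := by
    refine tendsto_integral_filter_of_dominated_convergence
      (fun u => Real.exp 1 * (Real.exp (-u) * u ^ (2 - 1 : ℝ)) + Real.exp 1 * Real.exp (-u)) ?_ ?_ ?_ ?_
    · refine Eventually.of_forall fun ε => ?_
      exact (Measurable.aestronglyMeasurable (by fun_prop)).mul integrableOn_expIntegrand.1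
    · filter_upwards [Ioo_mem_nhdsGT (zero_lt_one' ℝ)] with ε hε
      refine (ae_restrict_mem measurableSet_Ioi).mono fun u hu => ?_
      have hu' : 0 < u := hu
      rw [norm_mul, Real.norm_eq_abs, Real.norm_eq_abs, abs_div, abs_of_pos hu',
        abs_of_nonneg (Real.rpow_nonneg hu'.le _)]
      have h1 : u ^ ε ≤ u + 1 := by
        rcases le_total u 1 with h | h
        · linarith [Real.rpow_le_one hu'.le h hε.1.le]
        · have h3 := Real.rpow_le_rpow_of_exponent_le h hε.2.le
          rw [Real.rpow_one] at h3
          linarith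
      calc _ ≤ (u + 1) * (Real.exp 1 * Real.exp (-u)) := by
            gcongr; exact expIntegrand_bound hu'
        _ = _ := by norm_num; ring
    · exact ((Real.GammaIntegral_convergent two_pos).const_mul _).add
        ((integrableOn_exp_neg_Ioi 0).const_mul _)
    · refine (ae_restrict_mem measurableSet_Ioi).mono fun u hu => ?_
      have hu' : 0 < u := hu
      have : Tendsto (fun ε : ℝ => u ^ ε) (𝓝[>] 0) (𝓝 (u ^ (0 : ℝ))) :=
        (tendsto_const_nhds.rpow tendsto_id (Or.inl hu'.ne')).mono_left nhdsWithin_le_nhds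
      simpa using this.mul_const ((Real.exp (-u) - (Iic (1 : ℝ)).indicator 1 u) / u)
  refine tendsto_nhds_unique hdct (hslope.congr' ?_)
  filter_upwards [self_mem_nhdsWithin] with ε hε
  have hε' : 0 < ε := hε
  have e1 : ∫ u in Ioi (0 : ℝ), Real.exp (-u) * u ^ (ε - 1) = Real.Gamma ε :=
    (Real.Gamma_eq_integral hε').symm
  have e2 : ∫ u in Ioi (0 : ℝ), (Iic (1 : ℝ)).indicator (fun u => u ^ (ε - 1)) u = 1 / ε := by
    rw [setIntegral_indicator measurableSet_Iic, Ioi_inter_Iic,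
      ← intervalIntegral.integral_of_le zero_le_one, integral_rpow (Or.inl (by linarith))]
    simp [hε'.ne']
  have i2 : IntegrableOn ((Iic (1 : ℝ)).indicator (fun u => u ^ (ε - 1))) (Ioi (0 : ℝ)) := by
    rw [integrableOn_indicator_iff measurableSet_Iic, inter_comm, Ioi_inter_Iic,
      ← intervalIntegrable_iff_integrableOn_Ioc_of_le zero_le_one]
    exact intervalIntegral.intervalIntegrable_rpow' (by linarith)
  rw [show 1 + ε = ε + 1 by ring, Real.Gamma_add_one hε'.ne', Real.Gamma_one]
  have e3 : ∀ u ∈ Ioi (0 : ℝ), u ^ ε * ((Real.exp (-u) - (Iic (1 : ℝ)).indicator 1 u) / u) =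
      Real.exp (-u) * u ^ (ε - 1) - (Iic (1 : ℝ)).indicator (fun u => u ^ (ε - 1)) u := by
    intro u hu
    have hu' : 0 < u := hu
    rw [Real.rpow_sub_one hu'.ne']
    by_cases h : u ≤ 1
    · rw [indicator_of_mem (by exact h), indicator_of_mem (by exact h), Pi.one_apply,
        Real.rpow_sub_one hu'.ne']; ring
    · rw [indicator_of_notMem (by exact h), indicator_of_notMem (by exact h)]; ring
  rw [setIntegral_congr_fun measurableSet_Ioi e3,
    integral_sub (Real.GammaIntegral_convergent hε') i2, e1, e2]
  simp only [smul_eq_mul]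
  field_simp

/-- The exponential integral near `0`. -/
lemma abs_expIntegral_add_log_le {u : ℝ} (hu : 0 < u) (hu1 : u ≤ 1) :
    IntegrableOn (fun s : ℝ => Real.exp (-s) / s) (Ioi u) ∧
    |(∫ s in Ioi u, Real.exp (-s) / s) + Real.log u + Real.eulerMascheroniConstant| ≤ u := by
  have hI := integrableOn_expIntegrand
  have i1 : IntegrableOn (fun s : ℝ => (Real.exp (-s) - (Iic (1 : ℝ)).indicator 1 s) / s) (Ioi u) :=
    hI.mono_set (Ioi_subset_Ioi hu.le)
  have i2 : IntegrableOn (fun s : ℝ => (Real.exp (-s) - (Iic (1 : ℝ)).indicator 1 s) / s)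
    (Ioc 0 u) := hI.mono_set Ioc_subset_Ioi_self
  have i3 : IntegrableOn ((Iic (1 : ℝ)).indicator (fun s : ℝ => 1 / s)) (Ioi u) := by
    rw [integrableOn_indicator_iff measurableSet_Iic, inter_comm, Ioi_inter_Iic]
    refine (ContinuousOn.integrableOn_Icc ?_).mono_set Ioc_subset_Icc_self
    exact continuousOn_const.div continuousOn_id fun s hs => by have := hs.1; simp; linarith
  have e3 : ∫ s in Ioi u, (Iic (1 : ℝ)).indicator (fun s : ℝ => 1 / s) s = -Real.log u := by
    rw [setIntegral_indicator measurableSet_Iic, Ioi_inter_Iic,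
      ← intervalIntegral.integral_of_le hu1, integral_one_div_of_pos hu one_pos, one_div,
      Real.log_inv]
  have e4 : ∀ s : ℝ, Real.exp (-s) / s = (Real.exp (-s) - (Iic (1 : ℝ)).indicator 1 s) / s +
      (Iic (1 : ℝ)).indicator (fun s : ℝ => 1 / s) s := fun s => by
    by_cases h : s ≤ 1
    · rw [indicator_of_mem (by exact h), indicator_of_mem (by exact h), Pi.one_apply]; ring
    · rw [indicator_of_notMem (by exact h), indicator_of_notMem (by exact h)]; ring
  simp_rw [e4]
  refine ⟨i1.add i3, ?_⟩
  rw [integral_add i1 i3, e3]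
  have h5 := integral_expIntegrand
  rw [← Ioc_union_Ioi_eq_Ioi hu.le,
    setIntegral_union (Set.Ioc_disjoint_Ioi_same) measurableSet_Ioi i2 i1] at h5
  have h6 : ‖∫ s in Ioc 0 u, (Real.exp (-s) - (Iic (1 : ℝ)).indicator 1 s) / s‖ ≤
      1 * volume.real (Ioc 0 u) := by
    refine norm_setIntegral_le_of_norm_le_const (by simp) fun s hs => ?_
    rw [indicator_of_mem (show s ∈ Iic (1 : ℝ) from hs.2.trans hu1), Pi.one_apply, norm_div,
      Real.norm_eq_abs, Real.norm_eq_abs, abs_of_pos hs.1, div_le_one hs.1, abs_sub_comm,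
      abs_of_nonneg (by linarith [Real.exp_le_one_iff.mpr (by linarith [hs.1] : -s ≤ 0)])]
    linarith [Real.add_one_le_exp (-s)]
  rw [Real.volume_real_Ioc_of_le hu.le, one_mul, sub_zero, Real.norm_eq_abs] at h6
  have : (∫ s in Ioi u, (Real.exp (-s) - (Iic (1 : ℝ)).indicator 1 s) / s) + -Real.log u +
      Real.log u + Real.eulerMascheroniConstant =
      -∫ s in Ioc 0 u, (Real.exp (-s) - (Iic (1 : ℝ)).indicator 1 s) / s := by linarith
  rw [this, abs_neg]
  exact h6

/-- A logarithmically divergent Gaussian integral with a sharp cut-off at small radii. -/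
lemma integral_gaussian_cutoff {c : ℝ} (hc : 1 ≤ c) :
    IntegrableOn (fun t : ℝ => (Real.exp (-t ^ 2) - (Iic (1 : ℝ)).indicator 1 (c * t)) / t) (Ioi 0) ∧
    ∫ t in Ioi (0 : ℝ), (Real.exp (-t ^ 2) - (Iic (1 : ℝ)).indicator 1 (c * t)) / t =
      Real.log c - Real.eulerMascheroniConstant / 2 := by
  have hc0 : 0 < c := by linarith
  -- Substituting `u = t²` moves the cut-off `c t ≤ 1` to `u ≤ b`. Relative to the cut-off `u ≤ 1`
  -- of `integral_expIntegrand` this adds `∫_b^1 du / u = 2 log c`.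
  set b : ℝ := 1 / c ^ 2 with hb
  have hb0 : 0 < b := by positivity
  have hb1 : b ≤ 1 := by rw [hb, div_le_one (by positivity)]; exact one_le_pow₀ hc
  have i3 : IntegrableOn ((Ioc b (1 : ℝ)).indicator (fun s : ℝ => 1 / s)) (Ioi 0) := by
    rw [integrableOn_indicator_iff measurableSet_Ioc]
    refine ((ContinuousOn.integrableOn_Icc (a := b) (b := 1) ?_).mono_set
      (inter_subset_left.trans Ioc_subset_Icc_self))
    exact continuousOn_const.div continuousOn_id fun s hs => by have := hs.1; simp; linarith
  have e3 : ∫ s in Ioi (0 : ℝ), (Ioc b (1 : ℝ)).indicator (fun s : ℝ => 1 / s) s =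
      2 * Real.log c := by
    rw [setIntegral_indicator measurableSet_Ioc,
      inter_eq_right.mpr (show Ioc b 1 ⊆ Ioi 0 from fun s hs => hb0.trans hs.1),
      ← intervalIntegral.integral_of_le hb1, integral_one_div_of_pos hb0 one_pos, hb,
      one_div_one_div, Real.log_pow]
    norm_num
  have hI := integrableOn_expIntegrand
  have hsum := hI.add i3
  have esum : ∫ u in Ioi (0 : ℝ), ((Real.exp (-u) - (Iic (1 : ℝ)).indicator 1 u) / u +
      (Ioc b (1 : ℝ)).indicator (fun s : ℝ => 1 / s) u) =
      -Real.eulerMascheroniConstant + 2 * Real.log c := by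
    rw [integral_add hI i3, integral_expIntegrand, e3]
  have hcv := integral_comp_rpow_Ioi_of_pos (g := fun u : ℝ =>
    (Real.exp (-u) - (Iic (1 : ℝ)).indicator 1 u) / u +
      (Ioc b (1 : ℝ)).indicator (fun s : ℝ => 1 / s) u) (p := 2) two_pos
  have hci := (integrableOn_Ioi_comp_rpow_iff (fun u : ℝ =>
    (Real.exp (-u) - (Iic (1 : ℝ)).indicator 1 u) / u +
      (Ioc b (1 : ℝ)).indicator (fun s : ℝ => 1 / s) u) (p := 2) two_ne_zero).mpr hsum
  have e6 : ∀ t ∈ Ioi (0 : ℝ), (2 * t ^ (2 - 1 : ℝ)) • ((Real.exp (-t ^ (2 : ℝ)) -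
      (Iic (1 : ℝ)).indicator 1 (t ^ (2 : ℝ))) / t ^ (2 : ℝ) +
      (Ioc b (1 : ℝ)).indicator (fun s : ℝ => 1 / s) (t ^ (2 : ℝ))) =
      2 * ((Real.exp (-t ^ 2) - (Iic (1 : ℝ)).indicator 1 (c * t)) / t) := by
    intro t ht
    have ht' : 0 < t := ht
    rw [show (2 - 1 : ℝ) = 1 by norm_num, Real.rpow_one, Real.rpow_two, smul_eq_mul]
    have hbt : b < t ^ 2 ↔ 1 < c * t := by
      rw [hb, div_lt_iff₀ (by positivity), ← mul_pow, one_lt_sq_iff_one_lt_abs,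
        abs_of_pos (by positivity), mul_comm]
    by_cases h : c * t ≤ 1
    · have h2 : t ^ 2 ≤ b := not_lt.mp fun h' => absurd (hbt.mp h') (not_lt.mpr h)
      rw [indicator_of_mem (show t ^ 2 ∈ Iic (1 : ℝ) from h2.trans hb1),
        indicator_of_notMem (fun h' : t ^ 2 ∈ Ioc b 1 => absurd h'.1 (not_lt.mpr h2)),
        indicator_of_mem (show c * t ∈ Iic (1 : ℝ) from h)]
      simp only [Pi.one_apply]
      field_simp
      ring
    · have h2 : b < t ^ 2 := hbt.mpr (not_le.mp h)
      rw [indicator_of_notMem (show c * t ∉ Iic (1 : ℝ) from h)]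
      by_cases h3 : t ^ 2 ≤ 1
      · rw [indicator_of_mem (show t ^ 2 ∈ Iic (1 : ℝ) from h3),
          indicator_of_mem (show t ^ 2 ∈ Ioc b 1 from ⟨h2, h3⟩)]
        simp only [Pi.one_apply]
        field_simp
        ring
      · rw [indicator_of_notMem (show t ^ 2 ∉ Iic (1 : ℝ) from h3),
          indicator_of_notMem (fun h' : t ^ 2 ∈ Ioc b 1 => h3 h'.2)]
        field_simp
        ring
  rw [setIntegral_congr_fun measurableSet_Ioi e6, esum, integral_const_mul] at hcv
  refine ⟨?_, by linarith⟩
  have e7 : ∀ t ∈ Ioi (0 : ℝ), (t ^ (2 - 1 : ℝ)) • ((Real.exp (-t ^ (2 : ℝ)) -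
      (Iic (1 : ℝ)).indicator 1 (t ^ (2 : ℝ))) / t ^ (2 : ℝ) +
      (Ioc b (1 : ℝ)).indicator (fun s : ℝ => 1 / s) (t ^ (2 : ℝ))) =
      ((Real.exp (-t ^ 2) - (Iic (1 : ℝ)).indicator 1 (c * t)) / t) := by
    intro t ht
    have := e6 t ht
    simp only [smul_eq_mul] at this ⊢
    linarith
  have h8 : IntegrableOn (fun t : ℝ => (t ^ (2 - 1 : ℝ)) • ((Real.exp (-t ^ (2 : ℝ)) -
      (Iic (1 : ℝ)).indicator 1 (t ^ (2 : ℝ))) / t ^ (2 : ℝ) +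
      (Ioc b (1 : ℝ)).indicator (fun s : ℝ => 1 / s) (t ^ (2 : ℝ)))) (Ioi 0) := by
    simpa [abs_two, mul_assoc, IntegrableOn, integrable_const_mul_iff] using hci
  exact h8.congr_fun e7 measurableSet_Ioi

end ExpIntegral

/-! ### Riemann sums over a lattice -/

section Riemann

open Set

variable {d : ℕ}

/-- The point `h m` of the lattice `h ℤ^d`. -/
noncomputable def latticePoint (h : ℝ) (m : Fin d → ℤ) : Space d :=
  WithLp.toLp 2 fun i => h * (m i : ℝ)

/-- The half-open cube of side `h` with corner `h m`. -/
def latticeCell (h : ℝ) (m : Fin d → ℤ) : Set (Space d) := {x | ∀ i, ⌊x i / h⌋ = m i}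

lemma latticeCell_eq_preimage (h : ℝ) (m : Fin d → ℤ) :
    latticeCell h m = (fun (x : Space d) (i : Fin d) => ⌊x i / h⌋) ⁻¹' {m} := by
  ext x; simp [latticeCell, funext_iff]

lemma measurableSet_latticeCell (h : ℝ) (m : Fin d → ℤ) : MeasurableSet (latticeCell h m) := by
  rw [latticeCell_eq_preimage]
  refine measurableSet_preimage ?_ (measurableSet_singleton _)
  exact measurable_pi_lambda _ fun i => Int.measurable_floor.comp (by fun_prop)

lemma pairwise_disjoint_latticeCell (h : ℝ) :
    Pairwise (Function.onFun Disjoint (latticeCell (d := d) h)) := by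
  intro m m' hm
  rw [Function.onFun, Set.disjoint_left]
  exact fun x hx hx' => hm (funext fun i => (hx i).symm.trans (hx' i))

lemma iUnion_latticeCell (h : ℝ) : ⋃ m : Fin d → ℤ, latticeCell h m = univ :=
  eq_univ_of_forall fun x => mem_iUnion.mpr ⟨fun i => ⌊x i / h⌋, fun _ => rfl⟩

lemma volume_latticeCell {h : ℝ} (hh : 0 < h) (m : Fin d → ℤ) :
    volume (latticeCell h m) = ENNReal.ofReal (h ^ d) := by
  have e : latticeCell h m = (WithLp.ofLp : Space d → (Fin d → ℝ)) ⁻¹'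
      (univ.pi fun i => Ico (h * m i) (h * m i + h)) := by
    ext x
    simp only [latticeCell, mem_ofPred_eq, mem_preimage, mem_univ_pi, mem_Ico, Int.floor_eq_iff]
    refine forall_congr' fun i => and_congr ?_ ?_
    · rw [le_div_iff₀ hh, mul_comm]
    · rw [div_lt_iff₀ hh]
      constructor <;> intro h' <;> linarith
  rw [e, (PiLp.volume_preserving_ofLp (Fin d)).measure_preimage
    (MeasurableSet.univ_pi fun i => measurableSet_Ico).nullMeasurableSet, volume_pi_pi]
  simp [ENNReal.ofReal_pow hh.le]

/-- Each coordinate is off by at most `h`, so the distance is at most `√d h`, and `d ≤ 4`. -/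
lemma norm_sub_latticePoint_le {h : ℝ} (hh : 0 < h) (hd : d ≤ 4) {m : Fin d → ℤ} {x : Space d}
    (hx : x ∈ latticeCell h m) : ‖x - latticePoint h m‖ ≤ 2 * h := by
  rw [EuclideanSpace.norm_eq, Real.sqrt_le_left (by positivity)]
  have : ∀ i, ‖(x - latticePoint h m) i‖ ^ 2 ≤ h ^ 2 := fun i => by
    have h1 := (Int.floor_eq_iff.mp (hx i)).1
    have h2 := (Int.floor_eq_iff.mp (hx i)).2
    rw [le_div_iff₀ hh] at h1
    rw [div_lt_iff₀ hh] at h2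
    have : ‖(x - latticePoint h m) i‖ ≤ h := by
      simp only [latticePoint, PiLp.sub_apply, Real.norm_eq_abs, abs_le]
      constructor <;> linarith
    gcongr
  calc _ ≤ ∑ _i : Fin d, h ^ 2 := Finset.sum_le_sum fun i _ => this i
    _ = d * h ^ 2 := by simp
    _ ≤ 4 * h ^ 2 := by gcongr; exact_mod_cast hd
    _ = _ := by ring

lemma one_le_norm_latticePoint {h : ℝ} (hh : 0 < h) (m : Mode d) :
    h ≤ ‖latticePoint h m.1‖ := by
  obtain ⟨i, hi⟩ := Function.ne_iff.mp m.2
  calc h ≤ |h * (m.1 i : ℝ)| := by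
        rw [abs_mul, abs_of_pos hh]
        have : (1 : ℝ) ≤ |(m.1 i : ℝ)| := by exact_mod_cast Int.one_le_abs hi
        nlinarith
    _ ≤ _ := by
      have := PiLp.norm_apply_le (latticePoint h m.1) i
      simpa [latticePoint] using this

lemma hasSum_modes {f : (Fin d → ℤ) → ℝ} {s : ℝ} (h : HasSum f s) :
    HasSum (fun m : Mode d => f m.1) (s - f 0) := by
  have h1 := h.sub (hasSum_ite_eq (0 : Fin d → ℤ) (f 0))
  refine (hasSum_subtype_iff_indicator (s := {m : Fin d → ℤ | m ≠ 0})).mpr ?_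
  convert! h1 using 2 with m
  by_cases hm : m = 0 <;> simp [hm]

/-- Comparison of a lattice sum without the origin with the integral. -/
lemma abs_lattice_sum_sub_integral_le {h : ℝ} (hh : 0 < h) {F W : Space d → ℝ} {b : ℝ}
    (hF : Integrable F) (hW : Integrable W) (hW0 : ∀ x, 0 ≤ W x)
    (hFW : ∀ m : Mode d, ∀ x ∈ latticeCell h m.1, |F (latticePoint h m.1) - F x| ≤ W x)
    (hb : ∀ x, |F x| ≤ b) :
    (Summable fun m : Mode d => F (latticePoint h m.1)) ∧
      |h ^ d * ∑' m : Mode d, F (latticePoint h m.1) - ∫ x, F x| ≤ (∫ x, W x) + b * h ^ d := by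
  have hhd : 0 < h ^ d := by positivity
  have hs : ∀ {f : Space d → ℝ}, Integrable f →
      HasSum (fun m : Fin d → ℤ => ∫ x in latticeCell h m, f x) (∫ x, f x) := fun {f} hf => by
    have := hasSum_integral_iUnion (μ := volume) (measurableSet_latticeCell (d := d) h)
      (pairwise_disjoint_latticeCell h) (f := f) (by rw [iUnion_latticeCell]; exact hf.integrableOn)
    rwa [iUnion_latticeCell, setIntegral_univ] at this
  have hvol : ∀ m : Fin d → ℤ, volume.real (latticeCell h m) = h ^ d := fun m => by
    rw [measureReal_def, volume_latticeCell hh, ENNReal.toReal_ofReal hhd.le]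
  have hfin : ∀ m : Fin d → ℤ, volume (latticeCell h m) < ⊤ := fun m => by
    rw [volume_latticeCell hh]; exact ENNReal.ofReal_lt_top
  have hdiff : ∀ m : Mode d, ‖h ^ d * F (latticePoint h m.1) - ∫ x in latticeCell h m.1, F x‖ ≤
      ∫ x in latticeCell h m.1, W x := fun m => by
    have e : h ^ d * F (latticePoint h m.1) - ∫ x in latticeCell h m.1, F x =
        ∫ x in latticeCell h m.1, (F (latticePoint h m.1) - F x) := by
      rw [integral_sub (integrable_const_iff.mpr (Or.inr ⟨by simpa using hfin _⟩)) hF.integrableOn,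
        setIntegral_const, hvol,
        smul_eq_mul]
    rw [e]
    exact norm_integral_le_of_norm_le hW.integrableOn
      ((ae_restrict_mem (measurableSet_latticeCell h m.1)).mono fun x hx => hFW m x hx)
  have hsub : ∀ {f : Space d → ℝ}, Integrable f →
      HasSum (fun m : Mode d => ∫ x in latticeCell h m.1, f x)
        ((∫ x, f x) - ∫ x in latticeCell h (0 : Fin d → ℤ), f x) := fun {f} hf => hasSum_modes (hs hf)
  have hdS := Summable.of_norm_bounded (hsub hW).summable hdiff
  have hS : Summable fun m : Mode d => h ^ d * F (latticePoint h m.1) := by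
    simpa using hdS.add (hsub hF).summable
  refine ⟨(summable_mul_left_iff hhd.ne').mp hS, ?_⟩
  have h1 := tsum_of_norm_bounded (hsub hW) hdiff
  rw [Summable.tsum_sub hS (hsub hF).summable, tsum_mul_left, (hsub hF).tsum_eq,
    Real.norm_eq_abs] at h1
  -- The cell of the origin has no term in the sum; its integral is paid for by the supremum bound.
  have h2 : ‖∫ x in latticeCell h (0 : Fin d → ℤ), F x‖ ≤ b * h ^ d := by
    rw [← hvol 0]
    exact norm_setIntegral_le_of_norm_le_const (hfin 0) fun x _ => hb x
  have h3 : 0 ≤ ∫ x in latticeCell h (0 : Fin d → ℤ), W x := integral_nonneg hW0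
  rw [Real.norm_eq_abs] at h2
  rw [abs_le] at *
  constructor <;> linarith

end Riemann

/-! ### The Bogoliubov integral -/

section BogoliubovIntegral

open Set

/-- At infinity the square-root part behaves like `-1 / (2 s²)`, exactly what the subtraction
removes. The remaining order `s⁻⁴` is integrable in dimension at most three. -/
lemma abs_bogoliubovProfile_le_decay {s : ℝ} (hs : 0 ≤ s) :
    |bogoliubovProfile s| ≤ 32 / (1 + s) ^ 4 := by
  rcases le_total s 1 with h1 | h1
  · refine (abs_bogoliubovProfile_le s).trans ?_
    rw [le_div_iff₀ (by positivity)]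
    have : (1 + s) ^ 4 ≤ (1 + 1) ^ 4 := by gcongr
    linarith
  · have hs0 : 0 < s := by linarith
    have h2 : (0 : ℝ) < s ^ 2 + 2 := by positivity
    have h3 := Real.sq_sqrt h2.le
    have h4 := Real.sqrt_pos.mpr h2
    rw [bogoliubovProfile, sqrt_dispersion_eq hs]
    set q := Real.sqrt (s ^ 2 + 2)
    have hsq : s ≤ q := by nlinarith
    have hqs : s * q ≤ s ^ 2 + 1 := by nlinarith [sq_nonneg (q - s)]
    have he0 := Real.exp_pos (-s ^ 2)
    have he4 := exp_neg_le_two_div_sq (show 0 < s ^ 2 by positivity)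
    rw [← pow_mul] at he4
    set e := Real.exp (-s ^ 2)
    have b1 : s * q - s ^ 2 - 1 = -(1 / (s ^ 2 + 1 + s * q)) := by
      field_simp
      nlinarith
    have b2 : 1 / (s ^ 2 + 1 + s * q) ≤ 1 / (2 * s ^ 2) := by
      apply one_div_le_one_div_of_le (by positivity); nlinarith
    have b3 : 1 / (2 * (s ^ 2 + 1)) ≤ 1 / (s ^ 2 + 1 + s * q) := by
      apply one_div_le_one_div_of_le (by positivity); linarith
    have b4 : 1 / (2 * s ^ 2) - 1 / (2 * (s ^ 2 + 1)) ≤ 1 / s ^ 4 := by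
      rw [div_sub_div _ _ (by positivity) (by positivity), div_le_div_iff₀ (by positivity)
        (by positivity)]
      nlinarith [pow_pos hs0 2, pow_pos hs0 4]
    have b5 : e / (2 * s ^ 2) ≤ 1 / s ^ 4 := by
      calc e / (2 * s ^ 2) ≤ (2 / s ^ (2 * 2)) / (2 * 1) := by
            gcongr; exact one_le_pow₀ h1
        _ = _ := by norm_num; ring
    have b6 : (1 - e) / (2 * s ^ 2) = 1 / (2 * s ^ 2) - e / (2 * s ^ 2) := by ring
    have b7 : 1 / s ^ 4 ≤ 32 / (1 + s) ^ 4 := by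
      rw [div_le_div_iff₀ (by positivity) (by positivity)]
      have : (1 + s) ^ 4 ≤ (2 * s) ^ 4 := by gcongr; linarith
      nlinarith [pow_pos hs0 4]
    have c1 : 0 ≤ e / (2 * s ^ 2) := by positivity
    rw [b1, b6, abs_le]; constructor <;> linarith

variable {d : ℕ}

lemma integrable_inv_one_add_norm_pow (hd : d ≤ 3) :
    Integrable fun x : Space d => 1 / (1 + ‖x‖) ^ 4 := by
  have h := integrable_one_add_norm (E := Space d) (μ := volume) (r := 4)
    (by rw [finrank_euclideanSpace_fin]; exact_mod_cast Nat.lt_succ_of_le hd)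
  refine h.congr (Filter.Eventually.of_forall fun x => ?_)
  have : 0 < 1 + ‖x‖ := by positivity
  simp only
  rw [Real.rpow_neg this.le, one_div, show (4 : ℝ) = (4 : ℕ) by norm_num, Real.rpow_natCast]

lemma measurable_bogoliubovProfile : Measurable bogoliubovProfile := by
  unfold bogoliubovProfile; fun_prop

lemma integrable_bogoliubovProfile (hd : d ≤ 3) :
    Integrable fun x : Space d => bogoliubovProfile ‖x‖ := by
  refine ((integrable_inv_one_add_norm_pow hd).const_mul 32).mono'
    (measurable_bogoliubovProfile.comp measurable_norm).aestronglyMeasurable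
    (Filter.Eventually.of_forall fun x => ?_)
  rw [mul_one_div]
  exact abs_bogoliubovProfile_le_decay (norm_nonneg x)

/-- Riemann sums of the Bogoliubov profile. -/
theorem exists_bogoliubov_riemann_sum_bound (hd : d = 2 ∨ d = 3) :
    ∃ C : ℝ, 0 < C ∧ ∀ h : ℝ, 0 < h → h ≤ 1 →
      (Summable fun m : Mode d => bogoliubovProfile ‖latticePoint h m.1‖) ∧
      |h ^ d * ∑' m : Mode d, bogoliubovProfile ‖latticePoint h m.1‖ -
        ∫ x : Space d, bogoliubovProfile ‖x‖| ≤ C * h := by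
  have hd3 : d ≤ 3 := by omega
  have hd1 : d ≠ 0 := by omega
  have hI := integrable_inv_one_add_norm_pow hd3
  have hI0 : 0 ≤ ∫ x : Space d, 1 / (1 + ‖x‖) ^ 4 := integral_nonneg fun x => by positivity
  -- `18144 = 112 · 81 · 2`: the derivative bound at radius `‖x‖ / 3`, the loss `3⁴` in passing to
  -- `1 + ‖x‖`, and the displacement `2 h` in a cell. The `+ 2` is the supremum of the profile on
  -- the cell of the origin.
  refine ⟨18144 * (∫ x : Space d, 1 / (1 + ‖x‖) ^ 4) + 2, by positivity, fun h hh hh1 => ?_⟩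
  have key := abs_lattice_sum_sub_integral_le (d := d) hh (integrable_bogoliubovProfile hd3)
    (hI.const_mul (18144 * h)) (fun x => by positivity) (fun m x hx => ?_)
    (fun x => abs_bogoliubovProfile_le ‖x‖)
  · refine ⟨key.1, key.2.trans ?_⟩
    have : h ^ d ≤ h := pow_le_of_le_one hh.le hh1 hd1
    rw [integral_const_mul]
    nlinarith
  · have h1 := norm_sub_latticePoint_le hh (by omega) hx
    have h2 := one_le_norm_latticePoint hh m
    have h3 : |‖latticePoint h m.1‖ - ‖x‖| ≤ 2 * h := by
      rw [abs_sub_comm]; exact (abs_norm_sub_norm_le _ _).trans h1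
    -- A nonzero lattice point has norm at least `h`, so `‖x‖` is at most its norm plus `2 h`, hence
    -- at most three times its norm.
    have h4 : ‖x‖ / 3 ≤ ‖latticePoint h m.1‖ := by
      rw [abs_le] at h3; linarith
    have hx0 : 0 < ‖x‖ := by
      rw [norm_pos_iff]
      rintro rfl
      exact m.2 (funext fun i => by simpa using (hx i).symm)
    refine (abs_bogoliubovProfile_sub_le (r := ‖x‖ / 3) (by positivity) h4 (by linarith)).trans ?_
    have h5 : (1 + ‖x‖) ^ 4 / 81 ≤ (1 + ‖x‖ / 3) ^ 4 := by
      calc (1 + ‖x‖) ^ 4 / 81 = ((1 + ‖x‖) / 3) ^ 4 := by ring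
        _ ≤ _ := by gcongr; linarith
    calc _ ≤ 112 / ((1 + ‖x‖) ^ 4 / 81) * (2 * h) := by gcongr
      _ = _ := by field_simp; norm_num

lemma integral_fun_norm_space (hd : d ≠ 0) (f : ℝ → ℝ) :
    ∫ x : Space d, f ‖x‖ = d * volume.real (Metric.ball (0 : Space d) 1) *
      ∫ y in Ioi (0 : ℝ), y ^ (d - 1) * f y := by
  have : Nonempty (Fin d) := ⟨⟨0, Nat.pos_of_ne_zero hd⟩⟩
  rw [integral_fun_norm_addHaar, finrank_euclideanSpace_fin]
  simp [mul_assoc]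

lemma integrable_fun_norm_space (hd : d ≠ 0) {f : ℝ → ℝ} :
    Integrable (fun x : Space d => f ‖x‖) ↔ IntegrableOn (fun y => y ^ (d - 1) * f y) (Ioi 0) := by
  have : Nonempty (Fin d) := ⟨⟨0, Nat.pos_of_ne_zero hd⟩⟩
  rw [integrable_fun_norm_addHaar, finrank_euclideanSpace_fin]
  simp

lemma volume_real_unit_ball_two : volume.real (Metric.ball (0 : Space 2) 1) = Real.pi := by
  rw [measureReal_def, EuclideanSpace.volume_ball_fin_two]
  simp [Real.pi_pos.le]

lemma volume_real_unit_ball_three :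
    volume.real (Metric.ball (0 : Space 3) 1) = Real.pi * 4 / 3 := by
  rw [measureReal_def, EuclideanSpace.volume_ball_fin_three]
  simp [Real.pi_pos.le]
  positivity

/-- The integrand of the Bogoliubov integral, minus the regularized profile. -/
noncomputable def cutoffProfile (d : ℕ) (s : ℝ) : ℝ :=
  (Real.exp (-s ^ 2) -
    cutoff d (Real.sqrt (2 * Real.pi) * Real.exp Real.eulerMascheroniConstant * s)) / (2 * s ^ 2)

lemma bogoliubovIntegral_eq_add (hd : d ≤ 3)
    (h : Integrable fun x : Space d => cutoffProfile d ‖x‖) :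
    bogoliubovIntegral d = (2 / Real.pi) ^ ((d : ℝ) / 2) *
      ((∫ x : Space d, bogoliubovProfile ‖x‖) + ∫ x : Space d, cutoffProfile d ‖x‖) := by
  rw [bogoliubovIntegral, ← integral_add (integrable_bogoliubovProfile hd) h]
  congr 2
  funext x
  rw [bogoliubovProfile, cutoffProfile]
  ring

/-- In polar coordinates one power of the radius cancels and `integral_gaussian_cutoff` applies with
`c = √(2π) e^Γ`. These are the constants that will cancel against `heatLimit`. -/
lemma cutoffProfile_two :
    Integrable (fun x : Space 2 => cutoffProfile 2 ‖x‖) ∧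
    ∫ x : Space 2, cutoffProfile 2 ‖x‖ =
      Real.pi / 2 * (Real.log (2 * Real.pi) + Real.eulerMascheroniConstant) := by
  set c := Real.sqrt (2 * Real.pi) * Real.exp Real.eulerMascheroniConstant with hc
  have hpi := Real.pi_gt_three
  have hg := Real.one_half_lt_eulerMascheroniConstant
  have hc1 : 1 ≤ c := one_le_mul_of_one_le_of_one_le
    (Real.one_le_sqrt.mpr (by linarith)) (Real.one_le_exp (by linarith))
  have hlog : Real.log c = Real.log (2 * Real.pi) / 2 + Real.eulerMascheroniConstant := by
    rw [hc, Real.log_mul (by positivity) (by positivity), Real.log_exp, Real.log_sqrt (by positivity)]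
  obtain ⟨h1, h2⟩ := integral_gaussian_cutoff hc1
  have e : ∀ y ∈ Ioi (0 : ℝ), y ^ (2 - 1) * cutoffProfile 2 y =
      1 / 2 * ((Real.exp (-y ^ 2) - (Iic (1 : ℝ)).indicator 1 (c * y)) / y) := by
    intro y hy
    have hy' : 0 < y := hy
    have hcy : cutoff 2 (c * y) = (Iic (1 : ℝ)).indicator 1 (c * y) := by
      have : |c * y| = c * y := abs_of_nonneg (by positivity)
      simp [cutoff, this, Set.indicator]
    rw [cutoffProfile, ← hc, hcy, show 2 - 1 = 1 from rfl, pow_one]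
    field_simp
  constructor
  · rw [integrable_fun_norm_space two_ne_zero]
    exact IntegrableOn.congr_fun (h1.const_mul (1 / 2)) (fun y hy => (e y hy).symm)
      measurableSet_Ioi
  · rw [integral_fun_norm_space two_ne_zero, setIntegral_congr_fun measurableSet_Ioi e,
      integral_const_mul, h2, volume_real_unit_ball_two, hlog]
    push_cast
    ring

/-- Without a cut-off, the factor `y²` of the volume element removes the singularity and a plain
Gaussian integral remains. -/
lemma cutoffProfile_three :
    Integrable (fun x : Space 3 => cutoffProfile 3 ‖x‖) ∧
    ∫ x : Space 3, cutoffProfile 3 ‖x‖ = Real.pi * Real.sqrt Real.pi := by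
  have e : ∀ y ∈ Ioi (0 : ℝ), y ^ (3 - 1) * cutoffProfile 3 y =
      1 / 2 * Real.exp (-1 * y ^ 2) := by
    intro y hy
    have hy' : 0 < y := hy
    rw [cutoffProfile]
    simp only [cutoff]
    norm_num
    field_simp
  constructor
  · rw [integrable_fun_norm_space three_ne_zero]
    exact IntegrableOn.congr_fun ((integrable_exp_neg_mul_sq one_pos).integrableOn.const_mul (1 / 2))
      (fun y hy => (e y hy).symm) measurableSet_Ioi
  · rw [integral_fun_norm_space three_ne_zero, setIntegral_congr_fun measurableSet_Ioi e,
      integral_const_mul, integral_gaussian_Ioi, volume_real_unit_ball_three]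
    push_cast
    rw [div_one]
    ring

end BogoliubovIntegral

/-! ### Poisson summation for the heat kernel -/

section Poisson

open Set

lemma hasSum_pi_prod : ∀ (d : ℕ) (f : Fin d → ℤ → ℂ), (∀ i, Summable fun n => ‖f i n‖) →
    (Summable fun m : Fin d → ℤ => ‖∏ i, f i (m i)‖) ∧
      HasSum (fun m : Fin d → ℤ => ∏ i, f i (m i)) (∏ i, ∑' n, f i n)
  | 0, f, _ => by
      constructor
      · exact Summable.of_finite
      · simpa using hasSum_unique (fun m : Fin 0 → ℤ => ∏ i, f i (m i))
  | d + 1, f, hf => by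
      obtain ⟨h1, h2⟩ := hasSum_pi_prod d (fun i => f i.succ) fun i => hf i.succ
      have e : ∀ p : ℤ × (Fin d → ℤ), ∏ i, f i (Fin.consEquiv (fun _ => ℤ) p i) =
          f 0 p.1 * ∏ i : Fin d, f i.succ (p.2 i) := fun p => by
        rw [Fin.prod_univ_succ]; rfl
      have h3 := (hf 0).mul_norm h1
      constructor
      · rw [← (Fin.consEquiv (fun _ => ℤ)).summable_iff]
        exact h3.congr fun p => by simp only [Function.comp_apply, e]
      · rw [← (Fin.consEquiv (fun _ => ℤ)).hasSum_iff, Fin.prod_univ_succ]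
        have h4 : HasSum (fun p : ℤ × (Fin d → ℤ) => f 0 p.1 * ∏ i : Fin d, f i.succ (p.2 i)) _ :=
          h3.of_norm.hasSum
        rw [← tsum_mul_tsum_of_summable_norm (hf 0) h1, h2.tsum_eq] at h4
        convert! h4 using 1
        exact funext e
termination_by d => d

/-- The terms of the theta series on the circle of length `ℓ`. -/
noncomputable def thetaTerm (ℓ t u : ℝ) (n : ℤ) : ℂ :=
  Complex.exp (-(t * (2 * Real.pi / ℓ * n) ^ 2 : ℝ) + Complex.I * (2 * Real.pi / ℓ * n * u : ℝ))

lemma norm_thetaTerm (ℓ t u : ℝ) (n : ℤ) :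
    ‖thetaTerm ℓ t u n‖ = Real.exp (-(t * (2 * Real.pi / ℓ * n) ^ 2)) := by
  rw [thetaTerm, Complex.norm_exp]
  congr 1
  simp only [Complex.add_re, Complex.neg_re, Complex.ofReal_re, Complex.mul_re, Complex.I_re,
    Complex.I_im, Complex.ofReal_im]
  ring

lemma summable_gaussian_int {c : ℝ} (hc : 0 < c) : Summable fun n : ℤ => Real.exp (-(c * (n : ℝ) ^ 2)) := by
  have h1 : ∀ k : ℕ, Real.exp (-(c * (k : ℝ) ^ 2)) ≤ (Real.exp (-c)) ^ k := fun k => by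
    rw [← Real.exp_nat_mul]
    apply Real.exp_le_exp.mpr
    have : (k : ℝ) ≤ (k : ℝ) ^ 2 := by exact_mod_cast Nat.le_self_pow two_ne_zero k
    nlinarith
  have h2 : Summable fun k : ℕ => Real.exp (-(c * (k : ℝ) ^ 2)) :=
    Summable.of_nonneg_of_le (fun _ => (Real.exp_pos _).le) h1
      (summable_geometric_of_lt_one (Real.exp_pos _).le (by rw [Real.exp_lt_one_iff]; linarith))
  refine Summable.of_nat_of_neg ?_ ?_
  · simpa using h2
  · simpa using h2

lemma summable_norm_thetaTerm {ℓ t : ℝ} (hℓ : 0 < ℓ) (ht : 0 < t) (u : ℝ) :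
    Summable fun n => ‖thetaTerm ℓ t u n‖ := by
  have hc : 0 < t * (2 * Real.pi / ℓ) ^ 2 := by have := Real.pi_pos; positivity
  refine (summable_gaussian_int hc).congr fun n => ?_
  rw [norm_thetaTerm]; congr 1; ring

/-- Poisson summation for a Gaussian (Jacobi's theta identity): the Fourier series of the heat
kernel on the circle is a sum over periodic images. -/
lemma tsum_thetaTerm {ℓ t : ℝ} (hℓ : 0 < ℓ) (ht : 0 < t) (u : ℝ) :
    ∑' n, thetaTerm ℓ t u n =
      ((ℓ * (Real.sqrt (4 * Real.pi * t))⁻¹ *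
        ∑' n : ℤ, Real.exp (-((ℓ * n - u) ^ 2 / (4 * t))) : ℝ) : ℂ) := by
  have hpi := Real.pi_pos
  have ha : 0 < 4 * Real.pi * t / ℓ ^ 2 := by positivity
  have h := Complex.tsum_exp_neg_quadratic (a := ((4 * Real.pi * t / ℓ ^ 2 : ℝ) : ℂ))
    (by rw [Complex.ofReal_re]; exact ha) (Complex.I * ((u / ℓ : ℝ) : ℂ))
  have hℓ' : (ℓ : ℂ) ≠ 0 := by exact_mod_cast hℓ.ne'
  have ht' : (t : ℂ) ≠ 0 := by exact_mod_cast ht.ne'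
  have hpi' : (Real.pi : ℂ) ≠ 0 := by exact_mod_cast hpi.ne'
  have e1 : ∀ n : ℤ, Complex.exp (-Real.pi * ((4 * Real.pi * t / ℓ ^ 2 : ℝ) : ℂ) * n ^ 2 +
      2 * Real.pi * (Complex.I * ((u / ℓ : ℝ) : ℂ)) * n) = thetaTerm ℓ t u n := fun n => by
    rw [thetaTerm]; congr 1; push_cast; field_simp; ring
  have e2 : ∀ n : ℤ, Complex.exp (-Real.pi / ((4 * Real.pi * t / ℓ ^ 2 : ℝ) : ℂ) *
      (n + Complex.I * (Complex.I * ((u / ℓ : ℝ) : ℂ))) ^ 2) =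
      ((Real.exp (-((ℓ * n - u) ^ 2 / (4 * t))) : ℝ) : ℂ) := fun n => by
    rw [← mul_assoc, Complex.I_mul_I]; push_cast; congr 1; field_simp; ring
  have e3 : (1 : ℂ) / ((4 * Real.pi * t / ℓ ^ 2 : ℝ) : ℂ) ^ (1 / 2 : ℂ) =
      ((ℓ * (Real.sqrt (4 * Real.pi * t))⁻¹ : ℝ) : ℂ) := by
    rw [show (1 / 2 : ℂ) = ((1 / 2 : ℝ) : ℂ) by norm_num, ← Complex.ofReal_cpow ha.le,
      ← Real.sqrt_eq_rpow, Real.sqrt_div (by positivity), Real.sqrt_sq hℓ.le]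
    push_cast
    field_simp
  simp_rw [e1, e2] at h
  rw [h, e3, ← Complex.ofReal_tsum]
  push_cast
  rfl

/-- `∑_{n ≠ 0} n⁻⁴`, up to a factor. -/
noncomputable def imageConst : ℝ := 512 * ∑' n : ℤ, (1 / (n : ℝ) ^ 4)

lemma imageConst_nonneg : 0 ≤ imageConst :=
  mul_nonneg (by norm_num) (tsum_nonneg fun n => by positivity)

/-- On the scale of the circle, the periodic heat kernel is close to the heat kernel. -/
lemma norm_tsum_thetaTerm_sub_le {ℓ t u r : ℝ} (hℓ : 0 < ℓ) (hr : 0 < r) (ht : t = (r * ℓ) ^ 2)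
    (hu : |u| ≤ ℓ / 2) :
    ‖∑' n, thetaTerm ℓ t u n -
      ((ℓ * (Real.sqrt (4 * Real.pi * t))⁻¹ * Real.exp (-(u ^ 2 / (4 * t))) : ℝ) : ℂ)‖ ≤
      imageConst * r ^ 3 := by
  have hpi := Real.pi_gt_three
  have ht0 : 0 < t := by rw [ht]; positivity
  obtain ⟨hu1, hu2⟩ := abs_le.mp hu
  have hsq : r * ℓ ≤ Real.sqrt (4 * Real.pi * t) := by
    apply Real.le_sqrt_of_sq_le; rw [← ht]; nlinarith
  have hq0 : 0 < Real.sqrt (4 * Real.pi * t) := lt_of_lt_of_le (by positivity) hsq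
  have hz4 : Summable fun n : ℤ => 1 / (n : ℝ) ^ 4 := by
    exact_mod_cast (Real.summable_one_div_int_pow (p := 4)).mpr (by norm_num)
  -- Since `|u| ≤ ℓ / 2`, the `n`-th image is at distance at least `ℓ |n| / 2`; then `e^{-w} ≤ 2 /
  -- w²` with `w = n² / (16 r²)` gives the constant `512`.
  have hterm : ∀ n : ℤ, n ≠ 0 → Real.exp (-((ℓ * n - u) ^ 2 / (4 * t))) ≤
      512 * r ^ 4 * (1 / (n : ℝ) ^ 4) := fun n hn => by
    have h1 : (1 : ℝ) ≤ |(n : ℝ)| := by exact_mod_cast Int.one_le_abs hn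
    have h2 : ℓ * |(n : ℝ)| / 2 ≤ |ℓ * n - u| := by
      have := abs_sub_abs_le_abs_sub (ℓ * (n : ℝ)) u
      rw [abs_mul, abs_of_pos hℓ] at this
      nlinarith
    have h3 : ℓ ^ 2 * (n : ℝ) ^ 2 / 4 ≤ (ℓ * n - u) ^ 2 := by
      rw [← sq_abs (ℓ * (n : ℝ) - u), ← sq_abs (n : ℝ)]
      calc _ = (ℓ * |(n : ℝ)| / 2) ^ 2 := by ring
        _ ≤ _ := by gcongr
    have hn2 : 0 < (n : ℝ) ^ 2 := by positivity
    have h4 : (n : ℝ) ^ 2 / (16 * r ^ 2) ≤ (ℓ * n - u) ^ 2 / (4 * t) := by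
      rw [div_le_div_iff₀ (by positivity) (by positivity), ht]
      nlinarith [mul_le_mul_of_nonneg_left h3 (show 0 ≤ 16 * r ^ 2 by positivity)]
    calc _ ≤ Real.exp (-((n : ℝ) ^ 2 / (16 * r ^ 2))) := by gcongr
      _ ≤ 2 / ((n : ℝ) ^ 2 / (16 * r ^ 2)) ^ 2 := exp_neg_le_two_div_sq (by positivity)
      _ = _ := by field_simp; norm_num
  have hz : Summable fun n : ℤ => if n = 0 then 0 else Real.exp (-((ℓ * n - u) ^ 2 / (4 * t))) := by
    refine Summable.of_nonneg_of_le (fun n => ?_) (fun n => ?_) (hz4.mul_left (512 * r ^ 4))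
    · split_ifs <;> positivity
    · split_ifs with h
      · subst h; simp
      · exact hterm n h
  have hle : ∑' n : ℤ, (if n = 0 then 0 else Real.exp (-((ℓ * n - u) ^ 2 / (4 * t)))) ≤
      imageConst * r ^ 4 := by
    calc _ ≤ ∑' n : ℤ, 512 * r ^ 4 * (1 / (n : ℝ) ^ 4) := by
          refine hz.tsum_le_tsum (fun n => ?_) (hz4.mul_left _)
          split_ifs with h
          · subst h; simp
          · exact hterm n h
      _ = _ := by rw [tsum_mul_left, imageConst]; ring
  have hge : 0 ≤ ∑' n : ℤ, (if n = 0 then 0 else Real.exp (-((ℓ * n - u) ^ 2 / (4 * t)))) :=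
    tsum_nonneg fun n => by split_ifs <;> positivity
  have hsum : Summable fun n : ℤ => Real.exp (-((ℓ * n - u) ^ 2 / (4 * t))) := by
    have := hz.add (hasSum_ite_eq (0 : ℤ) (Real.exp (-((ℓ * (0 : ℤ) - u) ^ 2 / (4 * t))))).summable
    refine this.congr fun n => ?_
    by_cases h : n = 0 <;> simp [h]
  have hsplit := hsum.tsum_eq_add_tsum_ite 0
  rw [tsum_thetaTerm hℓ ht0, ← Complex.ofReal_sub, Complex.norm_real, Real.norm_eq_abs, hsplit]
  simp only [Int.cast_zero, mul_zero, zero_sub, neg_sq]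
  rw [mul_add, add_sub_cancel_left, abs_of_nonneg (by positivity)]
  calc _ ≤ ℓ * (r * ℓ)⁻¹ * (imageConst * r ^ 4) := by
        have := imageConst_nonneg
        gcongr
    _ = _ := by field_simp

variable {d : ℕ}

/-- The heat kernel on `ℝ^d`. -/
noncomputable def heatKernel (t : ℝ) (x : Space d) : ℝ :=
  (Real.sqrt (4 * Real.pi * t))⁻¹ ^ d * Real.exp (-(‖x‖ ^ 2 / (4 * t)))

lemma heatKernel_eq_prod (t : ℝ) (x : Space d) :
    heatKernel t x = ∏ i, ((Real.sqrt (4 * Real.pi * t))⁻¹ * Real.exp (-(x i ^ 2 / (4 * t)))) := by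
  rw [Finset.prod_mul_distrib, Finset.prod_const, Finset.card_univ, Fintype.card_fin,
    ← Real.exp_sum, heatKernel, EuclideanSpace.norm_sq_eq, Finset.sum_neg_distrib, Finset.sum_div]
  simp

/-- Telescoping. Every summand has one difference of size `r³` and at most two factors of size `1 /
r`, so the bound is uniform in `r ≤ 1`, that is, uniform down to time zero. -/
lemma norm_prod_sub_prod_le (hd : d = 2 ∨ d = 3) {A B : Fin d → ℂ} {r M s : ℝ} (hr : 0 < r)
    (hr1 : r ≤ 1) (hM : 0 ≤ M) (hs : 0 ≤ s) (hA : ∀ i, ‖A i‖ ≤ M / r) (hB : ∀ i, ‖B i‖ ≤ M / r)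
    (hAB : ∀ i, ‖A i - B i‖ ≤ s * r ^ 3) : ‖∏ i, A i - ∏ i, B i‖ ≤ 3 * (M + 1) ^ 2 * s := by
  rcases hd with rfl | rfl
  · rw [Fin.prod_univ_two, Fin.prod_univ_two,
      show A 0 * A 1 - B 0 * B 1 = A 0 * (A 1 - B 1) + (A 0 - B 0) * B 1 by ring]
    calc _ ≤ ‖A 0‖ * ‖A 1 - B 1‖ + ‖A 0 - B 0‖ * ‖B 1‖ := by
          rw [← norm_mul, ← norm_mul]; exact norm_add_le _ _
      _ ≤ M / r * (s * r ^ 3) + s * r ^ 3 * (M / r) := by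
          gcongr
          exacts [hA 0, hAB 1, hAB 0, hB 1]
      _ = 2 * M * s * r ^ 2 := by field_simp; ring
      _ ≤ 2 * M * s * 1 := by gcongr; exact pow_le_one₀ hr.le hr1
      _ ≤ _ := by nlinarith [mul_nonneg hM hs, mul_nonneg (mul_nonneg hM hM) hs]
  · rw [Fin.prod_univ_three, Fin.prod_univ_three,
      show A 0 * A 1 * A 2 - B 0 * B 1 * B 2 = A 0 * A 1 * (A 2 - B 2) +
        A 0 * (A 1 - B 1) * B 2 + (A 0 - B 0) * B 1 * B 2 by ring]
    calc _ ≤ ‖A 0‖ * ‖A 1‖ * ‖A 2 - B 2‖ + ‖A 0‖ * ‖A 1 - B 1‖ * ‖B 2‖ +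
            ‖A 0 - B 0‖ * ‖B 1‖ * ‖B 2‖ := by
          simp only [← norm_mul]; exact norm_add₃_le
      _ ≤ M / r * (M / r) * (s * r ^ 3) + M / r * (s * r ^ 3) * (M / r) +
            s * r ^ 3 * (M / r) * (M / r) := by
          gcongr
          exacts [hA 0, hA 1, hAB 2, hA 0, hAB 1, hB 2, hAB 0, hB 1, hB 2]
      _ = 3 * M ^ 2 * s * r := by field_simp; ring
      _ ≤ 3 * M ^ 2 * s * 1 := by gcongr
      _ ≤ _ := by nlinarith [mul_nonneg hM hs]

/-- The error constant in the comparison of the heat kernels of the torus and of `ℝ^d`. -/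
noncomputable def torusConst : ℝ := 3 * (1 + imageConst + 1) ^ 2 * imageConst

lemma torusConst_nonneg : 0 ≤ torusConst := by
  have := imageConst_nonneg
  unfold torusConst; positivity

lemma lattice_inner (h : ℝ) (m : Fin d → ℤ) (x : Space d) :
    inner ℝ (latticePoint h m) x = ∑ i, h * (m i : ℝ) * x i := by
  rw [PiLp.inner_apply]
  exact Finset.sum_congr rfl fun i _ => by simp [latticePoint, mul_comm]

lemma lattice_norm_sq (h : ℝ) (m : Fin d → ℤ) :
    ‖latticePoint h m‖ ^ 2 = ∑ i, (h * (m i : ℝ)) ^ 2 := by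
  rw [EuclideanSpace.norm_sq_eq]
  exact Finset.sum_congr rfl fun i _ => by simp [latticePoint, mul_pow]

/-- The heat kernel of the torus, as a Fourier series, compared with the heat kernel of `ℝ^d`. -/
theorem torus_heatKernel (hd : d = 2 ∨ d = 3) {ℓ t : ℝ} (hℓ : 0 < ℓ) (ht : 0 < t) (htℓ : t ≤ ℓ ^ 2)
    {x : Space d} (hx : ∀ i, |x i| ≤ ℓ / 2) :
    (Summable fun m : Fin d → ℤ => Real.exp (-(t * ‖latticePoint (2 * Real.pi / ℓ) m‖ ^ 2))) ∧
    |(∑' m : Fin d → ℤ, Real.exp (-(t * ‖latticePoint (2 * Real.pi / ℓ) m‖ ^ 2)) *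
      Real.cos (inner ℝ (latticePoint (2 * Real.pi / ℓ) m) x)) - ℓ ^ d * heatKernel t x| ≤
      torusConst := by
  obtain ⟨h1, h2⟩ := hasSum_pi_prod d (fun i => thetaTerm ℓ t (x i))
    fun i => summable_norm_thetaTerm hℓ ht (x i)
  have e1 : ∀ m : Fin d → ℤ, ∏ i, thetaTerm ℓ t (x i) (m i) =
      Complex.exp (-(t * ‖latticePoint (2 * Real.pi / ℓ) m‖ ^ 2 : ℝ) +
        Complex.I * (inner ℝ (latticePoint (2 * Real.pi / ℓ) m) x : ℝ)) := fun m => by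
    simp only [thetaTerm]
    rw [← Complex.exp_sum, lattice_inner, lattice_norm_sq, Finset.sum_add_distrib]
    push_cast
    simp only [Finset.sum_neg_distrib, Finset.mul_sum]
  have e2 : ∀ m : Fin d → ℤ, (∏ i, thetaTerm ℓ t (x i) (m i)).re =
      Real.exp (-(t * ‖latticePoint (2 * Real.pi / ℓ) m‖ ^ 2)) *
      Real.cos (inner ℝ (latticePoint (2 * Real.pi / ℓ) m) x) := fun m => by
    rw [e1, Complex.exp_re]
    simp only [Complex.add_re, Complex.neg_re, Complex.ofReal_re, Complex.mul_re, Complex.I_re,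
      Complex.I_im, Complex.ofReal_im, Complex.add_im, Complex.neg_im, Complex.mul_im]
    ring_nf
  have e3 : ∀ m : Fin d → ℤ, ‖∏ i, thetaTerm ℓ t (x i) (m i)‖ =
      Real.exp (-(t * ‖latticePoint (2 * Real.pi / ℓ) m‖ ^ 2)) := fun m => by
    rw [e1, Complex.norm_exp]
    simp only [Complex.add_re, Complex.neg_re, Complex.ofReal_re, Complex.mul_re, Complex.I_re,
      Complex.I_im, Complex.ofReal_im]
    ring_nf
  refine ⟨h1.congr e3, ?_⟩
  have h3 := Complex.hasSum_re h2
  simp_rw [e2] at h3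
  rw [h3.tsum_eq]
  set r := Real.sqrt t / ℓ with hr
  have hst : 0 < Real.sqrt t := Real.sqrt_pos.mpr ht
  have hr0 : 0 < r := by positivity
  have hr1 : r ≤ 1 := by
    rw [hr, div_le_one hℓ, Real.sqrt_le_left hℓ.le]; exact htℓ
  have htr : t = (r * ℓ) ^ 2 := by
    rw [hr, div_mul_cancel₀ _ hℓ.ne', Real.sq_sqrt ht.le]
  set B : Fin d → ℂ := fun i => ((ℓ * (Real.sqrt (4 * Real.pi * t))⁻¹ *
    Real.exp (-(x i ^ 2 / (4 * t))) : ℝ) : ℂ) with hB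
  have hAB := fun i => norm_tsum_thetaTerm_sub_le hℓ hr0 htr (hx i)
  have hi := imageConst_nonneg
  have hBn : ∀ i, ‖B i‖ ≤ 1 / r := fun i => by
    have hsq : r * ℓ ≤ Real.sqrt (4 * Real.pi * t) := by
      apply Real.le_sqrt_of_sq_le; rw [← htr]; nlinarith [Real.pi_gt_three]
    have : 0 < Real.sqrt (4 * Real.pi * t) := lt_of_lt_of_le (by positivity) hsq
    rw [hB, Complex.norm_real, Real.norm_eq_abs, abs_of_nonneg (by positivity)]
    calc _ ≤ ℓ * (r * ℓ)⁻¹ * 1 := by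
          gcongr
          apply Real.exp_le_one_iff.mpr
          have : 0 ≤ x i ^ 2 / (4 * t) := by positivity
          linarith
      _ = 1 / r := by field_simp
  have hAn : ∀ i, ‖∑' n, thetaTerm ℓ t (x i) n‖ ≤ (1 + imageConst) / r := fun i => by
    have h4 : r ^ 3 ≤ 1 / r := by
      rw [le_div_iff₀ hr0]; exact (pow_le_one₀ hr0.le hr1 (n := 4)).trans' (le_of_eq (by ring))
    calc _ = ‖(∑' n, thetaTerm ℓ t (x i) n - B i) + B i‖ := by rw [sub_add_cancel]
      _ ≤ imageConst * r ^ 3 + 1 / r := (norm_add_le _ _).trans (add_le_add (hAB i) (hBn i))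
      _ ≤ imageConst * (1 / r) + 1 / r := by gcongr
      _ = _ := by ring
  have key := norm_prod_sub_prod_le hd hr0 hr1 (M := 1 + imageConst) (by positivity) hi hAn
    (fun i => (hBn i).trans (by gcongr; linarith)) hAB
  have hBprod : ∏ i, B i = ((ℓ ^ d * heatKernel t x : ℝ) : ℂ) := by
    rw [hB, ← Complex.ofReal_prod, heatKernel_eq_prod]
    simp_rw [mul_assoc ℓ]
    rw [Finset.prod_mul_distrib (f := fun _ => ℓ), Finset.prod_const, Finset.card_univ,
      Fintype.card_fin]
  rw [hBprod] at key
  refine (le_trans ?_ key)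
  rw [← Complex.ofReal_re (ℓ ^ d * heatKernel t x), ← Complex.sub_re]
  exact Complex.abs_re_le_norm _

end Poisson

/-! ### Lattice sums of squared Fourier coefficients -/

section LatticeSum

open Set

variable {d : ℕ}

/-- The cosine transform of `g`. -/
noncomputable def cosTransform (g : Space d → ℝ) (k : Space d) : ℝ :=
  ∫ x, g x * Real.cos (inner ℝ k x)

/-- The energy `∫∫ g(x) g(y) p_t(x - y)` of `g` in the heat kernel. -/
noncomputable def heatEnergy (g : Space d → ℝ) (t : ℝ) : ℝ :=
  ∫ p : Space d × Space d, g p.1 * g p.2 * heatKernel t (p.1 - p.2)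

lemma continuous_heatKernel (t : ℝ) : Continuous (heatKernel (d := d) t) := by
  unfold heatKernel; fun_prop

lemma heatKernel_nonneg (t : ℝ) (x : Space d) : 0 ≤ heatKernel t x := by
  unfold heatKernel; positivity

lemma heatKernel_le {t : ℝ} (ht : 0 < t) (x : Space d) :
    heatKernel t x ≤ (Real.sqrt (4 * Real.pi * t))⁻¹ ^ d := by
  unfold heatKernel
  refine mul_le_of_le_one_right (by positivity) (Real.exp_le_one_iff.mpr ?_)
  have : 0 ≤ ‖x‖ ^ 2 / (4 * t) := by positivity
  linarith

lemma integrable_mul_of_bounded {α : Type*} [MeasurableSpace α] {μ : Measure α} {f h : α → ℝ}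
    (hf : Integrable f μ) (hh : AEStronglyMeasurable h μ) {C : ℝ} (hC : ∀ x, |h x| ≤ C) :
    Integrable (fun x => f x * h x) μ :=
  hf.mul_bdd hh (Filter.Eventually.of_forall hC)

lemma abs_cosTransform_le {g : Space d → ℝ} (hg : Integrable g) (k : Space d) :
    |cosTransform g k| ≤ ∫ x, |g x| := by
  refine (abs_integral_le_integral_abs).trans (integral_mono_of_nonneg
    (Filter.Eventually.of_forall fun x => abs_nonneg _) hg.abs
    (Filter.Eventually.of_forall fun x => ?_))
  simp only [abs_mul]
  exact mul_le_of_le_one_right (abs_nonneg _) (Real.abs_cos_le_one _)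

/-- Evenness kills the sine transform, so the square of the cosine transform is the full double
integral by the addition formula. -/
lemma cosTransform_sq {g : Space d → ℝ} (hg : Integrable g) (heven : ∀ᵐ x, g (-x) = g x)
    (k : Space d) :
    cosTransform g k ^ 2 = ∫ p : Space d × Space d, g p.1 * g p.2 *
      Real.cos (inner ℝ k (p.1 - p.2)) := by
  have hsin : ∫ x, g x * Real.sin (inner ℝ k x) = 0 := by
    have h1 : ∫ x, g (-x) * Real.sin (inner ℝ k (-x)) = ∫ x, g x * Real.sin (inner ℝ k x) :=
      integral_neg_eq_self (fun x => g x * Real.sin (inner ℝ k x)) volume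
    have h2 : ∫ x, g (-x) * Real.sin (inner ℝ k (-x)) = -∫ x, g x * Real.sin (inner ℝ k x) := by
      rw [← integral_neg]
      refine integral_congr_ae (heven.mono fun x hx => ?_)
      simp only [hx, inner_neg_right, Real.sin_neg]; ring
    linarith
  have i1 : Integrable fun x => g x * Real.cos (inner ℝ k x) :=
    integrable_mul_of_bounded hg (by fun_prop) (C := 1) fun x => Real.abs_cos_le_one _
  have i2 : Integrable fun x => g x * Real.sin (inner ℝ k x) :=
    integrable_mul_of_bounded hg (by fun_prop) (C := 1) fun x => Real.abs_sin_le_one _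
  have e : ∀ p : Space d × Space d, g p.1 * g p.2 * Real.cos (inner ℝ k (p.1 - p.2)) =
      (g p.1 * Real.cos (inner ℝ k p.1)) * (g p.2 * Real.cos (inner ℝ k p.2)) +
      (g p.1 * Real.sin (inner ℝ k p.1)) * (g p.2 * Real.sin (inner ℝ k p.2)) := fun p => by
    rw [inner_sub_right, Real.cos_sub]; ring
  simp_rw [e]
  rw [Measure.volume_eq_prod, integral_add (i1.mul_prod i1) (i2.mul_prod i2),
    integral_prod_mul (fun x => g x * Real.cos (inner ℝ k x))
      (fun x => g x * Real.cos (inner ℝ k x)),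
    integral_prod_mul (fun x => g x * Real.sin (inner ℝ k x))
      (fun x => g x * Real.sin (inner ℝ k x)), hsin, cosTransform]
  ring

lemma integrable_heatEnergy {f g : Space d → ℝ} (hf : Integrable f) (hg : Integrable g) {t : ℝ}
    (ht : 0 < t) :
    Integrable fun p : Space d × Space d => f p.1 * g p.2 * heatKernel t (p.1 - p.2) :=
  integrable_mul_of_bounded (hf.mul_prod hg)
    ((continuous_heatKernel t).comp (by fun_prop)).aestronglyMeasurable
    fun p => by rw [abs_of_nonneg (heatKernel_nonneg _ _)]; exact heatKernel_le ht _

lemma integral_abs_mul_prod {g : Space d → ℝ} :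
    ∫ p : Space d × Space d, |g p.1 * g p.2| = (∫ x, |g x|) ^ 2 := by
  simp_rw [abs_mul]
  rw [Measure.volume_eq_prod, integral_prod_mul (fun x => |g x|) (fun x => |g x|), sq]

/-- The sum is moved under the double integral, where it becomes the torus heat kernel at `x - y`.
As `R ≤ ℓ / 4`, this difference lies in the fundamental box, and `torus_heatKernel` replaces the
kernel at a bounded cost. -/
lemma heat_lattice_sum (hd : d = 2 ∨ d = 3) {g : Space d → ℝ} {R ℓ t : ℝ} (hg : Integrable g)
    (heven : ∀ᵐ x, g (-x) = g x) (hsupp : ∀ x, R < ‖x‖ → g x = 0) (hR : R ≤ ℓ / 4) (hℓ : 0 < ℓ)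
    (ht : 0 < t) (htℓ : t ≤ ℓ ^ 2) :
    (Summable fun m : Fin d → ℤ => Real.exp (-(t * ‖latticePoint (2 * Real.pi / ℓ) m‖ ^ 2)) *
      cosTransform g (latticePoint (2 * Real.pi / ℓ) m) ^ 2) ∧
    |(∑' m : Fin d → ℤ, Real.exp (-(t * ‖latticePoint (2 * Real.pi / ℓ) m‖ ^ 2)) *
      cosTransform g (latticePoint (2 * Real.pi / ℓ) m) ^ 2) - ℓ ^ d * heatEnergy g t| ≤
      torusConst * (∫ x, |g x|) ^ 2 := by
  set k : (Fin d → ℤ) → Space d := latticePoint (2 * Real.pi / ℓ)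
  have hexp : Summable fun m : Fin d → ℤ => Real.exp (-(t * ‖k m‖ ^ 2)) :=
    (torus_heatKernel hd hℓ ht htℓ (x := 0) (fun i => by simp; linarith)).1
  have hgg := hg.mul_prod hg
  set F : (Fin d → ℤ) → Space d × Space d → ℝ := fun m p => g p.1 * g p.2 *
    (Real.exp (-(t * ‖k m‖ ^ 2)) * Real.cos (inner ℝ (k m) (p.1 - p.2))) with hF
  have hcos : ∀ m (x : Space d), |Real.exp (-(t * ‖k m‖ ^ 2)) * Real.cos (inner ℝ (k m) x)| ≤
      Real.exp (-(t * ‖k m‖ ^ 2)) := fun m x => by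
    rw [abs_mul, Real.abs_exp]
    exact mul_le_of_le_one_right (Real.exp_pos _).le (Real.abs_cos_le_one _)
  have hFi : ∀ m, Integrable (F m) := fun m =>
    integrable_mul_of_bounded hgg (by fun_prop) fun p => hcos m _
  have hFn : ∀ m, ∫ p, ‖F m p‖ ≤ (∫ x, |g x|) ^ 2 * Real.exp (-(t * ‖k m‖ ^ 2)) := fun m => by
    rw [← integral_abs_mul_prod, ← integral_mul_const]
    refine integral_mono (hFi m).norm (hgg.abs.mul_const _) fun p => ?_
    simp only [hF, Real.norm_eq_abs]
    rw [abs_mul (g p.1 * g p.2)]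
    gcongr
    exact hcos m _
  have hFs := Summable.of_nonneg_of_le (fun m => integral_nonneg fun p => norm_nonneg (F m p)) hFn
    (hexp.mul_left ((∫ x, |g x|) ^ 2))
  have hsum := hasSum_integral_of_summable_integral_norm hFi hFs
  have hFe : ∀ m, ∫ p, F m p = Real.exp (-(t * ‖k m‖ ^ 2)) * cosTransform g (k m) ^ 2 := fun m => by
    rw [cosTransform_sq hg heven, ← integral_const_mul]
    refine integral_congr_ae (Filter.Eventually.of_forall fun p => ?_)
    simp only [hF]; ring
  simp_rw [hFe] at hsum
  refine ⟨hsum.summable, ?_⟩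
  rw [hsum.tsum_eq, heatEnergy, ← integral_const_mul]
  set V : Space d → ℝ := fun x => ∑' m, Real.exp (-(t * ‖k m‖ ^ 2)) *
    Real.cos (inner ℝ (k m) x) with hV
  have hFV : ∀ p : Space d × Space d, ∑' m, F m p = g p.1 * g p.2 * V (p.1 - p.2) := fun p => by
    simp only [hF]; rw [tsum_mul_left]
  simp_rw [hFV]
  have hVm : Measurable V := Measurable.tsum fun m => by fun_prop
  have hVi : Integrable fun p : Space d × Space d => g p.1 * g p.2 * V (p.1 - p.2) :=
    integrable_mul_of_bounded hgg (hVm.comp (by fun_prop)).aestronglyMeasurable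
      (C := ∑' m, Real.exp (-(t * ‖k m‖ ^ 2)))
      (fun p => tsum_of_norm_bounded (f := fun m => Real.exp (-(t * ‖k m‖ ^ 2)) *
        Real.cos (inner ℝ (k m) (p.1 - p.2))) hexp.hasSum fun m => hcos m (p.1 - p.2))
  rw [← integral_sub hVi ((integrable_heatEnergy hg hg ht).const_mul _),
    ← integral_abs_mul_prod, ← integral_const_mul]
  rw [← Real.norm_eq_abs]
  refine norm_integral_le_of_norm_le (hgg.abs.const_mul _) (Filter.Eventually.of_forall fun p => ?_)
  by_cases h1 : R < ‖p.1‖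
  · simp [hsupp _ h1]
  by_cases h2 : R < ‖p.2‖
  · simp [hsupp _ h2]
  have hx : ∀ i, |(p.1 - p.2) i| ≤ ℓ / 2 := fun i => by
    have := PiLp.norm_apply_le (p.1 - p.2) i
    rw [Real.norm_eq_abs] at this
    linarith [norm_sub_le p.1 p.2]
  have := (torus_heatKernel hd hℓ ht htℓ hx).2
  rw [show g p.1 * g p.2 * V (p.1 - p.2) - ℓ ^ d * (g p.1 * g p.2 * heatKernel t (p.1 - p.2)) =
    g p.1 * g p.2 * (V (p.1 - p.2) - ℓ ^ d * heatKernel t (p.1 - p.2)) by ring, norm_mul, mul_comm]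
  exact mul_le_mul_of_nonneg_right this (norm_nonneg _)

/-- The regularized high-momentum sum, compared with the time integral of the heat energy. -/
theorem abs_lattice_sum_sub_heatEnergy_le (hd : d = 2 ∨ d = 3) {g : Space d → ℝ} {R ℓ T : ℝ}
    (hg : Integrable g) (heven : ∀ᵐ x, g (-x) = g x) (hsupp : ∀ x, R < ‖x‖ → g x = 0)
    (hR : R ≤ ℓ / 4) (hℓ : 0 < ℓ) (hT : 0 < T) (hTℓ : T ≤ ℓ ^ 2)
    (hP : IntegrableOn (heatEnergy g) (Ioc 0 T)) :
    (Summable fun m : Mode d => cosTransform g (latticePoint (2 * Real.pi / ℓ) m.1) ^ 2 *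
      (1 - Real.exp (-(T * ‖latticePoint (2 * Real.pi / ℓ) m.1‖ ^ 2))) /
        ‖latticePoint (2 * Real.pi / ℓ) m.1‖ ^ 2) ∧
    |(∑' m : Mode d, cosTransform g (latticePoint (2 * Real.pi / ℓ) m.1) ^ 2 *
      (1 - Real.exp (-(T * ‖latticePoint (2 * Real.pi / ℓ) m.1‖ ^ 2))) /
        ‖latticePoint (2 * Real.pi / ℓ) m.1‖ ^ 2) - ℓ ^ d * ∫ t in Ioc 0 T, heatEnergy g t| ≤
      (torusConst + 1) * T * (∫ x, |g x|) ^ 2 := by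
  have hpi := Real.pi_pos
  set k : (Fin d → ℤ) → Space d := latticePoint (2 * Real.pi / ℓ)
  set G := ∫ x, |g x|
  set μ := volume.restrict (Ioc 0 T)
  set F : (Fin d → ℤ) → ℝ → ℝ := fun m t => Real.exp (-(t * ‖k m‖ ^ 2)) * cosTransform g (k m) ^ 2
    with hF
  have hlat : ∀ t ∈ Ioc 0 T, _ := fun t ht =>
    heat_lattice_sum hd hg heven hsupp hR hℓ ht.1 (ht.2.trans hTℓ)
  have hF0 : ∀ m t, 0 ≤ F m t := fun m t => by positivity
  have hFi : ∀ m, Integrable (F m) μ := fun m =>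
    ((by fun_prop : Continuous (F m)).integrableOn_Icc (a := 0) (b := T)).mono_set
      Ioc_subset_Icc_self
  have hB : Integrable (fun t => ℓ ^ d * heatEnergy g t + torusConst * G ^ 2) μ :=
    (hP.const_mul _).add (integrable_const _)
  -- All terms are nonnegative, so finite partial sums are dominated by the heat energy plus a
  -- constant; this justifies integrating the series in time term by term.
  have hfin : ∀ s : Finset (Fin d → ℤ), ∑ m ∈ s, ∫ t, ‖F m t‖ ∂μ ≤
      ∫ t, (ℓ ^ d * heatEnergy g t + torusConst * G ^ 2) ∂μ := fun s => by
    rw [← integral_finsetSum _ fun m _ => (hFi m).norm]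
    refine integral_mono_ae (integrable_finsetSum _ fun m _ => (hFi m).norm) hB ?_
    refine (ae_restrict_mem measurableSet_Ioc).mono fun t ht => ?_
    have h1 := hlat t ht
    have h2 := h1.1.sum_le_tsum s fun m _ => hF0 m t
    have h3 := (abs_le.mp h1.2).2
    simp only [Real.norm_eq_abs, abs_of_nonneg (hF0 _ _)]
    calc _ ≤ _ := h2
      _ ≤ _ := by linarith
  have hFs : Summable fun m => ∫ t, ‖F m t‖ ∂μ :=
    summable_of_sum_le (fun m => integral_nonneg fun t => norm_nonneg _) hfin
  have hsum := hasSum_integral_of_summable_integral_norm hFi hFs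
  have hVm : AEStronglyMeasurable (fun t => ∑' m, F m t) μ :=
    (Measurable.tsum fun m => (by fun_prop : Continuous (F m)).measurable).aestronglyMeasurable
  have hVi : Integrable (fun t => ∑' m, F m t) μ := by
    refine hB.mono' hVm ((ae_restrict_mem measurableSet_Ioc).mono fun t ht => ?_)
    rw [Real.norm_eq_abs, abs_of_nonneg (tsum_nonneg fun m => hF0 m t)]
    have h3 := (abs_le.mp (hlat t ht).2).2
    linarith
  have hbound : |(∫ t, ∑' m, F m t ∂μ) - ℓ ^ d * ∫ t, heatEnergy g t ∂μ| ≤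
      torusConst * G ^ 2 * T := by
    rw [← integral_const_mul, ← integral_sub hVi (hP.const_mul _)]
    have := norm_setIntegral_le_of_norm_le_const (μ := volume) (s := Ioc 0 T)
      (f := fun t => ∑' m, F m t - ℓ ^ d * heatEnergy g t) (C := torusConst * G ^ 2)
      (by simp) fun t ht => (hlat t ht).2
    rwa [Real.volume_real_Ioc_of_le hT.le, sub_zero] at this
  have hk : ∀ m : Mode d, 0 < ‖k m.1‖ ^ 2 := fun m => by
    have := one_le_norm_latticePoint (show 0 < 2 * Real.pi / ℓ by positivity) m
    have : 0 < ‖k m.1‖ := lt_of_lt_of_le (by positivity) this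
    positivity
  -- The Gaussian regularization of `1 / k²` is precisely the heat flow integrated up to time `T`.
  have hint : ∀ m : Mode d, ∫ t, F m.1 t ∂μ = cosTransform g (k m.1) ^ 2 *
      (1 - Real.exp (-(T * ‖k m.1‖ ^ 2))) / ‖k m.1‖ ^ 2 := fun m => by
    simp only [hF, μ]
    rw [integral_mul_const, ← intervalIntegral.integral_of_le hT.le]
    have h1 : ∀ t ∈ uIcc 0 T, HasDerivAt (fun t => -(Real.exp (-(t * ‖k m.1‖ ^ 2)) / ‖k m.1‖ ^ 2))
        (Real.exp (-(t * ‖k m.1‖ ^ 2))) t := fun t _ => by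
      have h2 : HasDerivAt (fun t => -(t * ‖k m.1‖ ^ 2)) (-(‖k m.1‖ ^ 2)) t := by
        have := ((hasDerivAt_id' t).mul_const (‖k m.1‖ ^ 2)).neg
        rwa [one_mul] at this
      refine ((h2.exp.div_const (‖k m.1‖ ^ 2)).neg).congr_deriv ?_
      have := (hk m).ne'
      rw [← neg_div, mul_neg, neg_neg, mul_div_assoc, div_self this, mul_one]
    rw [intervalIntegral.integral_eq_sub_of_hasDerivAt h1
      ((by fun_prop : Continuous _).intervalIntegrable _ _)]
    simp only [zero_mul, neg_zero, Real.exp_zero]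
    ring
  have hmodes := hasSum_modes hsum
  simp_rw [hint] at hmodes
  refine ⟨hmodes.summable, ?_⟩
  rw [hmodes.tsum_eq]
  -- Poisson summation includes the zero mode, whose time integral is of the same order as the torus
  -- error; it accounts for the `+ 1` in the constant.
  have h0 : ‖∫ t, F 0 t ∂μ‖ ≤ G ^ 2 * T := by
    have := norm_setIntegral_le_of_norm_le_const (μ := volume) (s := Ioc 0 T)
      (f := F 0) (C := G ^ 2) (by simp) fun t ht => by
        have h1 : k 0 = 0 := by ext i; simp [k, latticePoint]
        have h2 := abs_cosTransform_le hg (k 0)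
        simp only [hF, Real.norm_eq_abs, abs_mul, Real.abs_exp, abs_pow]
        rw [h1] at h2 ⊢
        simp only [norm_zero, ne_eq, OfNat.ofNat_ne_zero, not_false_eq_true, zero_pow, mul_zero,
          neg_zero, Real.exp_zero, one_mul]
        gcongr
    rwa [Real.volume_real_Ioc_of_le hT.le, sub_zero] at this
  rw [Real.norm_eq_abs] at h0
  calc _ = |((∫ t, ∑' m, F m t ∂μ) - ℓ ^ d * ∫ t, heatEnergy g t ∂μ) - ∫ t, F 0 t ∂μ| := by
        congr 1; ring
    _ ≤ _ := abs_sub _ _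
    _ ≤ torusConst * G ^ 2 * T + G ^ 2 * T := add_le_add hbound h0
    _ = _ := by ring

end LatticeSum

/-! ### The Laplacian in coordinates -/

section Laplacian

open Laplacian Set Filter Topology

variable {d : ℕ}

/-- The `i`-th coordinate vector. -/
noncomputable abbrev unitVec (i : Fin d) : Space d := EuclideanSpace.single i 1

theorem contDiff_fderiv_apply {f : Space d → ℝ} {n : ℕ∞} (hf : ContDiff ℝ (n + 1 : ℕ∞) f)
    (v : Space d) : ContDiff ℝ n fun y => fderiv ℝ f y v :=
  (hf.fderiv_right (m := n) (by norm_cast)).clm_apply contDiff_const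

theorem laplacian_eq_sum {f : Space d → ℝ} (hf : ContDiff ℝ 2 f) (x : Space d) :
    Δ f x = ∑ i, fderiv ℝ (fun y => fderiv ℝ f y (unitVec i)) x (unitVec i) := by
  rw [InnerProductSpace.laplacian_eq_iteratedFDeriv_orthonormalBasis f
    (EuclideanSpace.basisFun (Fin d) ℝ)]
  refine Finset.sum_congr rfl fun i _ => ?_
  have hd : DifferentiableAt ℝ (fderiv ℝ f) x :=
    ((hf.fderiv_right (m := 1) (by norm_num)).differentiable (by norm_num)).differentiableAt
  rw [iteratedFDeriv_two_apply, fderiv_clm_apply hd (by fun_prop)]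
  simp [unitVec]

theorem continuous_laplacian {f : Space d → ℝ} (hf : ContDiff ℝ 2 f) : Continuous (Δ f) := by
  rw [funext fun x => laplacian_eq_sum hf x]
  refine continuous_finsetSum _ fun i _ => ?_
  exact ((contDiff_fderiv_apply (n := 1) (by exact_mod_cast hf) _).continuous_fderiv
    (by norm_num)).clm_apply continuous_const

theorem tsupport_laplacian_subset (f : Space d → ℝ) : tsupport (Δ f) ⊆ tsupport f := by
  refine closure_minimal (fun x hx => ?_) (isClosed_tsupport f)
  by_contra h
  refine hx ?_
  have h0 : f =ᶠ[𝓝 x] fun _ => (0 : ℝ) := notMem_tsupport_iff_eventuallyEq.mp h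
  have := (InnerProductSpace.laplacian_congr_nhds h0).eq_of_nhds
  rw [this]; simp

theorem hasCompactSupport_laplacian {f : Space d → ℝ} (hf : HasCompactSupport f) :
    HasCompactSupport (Δ f) :=
  hf.of_isClosed_subset (isClosed_tsupport _) (tsupport_laplacian_subset f)

/-- Chain rule with the second-order term isolated: for convex `j` that term is nonnegative, which
drives Kato's inequality; with `u = ‖x‖²` it computes radial Laplacians. -/
theorem laplacian_comp {j j' : ℝ → ℝ} {j'' : ℝ} {u : Space d → ℝ} (hu : ContDiff ℝ 2 u)
    (hju : ContDiff ℝ 2 fun y => j (u y)) (hj : ∀ y, HasDerivAt j (j' (u y)) (u y)) (x : Space d)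
    (hj' : HasDerivAt j' j'' (u x)) :
    Δ (fun y => j (u y)) x =
      j' (u x) * Δ u x + j'' * ∑ i, fderiv ℝ u x (unitVec i) ^ 2 := by
  have hud : Differentiable ℝ u := hu.differentiable (by norm_num)
  rw [laplacian_eq_sum hju, laplacian_eq_sum hu, Finset.mul_sum, Finset.mul_sum,
    ← Finset.sum_add_distrib]
  refine Finset.sum_congr rfl fun i _ => ?_
  have h1 : (fun y => fderiv ℝ (fun y => j (u y)) y (unitVec i)) =
      fun y => j' (u y) * fderiv ℝ u y (unitVec i) := by
    funext y
    have := ((hj y).comp_hasFDerivAt y (hud y).hasFDerivAt).fderiv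
    rw [show (fun y => j (u y)) = j ∘ u from rfl, this]
    simp
  have h2 := hj'.comp_hasFDerivAt x (hud x).hasFDerivAt
  have h3 : HasFDerivAt (fun y => fderiv ℝ u y (unitVec i))
      (fderiv ℝ (fun y => fderiv ℝ u y (unitVec i)) x) x :=
    ((contDiff_fderiv_apply (n := 1) (by exact_mod_cast hu) _).differentiable
      (by norm_num) x).hasFDerivAt
  rw [h1]
  have h4 := (h2.mul h3).fderiv
  rw [show (fun y => j' (u y) * fderiv ℝ u y (unitVec i)) =
    (j' ∘ u) * fun y => fderiv ℝ u y (unitVec i) from rfl, h4]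
  simp; ring

theorem fderiv_norm_sq_apply_unitVec (x : Space d) (i : Fin d) :
    fderiv ℝ (fun y : Space d => ‖y‖ ^ 2) x (unitVec i) = 2 * x i := by
  rw [fderiv_norm_sq_apply]
  simp [unitVec, EuclideanSpace.inner_single_right]

theorem laplacian_norm_sq (x : Space d) : Δ (fun y : Space d => ‖y‖ ^ 2) x = 2 * d := by
  rw [laplacian_eq_sum (contDiff_norm_sq ℝ)]
  have h : ∀ i, fderiv ℝ (fun y : Space d => fderiv ℝ (fun z : Space d => ‖z‖ ^ 2) y (unitVec i)) x
      (unitVec i) = 2 := fun i => by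
    simp_rw [fderiv_norm_sq_apply_unitVec]
    have h1 : HasFDerivAt (fun y : Space d => 2 * y i)
        ((2 : ℝ) • (EuclideanSpace.proj i : Space d →L[ℝ] ℝ)) x :=
      ((EuclideanSpace.proj i : Space d →L[ℝ] ℝ).hasFDerivAt).const_mul 2
    rw [h1.fderiv]; simp [unitVec]
  simp_rw [h]
  simp [mul_comm]

/-- The Laplacian of a radial function, as a function of `‖x‖ ^ 2`. -/
theorem laplacian_radial {j j' : ℝ → ℝ} {j'' : ℝ}
    (hju : ContDiff ℝ 2 fun y : Space d => j (‖y‖ ^ 2))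
    (hj : ∀ s, 0 ≤ s → HasDerivAt j (j' s) s) (x : Space d) (hj' : HasDerivAt j' j'' (‖x‖ ^ 2)) :
    Δ (fun y : Space d => j (‖y‖ ^ 2)) x = 2 * d * j' (‖x‖ ^ 2) + 4 * ‖x‖ ^ 2 * j'' := by
  rw [laplacian_comp (contDiff_norm_sq ℝ) hju (fun y => hj _ (by positivity)) x hj',
    laplacian_norm_sq]
  simp_rw [fderiv_norm_sq_apply_unitVec]
  have : ∑ i, (2 * x i) ^ 2 = 4 * ‖x‖ ^ 2 := by
    rw [EuclideanSpace.real_norm_sq_eq, Finset.mul_sum]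
    exact Finset.sum_congr rfl fun i _ => by ring
  rw [this]; ring

theorem laplacian_comp_sub {f : Space d → ℝ} (hf : ContDiff ℝ 2 f) (x y : Space d) :
    Δ (fun z => f (x - z)) y = Δ f (x - y) := by
  have hf' : ContDiff ℝ 2 fun z => f (x - z) := hf.comp (by fun_prop)
  rw [laplacian_eq_sum hf', laplacian_eq_sum hf]
  refine Finset.sum_congr rfl fun i _ => ?_
  have key : ∀ (g : Space d → ℝ), Differentiable ℝ g → ∀ z v,
      fderiv ℝ (fun z => g (x - z)) z v = -fderiv ℝ g (x - z) v := fun g hg z v => by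
    have h1 : HasFDerivAt (fun z : Space d => x - z) (-ContinuousLinearMap.id ℝ (Space d)) z := by
      simpa using (hasFDerivAt_id z).const_sub x
    have := ((hg (x - z)).hasFDerivAt.comp z h1).fderiv
    rw [show (fun z => g (x - z)) = g ∘ fun z => x - z from rfl, this]; simp
  simp_rw [key f (hf.differentiable (by norm_num))]
  have h2 := key (fun y => -fderiv ℝ f y (unitVec i))
    ((contDiff_fderiv_apply (n := 1) (by exact_mod_cast hf) _).differentiable (by norm_num)).neg
    y (unitVec i)
  rw [h2, fderiv_fun_neg]; simp

theorem integral_mul_laplacian_eq {u χ : Space d → ℝ} (hu : ContDiff ℝ 2 u) (hχ : ContDiff ℝ 2 χ)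
    (hχc : HasCompactSupport χ) : ∫ x, u x * Δ χ x = ∫ x, Δ u x * χ x := by
  simp_rw [laplacian_eq_sum hu, laplacian_eq_sum hχ, Finset.mul_sum, Finset.sum_mul]
  have d1 : ∀ {f : Space d → ℝ}, ContDiff ℝ 2 f → ∀ i, ContDiff ℝ 1
      fun y => fderiv ℝ f y (unitVec i) := fun hf i =>
    contDiff_fderiv_apply (n := 1) (by exact_mod_cast hf) _
  have c2 : ∀ {f : Space d → ℝ}, ContDiff ℝ 2 f → ∀ i, Continuous
      fun x => fderiv ℝ (fun y => fderiv ℝ f y (unitVec i)) x (unitVec i) := fun hf i =>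
    ((d1 hf i).continuous_fderiv (by norm_num)).clm_apply continuous_const
  have s1 : ∀ i : Fin d, HasCompactSupport fun y => fderiv ℝ χ y (unitVec i) := fun i =>
    hχc.fderiv_apply (𝕜 := ℝ) _
  have s2 : ∀ i : Fin d, HasCompactSupport
      fun x => fderiv ℝ (fun y => fderiv ℝ χ y (unitVec i)) x (unitVec i) := fun i =>
    (s1 i).fderiv_apply (𝕜 := ℝ) _
  have i1 : ∀ i, Integrable fun x =>
      u x * fderiv ℝ (fun y => fderiv ℝ χ y (unitVec i)) x (unitVec i) := fun i =>
    (hu.continuous.mul (c2 hχ i)).integrable_of_hasCompactSupport (s2 i).mul_left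
  have i2 : ∀ i, Integrable fun x =>
      fderiv ℝ (fun y => fderiv ℝ u y (unitVec i)) x (unitVec i) * χ x := fun i =>
    ((c2 hu i).mul hχ.continuous).integrable_of_hasCompactSupport hχc.mul_left
  have i3 : ∀ i, Integrable fun x => fderiv ℝ u x (unitVec i) * fderiv ℝ χ x (unitVec i) :=
    fun i => ((d1 hu i).continuous.mul (d1 hχ i).continuous).integrable_of_hasCompactSupport
      (s1 i).mul_left
  have i4 : ∀ i, Integrable fun x => u x * fderiv ℝ χ x (unitVec i) := fun i =>
    (hu.continuous.mul (d1 hχ i).continuous).integrable_of_hasCompactSupport (s1 i).mul_left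
  have i5 : ∀ i, Integrable fun x => fderiv ℝ u x (unitVec i) * χ x := fun i =>
    ((d1 hu i).continuous.mul hχ.continuous).integrable_of_hasCompactSupport hχc.mul_left
  rw [integral_finsetSum _ fun i _ => i1 i, integral_finsetSum _ fun i _ => i2 i]
  refine Finset.sum_congr rfl fun i _ => ?_
  rw [integral_mul_fderiv_eq_neg_fderiv_mul_of_integrable (i3 i) (i1 i) (i4 i)
    (fun x _ => hu.differentiable (by norm_num) x)
    (fun x _ => (d1 hχ i).differentiable (by norm_num) x),
    integral_mul_fderiv_eq_neg_fderiv_mul_of_integrable (i2 i) (i3 i) (i5 i)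
    (fun x _ => (d1 hu i).differentiable (by norm_num) x)
    (fun x _ => hχ.differentiable (by norm_num) x), neg_neg]

end Laplacian

/-! ### Mollification -/

section Mollification

open Laplacian Set Filter Topology

variable {d : ℕ}

theorem continuous_translate_Lp {p : ℝ≥0∞} [Fact (1 ≤ p)] (hp : p ≠ ⊤)
    (F : Lp ℝ p (volume : Measure (Space d))) :
    Continuous fun h : Space d => Lp.compMeasurePreserving (fun x => x - h)
      (measurePreserving_sub_right volume h) F := by
  have hg : Continuous fun h : Space d => (⟨fun x => x - h, by fun_prop⟩ : C(Space d, Space d)) :=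
    ((ContinuousMap.mk (fun a : Space d × Space d => a.2 - a.1) (by fun_prop)).curry).continuous
  exact (continuous_const (y := F)).compMeasurePreservingLp hg
    (fun h => measurePreserving_sub_right volume h) hp

theorem tendsto_integral_abs_translate_sub {f : Space d → ℝ} (hf : Integrable f) :
    Tendsto (fun h : Space d => ∫ x, |f (x - h) - f x|) (𝓝 0) (𝓝 0) := by
  have : Fact ((1 : ℝ≥0∞) ≤ 1) := ⟨le_rfl⟩
  have hm := memLp_one_iff_integrable.2 hf
  set F := hm.toLp f
  have hc := (continuous_translate_Lp ENNReal.one_ne_top F).sub (continuous_const (y := F))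
  have h0 := (hc.norm).tendsto 0
  have hN : ∀ h : Space d, ‖Lp.compMeasurePreserving (fun x => x - h)
      (measurePreserving_sub_right volume h) F - F‖ = ∫ x, |f (x - h) - f x| := fun h => by
    rw [L1.norm_eq_integral_norm]
    refine integral_congr_ae ?_
    have e1 := Lp.coeFn_compMeasurePreserving F (measurePreserving_sub_right volume h)
    have e2 := (measurePreserving_sub_right volume h).quasiMeasurePreserving.ae_eq_comp
      hm.coeFn_toLp
    filter_upwards [Lp.coeFn_sub (Lp.compMeasurePreserving (fun x => x - h)
      (measurePreserving_sub_right volume h) F) F, e1, e2, hm.coeFn_toLp] with x h1 h2 h3 h4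
    rw [h1, Pi.sub_apply, h2, h3, h4]; rfl
  refine (h0.congr hN).trans (le_of_eq ?_)
  congr 1
  exact (hN 0).trans (by simp)

/-- A sequence of smooth bump functions whose supports shrink to the origin. -/
noncomputable def bump (d n : ℕ) : ContDiffBump (0 : Space d) :=
  ⟨1 / (n + 1), 2 / (n + 1), by positivity, by gcongr; norm_num⟩

noncomputable def mollifier (d n : ℕ) : Space d → ℝ := (bump d n).normed volume

/-- The convolution of `f` with the `n`-th mollifier. -/
noncomputable def mollify {d : ℕ} (n : ℕ) (f : Space d → ℝ) (x : Space d) : ℝ :=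
  ∫ y, f y * mollifier d n (x - y)

theorem contDiff_mollifier (n : ℕ) : ContDiff ℝ ∞ (mollifier d n) := (bump d n).contDiff_normed

theorem mollifier_nonneg (n : ℕ) (x : Space d) : 0 ≤ mollifier d n x := (bump d n).nonneg_normed x

theorem hasCompactSupport_mollifier (n : ℕ) : HasCompactSupport (mollifier d n) :=
  (bump d n).hasCompactSupport_normed

theorem integral_mollifier (n : ℕ) : ∫ x, mollifier d n x = 1 := (bump d n).integral_normed

theorem mollifier_eq_zero {n : ℕ} {x : Space d} (h : 2 / ((n : ℝ) + 1) ≤ ‖x‖) :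
    mollifier d n x = 0 := by
  have : x ∉ Function.support (mollifier d n) := by
    rw [mollifier, ContDiffBump.support_normed_eq, Metric.mem_ball, dist_zero_right]
    exact not_lt.2 h
  simpa using this

theorem integrable_mollifier (n : ℕ) : Integrable (mollifier d n) := (bump d n).integrable_normed

theorem mollify_eq_convolution (n : ℕ) (f : Space d → ℝ) :
    mollify n f = convolution f (mollifier d n) (ContinuousLinearMap.mul ℝ ℝ) volume := by
  funext x; simp [mollify, convolution_def]

theorem mollify_eq_swap (n : ℕ) (f : Space d → ℝ) (x : Space d) :
    mollify n f x = ∫ h, f (x - h) * mollifier d n h := by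
  rw [mollify_eq_convolution, convolution_eq_swap]; simp

theorem contDiff_mollify (n : ℕ) {f : Space d → ℝ} (hf : LocallyIntegrable f) :
    ContDiff ℝ ∞ (mollify n f) := by
  rw [mollify_eq_convolution]
  exact (hasCompactSupport_mollifier n).contDiff_convolution_right (n := ⊤) _ hf
    (contDiff_mollifier n)

theorem fderiv_convolution_apply {f g : Space d → ℝ} (hf : LocallyIntegrable f)
    (hg : ContDiff ℝ 1 g) (hgc : HasCompactSupport g) (x v : Space d) :
    fderiv ℝ (convolution f g (ContinuousLinearMap.mul ℝ ℝ) volume) x v =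
      convolution f (fun y => fderiv ℝ g y v) (ContinuousLinearMap.mul ℝ ℝ) volume x := by
  rw [(hgc.hasFDerivAt_convolution_right (ContinuousLinearMap.mul ℝ ℝ) hf hg x).fderiv,
    convolution_precompR_apply (ContinuousLinearMap.mul ℝ ℝ) hf (hgc.fderiv ℝ)
      (hg.continuous_fderiv (by norm_num))]

theorem laplacian_mollify (n : ℕ) {f : Space d → ℝ} (hf : LocallyIntegrable f) (x : Space d) :
    Δ (mollify n f) x = ∫ y, f y * Δ (mollifier d n) (x - y) := by
  have h2 : ContDiff ℝ 2 (mollifier d n) := (contDiff_mollifier n).of_le (by norm_cast)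
  have hc := hasCompactSupport_mollifier (d := d) n
  have d1 : ∀ i, ContDiff ℝ 1 fun y => fderiv ℝ (mollifier d n) y (unitVec i) := fun i =>
    contDiff_fderiv_apply (n := 1) (by exact_mod_cast h2) _
  have s1 : ∀ i : Fin d, HasCompactSupport fun y => fderiv ℝ (mollifier d n) y (unitVec i) :=
    fun i => hc.fderiv_apply (𝕜 := ℝ) _
  rw [laplacian_eq_sum ((contDiff_mollify n hf).of_le (by norm_cast))]
  simp_rw [mollify_eq_convolution, fderiv_convolution_apply hf (h2.of_le (by norm_num)) hc,
    laplacian_eq_sum h2, Finset.mul_sum]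
  rw [integral_finsetSum]
  · refine Finset.sum_congr rfl fun i _ => ?_
    rw [show (fun y => convolution f (fun y => fderiv ℝ (mollifier d n) y (unitVec i))
      (ContinuousLinearMap.mul ℝ ℝ) volume y) = convolution f
      (fun y => fderiv ℝ (mollifier d n) y (unitVec i)) (ContinuousLinearMap.mul ℝ ℝ) volume from rfl,
      fderiv_convolution_apply hf (d1 i) (s1 i), convolution_def]
    simp
  · intro i _
    have := (((s1 i).fderiv_apply (𝕜 := ℝ) (unitVec i)).convolutionExists_right
      (ContinuousLinearMap.mul ℝ ℝ) hf (((d1 i).continuous_fderiv (by norm_num)).clm_apply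
        continuous_const)) x
    simpa [ConvolutionExistsAt] using this

/-- The Laplacian of a mollified weak solution. -/
theorem laplacian_mollify_of_weak (n : ℕ) {w q : Space d → ℝ} (hw : LocallyIntegrable w)
    (h : ∀ η : Space d → ℝ, ContDiff ℝ ∞ η → HasCompactSupport η →
      ∫ x, w x * Δ η x = ∫ x, q x * η x) (x : Space d) :
    Δ (mollify n w) x = mollify n q x := by
  have hs : ContDiff ℝ ∞ fun y => mollifier d n (x - y) := (contDiff_mollifier n).comp (by fun_prop)
  have hc : HasCompactSupport fun y => mollifier d n (x - y) :=
    (hasCompactSupport_mollifier n).comp_homeomorph (Homeomorph.subLeft x)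
  rw [laplacian_mollify n hw, mollify, ← h _ hs hc]
  refine integral_congr_ae (Eventually.of_forall fun y => ?_)
  simp only
  rw [laplacian_comp_sub ((contDiff_mollifier n).of_le (by norm_cast))]

theorem ae_tendsto_mollify {f : Space d → ℝ} (hf : LocallyIntegrable f) :
    ∀ᵐ x, Tendsto (fun n => mollify n f x) atTop (𝓝 (f x)) := by
  have h0 : Tendsto (fun n : ℕ => (bump d n).rOut) atTop (𝓝 0) := by
    have := (tendsto_one_div_add_atTop_nhds_zero_nat (𝕜 := ℝ)).const_mul 2
    simpa [bump, div_eq_mul_inv] using this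
  have := ContDiffBump.ae_convolution_tendsto_right_of_locallyIntegrable (μ := volume) (K := 2) h0
    (Eventually.of_forall fun n => by simp only [bump]; apply le_of_eq; ring) hf
  filter_upwards [this] with x hx
  refine hx.congr fun n => ?_
  rw [convolution_def, mollify_eq_swap]
  refine integral_congr_ae (Eventually.of_forall fun y => ?_)
  simp [mollifier, mul_comm]

theorem integrable_mollify_kernel {f : Space d → ℝ} (hf : Integrable f) (n : ℕ) :
    Integrable fun p : Space d × Space d => f (p.1 - p.2) * mollifier d n p.2 := by
  have := (integrable_mollifier (d := d) n).convolution_integrand (ContinuousLinearMap.mul ℝ ℝ) hf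
  rw [Measure.volume_eq_prod]
  refine this.congr (Eventually.of_forall fun p => ?_)
  simp [mul_comm]

/-- By Fubini the `L¹` error is at most the average, over the mollifier, of the `L¹` translation
errors of `f`, and these are small because the supports shrink. -/
theorem tendsto_integral_abs_mollify_sub {f : Space d → ℝ} (hf : Integrable f) :
    Tendsto (fun n => ∫ x, |mollify n f x - f x|) atTop (𝓝 0) := by
  rw [Metric.tendsto_atTop]
  intro ε hε
  obtain ⟨r, hr, hN⟩ := Metric.eventually_nhds_iff.1
    ((tendsto_integral_abs_translate_sub hf).eventually (gt_mem_nhds (half_pos hε)))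
  obtain ⟨n₀, hn₀⟩ := exists_nat_gt (2 / r)
  refine ⟨n₀, fun n hn => ?_⟩
  have hnr : 2 / ((n : ℝ) + 1) < r := by
    rw [div_lt_iff₀ (by positivity)]
    rw [div_lt_iff₀ hr] at hn₀
    have : (n₀ : ℝ) ≤ n := by exact_mod_cast hn
    nlinarith
  have hK := integrable_mollify_kernel hf n
  have hK2 : Integrable fun p : Space d × Space d => f p.1 * mollifier d n p.2 := by
    rw [Measure.volume_eq_prod]; exact hf.mul_prod (integrable_mollifier n)
  have hD : Integrable fun p : Space d × Space d =>
      |(f (p.1 - p.2) - f p.1) * mollifier d n p.2| := by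
    refine ((hK.sub hK2).abs).congr (Eventually.of_forall fun p => ?_)
    simp [sub_mul]
  have hDv := hD
  rw [Measure.volume_eq_prod] at hDv
  have hae : ∀ᵐ x, |mollify n f x - f x| ≤
      ∫ h, |(f (x - h) - f x) * mollifier d n h| := by
    have h1 := hK
    rw [Measure.volume_eq_prod] at h1
    filter_upwards [h1.prod_right_ae] with x hx
    have h2 : mollify n f x - f x = ∫ h, (f (x - h) - f x) * mollifier d n h := by
      rw [mollify_eq_swap]
      simp_rw [sub_mul]
      rw [integral_sub hx ((integrable_mollifier n).const_mul _), integral_const_mul,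
        integral_mollifier, mul_one]
    rw [h2]
    exact abs_integral_le_integral_abs
  have hle : ∫ x, |mollify n f x - f x| ≤ ε / 2 := by
    calc ∫ x, |mollify n f x - f x|
        ≤ ∫ x, ∫ h, |(f (x - h) - f x) * mollifier d n h| :=
          integral_mono_of_nonneg (Eventually.of_forall fun x => abs_nonneg _)
            hDv.integral_prod_left hae
      _ = ∫ h, ∫ x, |(f (x - h) - f x) * mollifier d n h| := integral_integral_swap hDv
      _ = ∫ h, (∫ x, |f (x - h) - f x|) * mollifier d n h := by
          refine integral_congr_ae (Eventually.of_forall fun h => ?_)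
          simp only
          rw [← integral_mul_const]
          refine integral_congr_ae (Eventually.of_forall fun x => ?_)
          simp only [abs_mul, abs_of_nonneg (mollifier_nonneg n h)]
      _ ≤ ∫ h, ε / 2 * mollifier d n h := by
          refine integral_mono_of_nonneg (Eventually.of_forall fun h => ?_)
            ((integrable_mollifier n).const_mul _) (Eventually.of_forall fun h => ?_)
          · exact mul_nonneg (integral_nonneg fun x => abs_nonneg _) (mollifier_nonneg n h)
          · rcases le_or_gt (2 / ((n : ℝ) + 1)) ‖h‖ with hh | hh
            · simp [mollifier_eq_zero hh]
            · refine mul_le_mul_of_nonneg_right (hN ?_).le (mollifier_nonneg n h)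
              rw [dist_zero_right]; linarith
      _ = ε / 2 := by rw [integral_const_mul, integral_mollifier, mul_one]
  rw [Real.dist_eq, sub_zero, abs_of_nonneg (integral_nonneg fun x => abs_nonneg _)]
  linarith

/-- Every mollifier is supported within radius `2`, so on the ball of radius `r` nothing changes if
`f` is cut off at radius `r + 2`. -/
theorem tendsto_integral_ball_abs_mollify_sub {f : Space d → ℝ} (hf : LocallyIntegrable f)
    (r : ℝ) :
    Tendsto (fun n => ∫ x in Metric.ball 0 r, |mollify n f x - f x|) atTop (𝓝 0) := by
  set f' := (Metric.ball (0 : Space d) (r + 2)).indicator f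
  have hf' : Integrable f' := (integrable_indicator_iff Metric.isOpen_ball.measurableSet).2
    ((hf.integrableOn_isCompact (isCompact_closedBall 0 (r + 2))).mono_set
      Metric.ball_subset_closedBall)
  refine squeeze_zero (fun n => integral_nonneg fun x => abs_nonneg _) (fun n => ?_)
    (tendsto_integral_abs_mollify_sub hf')
  have hi : Integrable fun x => |mollify n f' x - f' x| := by
    have h1 := integrable_mollify_kernel hf' n
    rw [Measure.volume_eq_prod] at h1
    refine ((h1.integral_prod_left.congr (Eventually.of_forall fun x => ?_)).sub hf').abs
    exact (mollify_eq_swap n f' x).symm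
  refine le_trans (le_of_eq ?_) (setIntegral_le_integral (s := Metric.ball 0 r) hi
    (Eventually.of_forall fun x => abs_nonneg _))
  refine setIntegral_congr_fun Metric.isOpen_ball.measurableSet fun x hx => ?_
  rw [Metric.mem_ball, dist_zero_right] at hx
  have hx' : f' x = f x := indicator_of_mem (by rw [Metric.mem_ball, dist_zero_right]; linarith) f
  rw [hx']
  congr 2
  refine integral_congr_ae (Eventually.of_forall fun y => ?_)
  simp only
  by_cases hy : y ∈ Metric.ball (0 : Space d) (r + 2)
  · rw [show f' y = f y from indicator_of_mem hy f]
  · rw [Metric.mem_ball, dist_zero_right, not_lt] at hy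
    rw [mollifier_eq_zero, mul_zero, mul_zero]
    have h1 : 2 / ((n : ℝ) + 1) ≤ 2 := div_le_self (by norm_num) (by linarith [n.cast_nonneg (α := ℝ)])
    have := norm_sub_norm_le y x
    rw [norm_sub_rev]; linarith

end Mollification

/-! ### Kato's inequality and the maximum principle -/

section Kato

open Laplacian Set Filter Topology

variable {d : ℕ}

/-- A smooth convex version of `s ↦ max (s - B) 0`. -/
noncomputable def softPos (B s : ℝ) : ℝ := ∫ t in (0 : ℝ)..(s - B), Real.smoothTransition t

theorem hasDerivAt_softPos (B s : ℝ) :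
    HasDerivAt (softPos B) (Real.smoothTransition (s - B)) s := by
  have h1 : HasDerivAt (fun u => ∫ t in (0 : ℝ)..u, Real.smoothTransition t)
      (Real.smoothTransition (s - B)) (s - B) :=
    intervalIntegral.integral_hasDerivAt_right
      (Real.smoothTransition.continuous.intervalIntegrable _ _)
      (Real.smoothTransition.continuous.stronglyMeasurableAtFilter _ _)
      Real.smoothTransition.continuous.continuousAt
  have := h1.comp s ((hasDerivAt_id s).sub_const B)
  rwa [mul_one] at this

theorem contDiff_softPos (B : ℝ) : ContDiff ℝ 2 (softPos B) := by
  have hd : deriv (softPos B) = fun s => Real.smoothTransition (s - B) :=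
    funext fun s => (hasDerivAt_softPos B s).deriv
  rw [show (2 : ℕ∞ω) = 1 + 1 by norm_num, contDiff_succ_iff_deriv]
  refine ⟨fun s => (hasDerivAt_softPos B s).differentiableAt, by simp, ?_⟩
  rw [hd]
  exact (Real.smoothTransition.contDiff (n := 1)).comp (by fun_prop)

theorem softPos_of_le {B s : ℝ} (h : s ≤ B) : softPos B s = 0 := by
  rw [softPos, intervalIntegral.integral_symm, neg_eq_zero]
  rw [intervalIntegral.integral_congr (g := fun _ => 0)]
  · simp
  · intro t ht
    rw [uIcc_of_le (by linarith)] at ht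
    exact Real.smoothTransition.zero_of_nonpos ht.2

theorem softPos_pos {B s : ℝ} (h : B < s) : 0 < softPos B s := by
  refine intervalIntegral.intervalIntegral_pos_of_pos_on
    (Real.smoothTransition.continuous.intervalIntegrable _ _)
    (fun x hx => Real.smoothTransition.pos_of_pos hx.1) (by linarith)

theorem softPos_nonneg (B s : ℝ) : 0 ≤ softPos B s := by
  rcases le_or_gt s B with h | h
  · rw [softPos_of_le h]
  · exact (softPos_pos h).le

theorem abs_softPos_sub_le (B s t : ℝ) : |softPos B s - softPos B t| ≤ |s - t| := by
  have := Convex.norm_image_sub_le_of_norm_hasDerivWithin_le (f := softPos B) (s := univ)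
    (C := 1) (fun x _ => (hasDerivAt_softPos B x).hasDerivWithinAt)
    (fun x _ => by
      rw [Real.norm_eq_abs, abs_of_nonneg (Real.smoothTransition.nonneg _)]
      exact Real.smoothTransition.le_one _) convex_univ (mem_univ t) (mem_univ s)
  simpa using this

theorem locallyIntegrable_softPos {w : Space d → ℝ} (hw : LocallyIntegrable w) (B : ℝ) :
    LocallyIntegrable fun x => softPos B (w x) := by
  have hn : LocallyIntegrable fun x => |w x| :=
    hw.mono hw.aestronglyMeasurable.norm (Eventually.of_forall fun x => by simp)
  refine (hn.add (locallyIntegrable_const |B|)).mono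
    ((contDiff_softPos B).continuous.comp_aestronglyMeasurable hw.aestronglyMeasurable)
    (Eventually.of_forall fun x => ?_)
  have := abs_softPos_sub_le B (w x) B
  rw [softPos_of_le le_rfl, sub_zero] at this
  simp only [Pi.add_apply, Real.norm_eq_abs]
  rw [abs_of_nonneg (by positivity : (0 : ℝ) ≤ |w x| + |B|)]
  exact this.trans (abs_sub _ _)

theorem tsupport_subset_ball {χ : Space d → ℝ} (hχ : HasCompactSupport χ) :
    ∃ r, ∀ x, x ∉ Metric.ball (0 : Space d) r → χ x = 0 := by
  obtain ⟨r, hr⟩ := hχ.isCompact.isBounded.subset_ball (0 : Space d)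
  exact ⟨r, fun x hx => image_eq_zero_of_notMem_tsupport fun h => hx (hr h)⟩

theorem LocallyIntegrable.integrable_mul_of_bounded {w θ : Space d → ℝ} (hw : LocallyIntegrable w)
    {r C : ℝ} (hθm : AEStronglyMeasurable θ) (hθ : ∀ x, |θ x| ≤ C)
    (hr : ∀ x, x ∉ Metric.ball (0 : Space d) r → θ x = 0) : Integrable fun x => θ x * w x := by
  have hi : Integrable ((Metric.ball (0 : Space d) r).indicator w) :=
    (integrable_indicator_iff Metric.isOpen_ball.measurableSet).2
    ((hw.integrableOn_isCompact (isCompact_closedBall 0 r)).mono_set Metric.ball_subset_closedBall)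
  refine (hi.bdd_mul hθm (Eventually.of_forall hθ)).congr (Eventually.of_forall fun x => ?_)
  by_cases hx : x ∈ Metric.ball (0 : Space d) r
  · simp [indicator_of_mem hx]
  · simp [hr x hx]

/-- A weighted integral against a mollified function converges. -/
theorem tendsto_integral_mul_of_tendsto_L1 {u : ℕ → Space d → ℝ} {w : Space d → ℝ}
    {θ : Space d → ℝ} {r C : ℝ} (hu : ∀ n, LocallyIntegrable (u n)) (hw : LocallyIntegrable w)
    (hθm : AEStronglyMeasurable θ) (hθ : ∀ x, |θ x| ≤ C)
    (hr : ∀ x, x ∉ Metric.ball (0 : Space d) r → θ x = 0)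
    (h : Tendsto (fun n => ∫ x in Metric.ball 0 r, |u n x - w x|) atTop (𝓝 0)) :
    Tendsto (fun n => ∫ x, θ x * u n x) atTop (𝓝 (∫ x, θ x * w x)) := by
  rw [tendsto_iff_norm_sub_tendsto_zero]
  refine squeeze_zero (fun n => norm_nonneg _) (fun n => ?_) (by simpa using h.const_mul C)
  have hi : LocallyIntegrable fun x => u n x - w x := (hu n).sub hw
  rw [← integral_sub (LocallyIntegrable.integrable_mul_of_bounded (hu n) hθm hθ hr)
    (LocallyIntegrable.integrable_mul_of_bounded hw hθm hθ hr), ← integral_const_mul,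
    ← integral_indicator Metric.isOpen_ball.measurableSet]
  refine norm_integral_le_of_norm_le ?_ (Eventually.of_forall fun x => ?_)
  · refine (integrable_indicator_iff Metric.isOpen_ball.measurableSet).2 ?_
    exact (((hi.integrableOn_isCompact (isCompact_closedBall 0 r)).mono_set
      Metric.ball_subset_closedBall).abs).const_mul C
  · by_cases hx : x ∈ Metric.ball (0 : Space d) r
    · rw [indicator_of_mem hx, ← mul_sub, norm_mul]
      exact mul_le_mul_of_nonneg_right (hθ x) (norm_nonneg _)
    · rw [indicator_of_notMem hx, hr x hx]; simp

/-- **Kato's inequality** for weak solutions of `Δ w = q`. -/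
theorem integral_mul_smoothTransition_le {w q χ : Space d → ℝ} (hw : LocallyIntegrable w)
    (hq : LocallyIntegrable q) (h : ∀ η : Space d → ℝ, ContDiff ℝ ∞ η → HasCompactSupport η →
      ∫ x, w x * Δ η x = ∫ x, q x * η x) (hχ : ContDiff ℝ ∞ χ) (hχc : HasCompactSupport χ)
    (hχ0 : ∀ x, 0 ≤ χ x) (B : ℝ) :
    ∫ x, χ x * Real.smoothTransition (w x - B) * q x ≤ ∫ x, Δ χ x * softPos B (w x) := by
  have hχ2 : ContDiff ℝ 2 χ := hχ.of_le (by norm_cast)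
  have hΔc := continuous_laplacian hχ2
  obtain ⟨r, hr⟩ := tsupport_subset_ball hχc
  have hrΔ : ∀ x, x ∉ Metric.ball (0 : Space d) (r + 1) → Δ χ x = 0 := fun x hx => by
    have h0 : χ =ᶠ[𝓝 x] fun _ => (0 : ℝ) := by
      have hx' : x ∈ (Metric.closedBall (0 : Space d) r)ᶜ := by
        simp only [Metric.mem_ball, dist_zero_right, not_lt, mem_compl_iff,
          Metric.mem_closedBall, not_le] at hx ⊢
        linarith
      filter_upwards [Metric.isClosed_closedBall.isOpen_compl.mem_nhds hx'] with y hy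
      exact hr y fun hy' => hy (Metric.ball_subset_closedBall hy')
    rw [(InnerProductSpace.laplacian_congr_nhds h0).eq_of_nhds]; simp
  obtain ⟨C, hC⟩ := hχc.exists_bound_of_continuous hχ.continuous
  obtain ⟨C', hC'⟩ := (hasCompactSupport_laplacian hχc).exists_bound_of_continuous hΔc
  have hsm : ∀ n, ContDiff ℝ ∞ (mollify n w) := fun n => contDiff_mollify n hw
  have hsc : ∀ n, Continuous (mollify n w) := fun n => (hsm n).continuous
  have hqc : ∀ n, Continuous (mollify n q) := fun n => (contDiff_mollify n hq).continuous
  -- For the smooth mollified solution `Δ j(u) = j'(u) Δu + j''(u) |∇u|² ≥ j'(u) Δu`; this is tested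
  -- against `χ ≥ 0` and integrated by parts.
  have hjl : ∀ n, ∫ x, χ x * Real.smoothTransition (mollify n w x - B) * mollify n q x ≤
      ∫ x, Δ χ x * softPos B (mollify n w x) := fun n => by
    have hm2 : ContDiff ℝ 2 (mollify n w) := (hsm n).of_le (by norm_cast)
    have hj2 : ContDiff ℝ 2 fun x => softPos B (mollify n w x) := (contDiff_softPos B).comp hm2
    have hg := integral_mul_laplacian_eq hj2 hχ2 hχc
    simp_rw [fun x => mul_comm (Δ χ x)]
    rw [hg]
    have hcont : Continuous fun x => χ x * Real.smoothTransition (mollify n w x - B) *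
        mollify n q x := (hχ.continuous.mul (Real.smoothTransition.continuous.comp
          ((hsc n).sub continuous_const))).mul (hqc n)
    refine integral_mono (hcont.integrable_of_hasCompactSupport (hχc.mul_right.mul_right))
      (((continuous_laplacian hj2).mul hχ.continuous).integrable_of_hasCompactSupport
        hχc.mul_left) fun x => ?_
    have hd1 : Differentiable ℝ Real.smoothTransition :=
      (Real.smoothTransition.contDiff (n := 1)).differentiable (by norm_num)
    have hd2 : HasDerivAt (fun s => Real.smoothTransition (s - B))
        (deriv Real.smoothTransition (mollify n w x - B)) (mollify n w x) := by
      have := (hd1 (mollify n w x - B)).hasDerivAt.comp (mollify n w x)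
        ((hasDerivAt_id (mollify n w x)).sub_const B)
      rwa [mul_one] at this
    simp only
    rw [laplacian_comp (j' := fun s => Real.smoothTransition (s - B)) hm2 hj2
      (fun y => hasDerivAt_softPos B _) x hd2,
      laplacian_mollify_of_weak n hw h x]
    have h1 : 0 ≤ deriv Real.smoothTransition (mollify n w x - B) *
        ∑ i, fderiv ℝ (mollify n w) x (unitVec i) ^ 2 :=
      mul_nonneg Real.smoothTransition.monotone.deriv_nonneg
        (Finset.sum_nonneg fun i _ => sq_nonneg _)
    nlinarith [mul_nonneg h1 (hχ0 x)]
  have hwl := locallyIntegrable_softPos hw B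
  have hlim1 : Tendsto (fun n => ∫ x, Δ χ x * softPos B (mollify n w x)) atTop
      (𝓝 (∫ x, Δ χ x * softPos B (w x))) := by
    refine tendsto_integral_mul_of_tendsto_L1 (fun n =>
      ((contDiff_softPos B).continuous.comp (hsc n)).locallyIntegrable) hwl
      hΔc.aestronglyMeasurable hC' hrΔ ?_
    refine squeeze_zero (fun n => integral_nonneg fun x => abs_nonneg _) (fun n => ?_)
      (tendsto_integral_ball_abs_mollify_sub hw (r + 1))
    refine integral_mono_of_nonneg (Eventually.of_forall fun x => abs_nonneg _) ?_
      (Eventually.of_forall fun x => abs_softPos_sub_le B _ _)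
    have hi : LocallyIntegrable fun x => mollify n w x - w x := (hsc n).locallyIntegrable.sub hw
    exact ((hi.integrableOn_isCompact (isCompact_closedBall 0 (r + 1))).mono_set
      Metric.ball_subset_closedBall).abs
  have hst : ∀ s, |Real.smoothTransition s| ≤ 1 := fun s => by
    rw [abs_of_nonneg (Real.smoothTransition.nonneg _)]; exact Real.smoothTransition.le_one _
  -- The two mollified factors are released separately: the weight by dominated convergence against
  -- the fixed source, then the source in `L¹` against a uniformly bounded weight.
  have hlim2 : Tendsto (fun n => ∫ x, χ x * Real.smoothTransition (mollify n w x - B) * q x) atTop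
      (𝓝 (∫ x, χ x * Real.smoothTransition (w x - B) * q x)) := by
    have hqi : Integrable fun x => χ x * q x :=
      LocallyIntegrable.integrable_mul_of_bounded hq hχ.continuous.aestronglyMeasurable hC hr
    refine tendsto_integral_of_dominated_convergence (fun x => |χ x * q x|) (fun n => ?_)
      hqi.abs (fun n => Eventually.of_forall fun x => ?_) ?_
    · exact ((hχ.continuous.mul (Real.smoothTransition.continuous.comp
        ((hsc n).sub continuous_const))).aestronglyMeasurable).mul hq.aestronglyMeasurable
    · rw [show χ x * Real.smoothTransition (mollify n w x - B) * q x =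
        Real.smoothTransition (mollify n w x - B) * (χ x * q x) by ring, norm_mul]
      exact mul_le_of_le_one_left (norm_nonneg _) (hst _)
    · filter_upwards [ae_tendsto_mollify hw] with x hx
      exact (((Real.smoothTransition.continuous.tendsto _).comp (hx.sub_const B)).const_mul
        _).mul_const _
  have hlim3 : Tendsto (fun n => (∫ x, χ x * Real.smoothTransition (mollify n w x - B) * mollify n q x)
      - ∫ x, χ x * Real.smoothTransition (mollify n w x - B) * q x) atTop (𝓝 0) := by
    refine squeeze_zero_norm (fun n => ?_)
      (by simpa using (tendsto_integral_ball_abs_mollify_sub hq r).const_mul C)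
    have hm : AEStronglyMeasurable (fun x => χ x * Real.smoothTransition (mollify n w x - B)) :=
      (hχ.continuous.mul (Real.smoothTransition.continuous.comp
        ((hsc n).sub continuous_const))).aestronglyMeasurable
    have hb : ∀ x, |χ x * Real.smoothTransition (mollify n w x - B)| ≤ C := fun x => by
      rw [abs_mul]
      exact (mul_le_of_le_one_right (abs_nonneg _) (hst _)).trans (hC x)
    have hz : ∀ x, x ∉ Metric.ball (0 : Space d) r →
        χ x * Real.smoothTransition (mollify n w x - B) = 0 := fun x hx => by simp [hr x hx]
    have hi : LocallyIntegrable fun x => mollify n q x - q x := (hqc n).locallyIntegrable.sub hq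
    rw [← integral_sub
      (LocallyIntegrable.integrable_mul_of_bounded (hqc n).locallyIntegrable hm hb hz)
      (LocallyIntegrable.integrable_mul_of_bounded hq hm hb hz), ← integral_const_mul,
      ← integral_indicator Metric.isOpen_ball.measurableSet]
    refine norm_integral_le_of_norm_le ?_ (Eventually.of_forall fun x => ?_)
    · refine (integrable_indicator_iff Metric.isOpen_ball.measurableSet).2 ?_
      exact (((hi.integrableOn_isCompact (isCompact_closedBall 0 r)).mono_set
        Metric.ball_subset_closedBall).abs).const_mul C
    · by_cases hx : x ∈ Metric.ball (0 : Space d) r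
      · rw [indicator_of_mem hx, ← mul_sub, norm_mul]
        exact mul_le_mul_of_nonneg_right (hb x) (norm_nonneg _)
      · rw [indicator_of_notMem hx, hr x hx]; simp
  have := hlim3.add hlim2
  simp only [sub_add_cancel, zero_add] at this
  exact le_of_tendsto_of_tendsto' this hlim1 hjl

/-- A maximum principle: a weak solution of `Δ w = v w / 2` that is at most `B ≥ 0` in a
neighbourhood outside the support of `v ≥ 0` is at most `B`. -/
theorem ae_le_of_weak_solution {v w : Space d → ℝ} {R R' B : ℝ} (hd : 0 < d) (hR : 0 < R)
    (hRR' : R < R')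
    (hv : ∀ x, 0 ≤ v x) (hw : LocallyIntegrable w)
    (hvw : LocallyIntegrable fun x => v x * w x)
    (h : ∀ η : Space d → ℝ, ContDiff ℝ ∞ η → HasCompactSupport η →
      ∫ x, w x * Δ η x = ∫ x, 1 / 2 * (v x * w x) * η x) (hB : 0 ≤ B)
    (hwB : ∀ x, R ≤ ‖x‖ → ‖x‖ < R' → w x ≤ B) : ∀ᵐ x, ‖x‖ < R' → w x ≤ B := by
  let b : ContDiffBump (0 : Space d) := ⟨R, (R + R') / 2, hR, by linarith⟩
  -- A nonnegative test function with `Δ χ = -2d` inside radius `R`. Between `R` and `R'` its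
  -- Laplacian has no definite sign, but there `w ≤ B` and `softPos` vanishes.
  set χ : Space d → ℝ := fun x => (R' ^ 2 - ‖x‖ ^ 2) * b x with hχdef
  have hb0 : ∀ x : Space d, (R + R') / 2 ≤ ‖x‖ → b x = 0 := fun x hx =>
    b.zero_of_le_dist (by rwa [dist_zero_right])
  have hχs : ContDiff ℝ ∞ χ := (contDiff_const.sub (contDiff_norm_sq ℝ)).mul b.contDiff
  have hχc : HasCompactSupport χ := b.hasCompactSupport.mul_left
  have hχ0 : ∀ x, 0 ≤ χ x := fun x => by
    rcases le_or_gt ((R + R') / 2) ‖x‖ with hx | hx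
    · simp [hχdef, hb0 x hx]
    · exact mul_nonneg (by nlinarith [norm_nonneg x]) b.nonneg
  have hΔin : ∀ x : Space d, ‖x‖ < R → Δ χ x = -(2 * d) := fun x hx => by
    have h0 : χ =ᶠ[𝓝 x] (fun _ => R' ^ 2) - fun y : Space d => ‖y‖ ^ 2 := by
      have : Metric.ball (0 : Space d) R ∈ 𝓝 x :=
        Metric.isOpen_ball.mem_nhds (by rwa [Metric.mem_ball, dist_zero_right])
      filter_upwards [this] with y hy
      rw [hχdef]
      simp only [Pi.sub_apply]
      rw [b.one_of_mem_closedBall (Metric.ball_subset_closedBall hy), mul_one]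
    rw [(InnerProductSpace.laplacian_congr_nhds h0).eq_of_nhds,
      (contDiff_const.contDiffAt).laplacian_sub ((contDiff_norm_sq ℝ).contDiffAt)]
    rw [laplacian_norm_sq]
    simp
  have hΔout : ∀ x : Space d, R' ≤ ‖x‖ → Δ χ x = 0 := fun x hx => by
    have h0 : χ =ᶠ[𝓝 x] fun _ => (0 : ℝ) := by
      have hx' : x ∈ (Metric.closedBall (0 : Space d) ((R + R') / 2))ᶜ := by
        simp only [mem_compl_iff, Metric.mem_closedBall, dist_zero_right, not_le]
        linarith
      filter_upwards [Metric.isClosed_closedBall.isOpen_compl.mem_nhds hx'] with y hy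
      simp only [mem_compl_iff, Metric.mem_closedBall, dist_zero_right, not_le] at hy
      simp [hχdef, hb0 y hy.le]
    rw [(InnerProductSpace.laplacian_congr_nhds h0).eq_of_nhds]; simp
  have hq : LocallyIntegrable fun x => 1 / 2 * (v x * w x) := hvw.smul (1 / 2 : ℝ)
  have hK := integral_mul_smoothTransition_le hw hq h hχs hχc hχ0 B
  -- The weight is supported where `w > B ≥ 0`, so the source is nonnegative there. Kato's
  -- inequality then forces the integral of `softPos B w` over the ball to be nonpositive, hence
  -- zero.
  have hl : 0 ≤ ∫ x, χ x * Real.smoothTransition (w x - B) * (1 / 2 * (v x * w x)) := by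
    refine integral_nonneg fun x => ?_
    rcases le_or_gt (w x) B with hx | hx
    · simp [Real.smoothTransition.zero_of_nonpos (sub_nonpos.2 hx)]
    · have := hv x
      have := hχ0 x
      have := Real.smoothTransition.nonneg (w x - B)
      have : 0 ≤ w x := by linarith
      positivity
  have heq : ∀ x, Δ χ x * softPos B (w x) =
      (Metric.ball (0 : Space d) R).indicator (fun x => -(2 * d * softPos B (w x))) x := fun x => by
    by_cases hx : x ∈ Metric.ball (0 : Space d) R
    · rw [indicator_of_mem hx, hΔin x (by rwa [Metric.mem_ball, dist_zero_right] at hx)]; ring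
    · rw [indicator_of_notMem hx]
      rw [Metric.mem_ball, dist_zero_right, not_lt] at hx
      rcases le_or_gt R' ‖x‖ with h1 | h1
      · rw [hΔout x h1, zero_mul]
      · rw [softPos_of_le (hwB x hx h1), mul_zero]
  simp_rw [heq] at hK
  rw [integral_indicator Metric.isOpen_ball.measurableSet, integral_neg, integral_const_mul] at hK
  have hzero : ∫ x in Metric.ball (0 : Space d) R, softPos B (w x) = 0 := by
    have hp : (0 : ℝ) < d := by exact_mod_cast hd
    have h0 : 0 ≤ ∫ x in Metric.ball (0 : Space d) R, softPos B (w x) :=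
      integral_nonneg fun x => softPos_nonneg _ _
    nlinarith
  have hint : IntegrableOn (fun x => softPos B (w x)) (Metric.ball (0 : Space d) R) := by
    have hwl := locallyIntegrable_softPos hw B
    exact (hwl.integrableOn_isCompact (isCompact_closedBall 0 R)).mono_set
      Metric.ball_subset_closedBall
  have hae := (integral_eq_zero_iff_of_nonneg (fun x => softPos_nonneg _ _) hint).1 hzero
  rw [Filter.EventuallyEq, ae_restrict_iff' Metric.isOpen_ball.measurableSet] at hae
  filter_upwards [hae] with x hx hx'
  rcases le_or_gt R ‖x‖ with h1 | h1
  · exact hwB x h1 hx'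
  · by_contra hcon
    exact (softPos_pos (not_le.1 hcon)).ne' (hx (by rwa [Metric.mem_ball, dist_zero_right]))

end Kato

/-! ### The fundamental solution of the Laplacian -/

section FundamentalSolution

open Laplacian Set Filter Topology

variable {d : ℕ}

/-- The scattering solution outside the support of the potential. -/
noncomputable def farField (d : ℕ) (a : ℝ) (x : Space d) : ℝ :=
  if d = 2 then Real.log (‖x‖ / a) else 1 - a / ‖x‖

/-- The strength of the singularity of `farField`. -/
noncomputable def fluxConst (d : ℕ) (a : ℝ) : ℝ := if d = 2 then 2 * Real.pi else 4 * Real.pi * a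

theorem measurable_farField (d : ℕ) (a : ℝ) : Measurable (farField d a) := by
  unfold farField
  split_ifs <;> fun_prop

theorem memLp_farField (hd : d = 2 ∨ d = 3) {a : ℝ} (ha : 0 < a) (r : ℝ) :
    MemLp (farField d a) 2 (volume.restrict (Metric.ball 0 r)) := by
  rw [memLp_two_iff_integrable_sq (measurable_farField d a).aestronglyMeasurable]
  have hd0 : d ≠ 0 := by omega
  change IntegrableOn _ _ _
  rw [← integrable_indicator_iff Metric.isOpen_ball.measurableSet]
  set f : ℝ → ℝ := (Iio r).indicator
    fun y => (if d = 2 then Real.log (y / a) else 1 - a / y) ^ 2 with hf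
  have hfe : (Metric.ball (0 : Space d) r).indicator (fun x => farField d a x ^ 2) =
      fun x => f ‖x‖ := by
    funext x
    by_cases hx : ‖x‖ < r
    · rw [indicator_of_mem (by rwa [Metric.mem_ball, dist_zero_right]), hf,
        indicator_of_mem (by exact hx)]; rfl
    · rw [indicator_of_notMem (by rwa [Metric.mem_ball, dist_zero_right]), hf,
        indicator_of_notMem (by exact hx)]
  rw [hfe]
  rw [integrable_fun_norm_space hd0]
  -- The radial integrand in a form that is continuous at `0`: for `d = 2` the function `y log² y`
  -- is written through `√y log √y`; for `d = 3` the factor `y²` absorbs the pole.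
  have hcont : Continuous fun y : ℝ => if d = 2 then
      4 * (Real.sqrt y * Real.log (Real.sqrt y)) ^ 2 - 4 * Real.sqrt y * (Real.sqrt y * Real.log (Real.sqrt y)) * Real.log a +
        y * Real.log a ^ 2 else (y - a) ^ 2 := by
    split_ifs
    · have := Real.continuous_mul_log.comp Real.continuous_sqrt
      simp only [Function.comp_def] at this
      fun_prop
    · fun_prop
  have h1 := ((hcont.integrableOn_Icc (a := 0) (b := r)).mono_set Ioo_subset_Icc_self :
    IntegrableOn _ (Ioo 0 r) volume)
  have h2 : IntegrableOn (fun y => y ^ (d - 1) * f y) (Ioo 0 r) := by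
    refine h1.congr_fun (fun y hy => ?_) measurableSet_Ioo
    have hy0 : 0 < y := hy.1
    simp only [hf]
    rw [indicator_of_mem (by exact hy.2)]
    rcases hd with rfl | rfl
    · rw [if_pos rfl, if_pos rfl, Real.log_div hy0.ne' ha.ne', Real.log_sqrt hy0.le]
      have := Real.sq_sqrt hy0.le
      linear_combination (Real.log y ^ 2 - 2 * Real.log y * Real.log a) * this
    · rw [if_neg (by norm_num), if_neg (by norm_num)]
      field_simp
      try ring
  have h3 : IntegrableOn (fun y => y ^ (d - 1) * f y) (Ici r) := by
    refine integrableOn_zero.congr_fun (fun y hy => ?_) measurableSet_Ici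
    simp only [hf]
    rw [indicator_of_notMem (by simpa using hy)]; simp
  exact (h2.union h3).mono_set fun y hy => by
    rcases lt_or_ge y r with h | h
    · exact Or.inl ⟨hy, h⟩
    · exact Or.inr h

theorem locallyIntegrable_farField (hd : d = 2 ∨ d = 3) {a : ℝ} (ha : 0 < a) :
    LocallyIntegrable (farField d a) := fun x => by
  refine ⟨Metric.ball 0 (‖x‖ + 1), Metric.isOpen_ball.mem_nhds (by simp), ?_⟩
  have : IsFiniteMeasure (volume.restrict (Metric.ball (0 : Space d) (‖x‖ + 1))) :=
    ⟨by rw [Measure.restrict_apply_univ]; exact measure_ball_lt_top⟩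
  exact (memLp_farField hd ha _).integrable (by norm_num)

/-- A smooth regularization of `farField`. -/
noncomputable def farReg (d : ℕ) (a c : ℝ) (x : Space d) : ℝ :=
  if d = 2 then 1 / 2 * Real.log (‖x‖ ^ 2 + c⁻¹ ^ 2) - Real.log a
  else 1 - a * (Real.sqrt (‖x‖ ^ 2 + c⁻¹ ^ 2))⁻¹

/-- The Laplacian of the regularized fundamental solution. -/
noncomputable def peak (d : ℕ) (y : ℝ) : ℝ :=
  if d = 2 then Real.pi⁻¹ * ((y ^ 2 + 1) ^ 2)⁻¹
  else 3 / (4 * Real.pi) * (Real.sqrt (y ^ 2 + 1))⁻¹ ^ 5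

theorem contDiff_farReg (d : ℕ) (a : ℝ) {c : ℝ} (hc : 0 < c) : ContDiff ℝ ∞ (farReg d a c) := by
  have hpos : ∀ x : Space d, 0 < ‖x‖ ^ 2 + c⁻¹ ^ 2 := fun x => by positivity
  have h1 : ContDiff ℝ ∞ fun x : Space d => ‖x‖ ^ 2 + c⁻¹ ^ 2 :=
    (contDiff_norm_sq ℝ).add contDiff_const
  unfold farReg
  split_ifs
  · exact (contDiff_const.mul (h1.log fun x => (hpos x).ne')).sub contDiff_const
  · exact contDiff_const.sub (contDiff_const.mul ((h1.sqrt fun x => (hpos x).ne').inv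
      fun x => (Real.sqrt_pos.2 (hpos x)).ne'))

/-- Replacing `|x|` by `√(|x|² + c⁻²)` turns the point source into a rescaled profile of unit mass,
an approximate identity as `c` grows. -/
theorem laplacian_farReg (hd : d = 2 ∨ d = 3) (a : ℝ) {c : ℝ} (hc : 0 < c) (x : Space d) :
    Δ (farReg d a c) x = fluxConst d a * (c ^ d * peak d (c * ‖x‖)) := by
  have hs := (contDiff_farReg d a hc).of_le (m := 2) (by norm_cast)
  have hpos : ∀ s : ℝ, 0 ≤ s → 0 < s + c⁻¹ ^ 2 := fun s hs => by positivity
  have hadd : ∀ s : ℝ, HasDerivAt (fun s : ℝ => s + c⁻¹ ^ 2) 1 s := fun s =>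
    (hasDerivAt_id s).add_const _
  have hx := hpos (‖x‖ ^ 2) (by positivity)
  rcases hd with rfl | rfl
  · have e : farReg 2 a c = fun x => (fun s => 1 / 2 * Real.log (s + c⁻¹ ^ 2) - Real.log a) (‖x‖ ^ 2) := by
      funext x; simp [farReg]
    rw [e] at hs ⊢
    have d1 : ∀ s : ℝ, 0 ≤ s → HasDerivAt (fun s => 1 / 2 * Real.log (s + c⁻¹ ^ 2) - Real.log a)
        (1 / 2 * (s + c⁻¹ ^ 2)⁻¹) s := fun s h => by
      convert! (((hadd s).log (hpos s h).ne').const_mul (1 / 2)).sub_const (Real.log a) using 1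
      simp
    have d2 : HasDerivAt (fun s : ℝ => 1 / 2 * (s + c⁻¹ ^ 2)⁻¹)
        (1 / 2 * (-1 / (‖x‖ ^ 2 + c⁻¹ ^ 2) ^ 2)) (‖x‖ ^ 2) :=
      ((hadd _).fun_inv hx.ne').const_mul (1 / 2)
    rw [laplacian_radial hs d1 x d2]
    simp only [fluxConst, peak, if_true]
    have h2 : (c * ‖x‖) ^ 2 + 1 = c ^ 2 * (‖x‖ ^ 2 + c⁻¹ ^ 2) := by field_simp
    rw [h2]
    have hp := Real.pi_ne_zero
    have e3 : (c : ℝ) * c⁻¹ = 1 := mul_inv_cancel₀ hc.ne'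
    have e4 : c ^ 2 * c⁻¹ ^ 2 = 1 := by rw [← mul_pow, e3, one_pow]
    set u := c⁻¹
    clear_value u
    set A := ‖x‖ ^ 2 + u ^ 2 with hA
    have hxx : ‖x‖ ^ 2 = A - u ^ 2 := by rw [hA]; ring
    rw [hxx]
    push_cast
    clear_value A
    field_simp
    linear_combination (4 : ℝ) * e4
  · have e : farReg 3 a c = fun x => (fun s => 1 - a * (Real.sqrt (s + c⁻¹ ^ 2))⁻¹) (‖x‖ ^ 2) := by
      funext x; simp [farReg]
    rw [e] at hs ⊢
    have d0 : ∀ s : ℝ, 0 ≤ s → HasDerivAt (fun s => Real.sqrt (s + c⁻¹ ^ 2))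
        (1 / (2 * Real.sqrt (s + c⁻¹ ^ 2))) s := fun s h => (hadd s).sqrt (hpos s h).ne'
    have d1 : ∀ s : ℝ, 0 ≤ s → HasDerivAt (fun s => 1 - a * (Real.sqrt (s + c⁻¹ ^ 2))⁻¹)
        (a / 2 * (Real.sqrt (s + c⁻¹ ^ 2) ^ 3)⁻¹) s := fun s h => by
      have hsq := Real.sqrt_pos.2 (hpos s h)
      convert! (((d0 s h).fun_inv hsq.ne').const_mul a).const_sub 1 using 1
      field_simp
    have hsq := Real.sqrt_pos.2 hx
    have d2 : ∀ s : ℝ, 0 ≤ s → HasDerivAt (fun s : ℝ => a / 2 * (Real.sqrt (s + c⁻¹ ^ 2) ^ 3)⁻¹)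
        (-(3 * a / 4) * (Real.sqrt (s + c⁻¹ ^ 2) ^ 5)⁻¹) s := fun s h => by
      have hsq := Real.sqrt_pos.2 (hpos s h)
      convert! (((d0 s h).fun_pow 3).fun_inv (pow_pos hsq 3).ne').const_mul (a / 2) using 1
      set A := Real.sqrt (s + c⁻¹ ^ 2)
      clear_value A
      field_simp
      norm_num
      ring
    rw [laplacian_radial hs d1 x (d2 _ (by positivity))]
    simp only [fluxConst, peak, show (3 : ℕ) ≠ 2 by norm_num, if_false]
    have h2 : (c * ‖x‖) ^ 2 + 1 = c ^ 2 * (‖x‖ ^ 2 + c⁻¹ ^ 2) := by field_simp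
    rw [h2, Real.sqrt_mul (by positivity), Real.sqrt_sq hc.le]
    have hp := Real.pi_ne_zero
    have e3 : (c : ℝ) * c⁻¹ = 1 := mul_inv_cancel₀ hc.ne'
    have hA := Real.sq_sqrt hx.le
    have e4 : c ^ 2 * c⁻¹ ^ 2 = 1 := by rw [← mul_pow, e3, one_pow]
    set u := c⁻¹
    clear_value u
    set A := Real.sqrt (‖x‖ ^ 2 + u ^ 2)
    clear_value A
    have hxx : ‖x‖ ^ 2 = A ^ 2 - u ^ 2 := by rw [hA]; ring
    rw [hxx]
    push_cast
    field_simp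
    linear_combination a * e4

theorem peak_nonneg (d : ℕ) (y : ℝ) : 0 ≤ peak d y := by
  have := Real.pi_pos
  unfold peak
  split_ifs <;> positivity

theorem integral_peak (hd : d = 2 ∨ d = 3) : ∫ x : Space d, peak d ‖x‖ = 1 := by
  have hp := Real.pi_pos
  rw [integral_fun_norm_space (by omega)]
  rcases hd with rfl | rfl
  · rw [volume_real_unit_ball_two, integral_Ioi_of_hasDerivAt_of_nonneg'
      (g := fun y => -(2 * Real.pi * (y ^ 2 + 1))⁻¹) (l := -0) (a := 0)]
    · norm_num; field_simp
    · intro y _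
      have h1 : HasDerivAt (fun y : ℝ => 2 * Real.pi * (y ^ 2 + 1)) (2 * Real.pi * (2 * y)) y := by
        simpa using (((hasDerivAt_id y).fun_pow 2).add_const 1).const_mul (2 * Real.pi)
      convert! (h1.fun_inv (by positivity)).fun_neg using 1
      simp only [peak, if_true]
      field_simp
      try ring
    · intro y hy
      exact mul_nonneg (pow_nonneg (le_of_lt hy) _) (peak_nonneg _ _)
    · refine Tendsto.neg (Tendsto.inv_tendsto_atTop ?_)
      exact Tendsto.const_mul_atTop (by positivity)
        (tendsto_atTop_add_const_right _ _ (tendsto_pow_atTop two_ne_zero))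
  · rw [volume_real_unit_ball_three, integral_Ioi_of_hasDerivAt_of_nonneg'
      (g := fun y => (4 * Real.pi)⁻¹ * (y / Real.sqrt (y ^ 2 + 1)) ^ 3) (l := (4 * Real.pi)⁻¹ * 1 ^ 3) (a := 0)]
    · norm_num; field_simp
    · intro y _
      have hpos : 0 < y ^ 2 + 1 := by positivity
      have h1 : HasDerivAt (fun y : ℝ => y ^ 2 + 1) (2 * y) y := by
        simpa using ((hasDerivAt_id y).fun_pow 2).add_const 1
      have h2 := h1.sqrt hpos.ne'
      have hs := Real.sqrt_pos.2 hpos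
      have h3 := ((((hasDerivAt_id y).fun_div h2 hs.ne').fun_pow 3).const_mul (4 * Real.pi)⁻¹)
      convert! h3 using 1
      simp only [peak, id]
      have hA := Real.sq_sqrt hpos.le
      set A := Real.sqrt (y ^ 2 + 1)
      norm_num
      field_simp
      have : y ^ 2 = A ^ 2 - 1 := by linarith
      try rw [this]
      try ring
    · intro y hy
      exact mul_nonneg (pow_nonneg (le_of_lt hy) _) (peak_nonneg _ _)
    · refine Tendsto.const_mul _ (Tendsto.pow ?_ 3)
      have h1 : Tendsto (fun y : ℝ => Real.sqrt (1 - (y ^ 2 + 1)⁻¹)) atTop (𝓝 1) := by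
        have : Tendsto (fun y : ℝ => 1 - (y ^ 2 + 1)⁻¹) atTop (𝓝 (1 - 0)) :=
          tendsto_const_nhds.sub (Tendsto.inv_tendsto_atTop
            (tendsto_atTop_add_const_right _ _ (tendsto_pow_atTop two_ne_zero)))
        simpa using this.sqrt
      refine h1.congr' ?_
      filter_upwards [eventually_gt_atTop 0] with y hy
      have hpos : 0 < y ^ 2 + 1 := by positivity
      rw [show 1 - (y ^ 2 + 1)⁻¹ = y ^ 2 / (y ^ 2 + 1) by field_simp; ring, Real.sqrt_div (sq_nonneg _),
        Real.sqrt_sq hy.le]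

theorem tendsto_pow_mul_peak (hd : d = 2 ∨ d = 3) :
    Tendsto (fun x : Space d => ‖x‖ ^ d * peak d ‖x‖) (Bornology.cobounded _) (𝓝 0) := by
  have hp := Real.pi_pos
  suffices h : Tendsto (fun y : ℝ => y ^ d * peak d y) atTop (𝓝 0) from
    h.comp tendsto_norm_cobounded_atTop
  refine squeeze_zero' ?_ ?_ (tendsto_inv_atTop_zero)
  · filter_upwards [eventually_gt_atTop 0] with y hy
    exact mul_nonneg (by positivity) (peak_nonneg _ _)
  · filter_upwards [eventually_ge_atTop 1] with y hy
    have hy0 : 0 < y := by linarith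
    have hp1 : Real.pi⁻¹ ≤ 1 := inv_le_one_of_one_le₀ (by linarith [Real.pi_gt_three])
    rcases hd with rfl | rfl
    · simp only [peak, if_true]
      rw [show y ^ 2 * (Real.pi⁻¹ * ((y ^ 2 + 1) ^ 2)⁻¹) = Real.pi⁻¹ * (y ^ 2 * ((y ^ 2 + 1) ^ 2)⁻¹) by ring]
      refine (mul_le_of_le_one_left (by positivity) hp1).trans ?_
      rw [← div_eq_mul_inv, div_le_iff₀ (by positivity), inv_mul_eq_div, le_div_iff₀ hy0]
      nlinarith [sq_nonneg (y ^ 2 - y), sq_nonneg y, pow_pos hy0 3]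
    · simp only [peak]
      norm_num
      have h1 : y ≤ Real.sqrt (y ^ 2 + 1) := Real.le_sqrt_of_sq_le (by linarith)
      have h2 : (Real.sqrt (y ^ 2 + 1) ^ 5)⁻¹ ≤ (y ^ 5)⁻¹ :=
        inv_anti₀ (by positivity) (pow_le_pow_left₀ hy0.le h1 5)
      have h3 : 3 / (4 * Real.pi) ≤ 1 := by
        rw [div_le_one (by positivity)]; linarith [Real.pi_gt_three]
      calc y ^ 3 * (3 / (4 * Real.pi) * (Real.sqrt (y ^ 2 + 1) ^ 5)⁻¹)
          ≤ y ^ 3 * (1 * (y ^ 5)⁻¹) := by gcongr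
        _ = y⁻¹ * y⁻¹ := by field_simp
        _ ≤ y⁻¹ * 1 := by gcongr; exact inv_le_one_of_one_le₀ hy
        _ = y⁻¹ := mul_one _

/-- The regularization is monotone in `c`, so the limit and the value at `c = 1` dominate everything
in between. -/
theorem farField_le_farReg (hd : d = 2 ∨ d = 3) {a c : ℝ} (ha : 0 < a) (hc : 1 ≤ c) {x : Space d}
    (hx : x ≠ 0) : farField d a x ≤ farReg d a c x ∧ farReg d a c x ≤ farReg d a 1 x := by
  have hn : 0 < ‖x‖ := norm_pos_iff.2 hx
  have hc0 : 0 < c := by linarith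
  have hc1 : c⁻¹ ^ 2 ≤ (1 : ℝ)⁻¹ ^ 2 := by gcongr
  rcases hd with rfl | rfl
  · simp only [farField, farReg, if_true]
    constructor
    · rw [Real.log_div hn.ne' ha.ne']
      have := Real.log_le_log (by positivity) (show ‖x‖ ^ 2 ≤ ‖x‖ ^ 2 + c⁻¹ ^ 2 by
        linarith [sq_nonneg c⁻¹])
      rw [Real.log_pow] at this
      push_cast at this
      linarith
    · have := Real.log_le_log (by positivity) (show ‖x‖ ^ 2 + c⁻¹ ^ 2 ≤ ‖x‖ ^ 2 + (1 : ℝ)⁻¹ ^ 2 by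
        linarith)
      linarith
  · simp only [farField, farReg, show (3 : ℕ) ≠ 2 by norm_num, if_false]
    constructor
    · rw [div_eq_mul_inv]
      have h1 : ‖x‖ ≤ Real.sqrt (‖x‖ ^ 2 + c⁻¹ ^ 2) :=
        Real.le_sqrt_of_sq_le (by linarith [sq_nonneg c⁻¹])
      have := inv_anti₀ hn h1
      nlinarith
    · have h1 : Real.sqrt (‖x‖ ^ 2 + c⁻¹ ^ 2) ≤ Real.sqrt (‖x‖ ^ 2 + (1 : ℝ)⁻¹ ^ 2) :=
        Real.sqrt_le_sqrt (by linarith)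
      have := inv_anti₀ (Real.sqrt_pos.2 (by positivity)) h1
      nlinarith

theorem tendsto_farReg (hd : d = 2 ∨ d = 3) {a : ℝ} (ha : 0 < a) {x : Space d} (hx : x ≠ 0) :
    Tendsto (fun c => farReg d a c x) atTop (𝓝 (farField d a x)) := by
  have hn : 0 < ‖x‖ := norm_pos_iff.2 hx
  have h1 : Tendsto (fun c : ℝ => ‖x‖ ^ 2 + c⁻¹ ^ 2) atTop (𝓝 (‖x‖ ^ 2)) := by
    simpa using (tendsto_inv_atTop_zero (𝕜 := ℝ)).pow 2 |>.const_add (‖x‖ ^ 2)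
  rcases hd with rfl | rfl
  · simp only [farField, farReg, if_true]
    have := ((h1.log (by positivity)).const_mul (1 / 2)).sub_const (Real.log a)
    convert this using 2
    rw [Real.log_div hn.ne' ha.ne', Real.log_pow]; push_cast; ring
  · simp only [farField, farReg, show (3 : ℕ) ≠ 2 by norm_num, if_false]
    have := ((h1.sqrt.inv₀ (by rw [Real.sqrt_sq hn.le]; exact hn.ne')).const_mul a).const_sub 1
    rw [Real.sqrt_sq hn.le] at this
    exact this

theorem ae_ne_zero (hd : d ≠ 0) : ∀ᵐ x : Space d, x ≠ 0 := by
  have : Nonempty (Fin d) := ⟨⟨0, by omega⟩⟩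
  have : Nontrivial (Space d) := inferInstance
  rw [ae_iff]; simp

/-- `farField` is a multiple of the fundamental solution of the Laplacian, up to a constant. -/
theorem integral_farField_mul_laplacian (hd : d = 2 ∨ d = 3) {a : ℝ} (ha : 0 < a) {η : Space d → ℝ}
    (hη : ContDiff ℝ ∞ η) (hc : HasCompactSupport η) :
    ∫ x, farField d a x * Δ η x = fluxConst d a * η 0 := by
  have h2 : ContDiff ℝ 2 η := hη.of_le (by norm_cast)
  have hΔ := continuous_laplacian h2
  have hΔc := hasCompactSupport_laplacian hc
  have hdim : Module.finrank ℝ (Space d) = d := by simp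
  have hne := ae_ne_zero (show d ≠ 0 by omega)
  have hlim1 : Tendsto (fun c => ∫ x, farReg d a c x * Δ η x) atTop
      (𝓝 (∫ x, farField d a x * Δ η x)) := by
    refine tendsto_integral_filter_of_dominated_convergence
      (fun x => |farField d a x * Δ η x| + |farReg d a 1 x * Δ η x|) ?_ ?_ ?_ ?_
    · filter_upwards [eventually_gt_atTop 0] with c hc'
      exact ((contDiff_farReg d a hc').continuous.mul hΔ).aestronglyMeasurable
    · filter_upwards [eventually_ge_atTop 1] with c hc'
      filter_upwards [hne] with x hx
      obtain ⟨l1, l2⟩ := farField_le_farReg hd ha hc' hx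
      rw [norm_mul, abs_mul, abs_mul, ← add_mul]
      refine mul_le_mul_of_nonneg_right ?_ (abs_nonneg _)
      rw [Real.norm_eq_abs, abs_le]
      constructor
      · linarith [neg_abs_le (farField d a x), abs_nonneg (farReg d a 1 x)]
      · linarith [le_abs_self (farReg d a 1 x), abs_nonneg (farField d a x)]
    · refine Integrable.add ?_ ?_
      · have := (locallyIntegrable_farField hd ha).integrable_smul_left_of_hasCompactSupport hΔ hΔc
        exact (this.congr (Eventually.of_forall fun x => by simp [mul_comm])).abs
      · exact (((contDiff_farReg d a one_pos).continuous.mul hΔ).integrable_of_hasCompactSupport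
          hΔc.mul_left).abs
    · filter_upwards [hne] with x hx
      exact (tendsto_farReg hd ha hx).mul_const _
  have hlim2 := tendsto_integral_comp_smul_smul_of_integrable (μ := (volume : Measure (Space d)))
    (φ := fun x => peak d ‖x‖) (fun x => peak_nonneg d _) (integral_peak hd)
    (by rw [hdim]; exact tendsto_pow_mul_peak hd)
    (hη.continuous.integrable_of_hasCompactSupport hc) hη.continuous.continuousAt
  refine tendsto_nhds_unique hlim1 ((hlim2.const_mul (fluxConst d a)).congr' ?_)
  filter_upwards [eventually_gt_atTop 0] with c hc'
  rw [integral_mul_laplacian_eq ((contDiff_farReg d a hc').of_le (by norm_cast)) h2 hc,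
    ← integral_const_mul]
  refine integral_congr_ae (Eventually.of_forall fun x => ?_)
  simp only
  rw [laplacian_farReg hd a hc', hdim, norm_smul, Real.norm_eq_abs, abs_of_pos hc', smul_eq_mul]
  ring

end FundamentalSolution

/-! ### Properties of the scattering solution -/

section Scattering

open Laplacian Set Filter Topology

variable {d : ℕ} {v φ₀ : Space d → ℝ} {R a : ℝ}

theorem fluxConst_pos (d : ℕ) {a : ℝ} (ha : 0 < a) : 0 < fluxConst d a := by
  have := Real.pi_pos
  unfold fluxConst
  split_ifs <;> positivity

theorem farField_nonneg (d : ℕ) {a : ℝ} (ha : 0 < a) {x : Space d} (hx : a ≤ ‖x‖) :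
    0 ≤ farField d a x := by
  have hn : 0 < ‖x‖ := ha.trans_le hx
  unfold farField
  split_ifs
  · exact Real.log_nonneg ((one_le_div ha).2 hx)
  · exact sub_nonneg.2 ((div_le_one hn).2 hx)

theorem farField_nonpos (d : ℕ) {a : ℝ} (ha : 0 < a) {x : Space d} (h0 : 0 < ‖x‖) (hx : ‖x‖ ≤ a) :
    farField d a x ≤ 0 := by
  unfold farField
  split_ifs
  · exact Real.log_nonpos (by positivity) ((div_le_one ha).2 hx)
  · exact sub_nonpos.2 ((one_le_div h0).2 hx)

theorem farField_le (d : ℕ) {a r : ℝ} (ha : 0 < a) {x : Space d} (h0 : 0 < ‖x‖) (hx : ‖x‖ ≤ r) :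
    farField d a x ≤ |Real.log (r / a)| + 1 := by
  unfold farField
  split_ifs
  · have := Real.log_le_log (by positivity) (div_le_div_of_nonneg_right hx ha.le)
    linarith [le_abs_self (Real.log (r / a))]
  · have : 0 ≤ a / ‖x‖ := by positivity
    linarith [abs_nonneg (Real.log (r / a))]

theorem IsPotential.eq_zero (hv : IsPotential v R) {x : Space d} (hx : R < ‖x‖) : v x = 0 := by
  by_contra h
  have := hv.2.2.2.2 h
  rw [Metric.mem_closedBall, dist_zero_right] at this
  linarith

theorem IsScatteringSolution.locallyIntegrable (hs : IsScatteringSolution v R a φ₀) :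
    LocallyIntegrable φ₀ := by
  obtain ⟨⟨G, hG, -⟩, -⟩ := hs
  exact hG.1

theorem IsScatteringSolution.memLp (hs : IsScatteringSolution v R a φ₀) (r : ℝ) :
    MemLp φ₀ 2 (volume.restrict (Metric.ball (0 : Space d) r)) := by
  obtain ⟨⟨G, -, h⟩, -⟩ := hs
  exact (h r).1

theorem IsScatteringSolution.eq_farField (hs : IsScatteringSolution v R a φ₀) {x : Space d}
    (hx : R ≤ ‖x‖) : φ₀ x = farField d a x := hs.2.2 x hx

theorem integrable_mul_of_memLp_ball (hR : 0 < R) {q f : Space d → ℝ} (hq : MemLp q 2 volume)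
    (hsupp : ∀ x, R < ‖x‖ → q x = 0)
    (hf : MemLp f 2 (volume.restrict (Metric.ball (0 : Space d) (2 * R)))) :
    Integrable fun x => q x * f x := by
  have h1 : MemLp ((Metric.ball (0 : Space d) (2 * R)).indicator f) 2 volume :=
    (memLp_indicator_iff_restrict Metric.isOpen_ball.measurableSet).2 hf
  refine (hq.integrable_mul h1).congr (Eventually.of_forall fun x => ?_)
  simp only [Pi.mul_apply]
  by_cases hx : x ∈ Metric.ball (0 : Space d) (2 * R)
  · rw [indicator_of_mem hx]
  · rw [Metric.mem_ball, dist_zero_right, not_lt] at hx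
    rw [hsupp x (by linarith), zero_mul, zero_mul]

theorem IsScatteringSolution.integrable (hv : IsPotential v R)
    (hs : IsScatteringSolution v R a φ₀) : Integrable fun x => v x * φ₀ x :=
  integrable_mul_of_memLp_ball hv.1 hv.2.2.2.1 (fun _ hx => hv.eq_zero hx) (hs.memLp _)

theorem IsScatteringSolution.weak (hs : IsScatteringSolution v R a φ₀) {η : Space d → ℝ}
    (hη : ContDiff ℝ ∞ η) (hc : HasCompactSupport η) :
    ∫ x, φ₀ x * Δ η x = ∫ x, 1 / 2 * (v x * φ₀ x) * η x := by
  have := hs.2.1 η hη hc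
  simp_rw [mul_assoc (1 / 2 : ℝ)]
  rw [integral_const_mul]
  linarith

/-- Smooth cut-offs. -/
theorem exists_cutoff (d : ℕ) {R : ℝ} (hR : 0 < R) : ∃ b : Space d → ℝ, ContDiff ℝ ∞ b ∧
    HasCompactSupport b ∧ ∀ x, ‖x‖ ≤ R → b x = 1 :=
  let b : ContDiffBump (0 : Space d) := ⟨R, 2 * R, hR, by linarith⟩
  ⟨b, b.contDiff, b.hasCompactSupport, fun x hx =>
    b.one_of_mem_closedBall (by simpa [b] using hx)⟩

theorem laplacian_eq_of_eqOn_ball {f g : Space d → ℝ} {r : ℝ} (h : ∀ x, ‖x‖ ≤ r → f x = g x)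
    {x : Space d} (hx : ‖x‖ < r) : Δ f x = Δ g x := by
  have h0 : f =ᶠ[𝓝 x] g := by
    filter_upwards [Metric.isOpen_ball.mem_nhds (show x ∈ Metric.ball 0 r by
      rwa [Metric.mem_ball, dist_zero_right])] with y hy
    rw [Metric.mem_ball, dist_zero_right] at hy
    exact h y hy.le
  exact (InnerProductSpace.laplacian_congr_nhds h0).eq_of_nhds

/-- The total flux of the scattering solution. -/
theorem IsScatteringSolution.integral_eq (hd : d = 2 ∨ d = 3) (hv : IsPotential v R) (ha : 0 < a)
    (hs : IsScatteringSolution v R a φ₀) : ∫ x, v x * φ₀ x = 2 * fluxConst d a := by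
  obtain ⟨b, hb, hbc, hb1⟩ := exists_cutoff d hv.1
  have h1 := hs.weak hb hbc
  -- The cut-off is constant on the ball where `φ₀` may differ from its far field, so its Laplacian
  -- vanishes there and the flux is read off from the fundamental solution.
  have h2 : ∫ x, φ₀ x * Δ b x = ∫ x, farField d a x * Δ b x := by
    refine integral_congr_ae (Eventually.of_forall fun x => ?_)
    simp only
    rcases lt_or_ge ‖x‖ R with hx | hx
    · rw [laplacian_eq_of_eqOn_ball (g := fun _ => 1) hb1 hx]
      simp
    · rw [hs.eq_farField hx]
  have h3 : ∫ x, 1 / 2 * (v x * φ₀ x) * b x = 1 / 2 * ∫ x, v x * φ₀ x := by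
    rw [← integral_const_mul]
    refine integral_congr_ae (Eventually.of_forall fun x => ?_)
    simp only
    rcases le_or_gt ‖x‖ R with hx | hx
    · rw [hb1 x hx, mul_one]
    · rw [hv.eq_zero hx]; simp
  rw [h2, integral_farField_mul_laplacian hd ha hb hbc, hb1 0 (by simpa using hv.1.le), h3] at h1
  linarith

/-- If `R < a`, the far field is nonpositive for `R ≤ |x| < a`; the maximum principle makes `φ₀`
nonpositive on the support of `v`, against the positive total flux. -/
theorem IsScatteringSolution.scatteringLength_le (hd : d = 2 ∨ d = 3) (hv : IsPotential v R)
    (ha : 0 < a) (hs : IsScatteringSolution v R a φ₀) : a ≤ R := by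
  by_contra hcon
  rw [not_le] at hcon
  have h1 := ae_le_of_weak_solution (by omega) hv.1 hcon hv.2.1 hs.locallyIntegrable
    (hs.integrable hv).locallyIntegrable (fun η hη hc => hs.weak hη hc) le_rfl
    (fun x hx hx' => by
      rw [hs.eq_farField hx]; exact farField_nonpos d ha (hv.1.trans_le hx) hx'.le)
  have h2 : ∫ x, v x * φ₀ x ≤ 0 := by
    refine integral_nonpos_of_ae ?_
    filter_upwards [h1] with x hx
    rcases le_or_gt ‖x‖ R with h | h
    · exact mul_nonpos_of_nonneg_of_nonpos (hv.2.1 x) (hx (by linarith))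
    · simp [hv.eq_zero h]
  rw [hs.integral_eq hd hv ha] at h2
  linarith [fluxConst_pos d ha]

/-- As `a ≤ R`, the far field is nonnegative outside the ball, and the maximum principle applies to
`-φ₀`. -/
theorem IsScatteringSolution.nonneg (hd : d = 2 ∨ d = 3) (hv : IsPotential v R)
    (ha : 0 < a) (hs : IsScatteringSolution v R a φ₀) : ∀ᵐ x, 0 ≤ φ₀ x := by
  have haR := hs.scatteringLength_le hd hv ha
  have h1 := ae_le_of_weak_solution (w := fun x => -φ₀ x) (B := 0) (R' := 2 * R) (by omega) hv.1
    (by linarith [hv.1]) hv.2.1 hs.locallyIntegrable.neg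
    (((hs.integrable hv).neg.congr (Eventually.of_forall fun x =>
      (mul_neg (v x) (φ₀ x)).symm)).locallyIntegrable) (fun η hη hc => by
      have := hs.weak hη hc
      simp only [neg_mul, mul_neg, integral_neg]
      rw [this]) le_rfl
    (fun x hx hx' => by
      rw [hs.eq_farField hx]
      linarith [farField_nonneg d ha (haR.trans hx)])
  filter_upwards [h1] with x hx
  rcases lt_or_ge ‖x‖ (2 * R) with h | h
  · linarith [hx h]
  · have hR : R ≤ ‖x‖ := by linarith [hv.1]
    rw [hs.eq_farField hR]; exact farField_nonneg d ha (haR.trans hR)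

/-- This local bound is what puts the source `v φ₀` in `L²`; from `H¹` alone only integrability of
the product is available here. -/
theorem IsScatteringSolution.le (hd : d = 2 ∨ d = 3) (hv : IsPotential v R)
    (ha : 0 < a) (hs : IsScatteringSolution v R a φ₀) :
    ∀ᵐ x, ‖x‖ < 2 * R → φ₀ x ≤ |Real.log (2 * R / a)| + 1 :=
  ae_le_of_weak_solution (by omega) hv.1 (by linarith [hv.1]) hv.2.1 hs.locallyIntegrable
    (hs.integrable hv).locallyIntegrable (fun η hη hc => hs.weak hη hc) (by positivity)
    (fun x hx hx' => by
      rw [hs.eq_farField hx]; exact farField_le d ha (hv.1.trans_le hx) hx'.le)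

/-- The difference of `φ₀` and its reflection solves the same equation and vanishes outside the
support of `v`, so it is nonpositive; reflecting once more gives equality. Only this much symmetry
is used for the Fourier coefficients. -/
theorem IsScatteringSolution.even (hd : d = 2 ∨ d = 3) (hv : IsPotential v R)
    (hs : IsScatteringSolution v R a φ₀) : ∀ᵐ x, φ₀ (-x) = φ₀ x := by
  have hve : ∀ x, v (-x) = v x := fun x => hv.2.2.1 _ _ (norm_neg x)
  have hmp : MeasurePreserving (fun x : Space d => -x) volume volume :=
    Measure.measurePreserving_neg volume
  have hln : LocallyIntegrable fun x => φ₀ (-x) := by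
    rw [locallyIntegrable_iff]
    intro K hK
    have h1 := hs.locallyIntegrable.integrableOn_isCompact hK.neg
    have := (hmp.integrableOn_comp_preimage
      (MeasurableEquiv.neg (Space d)).measurableEmbedding (f := φ₀) (s := -K)).2 h1
    simpa [Function.comp_def] using this
  have hin : Integrable fun x => v x * φ₀ (-x) := by
    have := (hs.integrable hv).comp_neg
    simpa [hve] using this
  have hweak : ∀ η : Space d → ℝ, ContDiff ℝ ∞ η → HasCompactSupport η →
      ∫ x, φ₀ (-x) * Δ η x = ∫ x, 1 / 2 * (v x * φ₀ (-x)) * η x := fun η hη hc => by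
    have h1 := hs.weak (η := fun x => η (0 - x)) (hη.comp (by fun_prop))
      (hc.comp_homeomorph (Homeomorph.subLeft 0))
    simp_rw [laplacian_comp_sub (hη.of_le (m := 2) (by norm_cast)), zero_sub] at h1
    rw [← integral_neg_eq_self, ← integral_neg_eq_self (fun x => 1 / 2 * (v x * φ₀ (-x)) * η x)]
    simpa [hve] using h1
  have h1 := ae_le_of_weak_solution (w := fun x => φ₀ x - φ₀ (-x)) (B := 0) (R' := 2 * R)
    (by omega) hv.1 (by linarith [hv.1]) hv.2.1 (hs.locallyIntegrable.sub hln)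
    ((((hs.integrable hv).sub hin).congr (Eventually.of_forall fun x =>
      (mul_sub (v x) (φ₀ x) (φ₀ (-x))).symm)).locallyIntegrable)
    (fun η hη hc => by
      have e1 := hs.weak hη hc
      have e2 := hweak η hη hc
      have h2 : ContDiff ℝ 2 η := hη.of_le (by norm_cast)
      have hΔ := continuous_laplacian h2
      have hΔc := hasCompactSupport_laplacian hc
      have i1 : ∀ {f : Space d → ℝ}, LocallyIntegrable f → Integrable fun x => f x * Δ η x :=
        fun hf => (hf.integrable_smul_left_of_hasCompactSupport hΔ hΔc).congr
          (Eventually.of_forall fun x => by simp [mul_comm])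
      have i2 : ∀ {f : Space d → ℝ}, LocallyIntegrable f → Integrable fun x => 1 / 2 * f x * η x :=
        fun {f} hf => ((hf.integrable_smul_left_of_hasCompactSupport hη.continuous hc).const_mul
          (1 / 2)).congr (Eventually.of_forall fun x => by
            change 1 / 2 * (η x * f x) = 1 / 2 * f x * η x; ring)
      simp_rw [mul_sub, sub_mul]
      rw [integral_sub (i1 hs.locallyIntegrable) (i1 hln), e1, e2, integral_sub
        (i2 (hs.integrable hv).locallyIntegrable) (i2 hin.locallyIntegrable)]) le_rfl
    (fun x hx hx' => by
      rw [hs.eq_farField hx, hs.eq_farField (by rwa [norm_neg])]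
      simp [farField])
  have h2 : ∀ᵐ x, φ₀ x - φ₀ (-x) ≤ 0 := by
    filter_upwards [h1] with x hx
    rcases lt_or_ge ‖x‖ (2 * R) with h | h
    · exact hx h
    · have hR : R ≤ ‖x‖ := by linarith [hv.1]
      rw [hs.eq_farField hR, hs.eq_farField (by rwa [norm_neg])]
      simp [farField]
  filter_upwards [h2, hmp.quasiMeasurePreserving.ae h2] with x hx hx'
  rw [neg_neg] at hx'
  linarith

theorem IsScatteringSolution.memLp_source (hd : d = 2 ∨ d = 3) (hv : IsPotential v R)
    (ha : 0 < a) (hs : IsScatteringSolution v R a φ₀) : MemLp (fun x => v x * φ₀ x) 2 volume := by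
  refine (hv.2.2.2.1.const_mul (|Real.log (2 * R / a)| + 1)).mono
    (hs.integrable hv).aestronglyMeasurable ?_
  filter_upwards [hs.le hd hv ha, hs.nonneg hd hv ha] with x h1 h2
  rcases le_or_gt ‖x‖ R with h | h
  · have := h1 (by linarith [hv.1])
    rw [norm_mul, norm_mul, mul_comm]
    refine mul_le_mul_of_nonneg_right ?_ (norm_nonneg _)
    rw [Real.norm_of_nonneg h2, Real.norm_of_nonneg (by positivity)]
    exact this
  · simp [hv.eq_zero h]

theorem IsScatteringSolution.sub_farField_eq_zero (hs : IsScatteringSolution v R a φ₀) {x : Space d}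
    (hx : R ≤ ‖x‖) : φ₀ x - farField d a x = 0 := by
  rw [hs.eq_farField hx, sub_self]

theorem IsScatteringSolution.memLp_sub (hd : d = 2 ∨ d = 3) (ha : 0 < a)
    (hs : IsScatteringSolution v R a φ₀) : MemLp (fun x => φ₀ x - farField d a x) 2 volume := by
  have h1 := ((hs.memLp R).sub (memLp_farField hd ha R))
  have h2 := (memLp_indicator_iff_restrict (Metric.isOpen_ball (x := (0 : Space d))
    (ε := R)).measurableSet).2 h1
  refine h2.ae_eq (Eventually.of_forall fun x => ?_)
  by_cases hx : x ∈ Metric.ball (0 : Space d) R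
  · rw [indicator_of_mem hx]; rfl
  · rw [indicator_of_notMem hx]
    rw [Metric.mem_ball, dist_zero_right, not_lt] at hx
    exact (hs.sub_farField_eq_zero hx).symm

/-- After subtraction of the far field the source is `v φ₀` minus its total mass placed at the
origin. The difference vanishes outside the ball, so test functions need no decay and heat kernels
are allowed. -/
theorem IsScatteringSolution.weak_sub (hd : d = 2 ∨ d = 3) (hv : IsPotential v R)
    (ha : 0 < a) (hs : IsScatteringSolution v R a φ₀) {η : Space d → ℝ} (hη : ContDiff ℝ ∞ η) :
    ∫ x, (φ₀ x - farField d a x) * Δ η x = 1 / 2 * ∫ x, v x * φ₀ x * (η x - η 0) := by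
  have hR := hv.1
  obtain ⟨b, hb, hbc, hb1⟩ := exists_cutoff d (show 0 < 2 * R by linarith)
  have hs' : ContDiff ℝ ∞ fun x => η x * b x := hη.mul hb
  have hc' : HasCompactSupport fun x => η x * b x := hbc.mul_left
  have h2 : ContDiff ℝ 2 fun x => η x * b x := hs'.of_le (by norm_cast)
  have hΔ := continuous_laplacian h2
  have hΔc := hasCompactSupport_laplacian hc'
  have i1 : ∀ {f : Space d → ℝ}, LocallyIntegrable f →
      Integrable fun x => f x * Δ (fun x => η x * b x) x :=
    fun hf => (hf.integrable_smul_left_of_hasCompactSupport hΔ hΔc).congr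
      (Eventually.of_forall fun x => by simp [mul_comm])
  have e1 : ∫ x, (φ₀ x - farField d a x) * Δ η x =
      ∫ x, (φ₀ x - farField d a x) * Δ (fun x => η x * b x) x := by
    refine integral_congr_ae (Eventually.of_forall fun x => ?_)
    simp only
    rcases lt_or_ge ‖x‖ R with hx | hx
    · rw [laplacian_eq_of_eqOn_ball (r := 2 * R) (f := η) (g := fun x => η x * b x)
        (fun y hy => by rw [hb1 y hy, mul_one]) (by linarith)]
    · rw [hs.sub_farField_eq_zero hx, zero_mul, zero_mul]
  have hq := hs.integrable hv
  have hqb : ∀ x, v x * φ₀ x * (η x * b x) = v x * φ₀ x * η x := fun x => by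
    rcases le_or_gt ‖x‖ R with hx | hx
    · rw [hb1 x (by linarith), mul_one]
    · simp [hv.eq_zero hx]
  have iq : Integrable fun x => v x * φ₀ x * η x := by
    have := (hq.locallyIntegrable.integrable_smul_left_of_hasCompactSupport
      (hη.mul hb).continuous hbc.mul_left)
    refine this.congr (Eventually.of_forall fun x => ?_)
    exact (mul_comm _ _).trans (hqb x)
  rw [e1]
  simp_rw [sub_mul, mul_sub]
  rw [integral_sub (i1 hs.locallyIntegrable) (i1 (locallyIntegrable_farField hd ha)),
    hs.weak hs' hc', integral_farField_mul_laplacian hd ha hs' hc', hb1 0 (by simp; linarith),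
    integral_sub iq (hq.mul_const _), integral_mul_const, hs.integral_eq hd hv ha]
  simp_rw [mul_assoc (1 / 2 : ℝ), hqb]
  rw [integral_const_mul]
  ring

end Scattering

/-! ### The heat kernel -/

section Heat

open Laplacian Set Filter Topology

variable {d : ℕ}

/-- The maximum of the heat kernel at time `t`. -/
noncomputable def heatMax (d : ℕ) (t : ℝ) : ℝ := (Real.sqrt (4 * Real.pi * t))⁻¹ ^ d

/-- The time derivative of the heat kernel. -/
noncomputable def heatKernelDeriv (t : ℝ) (x : Space d) : ℝ :=
  heatKernel t x * (‖x‖ ^ 2 / (4 * t ^ 2) - d / (2 * t))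

theorem heatMax_pos (d : ℕ) {t : ℝ} (ht : 0 < t) : 0 < heatMax d t := by
  have := Real.pi_pos
  unfold heatMax; positivity

theorem heatMax_anti (d : ℕ) {s t : ℝ} (hs : 0 < s) (hst : s ≤ t) : heatMax d t ≤ heatMax d s := by
  have := Real.pi_pos
  unfold heatMax
  gcongr

theorem hasDerivAt_heatMax (hd : d = 2 ∨ d = 3) {t : ℝ} (ht : 0 < t) :
    HasDerivAt (heatMax d) (-(d / (2 * t)) * heatMax d t) t := by
  have hp := Real.pi_pos
  have h0 : HasDerivAt (fun t : ℝ => 4 * Real.pi * t) (4 * Real.pi) t := by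
    simpa using (hasDerivAt_id t).const_mul (4 * Real.pi)
  have hpos : 0 < 4 * Real.pi * t := by positivity
  have hs := Real.sqrt_pos.2 hpos
  have h1 := ((h0.sqrt hpos.ne').fun_inv hs.ne').fun_pow d
  convert! h1 using 1
  have hA := Real.sq_sqrt hpos.le
  unfold heatMax
  set A := Real.sqrt (4 * Real.pi * t)
  clear_value A
  have ht' : t = A ^ 2 / (4 * Real.pi) := by rw [hA]; field_simp
  subst ht'
  rcases hd with rfl | rfl
  · field_simp; norm_num; field_simp
  · field_simp; norm_num; field_simp

theorem hasDerivAt_heatKernel (hd : d = 2 ∨ d = 3) {t : ℝ} (ht : 0 < t) (x : Space d) :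
    HasDerivAt (fun t => heatKernel t x) (heatKernelDeriv t x) t := by
  have h1 : HasDerivAt (fun t : ℝ => -(‖x‖ ^ 2 / (4 * t))) (‖x‖ ^ 2 / (4 * t ^ 2)) t := by
    have := ((((hasDerivAt_id t).const_mul 4).fun_inv (by simp; positivity)).const_mul
      (‖x‖ ^ 2)).fun_neg
    convert! this using 1
    simp only [id]
    field_simp
  have h2 := (hasDerivAt_heatMax hd ht).fun_mul h1.exp
  convert! h2 using 1
  simp only [heatKernelDeriv, heatKernel, heatMax]
  ring

theorem contDiff_heatKernel (t : ℝ) : ContDiff ℝ ∞ (heatKernel (d := d) t) := by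
  unfold heatKernel
  exact contDiff_const.mul (((contDiff_norm_sq ℝ).div_const _).neg.exp)

theorem laplacian_heatKernel {t : ℝ} (ht : 0 < t) (x : Space d) :
    Δ (heatKernel t) x = heatKernelDeriv t x := by
  set j : ℝ → ℝ := fun s => heatMax d t * Real.exp (-(s / (4 * t)))
  have e : heatKernel t = fun x : Space d => j (‖x‖ ^ 2) := rfl
  have hj : ∀ s, HasDerivAt j (-(1 / (4 * t)) * j s) s := fun s => by
    have := ((((hasDerivAt_id s).div_const (4 * t)).fun_neg).exp).const_mul (heatMax d t)
    convert! this using 1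
    simp only [j, id]; ring
  have hs := (contDiff_heatKernel (d := d) t).of_le (m := 2) (by norm_cast)
  rw [e] at hs ⊢
  rw [laplacian_radial hs (fun s _ => hj s) x ((hj _).const_mul _), heatKernelDeriv, e]
  field_simp
  ring

theorem heatKernel_le_heatMax {t : ℝ} (ht : 0 < t) (x : Space d) :
    heatKernel t x ≤ heatMax d t := by
  refine mul_le_of_le_one_right (heatMax_pos d ht).le (Real.exp_le_one_iff.2 ?_)
  have : 0 ≤ ‖x‖ ^ 2 / (4 * t) := by positivity
  linarith

theorem heatMax_mul_le_heatKernel {t : ℝ} (ht : 0 < t) (x : Space d) :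
    heatMax d t * (1 - ‖x‖ ^ 2 / (4 * t)) ≤ heatKernel t x := by
  refine mul_le_mul_of_nonneg_left ?_ (heatMax_pos d ht).le
  have := Real.add_one_le_exp (-(‖x‖ ^ 2 / (4 * t)))
  linarith

theorem abs_heatKernelDeriv_le {t : ℝ} (ht : 0 < t) (x : Space d) :
    |heatKernelDeriv t x| ≤ heatMax d t * ((1 + d / 2) / t) := by
  have h1 : ‖x‖ ^ 2 / (4 * t) * Real.exp (-(‖x‖ ^ 2 / (4 * t))) ≤ 1 := by
    rw [Real.exp_neg, ← div_eq_mul_inv, div_le_one (Real.exp_pos _)]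
    linarith [Real.add_one_le_exp (‖x‖ ^ 2 / (4 * t))]
  have h2 : Real.exp (-(‖x‖ ^ 2 / (4 * t))) ≤ 1 := Real.exp_le_one_iff.2 (by
    have : 0 ≤ ‖x‖ ^ 2 / (4 * t) := by positivity
    linarith)
  have e : heatKernelDeriv t x = heatMax d t * ((‖x‖ ^ 2 / (4 * t) * Real.exp (-(‖x‖ ^ 2 / (4 * t)))
      - d / 2 * Real.exp (-(‖x‖ ^ 2 / (4 * t)))) / t) := by
    simp only [heatKernelDeriv, heatKernel, heatMax]
    field_simp
  rw [e, abs_mul, abs_of_pos (heatMax_pos d ht), abs_div, abs_of_pos ht]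
  have hm := (heatMax_pos d ht).le
  gcongr
  refine (abs_sub _ _).trans ?_
  have h3 : 0 ≤ ‖x‖ ^ 2 / (4 * t) * Real.exp (-(‖x‖ ^ 2 / (4 * t))) := by positivity
  rw [abs_of_nonneg h3, abs_of_nonneg (by positivity)]
  have : (d : ℝ) / 2 * Real.exp (-(‖x‖ ^ 2 / (4 * t))) ≤ d / 2 :=
    mul_le_of_le_one_right (by positivity) h2
  linarith

theorem heatKernel_scale {c : ℝ} (hc : 0 < c) (x : Space d) :
    heatKernel (c⁻¹ ^ 2) x = c ^ d * heatKernel 1 (c • x) := by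
  have hp := Real.pi_pos
  simp only [heatKernel, norm_smul, Real.norm_eq_abs, abs_of_pos hc]
  rw [Real.sqrt_mul (by positivity), Real.sqrt_sq (by positivity), mul_inv, inv_inv, mul_pow, mul_one]
  rw [show ‖x‖ ^ 2 / (4 * c⁻¹ ^ 2) = (c * ‖x‖) ^ 2 / 4 by field_simp]
  ring

theorem integral_heatKernel_one (d : ℕ) : ∫ x : Space d, heatKernel 1 x = 1 := by
  have hp := Real.pi_pos
  unfold heatKernel
  rw [integral_const_mul]
  have := GaussianFourier.integral_rexp_neg_mul_sq_norm (V := Space d) (show (0 : ℝ) < 1 / 4 by norm_num)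
  have e : ∀ x : Space d, Real.exp (-(‖x‖ ^ 2 / (4 * 1))) = Real.exp (-(1 / 4) * ‖x‖ ^ 2) :=
    fun x => by ring_nf
  simp_rw [e]
  rw [this, show Real.pi / (1 / 4) = 4 * Real.pi * 1 by ring, finrank_euclideanSpace, Fintype.card_fin,
    Real.sqrt_eq_rpow, inv_pow, ← Real.rpow_natCast, ← Real.rpow_mul (by positivity)]
  rw [show (1 / 2 : ℝ) * d = d / 2 by ring]
  exact inv_mul_cancel₀ (by positivity)

theorem tendsto_pow_mul_heatKernel_one (d : ℕ) :
    Tendsto (fun x : Space d => ‖x‖ ^ d * heatKernel 1 x) (Bornology.cobounded _) (𝓝 0) := by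
  suffices h : Tendsto (fun y : ℝ => y ^ d * (heatMax d 1 * Real.exp (-(y ^ 2 / (4 * 1))))) atTop
      (𝓝 0) from h.comp tendsto_norm_cobounded_atTop
  have h1 := (Real.tendsto_pow_mul_exp_neg_atTop_nhds_zero d).const_mul (heatMax d 1)
  rw [mul_zero] at h1
  have hm := (heatMax_pos d one_pos).le
  refine squeeze_zero' ?_ ?_ h1
  · filter_upwards [eventually_ge_atTop 0] with y hy
    positivity
  · filter_upwards [eventually_ge_atTop 4] with y hy
    rw [mul_left_comm]
    gcongr
    nlinarith

/-- The heat kernel is an approximate identity. -/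
theorem tendsto_integral_heatKernel_mul {g : Space d → ℝ} (hg : Integrable g)
    (hg0 : ContinuousAt g 0) :
    Tendsto (fun t => ∫ x, heatKernel t x * g x) (𝓝[>] 0) (𝓝 (g 0)) := by
  have hdim : Module.finrank ℝ (Space d) = d := by simp
  have h1 := tendsto_integral_comp_smul_smul_of_integrable (μ := (volume : Measure (Space d)))
    (φ := heatKernel 1) (fun x => heatKernel_nonneg 1 x) (integral_heatKernel_one d)
    (by rw [hdim]; exact tendsto_pow_mul_heatKernel_one d) hg hg0
  have h2 : Tendsto (fun t : ℝ => (Real.sqrt t)⁻¹) (𝓝[>] 0) atTop := by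
    refine Tendsto.inv_tendsto_nhdsGT_zero (tendsto_nhdsWithin_iff.2 ⟨?_, ?_⟩)
    · have := (Real.continuous_sqrt.tendsto 0).mono_left (nhdsWithin_le_nhds (s := Ioi 0))
      simpa using this
    · filter_upwards [self_mem_nhdsWithin] with t ht
      exact Real.sqrt_pos.2 ht
  refine (h1.comp h2).congr' ?_
  filter_upwards [self_mem_nhdsWithin] with t ht
  have ht : 0 < t := ht
  simp only [Function.comp_apply]
  refine integral_congr_ae (Eventually.of_forall fun x => ?_)
  simp only
  rw [hdim, ← heatKernel_scale (inv_pos.2 (Real.sqrt_pos.2 ht)), inv_inv, Real.sq_sqrt ht.le,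
    smul_eq_mul]

end Heat

/-! ### Heat flow of the scattering solution -/

section HeatFlow

open Laplacian Set Filter Topology

variable {d : ℕ} {q f : Space d → ℝ} {R : ℝ}

/-- The pairing of `q` and `f` in the heat kernel. -/
noncomputable def heatPairing (q f : Space d → ℝ) (t : ℝ) : ℝ :=
  ∫ p : Space d × Space d, q p.1 * f p.2 * heatKernel t (p.1 - p.2)

theorem integrable_prod_mul (hq : Integrable q) (hf : Integrable f) :
    Integrable fun p : Space d × Space d => q p.1 * f p.2 := by
  rw [Measure.volume_eq_prod]; exact hq.mul_prod hf

theorem continuous_heatKernelDeriv (t : ℝ) : Continuous (heatKernelDeriv (d := d) t) := by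
  unfold heatKernelDeriv
  exact (continuous_heatKernel t).mul (by fun_prop)

theorem integrable_heatPairing (hq : Integrable q) (hf : Integrable f) {t : ℝ} (ht : 0 < t) :
    Integrable fun p : Space d × Space d => q p.1 * f p.2 * heatKernel t (p.1 - p.2) :=
  integrable_mul_of_bounded (integrable_prod_mul hq hf)
    ((continuous_heatKernel t).comp (by fun_prop)).aestronglyMeasurable (C := heatMax d t)
    fun p => by rw [abs_of_nonneg (heatKernel_nonneg _ _)]; exact heatKernel_le_heatMax ht _

theorem integrable_heatPairing_deriv (hq : Integrable q) (hf : Integrable f) {t : ℝ} (ht : 0 < t) :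
    Integrable fun p : Space d × Space d => q p.1 * f p.2 * heatKernelDeriv t (p.1 - p.2) :=
  integrable_mul_of_bounded (integrable_prod_mul hq hf)
    ((continuous_heatKernelDeriv t).comp (by fun_prop)).aestronglyMeasurable
    fun p => abs_heatKernelDeriv_le ht _

theorem hasDerivAt_heatPairing (hd : d = 2 ∨ d = 3) (hq : Integrable q) (hf : Integrable f) {t : ℝ}
    (ht : 0 < t) : HasDerivAt (heatPairing q f)
      (∫ p : Space d × Space d, q p.1 * f p.2 * heatKernelDeriv t (p.1 - p.2)) t := by
  have hqf := integrable_prod_mul hq hf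
  refine (hasDerivAt_integral_of_dominated_loc_of_deriv_le (s := Ioi (t / 2))
    (F := fun s (p : Space d × Space d) => q p.1 * f p.2 * heatKernel s (p.1 - p.2))
    (F' := fun s p => q p.1 * f p.2 * heatKernelDeriv s (p.1 - p.2))
    (bound := fun p => |q p.1 * f p.2| * (heatMax d (t / 2) * ((1 + d / 2) / (t / 2))))
    (Ioi_mem_nhds (by linarith)) ?_ (integrable_heatPairing hq hf ht)
    (integrable_heatPairing_deriv hq hf ht).aestronglyMeasurable ?_ (hqf.abs.mul_const _) ?_).2
  · exact Eventually.of_forall fun s => hqf.aestronglyMeasurable.mul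
      ((continuous_heatKernel s).comp (by fun_prop)).aestronglyMeasurable
  · refine Eventually.of_forall fun p s hs => ?_
    have hs : t / 2 < s := hs
    have ht2 : 0 < t / 2 := by linarith
    rw [norm_mul]
    refine mul_le_mul_of_nonneg_left ((abs_heatKernelDeriv_le (by linarith) _).trans ?_)
      (abs_nonneg _)
    have hs0 : 0 < s := by linarith
    have h2 := (heatMax_pos d ht2).le
    exact mul_le_mul (heatMax_anti d ht2 hs.le) (by gcongr) (by positivity) h2
  · refine Eventually.of_forall fun p s hs => ?_
    have hs : t / 2 < s := hs
    exact (hasDerivAt_heatKernel hd (by linarith) _).const_mul _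

/-- The derivative of the heat pairing of a source and its potential. -/
theorem hasDerivAt_heatPairing_of_weak (hd : d = 2 ∨ d = 3) (hq : Integrable q) (hf : Integrable f)
    (hweak : ∀ η : Space d → ℝ, ContDiff ℝ ∞ η →
      ∫ x, f x * Δ η x = 1 / 2 * ∫ x, q x * (η x - η 0)) {t : ℝ} (ht : 0 < t) :
    HasDerivAt (heatPairing q f)
      (1 / 2 * (heatEnergy q t - (∫ x, q x) * ∫ x, q x * heatKernel t x)) t := by
  have hqk : ∀ y : Space d, Integrable fun x => q x * heatKernel t (y - x) := fun y =>
    integrable_mul_of_bounded hq ((continuous_heatKernel t).comp (by fun_prop)).aestronglyMeasurable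
      (C := heatMax d t) fun p => by
        rw [abs_of_nonneg (heatKernel_nonneg _ _)]; exact heatKernel_le_heatMax ht _
  have hqk0 : Integrable fun x => q x * heatKernel t x :=
    integrable_mul_of_bounded hq (continuous_heatKernel t).aestronglyMeasurable
      (C := heatMax d t) fun p => by
        rw [abs_of_nonneg (heatKernel_nonneg _ _)]; exact heatKernel_le_heatMax ht _
  have hP := integrable_heatPairing hq hq ht
  have h := hasDerivAt_heatPairing hd hq hf ht
  convert! h using 1
  have hI := integrable_heatPairing_deriv hq hf ht
  rw [heatEnergy]
  rw [Measure.volume_eq_prod] at hI hP ⊢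
  rw [integral_prod _ hI, integral_prod _ hP]
  -- The time derivative of the kernel is its Laplacian in `y`; the weak equation, tested with the
  -- kernel centred at `x`, converts it into the source.
  have e1 : ∀ x : Space d, ∫ y, q x * f y * heatKernelDeriv t (x - y) =
      1 / 2 * ((∫ y, q x * q y * heatKernel t (x - y)) - (∫ y, q y) * (q x * heatKernel t x)) :=
    fun x => by
      have h1 := hweak (fun y => heatKernel t (x - y)) ((contDiff_heatKernel t).comp (by fun_prop))
      simp_rw [laplacian_comp_sub ((contDiff_heatKernel t).of_le (m := 2) (by norm_cast)),
        laplacian_heatKernel ht, sub_zero, mul_sub] at h1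
      rw [integral_sub (hqk x) (hq.mul_const _), integral_mul_const] at h1
      simp_rw [mul_assoc (q x)]
      rw [integral_const_mul, h1, integral_const_mul]
      ring
  simp_rw [e1]
  rw [integral_const_mul, integral_sub hP.integral_prod_left (hqk0.const_mul _),
    integral_const_mul]

theorem abs_heatPairing_le (hq : Integrable q) (hf : Integrable f) {t : ℝ} (ht : 0 < t) :
    |heatPairing q f t| ≤ heatMax d t * ∫ p : Space d × Space d, |q p.1 * f p.2| := by
  rw [heatPairing, ← integral_const_mul]
  rw [← Real.norm_eq_abs]
  refine norm_integral_le_of_norm_le ((integrable_prod_mul hq hf).abs.const_mul _)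
    (Eventually.of_forall fun p => ?_)
  rw [norm_mul, Real.norm_of_nonneg (heatKernel_nonneg _ _), mul_comm]
  exact mul_le_mul_of_nonneg_right (heatKernel_le_heatMax ht _) (norm_nonneg _)

theorem tendsto_heatMax (hd : d ≠ 0) : Tendsto (heatMax d) atTop (𝓝 0) := by
  have hp := Real.pi_pos
  have h1 : Tendsto (fun t => (Real.sqrt (4 * Real.pi * t))⁻¹) atTop (𝓝 0) :=
    (Real.tendsto_sqrt_atTop.comp (tendsto_id.const_mul_atTop (by positivity))).inv_tendsto_atTop
  have := h1.pow d
  rwa [zero_pow hd] at this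

theorem tendsto_heatPairing_atTop (hd : d ≠ 0) (hq : Integrable q) (hf : Integrable f) :
    Tendsto (heatPairing q f) atTop (𝓝 0) := by
  have h := (tendsto_heatMax hd).mul_const (∫ p : Space d × Space d, |q p.1 * f p.2|)
  rw [zero_mul] at h
  refine squeeze_zero_norm' ?_ h
  filter_upwards [eventually_gt_atTop 0] with t ht
  exact abs_heatPairing_le hq hf ht

/-- For points of the support both `x - y` and `x` have norm at most `2R`, so both kernels lie
between `(1 - R² / t)` times the maximum and the maximum. -/
theorem abs_heatEnergy_sub_le (hq : Integrable q) (hq0 : ∀ᵐ x, 0 ≤ q x)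
    (hsupp : ∀ x, R < ‖x‖ → q x = 0) {t : ℝ} (ht : 0 < t) :
    |heatEnergy q t - (∫ x, q x) * ∫ x, q x * heatKernel t x| ≤
      (∫ x, q x) ^ 2 * R ^ 2 * (heatMax d t / t) := by
  have hqq := integrable_prod_mul hq hq
  have hm := heatMax_pos d ht
  have hP := integrable_heatPairing hq hq ht
  have hQ : Integrable fun p : Space d × Space d => q p.1 * q p.2 * heatKernel t p.1 :=
    integrable_mul_of_bounded hqq ((continuous_heatKernel t).comp (by fun_prop)).aestronglyMeasurable
      (C := heatMax d t) fun p => by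
        rw [abs_of_nonneg (heatKernel_nonneg _ _)]; exact heatKernel_le_heatMax ht _
  have habs : ∀ᵐ x, |q x| = q x := hq0.mono fun x hx => abs_of_nonneg hx
  have e1 : (∫ x, q x) * ∫ x, q x * heatKernel t x =
      ∫ p : Space d × Space d, q p.1 * q p.2 * heatKernel t p.1 := by
    rw [mul_comm, Measure.volume_eq_prod, ← integral_prod_mul]
    exact integral_congr_ae (Eventually.of_forall fun p => by simp only; ring)
  have e2 : (∫ x, q x) ^ 2 = ∫ p : Space d × Space d, |q p.1 * q p.2| := by
    simp_rw [abs_mul]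
    rw [Measure.volume_eq_prod, integral_prod_mul (fun x => |q x|) (fun x => |q x|),
      integral_congr_ae habs, sq]
  rw [e1, heatEnergy, ← integral_sub hP hQ, e2, mul_assoc, ← integral_mul_const,
    ← Real.norm_eq_abs]
  refine norm_integral_le_of_norm_le (hqq.abs.mul_const _) (Eventually.of_forall fun p => ?_)
  rw [← mul_sub, norm_mul, Real.norm_eq_abs]
  by_cases h1 : R < ‖p.1‖
  · simp [hsupp _ h1]
  by_cases h2 : R < ‖p.2‖
  · simp [hsupp _ h2]
  rw [not_lt] at h1 h2
  refine mul_le_mul_of_nonneg_left ?_ (abs_nonneg _)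
  have hb : ∀ z : Space d, ‖z‖ ≤ 2 * R → heatMax d t - R ^ 2 * (heatMax d t / t) ≤ heatKernel t z :=
    fun z hz => by
      refine le_trans ?_ (heatMax_mul_le_heatKernel ht z)
      have h3 : ‖z‖ ^ 2 ≤ (2 * R) ^ 2 := by gcongr
      have h4 : ‖z‖ ^ 2 / (4 * t) ≤ R ^ 2 / t := by
        rw [div_le_div_iff₀ (by positivity) ht]; nlinarith
      have : R ^ 2 * (heatMax d t / t) = heatMax d t * (R ^ 2 / t) := by ring
      rw [this]
      nlinarith
  have hR0 : 0 ≤ R := (norm_nonneg _).trans h1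
  have a1 := hb (p.1 - p.2) (by linarith [norm_sub_le p.1 p.2])
  have a2 := hb p.1 (by linarith)
  have a3 := heatKernel_le_heatMax ht (p.1 - p.2)
  have a4 := heatKernel_le_heatMax ht p.1
  rw [Real.norm_eq_abs, abs_le]
  constructor <;> linarith

/-- Decay of the heat pairing of a source and its potential. -/
theorem abs_heatPairing_of_weak_le (hd : d = 2 ∨ d = 3) (hq : Integrable q) (hf : Integrable f)
    (hq0 : ∀ᵐ x, 0 ≤ q x) (hsupp : ∀ x, R < ‖x‖ → q x = 0)
    (hweak : ∀ η : Space d → ℝ, ContDiff ℝ ∞ η →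
      ∫ x, f x * Δ η x = 1 / 2 * ∫ x, q x * (η x - η 0)) {T : ℝ} (hT : 0 < T) :
    |heatPairing q f T| ≤ (∫ x, q x) ^ 2 * R ^ 2 / d * heatMax d T := by
  have hd0 : d ≠ 0 := by omega
  have hdp : (0 : ℝ) < d := by positivity
  set κ := (∫ x, q x) ^ 2 * R ^ 2 / d with hκ
  have hc := tendsto_heatPairing_atTop hd0 hq hf
  have hm := (tendsto_heatMax hd0).const_mul κ
  rw [mul_zero] at hm
  -- The constant `κ` is chosen so that the derivative of `κ heatMax` offsets the bound on the
  -- derivative of the pairing. With either sign the sum is then decreasing with limit `0`, hence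
  -- nonnegative.
  have key : ∀ σ : ℝ, |σ| = 1 → 0 ≤ σ * heatPairing q f T + κ * heatMax d T := fun σ hσ => by
    have hder : ∀ t, 0 < t → HasDerivAt (fun t => σ * heatPairing q f t + κ * heatMax d t)
        (σ * (1 / 2 * (heatEnergy q t - (∫ x, q x) * ∫ x, q x * heatKernel t x)) +
          κ * (-(d / (2 * t)) * heatMax d t)) t := fun t ht =>
      ((hasDerivAt_heatPairing_of_weak hd hq hf hweak ht).const_mul σ).add
        ((hasDerivAt_heatMax hd ht).const_mul κ)
    have hanti : AntitoneOn (fun t => σ * heatPairing q f t + κ * heatMax d t) (Ici T) := by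
      refine antitoneOn_of_deriv_nonpos (convex_Ici T)
        (fun t ht => (hder t (hT.trans_le ht)).continuousAt.continuousWithinAt)
        (fun t ht => ?_) fun t ht => ?_
      · rw [interior_Ici] at ht
        exact (hder t (hT.trans ht)).differentiableAt.differentiableWithinAt
      · rw [interior_Ici] at ht
        have ht0 : 0 < t := hT.trans ht
        rw [(hder t ht0).deriv]
        have h1 := abs_heatEnergy_sub_le hq hq0 hsupp ht0
        set X := heatEnergy q t - (∫ x, q x) * ∫ x, q x * heatKernel t x
        have h2 : σ * X ≤ |X| := by
          calc σ * X ≤ |σ * X| := le_abs_self _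
            _ = |X| := by rw [abs_mul, hσ, one_mul]
        have h3 : κ * (-(d / (2 * t)) * heatMax d t) =
            -(1 / 2 * ((∫ x, q x) ^ 2 * R ^ 2 * (heatMax d t / t))) := by
          rw [hκ]; field_simp
        rw [h3]
        linarith
    have hlim : Tendsto (fun t => σ * heatPairing q f t + κ * heatMax d t) atTop (𝓝 0) := by
      simpa using (hc.const_mul σ).add hm
    refine le_of_tendsto hlim ?_
    filter_upwards [eventually_ge_atTop T] with t ht
    exact hanti self_mem_Ici ht ht
  have k1 := key 1 (by simp)
  have k2 := key (-1) (by simp)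
  rw [abs_le]
  constructor <;> linarith

/-- The heat pairing converges to the pairing as the time tends to zero. -/
theorem tendsto_heatPairing_zero (hq : Integrable q) (hf : Integrable f) (hq2 : MemLp q 2 volume)
    (hf2 : MemLp f 2 volume) :
    Tendsto (heatPairing q f) (𝓝[>] 0) (𝓝 (∫ x, q x * f x)) := by
  set C : Space d → ℝ := fun h => ∫ x, q x * f (x - h) with hC
  have hmeas : Integrable (fun p : Space d × Space d => q p.1 * f (p.1 - p.2)) := by
    have := hq.convolution_integrand (ContinuousLinearMap.mul ℝ ℝ) hf.comp_neg
    rw [Measure.volume_eq_prod]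
    refine this.swap.congr (Eventually.of_forall fun p => ?_)
    simp
  have hmeas' := hmeas
  rw [Measure.volume_eq_prod] at hmeas'
  have hCi : Integrable C := hmeas'.integral_prod_right
  -- The cross-correlation is an `L²` inner product with a translate, and translations are strongly
  -- continuous. Continuity at the origin is what the approximate identity needs.
  have hCc : Continuous C := by
    have : Fact ((1 : ℝ≥0∞) ≤ 2) := ⟨by norm_num⟩
    set F := hf2.toLp f
    set G := hq2.toLp q
    have h1 : Continuous fun h : Space d => inner ℝ (Lp.compMeasurePreserving (fun x => x - h)
        (measurePreserving_sub_right volume h) F) G :=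
      (continuous_translate_Lp (by norm_num) F).inner continuous_const
    convert! h1 using 1
    funext h
    rw [L2.inner_def]
    refine integral_congr_ae ?_
    have e1 := Lp.coeFn_compMeasurePreserving F (measurePreserving_sub_right volume h)
    have e2 := (measurePreserving_sub_right volume h).quasiMeasurePreserving.ae_eq_comp
      hf2.coeFn_toLp
    filter_upwards [e1, e2, hq2.coeFn_toLp] with x h1 h2 h3
    rw [h1, h2, h3]
    simp
  have h0 : C 0 = ∫ x, q x * f x := by simp [hC]
  rw [← h0]
  refine (tendsto_integral_heatKernel_mul hCi hCc.continuousAt).congr' ?_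
  filter_upwards [self_mem_nhdsWithin] with t ht
  have ht : 0 < t := ht
  have hP := integrable_heatPairing hq hf ht
  have hP2 : Integrable (fun p : Space d × Space d => q p.1 * f (p.1 - p.2) * heatKernel t p.2) :=
    integrable_mul_of_bounded hmeas
      ((continuous_heatKernel t).comp (by fun_prop)).aestronglyMeasurable
      (C := heatMax d t) fun p => by
        rw [abs_of_nonneg (heatKernel_nonneg _ _)]; exact heatKernel_le_heatMax ht _
  rw [heatPairing]
  rw [Measure.volume_eq_prod] at hP hP2 ⊢
  rw [integral_prod _ hP]
  have e3 : ∀ x : Space d, ∫ y, q x * f y * heatKernel t (x - y) =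
      ∫ h, q x * f (x - h) * heatKernel t h := fun x => by
    rw [← integral_sub_left_eq_self _ volume x]
    simp
  simp_rw [e3]
  rw [integral_integral_swap hP2]
  refine integral_congr_ae (Eventually.of_forall fun h => ?_)
  simp only [hC]
  rw [integral_mul_const, mul_comm]

end HeatFlow

/-! ### The heat flow of the fundamental solution -/

section HeatProfile

open Set Filter Topology

variable {d : ℕ} {a : ℝ}

/-- The exponential integral. -/
noncomputable def expIntegral (u : ℝ) : ℝ := ∫ s in Ioi u, Real.exp (-s) / s

/-- The unnormalized error function. -/
noncomputable def erfIntegral (u : ℝ) : ℝ := ∫ s in (0 : ℝ)..u, Real.exp (-s ^ 2)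

/-- The sum of `farField` and of the time integral of the heat kernel up to time `t`. -/
noncomputable def heatProfile (d : ℕ) (a t : ℝ) (x : Space d) : ℝ :=
  if d = 2 then Real.log (‖x‖ / a) + 1 / 2 * expIntegral (‖x‖ ^ 2 / (4 * t))
  else 1 - 2 * a / (Real.sqrt Real.pi * ‖x‖) * erfIntegral (‖x‖ / (2 * Real.sqrt t))

/-- The value of `heatProfile` near the origin, for large times. -/
noncomputable def heatLimit (d : ℕ) (a t : ℝ) : ℝ :=
  if d = 2 then 1 / 2 * (Real.log (4 * t / a ^ 2) - Real.eulerMascheroniConstant)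
  else 1 - a / Real.sqrt (Real.pi * t)

theorem integrableOn_expIntegral {u : ℝ} (hu : 0 < u) :
    IntegrableOn (fun s : ℝ => Real.exp (-s) / s) (Ioi u) :=
  (abs_expIntegral_add_log_le (lt_min hu one_pos) (min_le_right u 1)).1.mono_set
    (Ioi_subset_Ioi (min_le_left u 1))

theorem expIntegral_eq {u w : ℝ} (hu : 0 < u) (hw : 0 < w) :
    expIntegral w = expIntegral u - ∫ s in u..w, Real.exp (-s) / s := by
  have := intervalIntegral.integral_interval_add_Ioi (integrableOn_expIntegral hu)
    (integrableOn_expIntegral hw)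
  simp only [expIntegral]
  linarith

theorem hasDerivAt_expIntegral {u : ℝ} (hu : 0 < u) :
    HasDerivAt expIntegral (-(Real.exp (-u) / u)) u := by
  have hc : ContinuousOn (fun s : ℝ => Real.exp (-s) / s) (Ioi 0) :=
    (Real.continuous_exp.comp continuous_neg).continuousOn.div continuousOn_id fun s hs => ne_of_gt hs
  have h1 : HasDerivAt (fun w => ∫ s in u..w, Real.exp (-s) / s) (Real.exp (-u) / u) u :=
    intervalIntegral.integral_hasDerivAt_right (by simp)
      (hc.stronglyMeasurableAtFilter isOpen_Ioi u hu) (hc.continuousAt (Ioi_mem_nhds hu))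
  have h2 := h1.const_sub (expIntegral u)
  refine h2.congr_of_eventuallyEq ?_
  filter_upwards [Ioi_mem_nhds hu] with w hw
  exact expIntegral_eq hu hw

theorem tendsto_expIntegral_atTop : Tendsto expIntegral atTop (𝓝 0) := by
  have h := intervalIntegral_tendsto_integral_Ioi 1 (integrableOn_expIntegral one_pos) tendsto_id
  have h2 := h.const_sub (expIntegral 1)
  rw [show expIntegral 1 - ∫ s in Ioi 1, Real.exp (-s) / s = 0 from sub_self _] at h2
  refine h2.congr' ?_
  filter_upwards [eventually_gt_atTop 0] with w hw
  exact (expIntegral_eq one_pos hw).symm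

theorem hasDerivAt_erfIntegral (u : ℝ) : HasDerivAt erfIntegral (Real.exp (-u ^ 2)) u := by
  have hc : Continuous fun s : ℝ => Real.exp (-s ^ 2) := by fun_prop
  exact intervalIntegral.integral_hasDerivAt_right (hc.intervalIntegrable _ _)
    (hc.stronglyMeasurableAtFilter _ _) hc.continuousAt

theorem tendsto_erfIntegral_atTop : Tendsto erfIntegral atTop (𝓝 (Real.sqrt Real.pi / 2)) := by
  have h1 := integral_gaussian_Ioi 1
  have h2 : IntegrableOn (fun s : ℝ => Real.exp (-s ^ 2)) (Ioi 0) := by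
    simpa using (integrable_exp_neg_mul_sq one_pos).integrableOn (s := Ioi 0)
  have := intervalIntegral_tendsto_integral_Ioi 0 h2 tendsto_id
  simp only [neg_mul, one_mul, div_one] at h1
  rwa [h1] at this

theorem abs_erfIntegral_sub_le {u : ℝ} (hu : 0 ≤ u) : |erfIntegral u - u| ≤ u ^ 3 / 3 := by
  have h1 : erfIntegral u - u = -∫ s in (0 : ℝ)..u, (1 - Real.exp (-s ^ 2)) := by
    rw [intervalIntegral.integral_sub (by simp)
      ((by fun_prop : Continuous fun s : ℝ => Real.exp (-s ^ 2)).intervalIntegrable _ _)]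
    simp [erfIntegral]
  have h2 : ∫ s in (0 : ℝ)..u, (1 - Real.exp (-s ^ 2)) ≤ ∫ s in (0 : ℝ)..u, s ^ 2 := by
    refine intervalIntegral.integral_mono_on hu
      ((by fun_prop : Continuous fun s : ℝ => 1 - Real.exp (-s ^ 2)).intervalIntegrable _ _)
      ((by fun_prop : Continuous fun s : ℝ => s ^ 2).intervalIntegrable _ _) fun s _ => ?_
    linarith [Real.add_one_le_exp (-s ^ 2)]
  have h3 : 0 ≤ ∫ s in (0 : ℝ)..u, (1 - Real.exp (-s ^ 2)) :=
    intervalIntegral.integral_nonneg hu fun s _ => by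
      have : Real.exp (-s ^ 2) ≤ 1 := Real.exp_le_one_iff.2 (by nlinarith [sq_nonneg s])
      linarith
  rw [integral_pow] at h2
  norm_num at h2
  rw [h1, abs_neg, abs_of_nonneg h3]
  exact h2

theorem heatMax_two {t : ℝ} (ht : 0 < t) : heatMax 2 t = 1 / (4 * Real.pi * t) := by
  have hp := Real.pi_pos
  rw [heatMax, inv_pow, Real.sq_sqrt (by positivity), one_div]

theorem heatMax_three {t : ℝ} (ht : 0 < t) :
    heatMax 3 t = 1 / (8 * Real.pi * Real.sqrt Real.pi * t * Real.sqrt t) := by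
  have hp := Real.pi_pos
  have h1 : Real.sqrt (4 * Real.pi * t) = 2 * Real.sqrt Real.pi * Real.sqrt t := by
    rw [Real.sqrt_mul (by positivity), Real.sqrt_mul (by norm_num),
      show (4 : ℝ) = 2 ^ 2 by norm_num, Real.sqrt_sq (by norm_num)]
  rw [heatMax, h1, inv_pow, one_div]
  congr 1
  have e1 := Real.sq_sqrt hp.le
  have e2 := Real.sq_sqrt ht.le
  calc (2 * Real.sqrt Real.pi * Real.sqrt t) ^ 3 =
      8 * Real.sqrt Real.pi ^ 2 * Real.sqrt Real.pi * Real.sqrt t ^ 2 * Real.sqrt t := by ring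
    _ = _ := by rw [e1, e2]

theorem heatKernel_eq_heatMax (t : ℝ) (x : Space d) :
    heatKernel t x = heatMax d t * Real.exp (-(‖x‖ ^ 2 / (4 * t))) := rfl

theorem hasDerivAt_heatProfile (hd : d = 2 ∨ d = 3) (a : ℝ) {t : ℝ} (ht : 0 < t) {x : Space d}
    (hx : x ≠ 0) :
    HasDerivAt (fun t => heatProfile d a t x) (fluxConst d a * heatKernel t x) t := by
  have hn : 0 < ‖x‖ := norm_pos_iff.2 hx
  have hp := Real.pi_pos
  rcases hd with rfl | rfl
  · have h1 : HasDerivAt (fun t : ℝ => ‖x‖ ^ 2 / (4 * t)) (-(‖x‖ ^ 2 / (4 * t ^ 2))) t := by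
      have := (((hasDerivAt_id t).const_mul 4).fun_inv (by simp; positivity)).const_mul (‖x‖ ^ 2)
      convert! this using 1
      simp only [id]
      field_simp
    have h2 := (((hasDerivAt_expIntegral (show 0 < ‖x‖ ^ 2 / (4 * t) by positivity)).comp t
      h1).const_mul (1 / 2)).const_add (Real.log (‖x‖ / a))
    have e : (fun t => heatProfile 2 a t x) = fun t =>
        Real.log (‖x‖ / a) + 1 / 2 * (expIntegral ∘ fun t => ‖x‖ ^ 2 / (4 * t)) t := by
      funext t; simp [heatProfile]
    rw [e]
    convert! h2 using 1
    rw [heatKernel_eq_heatMax, heatMax_two ht]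
    simp only [fluxConst, if_true]
    field_simp
    try norm_num
  · have hs := Real.sqrt_pos.2 ht
    have hsp := Real.sqrt_pos.2 hp
    have h1 : HasDerivAt (fun t : ℝ => ‖x‖ / (2 * Real.sqrt t))
        (-(‖x‖ / (4 * t * Real.sqrt t))) t := by
      have := ((((Real.hasDerivAt_sqrt ht.ne').const_mul 2).fun_inv (by positivity)).const_mul ‖x‖)
      convert! this using 1
      have e := Real.sq_sqrt ht.le
      set A := Real.sqrt t
      clear_value A
      subst e
      field_simp
      try norm_num
    have h2 := (((hasDerivAt_erfIntegral (‖x‖ / (2 * Real.sqrt t))).comp t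
      h1).const_mul (2 * a / (Real.sqrt Real.pi * ‖x‖))).const_sub 1
    have e : (fun t => heatProfile 3 a t x) = fun t => 1 - 2 * a / (Real.sqrt Real.pi * ‖x‖) *
        (erfIntegral ∘ fun t => ‖x‖ / (2 * Real.sqrt t)) t := by
      funext t; simp [heatProfile]
    rw [e]
    convert! h2 using 1
    rw [heatKernel_eq_heatMax, heatMax_three ht]
    simp only [fluxConst, show (3 : ℕ) ≠ 2 by norm_num, if_false]
    have e2 : (‖x‖ / (2 * Real.sqrt t)) ^ 2 = ‖x‖ ^ 2 / (4 * t) := by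
      rw [div_pow, mul_pow, Real.sq_sqrt ht.le]; norm_num
    rw [e2]
    field_simp
    ring

theorem tendsto_heatProfile_zero (hd : d = 2 ∨ d = 3) (a : ℝ) {x : Space d} (hx : x ≠ 0) :
    Tendsto (fun t => heatProfile d a t x) (𝓝[>] 0) (𝓝 (farField d a x)) := by
  have hn : 0 < ‖x‖ := norm_pos_iff.2 hx
  have hp := Real.pi_pos
  rcases hd with rfl | rfl
  · have h1 : Tendsto (fun t : ℝ => ‖x‖ ^ 2 / (4 * t)) (𝓝[>] 0) atTop := by
      have := (tendsto_inv_nhdsGT_zero (𝕜 := ℝ)).const_mul_atTop (show 0 < ‖x‖ ^ 2 / 4 by positivity)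
      refine this.congr fun t => ?_
      rw [← div_eq_mul_inv, div_div]
    have h2 := ((tendsto_expIntegral_atTop.comp h1).const_mul (1 / 2)).const_add
      (Real.log (‖x‖ / a))
    simpa [heatProfile, farField] using h2
  · have hsp := Real.sqrt_pos.2 hp
    have h0 : Tendsto (fun t : ℝ => (Real.sqrt t)⁻¹) (𝓝[>] 0) atTop := by
      refine Tendsto.inv_tendsto_nhdsGT_zero (tendsto_nhdsWithin_iff.2 ⟨?_, ?_⟩)
      · have := (Real.continuous_sqrt.tendsto 0).mono_left (nhdsWithin_le_nhds (s := Ioi 0))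
        simpa using this
      · filter_upwards [self_mem_nhdsWithin] with t ht
        exact Real.sqrt_pos.2 ht
    have h1 : Tendsto (fun t : ℝ => ‖x‖ / (2 * Real.sqrt t)) (𝓝[>] 0) atTop := by
      refine (h0.const_mul_atTop (show 0 < ‖x‖ / 2 by positivity)).congr fun t => ?_
      rw [← div_eq_mul_inv, div_div]
    have h2 := ((tendsto_erfIntegral_atTop.comp h1).const_mul
      (2 * a / (Real.sqrt Real.pi * ‖x‖))).const_sub 1
    simp only [heatProfile, farField, show (3 : ℕ) ≠ 2 by norm_num, if_false]
    convert! h2 using 2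
    field_simp

/-- The time derivative is the positive flux times the heat kernel. Monotonicity supplies the lower
half of a bound uniform down to time zero. -/
theorem heatProfile_mono (hd : d = 2 ∨ d = 3) (ha : 0 < a) {x : Space d} (hx : x ≠ 0) {s t : ℝ}
    (hs : 0 < s) (hst : s ≤ t) : heatProfile d a s x ≤ heatProfile d a t x := by
  have hder := fun t (ht : 0 < t) => hasDerivAt_heatProfile hd a ht hx
  have : MonotoneOn (fun t => heatProfile d a t x) (Ioi 0) := by
    refine monotoneOn_of_deriv_nonneg (convex_Ioi 0)
      (fun t ht => (hder t ht).continuousAt.continuousWithinAt) (fun t ht => ?_) fun t ht => ?_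
    · rw [interior_Ioi] at ht
      exact (hder t ht).differentiableAt.differentiableWithinAt
    · rw [interior_Ioi] at ht
      rw [(hder t ht).deriv]
      exact mul_nonneg (fluxConst_pos d ha).le (heatKernel_nonneg _ _)
  exact this hs (hs.trans_le hst) hst

theorem farField_le_heatProfile (hd : d = 2 ∨ d = 3) (ha : 0 < a) {x : Space d} (hx : x ≠ 0)
    {t : ℝ} (ht : 0 < t) : farField d a x ≤ heatProfile d a t x := by
  refine le_of_tendsto (tendsto_heatProfile_zero hd a hx) ?_
  filter_upwards [Ioc_mem_nhdsGT ht] with s hs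
  exact heatProfile_mono hd ha hx hs.1 hs.2

/-- Small-argument expansions: the exponential integral is `-log u - Γ + O(u)`, the error function
`u + O(u³)`. The singularity of the far field at the origin cancels, and for `d = 2` the constant
`Γ` enters. -/
theorem abs_heatProfile_sub_le (hd : d = 2 ∨ d = 3) (ha : 0 < a) {x : Space d} (hx : x ≠ 0)
    {t : ℝ} (ht : 0 < t) (hxt : ‖x‖ ^ 2 ≤ 4 * t) :
    |heatProfile d a t x - heatLimit d a t| ≤ fluxConst d a * heatMax d t * ‖x‖ ^ 2 := by
  have hn : 0 < ‖x‖ := norm_pos_iff.2 hx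
  have hp := Real.pi_pos
  rcases hd with rfl | rfl
  · have h1 := (abs_expIntegral_add_log_le (show 0 < ‖x‖ ^ 2 / (4 * t) by positivity)
      ((div_le_one (by positivity)).2 hxt)).2
    have e : heatProfile 2 a t x - heatLimit 2 a t = 1 / 2 * (expIntegral (‖x‖ ^ 2 / (4 * t)) +
        Real.log (‖x‖ ^ 2 / (4 * t)) + Real.eulerMascheroniConstant) := by
      simp only [heatProfile, heatLimit, if_true]
      rw [Real.log_div hn.ne' ha.ne', Real.log_div (by positivity) (by positivity),
        Real.log_div (by positivity) (by positivity), Real.log_pow, Real.log_pow]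
      push_cast; ring
    rw [e, abs_mul, heatMax_two ht]
    simp only [fluxConst, if_true]
    rw [show |(1 / 2 : ℝ)| = 1 / 2 by norm_num]
    have h2 : 2 * Real.pi * (1 / (4 * Real.pi * t)) * ‖x‖ ^ 2 = 2 * (‖x‖ ^ 2 / (4 * t)) := by
      field_simp
    rw [h2]
    have h3 : 0 ≤ ‖x‖ ^ 2 / (4 * t) := by positivity
    simp only [expIntegral]
    linarith
  · have hs := Real.sqrt_pos.2 ht
    have hsp := Real.sqrt_pos.2 hp
    have h1 := abs_erfIntegral_sub_le (show 0 ≤ ‖x‖ / (2 * Real.sqrt t) by positivity)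
    have e : heatProfile 3 a t x - heatLimit 3 a t = -(2 * a / (Real.sqrt Real.pi * ‖x‖) *
        (erfIntegral (‖x‖ / (2 * Real.sqrt t)) - ‖x‖ / (2 * Real.sqrt t))) := by
      simp only [heatProfile, heatLimit, show (3 : ℕ) ≠ 2 by norm_num, if_false]
      rw [Real.sqrt_mul hp.le]
      field_simp
      ring
    rw [e, abs_neg, abs_mul, abs_of_pos (by positivity), heatMax_three ht]
    simp only [fluxConst, show (3 : ℕ) ≠ 2 by norm_num, if_false]
    refine (mul_le_mul_of_nonneg_left h1 (by positivity)).trans ?_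
    have h2 : 2 * a / (Real.sqrt Real.pi * ‖x‖) * ((‖x‖ / (2 * Real.sqrt t)) ^ 3 / 3) =
        a * ‖x‖ ^ 2 / (Real.sqrt Real.pi * t * Real.sqrt t) * (1 / 12) := by
      have e2 := Real.sq_sqrt ht.le
      set A := Real.sqrt t
      clear_value A
      subst e2
      field_simp
      norm_num
    have h3 : 4 * Real.pi * a * (1 / (8 * Real.pi * Real.sqrt Real.pi * t * Real.sqrt t)) * ‖x‖ ^ 2 =
        a * ‖x‖ ^ 2 / (Real.sqrt Real.pi * t * Real.sqrt t) * (1 / 2) := by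
      field_simp
      norm_num
    rw [h2, h3]
    have : 0 ≤ a * ‖x‖ ^ 2 / (Real.sqrt Real.pi * t * Real.sqrt t) := by positivity
    linarith

theorem aestronglyMeasurable_heatProfile (d : ℕ) (a t : ℝ) :
    AEStronglyMeasurable (heatProfile d a t) := by
  have h1 : Measurable erfIntegral :=
    (continuous_iff_continuousAt.2 fun u => (hasDerivAt_erfIntegral u).continuousAt).measurable
  unfold heatProfile
  split_ifs
  · have h2 : StronglyMeasurable fun x : Space d => expIntegral (‖x‖ ^ 2 / (4 * t)) := by
      have : ∀ x : Space d, expIntegral (‖x‖ ^ 2 / (4 * t)) =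
          ∫ s, (Ioi (‖x‖ ^ 2 / (4 * t))).indicator (fun s => Real.exp (-s) / s) s := fun x => by
        rw [integral_indicator measurableSet_Ioi]; rfl
      simp_rw [this]
      refine StronglyMeasurable.integral_prod_right (f := fun (x : Space d) s =>
        (Ioi (‖x‖ ^ 2 / (4 * t))).indicator (fun s => Real.exp (-s) / s) s) ?_
      refine Measurable.stronglyMeasurable ?_
      have hset : MeasurableSet {p : Space d × ℝ | ‖p.1‖ ^ 2 / (4 * t) < p.2} :=
        measurableSet_lt (by fun_prop) measurable_snd
      exact Measurable.indicator (f := fun p : Space d × ℝ => Real.exp (-p.2) / p.2)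
        (by fun_prop) hset
    exact ((by fun_prop : Measurable fun x : Space d => Real.log (‖x‖ / a)).aestronglyMeasurable).add
      (h2.aestronglyMeasurable.const_mul _)
  · exact Measurable.aestronglyMeasurable (by fun_prop)

end HeatProfile

/-! ### The heat energy of the scattering solution -/

section HeatIdentity

open Set Filter Topology

variable {d : ℕ} {v φ₀ q : Space d → ℝ} {R a : ℝ}

/-- The profile increases in time, so it lies between the far field and its value at `max T R²`, a
time late enough for `abs_heatProfile_sub_le` on the whole ball. -/
theorem exists_abs_heatProfile_le (hd : d = 2 ∨ d = 3) (ha : 0 < a) {T : ℝ}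
    (hT : 0 < T) : ∃ C, ∀ t, 0 < t → t ≤ T → ∀ x : Space d, x ≠ 0 → ‖x‖ ≤ R →
      |heatProfile d a t x| ≤ |farField d a x| + C := by
  set T' := max T (R ^ 2)
  have hT' : 0 < T' := hT.trans_le (le_max_left _ _)
  refine ⟨|heatLimit d a T'| + fluxConst d a * heatMax d T' * R ^ 2, fun t ht htT x hx hxR => ?_⟩
  have h1 := farField_le_heatProfile hd ha hx ht
  have h2 := heatProfile_mono hd ha hx ht (htT.trans (le_max_left T (R ^ 2)))
  have hx2 : ‖x‖ ^ 2 ≤ R ^ 2 := by gcongr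
  have h3 := abs_heatProfile_sub_le hd ha hx hT' (by linarith [le_max_right T (R ^ 2)])
  have h4 : fluxConst d a * heatMax d T' * ‖x‖ ^ 2 ≤ fluxConst d a * heatMax d T' * R ^ 2 :=
    mul_le_mul_of_nonneg_left hx2 (mul_pos (fluxConst_pos d ha) (heatMax_pos d hT')).le
  have h5 := le_abs_self (heatLimit d a T')
  have h6 := le_abs_self (heatProfile d a T' x - heatLimit d a T')
  have h7 := neg_abs_le (farField d a x)
  have h8 := abs_nonneg (farField d a x)
  have h9 := abs_nonneg (heatLimit d a T')
  have h10 := (abs_nonneg _).trans h3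
  rw [abs_le]
  constructor <;> linarith

theorem integrable_mul_heatProfile (hd : d = 2 ∨ d = 3) (ha : 0 < a) (hR : 0 < R)
    (hq : Integrable q) (hq2 : MemLp q 2 volume) (hsupp : ∀ x, R < ‖x‖ → q x = 0) {T : ℝ}
    (hT : 0 < T) : ∃ b : Space d → ℝ, Integrable b ∧ ∀ᵐ x, ∀ t, 0 < t → t ≤ T →
      |q x * heatProfile d a t x| ≤ b x := by
  obtain ⟨C, hC⟩ := exists_abs_heatProfile_le hd ha hT
  refine ⟨fun x => |q x * farField d a x| + |q x| * C,
    ((integrable_mul_of_memLp_ball hR hq2 hsupp (memLp_farField hd ha _)).abs).add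
      (hq.abs.mul_const C), ?_⟩
  filter_upwards [ae_ne_zero (show d ≠ 0 by omega)] with x hx t ht htT
  rcases le_or_gt ‖x‖ R with h | h
  · rw [abs_mul, abs_mul, ← mul_add]
    exact mul_le_mul_of_nonneg_left (hC t ht htT x hx h) (abs_nonneg _)
  · simp [hsupp x h]

theorem hasDerivAt_integral_heatProfile (hd : d = 2 ∨ d = 3) (ha : 0 < a) (hR : 0 < R)
    (hq : Integrable q) (hq2 : MemLp q 2 volume) (hsupp : ∀ x, R < ‖x‖ → q x = 0) {t : ℝ}
    (ht : 0 < t) : HasDerivAt (fun t => ∫ x, q x * heatProfile d a t x)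
      (fluxConst d a * ∫ x, q x * heatKernel t x) t := by
  obtain ⟨b, hb, hbt⟩ := integrable_mul_heatProfile hd ha hR hq hq2 hsupp ht
  have hm : ∀ s, 0 < s → AEStronglyMeasurable (fun x => q x * heatProfile d a s x) := fun s hs =>
    hq.aestronglyMeasurable.mul (aestronglyMeasurable_heatProfile d a _)
  have hF := (fluxConst_pos d ha).le
  have e : fluxConst d a * ∫ x, q x * heatKernel t x =
      ∫ x, q x * (fluxConst d a * heatKernel t x) := by
    rw [← integral_const_mul]
    exact integral_congr_ae (Eventually.of_forall fun x => by simp only; ring)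
  rw [e]
  refine (hasDerivAt_integral_of_dominated_loc_of_deriv_le (s := Ioi (t / 2))
    (F := fun s x => q x * heatProfile d a s x) (μ := volume)
    (F' := fun s x => q x * (fluxConst d a * heatKernel s x))
    (bound := fun x => |q x| * (fluxConst d a * heatMax d (t / 2)))
    (Ioi_mem_nhds (half_lt_self ht)) ?_ ?_ ?_ ?_ (hq.abs.mul_const _) ?_).2
  · filter_upwards [Ioi_mem_nhds ht] with s hs using hm s hs
  · exact hb.mono' (hm t ht) (hbt.mono fun x hx => hx t ht le_rfl)
  · exact hq.aestronglyMeasurable.mul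
      ((continuous_heatKernel t).aestronglyMeasurable.const_mul _)
  · refine Eventually.of_forall fun x s hs => ?_
    have hs : t / 2 < s := hs
    have ht2 : 0 < t / 2 := by linarith
    rw [norm_mul, norm_mul, Real.norm_of_nonneg hF, Real.norm_of_nonneg (heatKernel_nonneg _ _)]
    refine mul_le_mul_of_nonneg_left (mul_le_mul_of_nonneg_left ?_ hF) (norm_nonneg _)
    exact (heatKernel_le_heatMax (by linarith) x).trans (heatMax_anti d ht2 hs.le)
  · filter_upwards [ae_ne_zero (show d ≠ 0 by omega)] with x hx s hs
    have hs : t / 2 < s := hs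
    exact (hasDerivAt_heatProfile hd a (by linarith) hx).const_mul _

theorem tendsto_integral_heatProfile (hd : d = 2 ∨ d = 3) (ha : 0 < a) (hR : 0 < R)
    (hq : Integrable q) (hq2 : MemLp q 2 volume) (hsupp : ∀ x, R < ‖x‖ → q x = 0) :
    Tendsto (fun t => ∫ x, q x * heatProfile d a t x) (𝓝[>] 0)
      (𝓝 (∫ x, q x * farField d a x)) := by
  obtain ⟨b, hb, hbt⟩ := integrable_mul_heatProfile hd ha hR hq hq2 hsupp one_pos
  refine tendsto_integral_filter_of_dominated_convergence b ?_ ?_ hb ?_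
  · filter_upwards [self_mem_nhdsWithin] with s hs
    exact hq.aestronglyMeasurable.mul (aestronglyMeasurable_heatProfile d a _)
  · filter_upwards [Ioc_mem_nhdsGT one_pos] with s hs
    exact hbt.mono fun x hx => hx s hs.1 hs.2
  · filter_upwards [ae_ne_zero (show d ≠ 0 by omega)] with x hx
    exact (tendsto_heatProfile_zero hd a hx).const_mul _

/-- The time integral of the heat energy of `v φ₀`. -/
theorem IsScatteringSolution.heatEnergy_integral (hd : d = 2 ∨ d = 3) (hv : IsPotential v R)
    (ha : 0 < a) (hs : IsScatteringSolution v R a φ₀) {T : ℝ} (hT : 0 < T) (hRT : R ^ 2 ≤ 4 * T) :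
    IntegrableOn (heatEnergy fun x => v x * φ₀ x) (Ioc 0 T) ∧
    |1 / 2 * (∫ t in Ioc 0 T, heatEnergy (fun x => v x * φ₀ x) t) -
      2 * fluxConst d a * heatLimit d a T + ∫ x, v x * φ₀ x * φ₀ x| ≤
      (2 * fluxConst d a) ^ 2 * R ^ 2 * heatMax d T := by
  have hR := hv.1
  set q : Space d → ℝ := fun x => v x * φ₀ x with hqdef
  set f : Space d → ℝ := fun x => φ₀ x - farField d a x
  have hq : Integrable q := hs.integrable hv
  have hq2 : MemLp q 2 volume := hs.memLp_source hd hv ha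
  have hsupp : ∀ x, R < ‖x‖ → q x = 0 := fun x hx => by simp [hqdef, hv.eq_zero hx]
  have hq0 : ∀ᵐ x, 0 ≤ q x := by
    filter_upwards [hs.nonneg hd hv ha] with x hx using mul_nonneg (hv.2.1 x) hx
  have hf2 : MemLp f 2 volume := hs.memLp_sub hd ha
  have hf : Integrable f := by
    have : IsFiniteMeasure (volume.restrict (Metric.ball (0 : Space d) R)) :=
      ⟨by rw [Measure.restrict_apply_univ]; exact measure_ball_lt_top⟩
    have h1 : IntegrableOn f (Metric.ball 0 R) := (hf2.restrict _).integrable (by norm_num)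
    refine (integrableOn_iff_integrable_of_support_subset fun x hx => ?_).1 h1
    by_contra h
    rw [Metric.mem_ball, dist_zero_right, not_lt] at h
    exact hx (hs.sub_farField_eq_zero h)
  have hweak : ∀ η : Space d → ℝ, ContDiff ℝ ∞ η →
      ∫ x, f x * Laplacian.laplacian η x = 1 / 2 * ∫ x, q x * (η x - η 0) := fun η hη =>
    hs.weak_sub hd hv ha hη
  have hm : ∫ x, q x = 2 * fluxConst d a := hs.integral_eq hd hv ha
  have hqE : Integrable fun x => q x * farField d a x :=
    integrable_mul_of_memLp_ball hR hq2 hsupp (memLp_farField hd ha _)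
  have hqf : Integrable fun x => q x * f x := hq2.integrable_mul hf2
  have hsum : ∫ x, q x * φ₀ x = (∫ x, q x * f x) + ∫ x, q x * farField d a x := by
    rw [← integral_add hqf hqE]
    exact integral_congr_ae (Eventually.of_forall fun x => by simp only [f]; ring)
  -- The pairing of `q` with the heat flow of `φ₀`, split into compactly supported part and far
  -- field. Because `∫ q` is twice the flux constant, the two terms `∫ q p_t` cancel in the
  -- derivative and only half the heat energy is left.
  set W : ℝ → ℝ := fun t => heatPairing q f t + ∫ x, q x * heatProfile d a t x with hW
  -- Extending by the limiting value makes `G` continuous on `[0, T]`. Its derivative inside is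
  -- nonnegative, so integrability up to `0` comes with the fundamental theorem of calculus.
  set G : ℝ → ℝ := fun t => if t ≤ 0 then 2 * ∫ x, q x * φ₀ x else 2 * W t with hG
  have hWd : ∀ t, 0 < t → HasDerivAt W (1 / 2 * heatEnergy q t) t := fun t ht => by
    have := (hasDerivAt_heatPairing_of_weak hd hq hf hweak ht).add
      (hasDerivAt_integral_heatProfile hd ha hR hq hq2 hsupp ht)
    convert! this using 1
    rw [hm]; ring
  have hGd : ∀ t, 0 < t → HasDerivAt G (heatEnergy q t) t := fun t ht => by
    have h1 := (hWd t ht).const_mul 2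
    have h2 : HasDerivAt (fun t => 2 * W t) (heatEnergy q t) t := by
      convert! h1 using 1; ring
    refine h2.congr_of_eventuallyEq ?_
    filter_upwards [Ioi_mem_nhds ht] with s hs
    exact if_neg (not_le.2 hs)
  have hG0 : G 0 = 2 * ∫ x, q x * φ₀ x := if_pos le_rfl
  have hGc : ContinuousOn G (Icc 0 T) := fun t ht => by
    rcases ht.1.eq_or_lt with h | h
    · rw [← h]
      have h1 : ContinuousWithinAt G (Ioi 0) 0 := by
        have h2 := ((tendsto_heatPairing_zero hq hf hq2 hf2).add
          (tendsto_integral_heatProfile hd ha hR hq hq2 hsupp)).const_mul 2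
        rw [← hsum, ← hG0] at h2
        refine h2.congr' ?_
        filter_upwards [self_mem_nhdsWithin] with s hs
        exact (if_neg (not_le.2 hs)).symm
      exact (continuousWithinAt_Ioi_iff_Ici.1 h1).mono Icc_subset_Ici_self
    · exact (hGd t h).continuousAt.continuousWithinAt
  have hpos : ∀ t ∈ Ioo 0 T, 0 ≤ heatEnergy q t := fun t _ => by
    refine integral_nonneg_of_ae ?_
    have h1 : ∀ᵐ p : Space d × Space d, 0 ≤ q p.1 :=
      Measure.quasiMeasurePreserving_fst.ae hq0
    have h2 : ∀ᵐ p : Space d × Space d, 0 ≤ q p.2 :=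
      Measure.quasiMeasurePreserving_snd.ae hq0
    filter_upwards [h1, h2] with p h1 h2
    exact mul_nonneg (mul_nonneg h1 h2) (heatKernel_nonneg _ _)
  have hint : IntegrableOn (heatEnergy q) (Ioc 0 T) :=
    intervalIntegral.integrableOn_deriv_of_nonneg hGc (fun t ht => hGd t ht.1) hpos
  refine ⟨hint, ?_⟩
  have hFTC := intervalIntegral.integral_eq_sub_of_hasDerivAt_of_le hT.le hGc
    (fun t ht => hGd t ht.1) ((intervalIntegrable_iff_integrableOn_Ioc_of_le hT.le).2 hint)
  rw [intervalIntegral.integral_of_le hT.le, hG0, show G T = 2 * W T from if_neg (not_le.2 hT)] at hFTC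
  have hc := abs_heatPairing_of_weak_le hd hq hf hq0 hsupp hweak hT
  obtain ⟨b, hb, hbt⟩ := integrable_mul_heatProfile hd ha hR hq hq2 hsupp hT
  have hWi : Integrable fun x => q x * heatProfile d a T x :=
    hb.mono' (hq.aestronglyMeasurable.mul (aestronglyMeasurable_heatProfile d a _))
      (hbt.mono fun x hx => hx T hT le_rfl)
  set F := fluxConst d a
  have hF : 0 < F := fluxConst_pos d ha
  have hmx := heatMax_pos d hT
  have hprof : |(∫ x, q x * heatProfile d a T x) - 2 * F * heatLimit d a T| ≤
      2 * F * (F * heatMax d T * R ^ 2) := by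
    rw [← hm, ← integral_mul_const, ← integral_mul_const, ← integral_sub hWi (hq.mul_const _),
      ← Real.norm_eq_abs]
    refine norm_integral_le_of_norm_le (hq.mul_const _) ?_
    filter_upwards [ae_ne_zero (show d ≠ 0 by omega), hq0] with x hx hqx
    rw [← mul_sub, norm_mul, Real.norm_of_nonneg hqx]
    rcases le_or_gt ‖x‖ R with h | h
    · have hx2 : ‖x‖ ^ 2 ≤ R ^ 2 := by gcongr
      refine mul_le_mul_of_nonneg_left ?_ hqx
      exact (abs_heatProfile_sub_le hd ha hx hT (hx2.trans hRT)).trans (by gcongr)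
    · simp [hsupp x h]
  have hfin : 1 / 2 * (∫ t in Ioc 0 T, heatEnergy q t) - 2 * F * heatLimit d a T + ∫ x, q x * φ₀ x =
      heatPairing q f T + ((∫ x, q x * heatProfile d a T x) - 2 * F * heatLimit d a T) := by
    rw [hFTC]; simp only [hW]; ring
  have hd2 : (2 : ℝ) ≤ d := by
    have : 2 ≤ d := by omega
    exact_mod_cast this
  have hc2 : (∫ x, q x) ^ 2 * R ^ 2 / d * heatMax d T ≤ (2 * F) ^ 2 * R ^ 2 / 2 * heatMax d T := by
    rw [hm]; gcongr
  change |1 / 2 * (∫ t in Ioc 0 T, heatEnergy q t) - 2 * F * heatLimit d a T + ∫ x, q x * φ₀ x| ≤ _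
  rw [hfin]
  refine (abs_add_le _ _).trans ?_
  have : (2 * F) ^ 2 * R ^ 2 / 2 * heatMax d T + 2 * F * (F * heatMax d T * R ^ 2) =
      (2 * F) ^ 2 * R ^ 2 * heatMax d T := by ring
  linarith

end HeatIdentity

/-! ### The parameters -/

namespace Setup

open Set Filter Topology

variable {d : ℕ} (S : Setup d)

/-- With `X = -log (ρ a²) ≥ 1` both absolute values in the definition open with known sign, giving
`δ⁻¹ = X + log X`. -/
theorem inv_δ_eq (ha : 0 < S.a) (hρ : 0 < S.ρ) (hc : S.ρ * S.a ^ 2 ≤ Real.exp (-1)) :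
    0 < S.δ ∧ S.δ⁻¹ = -Real.log (S.ρ * S.a ^ 2) + Real.log (-Real.log (S.ρ * S.a ^ 2)) ∧
      1 ≤ -Real.log (S.ρ * S.a ^ 2) := by
  have hpos : 0 < S.ρ * S.a ^ 2 := by positivity
  have hX : Real.log (S.ρ * S.a ^ 2) ≤ -1 := by
    have := Real.log_le_log hpos hc
    rwa [Real.log_exp] at this
  set X := -Real.log (S.ρ * S.a ^ 2) with hXdef
  have hX1 : 1 ≤ X := by linarith
  have hlogX := Real.log_nonneg hX1
  have h1 : |Real.log (S.ρ * S.a ^ 2)| = X := abs_of_nonpos (by linarith)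
  have h2 : |Real.log (S.ρ * S.a ^ 2 * |Real.log (S.ρ * S.a ^ 2)|⁻¹)| = X + Real.log X := by
    rw [h1, Real.log_mul hpos.ne' (by positivity), Real.log_inv, abs_of_nonpos (by linarith)]
    linarith
  refine ⟨?_, ?_, hX1⟩
  · rw [δ, h2]; positivity
  · rw [δ, h2, one_div, inv_inv]

/-- In dimension two `δ` is only logarithmically small in `ρ a²`, which is why the diluteness
threshold is exponential in `Y`. -/
theorem small_pos_le (hd : d = 2 ∨ d = 3) (ha : 0 < S.a) (hρ : 0 < S.ρ) {Y : ℝ} (hY : 1 ≤ Y)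
    (hc : S.ρ * S.a ^ d ≤ Real.exp (-Y)) : 0 < S.small ∧ S.small ≤ Y⁻¹ := by
  have hY0 : 0 < Y := by linarith
  rcases hd with rfl | rfl
  · obtain ⟨h1, h2, h3⟩ := S.inv_δ_eq ha hρ (hc.trans (Real.exp_le_exp.2 (by linarith)))
    have h4 : Y ≤ -Real.log (S.ρ * S.a ^ 2) := by
      have := Real.log_le_log (by positivity) hc
      rw [Real.log_exp] at this
      linarith
    simp only [small, if_true]
    refine ⟨h1, ?_⟩
    rw [← inv_inv S.δ, h2]
    exact inv_anti₀ hY0 (by linarith [Real.log_nonneg h3])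
  · simp only [small, show (3 : ℕ) ≠ 2 by norm_num, if_false]
    refine ⟨by positivity, hc.trans ?_⟩
    rw [Real.exp_neg]
    exact inv_anti₀ hY0 (by linarith [Real.add_one_le_exp Y])

/-- With `C₀ σ^ζ ≤ 1 / 100`, each `≪` gains a factor `100`. Here `R K_ℓ⁶ ≤ ℓ` comes from the last
gap condition together with `K_ℓ⁴ ≪ K_L`, and `ε_+ K_ℓ² ≤ 1` from `K_ℓ⁴ ≪ K_L` and the upper bound
on `K_ℓ`. -/
theorem parameter_bounds (hd : d = 2 ∨ d = 3) {C₀ ζ : ℝ} (hθ0 : 0 ≤ C₀ * S.small ^ ζ)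
    (hθ : C₀ * S.small ^ ζ ≤ 1 / 100) (hσ : 0 < S.small) (hσ1 : S.small ≤ 1) (hg : 0 < S.g0)
    (hg0 : S.gHat 0 = S.g0) (hρ : 0 < S.ρ) (hR : 0 < S.R) (h : S.ParameterRelations C₀ ζ) :
    100 ≤ S.Kl ∧ S.small * S.Kl ^ 26 ≤ 1 ∧ 0 < S.ell ∧ S.ell ^ 2 * (S.ρ * S.g0) = S.Kl ^ 2 ∧
      S.R * S.Kl ^ 6 ≤ S.ell ∧ S.εplus * S.Kl ^ 2 ≤ 1 := by
  set θ := C₀ * S.small ^ ζ with hθd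
  have hK := h.Kl_pos
  have hKL := h.KL_pos
  have hK100 : 100 ≤ S.Kl := by
    have h1 : 1 ≤ θ * S.Kl := h.Kl_large
    nlinarith
  have hρg : 0 < S.ρ * S.g0 := by positivity
  have hell : 0 < S.ell := div_pos hK (Real.sqrt_pos.2 hρg)
  have hell2 : S.ell ^ 2 * (S.ρ * S.g0) = S.Kl ^ 2 := by
    rw [ell, div_pow, Real.sq_sqrt hρg.le]; field_simp
  have hKL4 : 100 * S.Kl ^ 4 ≤ S.KL := by
    have h1 : S.Kl ^ 4 ≤ θ * S.KL := h.Kl4_KL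
    nlinarith
  have hup : S.small * S.Kl ^ 26 ≤ 1 := by
    -- As `K_ℓ ≥ 1`, the exponent `28` of dimension three implies the statement with `26`, so one
    -- conclusion serves both dimensions.
    have key : ∀ n : ℕ, 26 ≤ n → S.Kl ≤ S.small ^ (-(1 / (n : ℝ)) : ℝ) → S.small * S.Kl ^ 26 ≤ 1 := by
      intro n hn hle
      have hn0 : (n : ℝ) ≠ 0 := by have : 0 < n := by omega
                                   positivity
      have h1 : S.Kl ^ n ≤ S.small⁻¹ := by
        calc S.Kl ^ n ≤ (S.small ^ (-(1 / (n : ℝ)) : ℝ)) ^ n := by gcongr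
          _ = S.small⁻¹ := by
            rw [← Real.rpow_natCast, ← Real.rpow_mul hσ.le, ← Real.rpow_neg_one]
            congr 1; field_simp
      have h2 : S.Kl ^ 26 ≤ S.Kl ^ n := pow_le_pow_right₀ (by linarith) hn
      calc S.small * S.Kl ^ 26 ≤ S.small * S.small⁻¹ :=
            mul_le_mul_of_nonneg_left (h2.trans h1) hσ.le
        _ = 1 := mul_inv_cancel₀ hσ.ne'
    have h1 := h.Kl_upper
    simp only [MuchLess] at h1
    rw [← hθd] at h1
    have hle1 : ∀ p : ℝ, 0 < p → S.Kl ≤ θ * p → S.Kl ≤ p := fun p hp hh => by nlinarith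
    rcases hd with rfl | rfl
    · rw [if_pos rfl] at h1
      have hs : S.small = S.δ := if_pos rfl
      rw [← hs] at h1
      have := hle1 _ (Real.rpow_pos_of_pos hσ _) h1
      exact key 26 le_rfl (by exact_mod_cast this)
    · rw [if_neg (by norm_num)] at h1
      have hs : S.small = S.ρ * S.a ^ 3 := if_neg (by norm_num)
      rw [← hs] at h1
      have := hle1 _ (Real.rpow_pos_of_pos hσ _) h1
      exact key 28 (by norm_num) (by exact_mod_cast this)
  refine ⟨hK100, hup, hell, hell2, ?_, ?_⟩
  · have h1 : S.R / S.ell * S.KL * S.ell ^ 2 * S.ρ * S.gHat 0 ≤ θ * S.εgap := h.gap₃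
    have h2 : S.εgap ≤ θ * 1 := h.εgap_small
    have h3 := h.εgap_pos
    have h4 : S.R / S.ell * S.KL * S.Kl ^ 2 ≤ 1 := by
      have : S.R / S.ell * S.KL * S.ell ^ 2 * S.ρ * S.gHat 0 = S.R / S.ell * S.KL * S.Kl ^ 2 := by
        rw [hg0, ← hell2]; ring
      rw [← this]
      nlinarith
    have h5 : S.R / S.ell * S.Kl ^ 6 ≤ 1 := by
      refine le_trans ?_ h4
      rw [show S.Kl ^ 6 = S.Kl ^ 4 * S.Kl ^ 2 by ring, ← mul_assoc]
      have : S.Kl ^ 4 ≤ S.KL := by nlinarith [pow_pos hK 4]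
      gcongr
    rwa [div_mul_eq_mul_div, div_le_one hell] at h5
  · have h1 : S.Kl ^ 2 * S.KL⁻¹ * S.Kl ^ 2 ≤ 1 := by
      rw [show S.Kl ^ 2 * S.KL⁻¹ * S.Kl ^ 2 = S.Kl ^ 4 / S.KL by rw [div_eq_mul_inv]; ring,
        div_le_one hKL]
      nlinarith [pow_pos hK 4]
    have hl0 : 0 ≤ S.lhyOrder S.ρ := by
      unfold lhyOrder
      split_ifs with h2
      · rw [small, if_pos h2] at hσ; exact hσ.le
      · exact Real.sqrt_nonneg _
    have hl : S.lhyOrder S.ρ * S.Kl ^ 4 ≤ 1 := by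
      have hs8 : S.small * S.Kl ^ 8 ≤ 1 := le_trans (mul_le_mul_of_nonneg_left
        (pow_le_pow_right₀ (by linarith) (by norm_num)) hσ.le) hup
      have hs4 : S.small * S.Kl ^ 4 ≤ 1 := le_trans (mul_le_mul_of_nonneg_left
        (pow_le_pow_right₀ (by linarith) (by norm_num)) hσ.le) hup
      unfold lhyOrder
      unfold small at hs8 hs4
      split_ifs with h2
      · rwa [if_pos h2] at hs4
      · rw [if_neg h2] at hs8
        rw [← Real.sqrt_sq (show 0 ≤ S.Kl ^ 4 by positivity), ← Real.sqrt_mul (by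
          rw [small, if_neg h2] at hσ; exact hσ.le)]
        refine Real.sqrt_le_one.2 ?_
        rw [← pow_mul]; exact hs8
    have h2 : Real.sqrt (S.lhyOrder S.ρ) * S.Kl ^ 2 ≤ 1 := by
      rw [← Real.sqrt_sq (show 0 ≤ S.Kl ^ 2 by positivity), ← Real.sqrt_mul hl0]
      refine Real.sqrt_le_one.2 ?_
      rw [← pow_mul]; exact hl
    rw [εplus, max_mul_of_nonneg _ _ (by positivity)]
    exact max_le h1 h2

/-! ### The interaction and its Fourier transform -/

/-- The normalization of the scattering solution. -/
noncomputable def scale : ℝ := if d = 2 then 2 * S.δ else 1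

theorem φ_eq (x : Space d) : S.φ x = S.scale * S.φ₀ x := by
  unfold φ scale; split_ifs <;> simp

theorem g_eq (x : Space d) : S.g x = S.scale * (S.v x * S.φ₀ x) := by
  rw [g, φ_eq]; ring

variable {S}

theorem g_eq_zero (hv : IsPotential S.v S.R) {x : Space d} (hx : S.R < ‖x‖) : S.g x = 0 := by
  rw [g, hv.eq_zero hx, zero_mul]

theorem integrable_g (hv : IsPotential S.v S.R)
    (hs : IsScatteringSolution S.v S.R S.a S.φ₀) : Integrable S.g :=
  ((hs.integrable hv).const_mul S.scale).congr (Eventually.of_forall fun x => (S.g_eq x).symm)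

theorem g0_eq (hd : d = 2 ∨ d = 3) (ha : 0 < S.a) (hv : IsPotential S.v S.R)
    (hs : IsScatteringSolution S.v S.R S.a S.φ₀) :
    S.g0 = S.scale * (2 * fluxConst d S.a) := by
  rw [g0, ← hs.integral_eq hd hv ha, ← integral_const_mul]
  exact integral_congr_ae (Eventually.of_forall fun x => S.g_eq x)

theorem mem_box_of_norm_le (hR : S.R ≤ S.ell / 4) (hell : 0 < S.ell) {x : Space d}
    (hx : ‖x‖ ≤ S.R) : x ∈ S.box := fun i => by
  have := PiLp.norm_apply_le x i
  rw [Real.norm_eq_abs] at this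
  linarith

/-- The support lies inside the box, so the coefficient is an integral over the whole space and its
real part is a cosine transform. -/
theorem fourier_eq_cosTransform (hR : S.R ≤ S.ell / 4) (hell : 0 < S.ell) {f : Space d → ℝ}
    (hf : Integrable f) (hsupp : ∀ x, S.R < ‖x‖ → f x = 0) (k : Space d) :
    S.fourier f k = cosTransform f k := by
  have hbox : S.box = ⋂ i, {x : Space d | |x i| ≤ S.ell / 2} := by
    ext x; simp [box]
  have hm : MeasurableSet S.box := by
    rw [hbox]
    exact MeasurableSet.iInter fun i => measurableSet_le (by fun_prop) measurable_const
  have h1 : ∫ x in S.box, (f x : ℂ) * Complex.exp (-Complex.I * ((inner ℝ k x : ℝ) : ℂ)) =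
      ∫ x, (f x : ℂ) * Complex.exp (-Complex.I * ((inner ℝ k x : ℝ) : ℂ)) := by
    refine setIntegral_eq_integral_of_forall_compl_eq_zero fun x hx => ?_
    rw [hsupp x]
    · simp
    · by_contra h
      exact hx (mem_box_of_norm_le hR hell (not_lt.1 h))
  have hi : Integrable fun x => (f x : ℂ) * Complex.exp (-Complex.I * ((inner ℝ k x : ℝ) : ℂ)) := by
    refine hf.ofReal.mul_bdd (c := 1) (Continuous.aestronglyMeasurable (by fun_prop))
      (Eventually.of_forall fun x => ?_)
    rw [show -Complex.I * ((inner ℝ k x : ℝ) : ℂ) = ((-inner ℝ k x : ℝ) : ℂ) * Complex.I by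
      push_cast; ring, Complex.norm_exp_ofReal_mul_I]
  rw [fourier, h1]
  have h2 := Complex.reCLM.integral_comp_comm hi
  simp only [Complex.reCLM_apply] at h2
  rw [← h2, cosTransform]
  refine integral_congr_ae (Eventually.of_forall fun x => ?_)
  simp only
  rw [show -Complex.I * ((inner ℝ k x : ℝ) : ℂ) = ((-inner ℝ k x : ℝ) : ℂ) * Complex.I by
      push_cast; ring, Complex.re_ofReal_mul, Complex.exp_ofReal_mul_I_re, Real.cos_neg]

theorem gHat_eq (hv : IsPotential S.v S.R) (hs : IsScatteringSolution S.v S.R S.a S.φ₀)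
    (hR : S.R ≤ S.ell / 4) (hell : 0 < S.ell) (k : Space d) : S.gHat k = cosTransform S.g k :=
  fourier_eq_cosTransform hR hell (integrable_g hv hs) (fun _ hx => g_eq_zero hv hx) k

theorem gHat_zero (hv : IsPotential S.v S.R) (hs : IsScatteringSolution S.v S.R S.a S.φ₀)
    (hR : S.R ≤ S.ell / 4) (hell : 0 < S.ell) : S.gHat 0 = S.g0 := by
  rw [gHat_eq hv hs hR hell]; simp [cosTransform, g0]

theorem gomHat_zero (hd : d = 2 ∨ d = 3) (ha : 0 < S.a) (hv : IsPotential S.v S.R)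
    (hs : IsScatteringSolution S.v S.R S.a S.φ₀) (hR : S.R ≤ S.ell / 4) (hell : 0 < S.ell) :
    S.gomHat 0 = S.g0 - S.scale ^ 2 * ∫ x, S.v x * S.φ₀ x * S.φ₀ x := by
  have hqφ : Integrable fun x => S.v x * S.φ₀ x * S.φ₀ x :=
    integrable_mul_of_memLp_ball hv.1 (hs.memLp_source hd hv ha)
      (fun x hx => by rw [hv.eq_zero hx, zero_mul]) (hs.memLp _)
  have e : ∀ x, S.g x * S.om x = S.g x - S.scale ^ 2 * (S.v x * S.φ₀ x * S.φ₀ x) := fun x => by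
    rw [om, φ_eq, g_eq]; ring
  have hi : Integrable fun x => S.g x * S.om x :=
    ((integrable_g hv hs).sub (hqφ.const_mul (S.scale ^ 2))).congr
      (Eventually.of_forall fun x => (e x).symm)
  rw [gomHat, fourier_eq_cosTransform hR hell hi fun x hx => by rw [g_eq_zero hv hx, zero_mul]]
  simp only [cosTransform, inner_zero_left, Real.cos_zero, mul_one]
  simp_rw [e]
  rw [integral_sub (integrable_g hv hs) (hqφ.const_mul _), integral_const_mul, g0]

theorem heatEnergy_g (t : ℝ) :
    heatEnergy S.g t = S.scale ^ 2 * heatEnergy (fun x => S.v x * S.φ₀ x) t := by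
  rw [heatEnergy, heatEnergy, ← integral_const_mul]
  refine integral_congr_ae (Eventually.of_forall fun p => ?_)
  simp only [g_eq]; ring

/-- The zeroth Fourier coefficient of `g ω` in terms of the heat energy of `g`. -/
theorem abs_gomHat_zero_sub_le (hd : d = 2 ∨ d = 3) (ha : 0 < S.a) (hv : IsPotential S.v S.R)
    (hs : IsScatteringSolution S.v S.R S.a S.φ₀) (hR : S.R ≤ S.ell / 4) (hell : 0 < S.ell) {T : ℝ}
    (hT : 0 < T) (hRT : S.R ^ 2 ≤ 4 * T) :
    IntegrableOn (heatEnergy S.g) (Ioc 0 T) ∧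
    |S.gomHat 0 - (1 / 2 * (∫ t in Ioc 0 T, heatEnergy S.g t) +
      S.g0 * (1 - S.scale * heatLimit d S.a T))| ≤ S.g0 ^ 2 * S.R ^ 2 * heatMax d T := by
  obtain ⟨h1, h2⟩ := hs.heatEnergy_integral hd hv ha hT hRT
  have e : heatEnergy S.g = fun t => S.scale ^ 2 * heatEnergy (fun x => S.v x * S.φ₀ x) t :=
    funext fun t => heatEnergy_g t
  rw [e]
  refine ⟨h1.const_mul _, ?_⟩
  rw [integral_const_mul, gomHat_zero hd ha hv hs hR hell, g0_eq hd ha hv hs]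
  set I := ∫ t in Ioc 0 T, heatEnergy (fun x => S.v x * S.φ₀ x) t
  set J := ∫ x, S.v x * S.φ₀ x * S.φ₀ x
  rw [show S.scale * (2 * fluxConst d S.a) - S.scale ^ 2 * J - (1 / 2 * (S.scale ^ 2 * I) +
    S.scale * (2 * fluxConst d S.a) * (1 - S.scale * heatLimit d S.a T)) =
    -(S.scale ^ 2 * (1 / 2 * I - 2 * fluxConst d S.a * heatLimit d S.a T + J)) by ring,
    abs_neg, abs_mul, abs_of_nonneg (sq_nonneg S.scale)]
  calc S.scale ^ 2 * |1 / 2 * I - 2 * fluxConst d S.a * heatLimit d S.a T + J|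
      ≤ S.scale ^ 2 * ((2 * fluxConst d S.a) ^ 2 * S.R ^ 2 * heatMax d T) :=
        mul_le_mul_of_nonneg_left h2 (sq_nonneg _)
    _ = _ := by ring

end Setup

/-! ### The sum of the excitation gaps -/

section GapSum

open Set Filter Topology

variable {d : ℕ}

/-- The power `1 / 2` is chosen for summability: multiplied by `|k|⁻⁴` it converges on a
three-dimensional lattice, whereas a linear bound would diverge logarithmically. -/
theorem one_sub_cos_le (u : ℝ) : 1 - Real.cos u ≤ 2 * Real.sqrt |u| := by
  rcases le_total |u| 1 with h | h
  · have h1 := Real.one_sub_sq_div_two_le_cos (x := u)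
    have h2 : |u| ≤ Real.sqrt |u| := by
      rw [Real.le_sqrt (abs_nonneg u) (abs_nonneg u)]
      nlinarith [abs_nonneg u]
    have h3 : u ^ 2 ≤ |u| := by rw [← sq_abs]; nlinarith [abs_nonneg u]
    linarith [abs_nonneg u]
  · have h1 := Real.neg_one_le_cos u
    have h2 : 1 ≤ Real.sqrt |u| := Real.one_le_sqrt.2 h
    linarith

theorem integrable_cosTransform {g : Space d → ℝ} (hg : Integrable g) (k : Space d) :
    Integrable fun x => g x * Real.cos (inner ℝ k x) :=
  hg.mul_bdd (c := 1) (Continuous.aestronglyMeasurable (by fun_prop))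
    (Eventually.of_forall fun x => by rw [Real.norm_eq_abs]; exact Real.abs_cos_le_one _)

theorem abs_cosTransform_sub_le {g : Space d → ℝ} {R : ℝ} (hg : Integrable g)
    (hg0 : ∀ᵐ x, 0 ≤ g x) (hsupp : ∀ x, R < ‖x‖ → g x = 0) (k : Space d) :
    |cosTransform g k - ∫ x, g x| ≤ 2 * Real.sqrt (R * ‖k‖) * ∫ x, g x := by
  rw [cosTransform, ← integral_sub (integrable_cosTransform hg k) hg, ← Real.norm_eq_abs,
    ← integral_const_mul]
  refine norm_integral_le_of_norm_le (hg.const_mul _) ?_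
  filter_upwards [hg0] with x hx
  by_cases hxR : R < ‖x‖
  · simp [hsupp x hxR]
  have h1 : |inner ℝ k x| ≤ R * ‖k‖ := by
    refine (abs_real_inner_le_norm k x).trans ?_
    rw [mul_comm]; gcongr; exact not_lt.1 hxR
  have h2 := one_sub_cos_le (inner ℝ k x)
  have h3 := Real.sqrt_le_sqrt h1
  have h4 := Real.cos_le_one (inner ℝ k x)
  rw [show g x * Real.cos (inner ℝ k x) - g x = -(g x * (1 - Real.cos (inner ℝ k x))) by ring,
    norm_neg, Real.norm_of_nonneg (mul_nonneg hx (by linarith)), mul_comm]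
  gcongr
  linarith

/-- At low momenta the phase stays below `1` on the support, where the cosine is positive. -/
theorem cosTransform_nonneg {g : Space d → ℝ} {R : ℝ} (hg0 : ∀ᵐ x, 0 ≤ g x)
    (hsupp : ∀ x, R < ‖x‖ → g x = 0) {k : Space d} (hk : R * ‖k‖ ≤ 1) :
    0 ≤ cosTransform g k := by
  refine integral_nonneg_of_ae ?_
  filter_upwards [hg0] with x hx
  by_cases hxR : R < ‖x‖
  · simp [hsupp x hxR]
  have h1 : |inner ℝ k x| ≤ 1 := by
    refine (abs_real_inner_le_norm k x).trans (le_trans ?_ hk)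
    rw [mul_comm]; gcongr; exact not_lt.1 hxR
  exact mul_nonneg hx (Real.cos_pos_of_le_one h1).le

theorem latticePoint_eq_smul (h : ℝ) (m : Fin d → ℤ) :
    latticePoint h m = h • latticePoint 1 m := by
  ext i; simp [latticePoint]

theorem norm_latticePoint {h : ℝ} (hh : 0 ≤ h) (m : Fin d → ℤ) :
    ‖latticePoint h m‖ = h * ‖latticePoint 1 m‖ := by
  rw [latticePoint_eq_smul, norm_smul, Real.norm_of_nonneg hh]

/-- Comparison with `(1 + |x|)^(-7/2)`, integrable because `7 / 2 > 3`, through the same cell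
estimate as for the Riemann sums. -/
theorem summable_sqrt_norm_div_pow (hd : d ≤ 3) :
    Summable fun m : Mode d => Real.sqrt ‖latticePoint 1 m.1‖ / ‖latticePoint 1 m.1‖ ^ 4 := by
  set F : Space d → ℝ := fun x => (1 + ‖x‖) ^ (-(7 / 2) : ℝ) with hF
  have hi : Integrable F := integrable_one_add_norm (E := Space d) (μ := volume) (r := 7 / 2)
    (by rw [finrank_euclideanSpace_fin]
        have : (d : ℝ) ≤ 3 := by exact_mod_cast hd
        linarith)
  have hF0 : ∀ x, 0 ≤ F x := fun x => by positivity
  have hcmp : ∀ m : Mode d, ∀ x ∈ latticeCell 1 m.1,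
      |F (latticePoint 1 m.1) - F x| ≤ (1 + 3 ^ (7 / 2 : ℝ)) * F x := fun m x hx => by
    have h1 := norm_sub_latticePoint_le one_pos (by omega) hx
    have h2 : ‖x‖ ≤ ‖latticePoint 1 m.1‖ + 2 := by
      have := norm_sub_norm_le x (latticePoint 1 m.1)
      linarith
    have h3 : F (latticePoint 1 m.1) ≤ 3 ^ (7 / 2 : ℝ) * F x := by
      calc F (latticePoint 1 m.1) ≤ ((1 + ‖x‖) / 3) ^ (-(7 / 2) : ℝ) :=
            Real.rpow_le_rpow_of_nonpos (by positivity)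
              (by linarith [norm_nonneg (latticePoint 1 m.1)]) (by norm_num)
        _ = 3 ^ (7 / 2 : ℝ) * F x := by
            rw [Real.div_rpow (by positivity) (by norm_num), Real.rpow_neg (by norm_num : (0 : ℝ) ≤ 3),
              div_inv_eq_mul, mul_comm]
    have := abs_sub (F (latticePoint 1 m.1)) (F x)
    rw [abs_of_nonneg (hF0 _), abs_of_nonneg (hF0 _)] at this
    linarith
  have hs := (abs_lattice_sum_sub_integral_le one_pos hi (hi.const_mul (1 + 3 ^ (7 / 2 : ℝ)))
    (fun x => mul_nonneg (by positivity) (hF0 x)) hcmp (b := 1) fun x => by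
      rw [abs_of_nonneg (hF0 x)]
      exact Real.rpow_le_one_of_one_le_of_nonpos (by linarith [norm_nonneg x]) (by norm_num)).1
  refine Summable.of_nonneg_of_le (fun m => by positivity) (fun m => ?_)
    (hs.mul_left (2 ^ (7 / 2 : ℝ)))
  have h1 := one_le_norm_latticePoint one_pos m
  set t := ‖latticePoint 1 m.1‖ with ht
  have ht0 : 0 < t := by linarith
  have e : Real.sqrt t / t ^ 4 = t ^ (-(7 / 2) : ℝ) := by
    rw [Real.sqrt_eq_rpow, ← Real.rpow_natCast, ← Real.rpow_sub ht0]; norm_num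
  rw [e]
  calc t ^ (-(7 / 2) : ℝ) ≤ ((1 + t) / 2) ^ (-(7 / 2) : ℝ) :=
        Real.rpow_le_rpow_of_nonpos (by positivity) (by linarith) (by norm_num)
    _ = 2 ^ (7 / 2 : ℝ) * (1 + t) ^ (-(7 / 2) : ℝ) := by
        rw [Real.div_rpow (by positivity) (by norm_num), Real.rpow_neg (by norm_num : (0 : ℝ) ≤ 2),
          div_inv_eq_mul, mul_comm]

set_option maxHeartbeats 1000000 in
/-- The sum of the excitation gaps of the quadratic Hamiltonian with interaction `r g` on the torus
of side `ℓ`. -/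
theorem exists_gap_sum_bound (hd : d = 2 ∨ d = 3) :
    ∃ C : ℝ, 0 < C ∧ ∀ (g : Space d → ℝ) (R ℓ r y₀ u : ℝ), Integrable g → (∀ᵐ x, 0 ≤ g x) →
      (∀ᵐ x, g (-x) = g x) → (∀ x, R < ‖x‖ → g x = 0) → 0 < R → R ≤ ℓ / 4 → 0 < ℓ → 0 < r →
      y₀ = r * ∫ x, g x → 0 < y₀ → u = ℓ * Real.sqrt y₀ → 2 * Real.pi ≤ u →
      2 * R * Real.sqrt y₀ ≤ 1 → IntegrableOn (heatEnergy g) (Ioc 0 y₀⁻¹) →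
      (∀ m : Mode d, ‖latticePoint (2 * Real.pi / ℓ) m.1‖ ^ 2 / 2 ≤
        ‖latticePoint (2 * Real.pi / ℓ) m.1‖ ^ 2 +
          2 * (r * cosTransform g (latticePoint (2 * Real.pi / ℓ) m.1))) ∧
      (Summable fun m : Mode d => (r * cosTransform g (latticePoint (2 * Real.pi / ℓ) m.1)) ^ 2 /
        ‖latticePoint (2 * Real.pi / ℓ) m.1‖ ^ 2) ∧
      |∑' m : Mode d, (‖latticePoint (2 * Real.pi / ℓ) m.1‖ ^ 2 +
          r * cosTransform g (latticePoint (2 * Real.pi / ℓ) m.1) -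
          Real.sqrt ((‖latticePoint (2 * Real.pi / ℓ) m.1‖ ^ 2) ^ 2 +
            2 * ‖latticePoint (2 * Real.pi / ℓ) m.1‖ ^ 2 *
              (r * cosTransform g (latticePoint (2 * Real.pi / ℓ) m.1)))) -
        (1 / 2 * r ^ 2 * ℓ ^ d * (∫ t in Ioc 0 y₀⁻¹, heatEnergy g t) -
          y₀ * (u / (2 * Real.pi)) ^ d * ∫ x : Space d, bogoliubovProfile ‖x‖)| ≤
        C * (y₀ * u ^ d * (u⁻¹ + u ^ 2 * Real.sqrt (R / ℓ))) := by
  obtain ⟨C₁, hC₁, hRS⟩ := exists_bogoliubov_riemann_sum_bound hd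
  have hd3 : d ≤ 3 := by omega
  have hS := summable_sqrt_norm_div_pow hd3
  set S₇ := ∑' m : Mode d, Real.sqrt ‖latticePoint 1 m.1‖ / ‖latticePoint 1 m.1‖ ^ 4
  have hS₇ : 0 ≤ S₇ := tsum_nonneg fun m => by positivity
  have hπ := Real.pi_gt_three
  refine ⟨torusConst + 1 + C₁ * (2 * Real.pi) + 8 * Real.sqrt (2 * Real.pi) * S₇,
    by have := torusConst_nonneg; positivity, ?_⟩
  intro g R ℓ r y₀ u hg hg0 heven hsupp hR hRℓ hℓ hr hy₀ hy₀pos hu huπ hRy hP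
  have hG : ∫ x, |g x| = ∫ x, g x := integral_congr_ae (by
    filter_upwards [hg0] with x hx using abs_of_nonneg hx)
  have hq := Real.sqrt_pos.2 hy₀pos
  have hq2 := Real.sq_sqrt hy₀pos.le
  set q := Real.sqrt y₀
  have hu1 : 1 ≤ u := by linarith
  have hu0 : 0 < u := by linarith
  have hu2 : u ^ 2 = ℓ ^ 2 * y₀ := by rw [hu, mul_pow, hq2]
  set p := 2 * Real.pi / ℓ with hp
  have hp0 : 0 < p := by positivity
  set h := 2 * Real.pi / u with hh
  have hh0 : 0 < h := by positivity
  have hh1 : h ≤ 1 := by rw [hh, div_le_one hu0]; exact huπ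
  have hpq : p = q * h := by rw [hp, hh, hu]; field_simp
  -- The regularization time is `1 / y₀`, the natural time scale of the dispersion relation. It
  -- stays below `ℓ²`, as the torus comparison requires, because `u ≥ 1`.
  have hT : (0 : ℝ) < y₀⁻¹ := by positivity
  have hTℓ : y₀⁻¹ ≤ ℓ ^ 2 := by
    rw [inv_le_iff_one_le_mul₀ hy₀pos, ← hu2]; nlinarith
  obtain ⟨hL1, hL2⟩ := abs_lattice_sum_sub_heatEnergy_le hd hg heven hsupp hRℓ hℓ hT hTℓ hP
  obtain ⟨hB1, hB2⟩ := hRS h hh0 hh1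
  rw [hG] at hL2
  set P := ∫ t in Ioc 0 y₀⁻¹, heatEnergy g t
  set J := ∫ x : Space d, bogoliubovProfile ‖x‖
  rw [← hp] at hL1 hL2
  have hxn : ∀ m : Mode d, ‖latticePoint p m.1‖ ^ 2 = y₀ * ‖latticePoint h m.1‖ ^ 2 := fun m => by
    rw [norm_latticePoint hp0.le, norm_latticePoint hh0.le, hpq, ← hq2]; ring
  have hx1 : ∀ m : Mode d, ‖latticePoint p m.1‖ = p * ‖latticePoint 1 m.1‖ := fun m =>
    norm_latticePoint hp0.le _
  have hxp : ∀ m : Mode d, p ≤ ‖latticePoint p m.1‖ := fun m => one_le_norm_latticePoint hp0 m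
  have hyabs : ∀ m : Mode d, |r * cosTransform g (latticePoint p m.1)| ≤ y₀ := fun m => by
    rw [abs_mul, abs_of_pos hr, hy₀, ← hG]
    exact mul_le_mul_of_nonneg_left (abs_cosTransform_le hg _) hr.le
  have hysub : ∀ m : Mode d, |r * cosTransform g (latticePoint p m.1) - y₀| ≤
      2 * Real.sqrt (R * ‖latticePoint p m.1‖) * y₀ := fun m => by
    rw [hy₀, ← mul_sub, abs_mul, abs_of_pos hr]
    have := mul_le_mul_of_nonneg_left (abs_cosTransform_sub_le hg hg0 hsupp (latticePoint p m.1)) hr.le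
    linarith
  -- If `R |k| ≤ 1` the coefficient is nonnegative. Otherwise `|k| ≥ 2 √y₀`, and then `|y| ≤ y₀ ≤ k²
  -- / 4`.
  have hynn : ∀ m : Mode d, ‖latticePoint p m.1‖ ^ 2 / 2 ≤ ‖latticePoint p m.1‖ ^ 2 +
      2 * (r * cosTransform g (latticePoint p m.1)) := fun m => by
    by_cases hc : R * ‖latticePoint p m.1‖ ≤ 1
    · have := mul_nonneg hr.le (cosTransform_nonneg hg0 hsupp hc)
      nlinarith [sq_nonneg ‖latticePoint p m.1‖]
    · have h1 : 2 * q ≤ ‖latticePoint p m.1‖ := by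
        by_contra h2
        exact hc (by nlinarith)
      have h2 := (abs_le.1 (hyabs m)).1
      nlinarith
  obtain ⟨x, hx⟩ : ∃ x : Mode d → ℝ, ∀ m, ‖latticePoint p m.1‖ ^ 2 = x m := ⟨_, fun _ => rfl⟩
  obtain ⟨y, hy⟩ : ∃ y : Mode d → ℝ, ∀ m, r * cosTransform g (latticePoint p m.1) = y m :=
    ⟨_, fun _ => rfl⟩
  have hxpos : ∀ m, 0 < x m := fun m => by rw [← hx]; have := hp0.trans_le (hxp m); positivity
  have hx0 : ∀ m, p ^ 2 ≤ x m := fun m => by rw [← hx]; have := hxp m; gcongr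
  have hterm : ∀ m, r ^ 2 * (cosTransform g (latticePoint p m.1) ^ 2 *
      (1 - Real.exp (-(y₀⁻¹ * x m))) / x m) =
      y m ^ 2 / x m * (1 - Real.exp (-(x m / y₀))) := fun m => by
    rw [← hy, inv_mul_eq_div]; ring
  simp only [hx] at hL1 hL2 hynn
  have hL1' := hL1.mul_left (r ^ 2)
  have hLsum : r ^ 2 * ∑' m : Mode d, (cosTransform g (latticePoint p m.1) ^ 2 *
      (1 - Real.exp (-(y₀⁻¹ * x m))) / x m) =
      ∑' m, y m ^ 2 / x m * (1 - Real.exp (-(x m / y₀))) := by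
    rw [← tsum_mul_left]; exact tsum_congr hterm
  simp only [hterm] at hL1'
  simp only [hx, hy] at hynn hyabs hysub ⊢
  -- The regularized series converges, and its damping factor is bounded below by its value at the
  -- smallest momentum `p`, so it can be divided out.
  have hsq : Summable fun m => y m ^ 2 / x m := by
    have hc0 : 0 < 1 - Real.exp (-(p ^ 2 / y₀)) := by
      have : Real.exp (-(p ^ 2 / y₀)) < 1 := by
        rw [Real.exp_lt_one_iff]; have : 0 < p ^ 2 / y₀ := by positivity
        linarith
      linarith
    refine Summable.of_nonneg_of_le (fun m => ?_) (fun m => ?_)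
      (hL1'.mul_left (1 - Real.exp (-(p ^ 2 / y₀)))⁻¹)
    · have := hxpos m; positivity
    · have h1 : 1 - Real.exp (-(p ^ 2 / y₀)) ≤ 1 - Real.exp (-(x m / y₀)) := by
        have := hx0 m
        gcongr
      have h2 : 0 ≤ y m ^ 2 / x m := by have := hxpos m; positivity
      calc y m ^ 2 / x m = (1 - Real.exp (-(p ^ 2 / y₀)))⁻¹ *
            (y m ^ 2 / x m * (1 - Real.exp (-(p ^ 2 / y₀)))) := by field_simp
        _ ≤ _ := by gcongr
  refine ⟨hynn, hsq, ?_⟩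
  -- the gap splits into its regularized value at `y₀`, the Gaussian part and an error
  have hdec : ∀ m, x m + y m - Real.sqrt (x m ^ 2 + 2 * x m * y m) =
      (reducedGap y₀ (x m) (y m) - reducedGap y₀ (x m) y₀) +
      (-(y₀ * bogoliubovProfile ‖latticePoint h m.1‖) +
      1 / 2 * (y m ^ 2 / x m * (1 - Real.exp (-(x m / y₀))))) := fun m => by
    have hm := hh0.trans_le (one_le_norm_latticePoint hh0 m)
    rw [← reducedGap_self hy₀pos hm, ← hxn, hx]
    have := (hxpos m).ne'
    simp only [reducedGap]
    field_simp
    ring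
  have hO3 : ∀ m, |reducedGap y₀ (x m) (y m) - reducedGap y₀ (x m) y₀| ≤
      8 * y₀ ^ 3 * Real.sqrt (R * p) / p ^ 4 *
        (Real.sqrt ‖latticePoint 1 m.1‖ / ‖latticePoint 1 m.1‖ ^ 4) := fun m => by
    refine (abs_reducedGap_sub_le (hxpos m) hy₀pos (hyabs m) (hynn m)).trans ?_
    calc 4 * (y₀ / x m) ^ 2 * |y m - y₀|
        ≤ 4 * (y₀ / x m) ^ 2 * (2 * Real.sqrt (R * ‖latticePoint p m.1‖) * y₀) := by
          gcongr; exact hysub m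
      _ = _ := by
          have h1 := hx1 m
          have h2 := hp0.trans_le (hxp m)
          rw [h1] at h2
          have h3 : 0 < ‖latticePoint 1 m.1‖ := pos_of_mul_pos_right h2 hp0.le
          rw [← hx, h1, ← mul_assoc R p, Real.sqrt_mul (by positivity : 0 ≤ R * p)]
          field_simp
          norm_num
  have hsO3 : Summable fun m => reducedGap y₀ (x m) (y m) - reducedGap y₀ (x m) y₀ :=
    Summable.of_norm_bounded (hS.mul_left _) hO3
  have hO3' : |∑' m, (reducedGap y₀ (x m) (y m) - reducedGap y₀ (x m) y₀)| ≤
      8 * y₀ ^ 3 * Real.sqrt (R * p) / p ^ 4 * S₇ := by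
    rw [← Real.norm_eq_abs]
    refine tsum_of_norm_bounded ?_ hO3
    exact hS.hasSum.mul_left _
  have htot : ∑' m, (x m + y m - Real.sqrt (x m ^ 2 + 2 * x m * y m)) =
      ∑' m, (reducedGap y₀ (x m) (y m) - reducedGap y₀ (x m) y₀) +
      (-(y₀ * ∑' m : Mode d, bogoliubovProfile ‖latticePoint h m.1‖) +
      1 / 2 * ∑' m, y m ^ 2 / x m * (1 - Real.exp (-(x m / y₀)))) := by
    rw [tsum_congr hdec, hsO3.tsum_add (((hB1.mul_left y₀).neg).add (hL1'.mul_left _)),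
      ((hB1.mul_left y₀).neg).tsum_add (hL1'.mul_left _), tsum_neg, tsum_mul_left, tsum_mul_left]
  rw [htot, ← hLsum]
  set SL := ∑' m : Mode d, cosTransform g (latticePoint p m.1) ^ 2 *
      (1 - Real.exp (-(y₀⁻¹ * x m))) / x m
  set SB := ∑' m : Mode d, bogoliubovProfile ‖latticePoint h m.1‖
  set SO := ∑' m, (reducedGap y₀ (x m) (y m) - reducedGap y₀ (x m) y₀)
  have hhu : u / (2 * Real.pi) = h⁻¹ := by rw [hh, inv_div]
  have hhd : 0 < h ^ d := by positivity
  -- the three errors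
  have b1 : |1 / 2 * (r ^ 2 * (SL - ℓ ^ d * P))| ≤ (torusConst + 1) * (y₀ * u ^ d * u⁻¹) := by
    rw [abs_mul, abs_mul, abs_of_pos (by norm_num : (0 : ℝ) < 1 / 2), abs_of_pos (by positivity)]
    have h1 : r ^ 2 * |SL - ℓ ^ d * P| ≤ (torusConst + 1) * y₀ := by
      calc r ^ 2 * |SL - ℓ ^ d * P| ≤ r ^ 2 * ((torusConst + 1) * y₀⁻¹ * (∫ x, g x) ^ 2) := by gcongr
        _ = (torusConst + 1) * y₀⁻¹ * (r * ∫ x, g x) ^ 2 := by ring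
        _ = (torusConst + 1) * y₀ := by rw [← hy₀]; field_simp
    have h2 : 1 ≤ u ^ d * u⁻¹ := by
      rw [← div_eq_mul_inv, one_le_div hu0]
      exact le_self_pow₀ hu1 (by omega)
    have h3 : 0 ≤ (torusConst + 1) * y₀ := by have := torusConst_nonneg; positivity
    calc 1 / 2 * (r ^ 2 * |SL - ℓ ^ d * P|) ≤ (torusConst + 1) * y₀ := by
          have := abs_nonneg (SL - ℓ ^ d * P)
          nlinarith [sq_nonneg r]
      _ ≤ (torusConst + 1) * y₀ * (u ^ d * u⁻¹) := le_mul_of_one_le_right h3 h2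
      _ = _ := by ring
  have b2 : |y₀ * h⁻¹ ^ d * (h ^ d * SB - J)| ≤ C₁ * (2 * Real.pi) * (y₀ * u ^ d * u⁻¹) := by
    rw [abs_mul, abs_of_pos (by positivity : 0 < y₀ * h⁻¹ ^ d)]
    calc y₀ * h⁻¹ ^ d * |h ^ d * SB - J| ≤ y₀ * u ^ d * (C₁ * h) := by
          gcongr
          rw [hh, inv_div, div_le_iff₀ (by positivity)]
          nlinarith
      _ = _ := by rw [hh]; field_simp
  have b3 : |SO| ≤ 8 * Real.sqrt (2 * Real.pi) * S₇ * (y₀ * u ^ d * (u ^ 2 * Real.sqrt (R / ℓ))) := by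
    refine hO3'.trans ?_
    have e1 : Real.sqrt (R * p) = Real.sqrt (2 * Real.pi) * Real.sqrt (R / ℓ) := by
      rw [← Real.sqrt_mul (by positivity), hp]; congr 1; ring
    -- Since `p = 2π / ℓ` and `u² = ℓ² y₀`, the left side is `y₀ u⁴ / (2π)⁴`, and `4 ≤ d + 2`.
    have e2 : y₀ ^ 3 / p ^ 4 ≤ y₀ * u ^ d * u ^ 2 := by
      have h1 : (1 : ℝ) ≤ (2 * Real.pi) ^ 4 := one_le_pow₀ (by linarith)
      have h2 : y₀ ^ 3 / p ^ 4 = y₀ * u ^ 4 / (2 * Real.pi) ^ 4 := by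
        rw [show u ^ 4 = (u ^ 2) ^ 2 by ring, hu2, hp]; field_simp
      rw [h2]
      calc y₀ * u ^ 4 / (2 * Real.pi) ^ 4 ≤ y₀ * u ^ 4 := div_le_self (by positivity) h1
        _ ≤ y₀ * u ^ (d + 2) := by gcongr <;> omega
        _ = _ := by ring
    rw [e1]
    calc 8 * y₀ ^ 3 * (Real.sqrt (2 * Real.pi) * Real.sqrt (R / ℓ)) / p ^ 4 * S₇ =
        y₀ ^ 3 / p ^ 4 * (8 * Real.sqrt (2 * Real.pi) * S₇ * Real.sqrt (R / ℓ)) := by ring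
      _ ≤ y₀ * u ^ d * u ^ 2 * (8 * Real.sqrt (2 * Real.pi) * S₇ * Real.sqrt (R / ℓ)) := by gcongr
      _ = _ := by ring
  have e : SO + (-(y₀ * SB) + 1 / 2 * (r ^ 2 * SL)) -
      (1 / 2 * r ^ 2 * ℓ ^ d * P - y₀ * (u / (2 * Real.pi)) ^ d * J) =
      SO - y₀ * h⁻¹ ^ d * (h ^ d * SB - J) + 1 / 2 * (r ^ 2 * (SL - ℓ ^ d * P)) := by
    rw [hhu, inv_pow]
    field_simp
    ring
  rw [e]
  have hΘ : 0 ≤ y₀ * u ^ d := by positivity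
  have t1 : 0 ≤ y₀ * u ^ d * u⁻¹ := by positivity
  have t2 : 0 ≤ y₀ * u ^ d * (u ^ 2 * Real.sqrt (R / ℓ)) := by positivity
  have t3 := torusConst_nonneg
  have t4 : 0 ≤ C₁ * (2 * Real.pi) := by positivity
  have t5 : 0 ≤ 8 * Real.sqrt (2 * Real.pi) * S₇ := by positivity
  have hab := (abs_add_le (SO - y₀ * h⁻¹ ^ d * (h ^ d * SB - J))
    (1 / 2 * (r ^ 2 * (SL - ℓ ^ d * P)))).trans (add_le_add_left (abs_sub _ _) _)
  refine hab.trans ?_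
  generalize 8 * Real.sqrt (2 * Real.pi) * S₇ = c3 at *
  generalize C₁ * (2 * Real.pi) = c2 at *
  rw [mul_add (y₀ * u ^ d)]
  generalize y₀ * u ^ d * u⁻¹ = s1 at *
  generalize y₀ * u ^ d * (u ^ 2 * Real.sqrt (R / ℓ)) = s2 at *
  nlinarith [mul_nonneg t4 t2, mul_nonneg t5 t1, mul_nonneg (add_nonneg t3 zero_le_one) t2]

end GapSum

/-! ### The ground state energy of the quadratic Hamiltonian -/

namespace Setup

open Set Filter Topology

variable {d : ℕ} (S : Setup d)

/-- The energy at density `ρ'` left over after extraction of the leading term and the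
Lee-Huang-Yang term. -/
noncomputable def remainder (ρ' : ℝ) : ℝ :=
  1 / 2 * ρ' ^ 2 * S.vol * S.gomHat 0 -
    1 / 2 * ∑' k : Mode d, (‖S.momentum k‖ ^ 2 + ρ' * S.gHat (S.momentum k) -
      Real.sqrt (‖S.momentum k‖ ^ 4 + 2 * ‖S.momentum k‖ ^ 2 * ρ' * S.gHat (S.momentum k))) -
    S.lhyEnergy ρ'

/-- The leading part of the remainder. -/
noncomputable def mainTerm (r : ℝ) : ℝ :=
  1 / 2 * r ^ 2 * S.vol * (S.g0 * (1 - S.scale * heatLimit d S.a (r * S.g0)⁻¹)) +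
    1 / 2 * (r * S.g0 * (S.ell * Real.sqrt (r * S.g0) / (2 * Real.pi)) ^ d *
      ∫ x : Space d, bogoliubovProfile ‖x‖) - S.lhyEnergy r

/-- The finite part `a / √(π T)` left by the heat flow at `T = 1 / (r g₀)` is exactly the Gaussian
correction `π √π` between the profile integral and the Bogoliubov integral. -/
theorem mainTerm_three (S : Setup 3) (ha : 0 < S.a) (hg0 : S.g0 = 8 * Real.pi * S.a)
    (hgH : S.gHat 0 = S.g0) {r : ℝ} (hr : 0 < r) : S.mainTerm r = 0 := by
  have hπ := Real.pi_pos
  have h2π : ((2 : ℝ) / Real.pi) ^ (((3 : ℕ) : ℝ) / 2) =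
      2 * Real.sqrt 2 / (Real.pi * Real.sqrt Real.pi) := by
    rw [show (((3 : ℕ) : ℝ) / 2) = 1 + 1 / 2 by norm_num, Real.rpow_add (by positivity),
      Real.rpow_one, ← Real.sqrt_eq_rpow, Real.sqrt_div (by norm_num)]
    field_simp
  have hI := bogoliubovIntegral_eq_add (d := 3) le_rfl cutoffProfile_three.1
  rw [cutoffProfile_three.2, h2π] at hI
  rw [mainTerm, lhyEnergy, hI, hgH, hg0, heatLimit, lhyOrder, scale, vol]
  simp only [show (3 : ℕ) ≠ 2 by norm_num, if_false]
  set J := ∫ x : Space 3, bogoliubovProfile ‖x‖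
  have e1 : Real.sqrt (r * (8 * Real.pi * S.a)) =
      2 * Real.sqrt 2 * Real.sqrt Real.pi * Real.sqrt (r * S.a) := by
    rw [show r * (8 * Real.pi * S.a) = 2 ^ 2 * 2 * Real.pi * (r * S.a) by ring,
      Real.sqrt_mul (by positivity), Real.sqrt_mul (by positivity), Real.sqrt_mul (by positivity),
      Real.sqrt_sq (by norm_num)]
  have e2 : Real.sqrt (r * S.a ^ 3) = S.a * Real.sqrt (r * S.a) := by
    rw [show r * S.a ^ 3 = S.a ^ 2 * (r * S.a) by ring, Real.sqrt_mul (by positivity),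
      Real.sqrt_sq ha.le]
  have e3 : Real.sqrt (Real.pi * (r * (8 * Real.pi * S.a))⁻¹) =
      (2 * Real.sqrt 2 * Real.sqrt (r * S.a))⁻¹ := by
    rw [show Real.pi * (r * (8 * Real.pi * S.a))⁻¹ = (2 ^ 2 * 2 * (r * S.a))⁻¹ by field_simp; norm_num,
      Real.sqrt_inv, Real.sqrt_mul (by positivity), Real.sqrt_mul (by positivity),
      Real.sqrt_sq (by norm_num)]
  rw [e1, e2, e3]
  have s2 := Real.sq_sqrt (show (0 : ℝ) ≤ 2 by norm_num)
  have sp := Real.sq_sqrt hπ.le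
  have sr := Real.sq_sqrt (mul_pos hr ha).le
  have p2 := Real.sqrt_pos.2 (show (0 : ℝ) < 2 by norm_num)
  have pp := Real.sqrt_pos.2 hπ
  have pr := Real.sqrt_pos.2 (mul_pos hr ha)
  generalize Real.sqrt 2 = w at *
  generalize Real.sqrt (r * S.a) = q at *
  generalize Real.sqrt Real.pi = t at *
  have sa : S.a = q ^ 2 / r := by rw [sr]; field_simp
  rw [sa, ← sp]
  field_simp
  ring_nf
  simp only [show w ^ 3 = w ^ 2 * w by ring, s2]
  ring

/-- Here `δ X = 1 / (1 + log X / X)`, so the logarithm is at most `log X / X`. With `log X ≤ 2 √X`,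
and `K² ≤ 2X` forced by `δ K^26 ≤ 1`, this is at most `4 / K`. -/
theorem log_order_le {X δ K : ℝ} (hK : 1 ≤ K) (hδ : 0 < δ) (hX : 1 ≤ X)
    (hδX : δ⁻¹ = X + Real.log X) (hδK : δ * K ^ 26 ≤ 1) :
    |Real.log (δ * X)| ≤ 4 / K := by
  have hX0 : 0 < X := by linarith
  have hl := Real.log_nonneg hX
  have hs := Real.sqrt_pos.2 hX0
  have hs2 := Real.sq_sqrt hX0.le
  have hlog : Real.log X ≤ 2 * Real.sqrt X := by
    have h1 := Real.log_le_sub_one_of_pos hs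
    rw [Real.log_sqrt hX0.le] at h1
    linarith
  have hlogX : Real.log X ≤ X := by linarith [Real.log_le_sub_one_of_pos hX0]
  have hKX : K ^ 2 ≤ 2 * X := by
    have h1 : K ^ 26 ≤ δ⁻¹ := by rwa [← one_div, le_div_iff₀ hδ, mul_comm]
    have h2 : K ^ 2 ≤ K ^ 26 := pow_le_pow_right₀ hK (by norm_num)
    linarith
  have hKs : K ≤ 2 * Real.sqrt X := by nlinarith
  have hδ' : δ = (X + Real.log X)⁻¹ := by rw [← hδX, inv_inv]
  have h1 : Real.log (δ * X) = -Real.log (1 + Real.log X / X) := by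
    rw [← Real.log_inv]; congr 1
    rw [hδ']; field_simp
  have h2 : 0 ≤ Real.log X / X := by positivity
  rw [h1, abs_neg, abs_of_nonneg (Real.log_nonneg (by linarith))]
  have h3 := Real.log_le_sub_one_of_pos (show 0 < 1 + Real.log X / X by linarith)
  have h4 : Real.log X / X ≤ 4 / K := by
    rw [div_le_div_iff₀ hX0 (by linarith)]
    calc Real.log X * K ≤ (2 * Real.sqrt X) * (2 * Real.sqrt X) := by gcongr
      _ = 4 * X := by rw [← hs2]; ring_nf; simp only [hs2]
  linarith

theorem abs_log_ratio_le {ρ r ε K : ℝ} (hρ : 0 < ρ) (hK : 100 ≤ K) (hε : ε * K ^ 2 ≤ 1)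
    (hr : |ρ - r| ≤ ρ * ε) : 0 < r ∧ ρ / 2 ≤ r ∧ r ≤ 2 * ρ ∧ |Real.log (r / ρ)| ≤ 2 / K := by
  have hK0 : 0 < K := by linarith
  have hεK : ε ≤ 1 / K * (1 / 100) := by
    rw [div_mul_div_comm, le_div_iff₀ (by positivity)]
    have h0 : 0 ≤ ρ * ε := (abs_nonneg _).trans hr
    have h1 : 0 ≤ ε := nonneg_of_mul_nonneg_right h0 hρ
    nlinarith [mul_nonneg h1 hK0.le]
  have hK1 : 1 / K ≤ 1 / 100 := one_div_le_one_div_of_le (by norm_num) hK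
  obtain ⟨h1, h2⟩ := abs_le.1 hr
  have hε2 : ε ≤ 1 / 2 := by linarith
  have a1 : ρ / 2 ≤ r := by nlinarith
  have a2 : r ≤ 2 * ρ := by nlinarith
  have hr0 : 0 < r := by linarith
  refine ⟨hr0, a1, a2, ?_⟩
  have u1 := Real.log_le_sub_one_of_pos (div_pos hr0 hρ)
  have u2 := Real.log_le_sub_one_of_pos (div_pos hρ hr0)
  rw [show ρ / r = (r / ρ)⁻¹ by rw [inv_div], Real.log_inv] at u2
  have v1 : r / ρ - 1 ≤ 1 / K := by
    rw [sub_le_iff_le_add, div_le_iff₀ hρ]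
    nlinarith
  have v2 : (r / ρ)⁻¹ - 1 ≤ 2 / K := by
    have h3 : 0 < 1 / K := by positivity
    rw [inv_div, sub_le_iff_le_add, div_le_iff₀ hr0, show 2 / K = 2 * (1 / K) by ring]
    nlinarith
  rw [abs_le]
  have : 1 / K ≤ 2 / K := by gcongr; norm_num
  constructor <;> linarith

/-- The constants `log (2π)` and `Γ` of `heatLimit` cancel against `cutoffProfile_two`; this singles
out the cut-off radius in the Bogoliubov integral. The normalization `δ (X + log X) = 1` then
absorbs the term `1` in `1 - 2δ · heatLimit`. -/
theorem mainTerm_two (S : Setup 2) (ha : 0 < S.a) (hρ : 0 < S.ρ)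
    (hc : S.ρ * S.a ^ 2 ≤ Real.exp (-1)) (hg0 : S.g0 = 8 * Real.pi * S.δ)
    (hgH : S.gHat 0 = S.g0) {r : ℝ} (hr : 0 < r) (hℓ : 0 < S.ell) :
    S.mainTerm r = 4 * Real.pi * (S.vol * r ^ 2 * S.δ ^ 2) *
      (Real.log (S.δ * (-Real.log (S.ρ * S.a ^ 2))) + Real.log (r / S.ρ)) := by
  obtain ⟨hδ, hδX, hX⟩ := S.inv_δ_eq ha hρ hc
  have hπ := Real.pi_pos
  have hI := bogoliubovIntegral_eq_add (d := 2) (by norm_num) cutoffProfile_two.1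
  rw [cutoffProfile_two.2, show (((2 : ℕ) : ℝ) / 2) = 1 by norm_num, Real.rpow_one] at hI
  have e1 : Real.log (4 * (r * (8 * Real.pi * S.δ))⁻¹ / S.a ^ 2) =
      -Real.log (2 * Real.pi) - Real.log S.δ - Real.log (r / S.ρ) - Real.log (S.ρ * S.a ^ 2) := by
    rw [show 4 * (r * (8 * Real.pi * S.δ))⁻¹ / S.a ^ 2 =
      (2 * Real.pi * S.δ * (r / S.ρ) * (S.ρ * S.a ^ 2))⁻¹ by field_simp; norm_num, Real.log_inv,
      Real.log_mul (by positivity) (by positivity), Real.log_mul (by positivity) (by positivity),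
      Real.log_mul (by positivity) (by positivity)]
    ring
  rw [mainTerm, lhyEnergy, hI, hgH, hg0, heatLimit, lhyOrder, scale, vol]
  simp only [if_true]
  rw [e1, Real.log_mul hδ.ne' (by linarith), div_pow, mul_pow, Real.sq_sqrt (by positivity)]
  set J := ∫ x : Space 2, bogoliubovProfile ‖x‖
  set X := -Real.log (S.ρ * S.a ^ 2) with hXd
  have hlr : Real.log (S.ρ * S.a ^ 2) = -X := by rw [hXd, neg_neg]
  rw [hlr]
  have h1 : S.δ * (X + Real.log X) = 1 := by rw [← hδX]; exact mul_inv_cancel₀ hδ.ne'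
  generalize Real.log X = LX at *
  generalize Real.log S.δ = Lδ
  generalize Real.log (r / S.ρ) = Lr
  generalize Real.log (2 * Real.pi) = Lp
  have hδne := hδ.ne'
  generalize S.δ = δ at *
  field_simp
  linear_combination (-32 * Real.pi) * h1

end Setup

/-! ### Error bounds for the remainder -/

namespace Setup

open Set Filter Topology

variable {d : ℕ} {S : Setup d}

theorem ae_g_nonneg (hd : d = 2 ∨ d = 3) (ha : 0 < S.a) (hv : IsPotential S.v S.R)
    (hs : IsScatteringSolution S.v S.R S.a S.φ₀) (hδ : 0 ≤ S.scale) : ∀ᵐ x, 0 ≤ S.g x := by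
  filter_upwards [hs.nonneg hd hv ha] with x hx
  rw [g_eq]
  exact mul_nonneg hδ (mul_nonneg (hv.2.1 x) hx)

theorem ae_g_even (hd : d = 2 ∨ d = 3) (hv : IsPotential S.v S.R)
    (hs : IsScatteringSolution S.v S.R S.a S.φ₀) : ∀ᵐ x, S.g (-x) = S.g x := by
  filter_upwards [hs.even hd hv] with x hx
  rw [g_eq, g_eq, hx, hv.2.2.1 (-x) x (norm_neg x)]

theorem scale_pos (hδ : d = 2 → 0 < S.δ) : 0 < S.scale := by
  unfold scale
  split_ifs with h
  · have := hδ h; positivity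
  · exact one_pos

/-- The natural size of the errors in terms of the density and the scattering length. -/
theorem volume_scale_le (hd : d = 2 ∨ d = 3) (ha : 0 < S.a) (hδ : d = 2 → 0 < S.δ)
    (hg0 : S.g0 = S.scale * (2 * fluxConst d S.a)) (hℓ : 0 < S.ell) (hK : 0 < S.Kl) {r : ℝ}
    (hr : 0 < r) :
    r * S.g0 * (S.ell * Real.sqrt (r * S.g0)) ^ d ≤ 1000 * Real.pi ^ 3 * (S.errorSize r * S.Kl) := by
  have hπ := Real.pi_gt_three
  rcases hd with rfl | rfl
  · have hδ0 := hδ rfl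
    have hg : S.g0 = 8 * Real.pi * S.δ := by rw [hg0, scale, fluxConst]; norm_num; ring
    rw [hg, mul_pow, Real.sq_sqrt (by positivity), errorSize, vol]
    simp only [if_true]
    have h0 : 0 ≤ S.ell ^ 2 * r ^ 2 * S.δ ^ 2 * Real.pi ^ 2 := by positivity
    calc r * (8 * Real.pi * S.δ) * (S.ell ^ 2 * (r * (8 * Real.pi * S.δ))) =
        64 * (S.ell ^ 2 * r ^ 2 * S.δ ^ 2 * Real.pi ^ 2) := by ring
      _ ≤ 1000 * Real.pi * (S.ell ^ 2 * r ^ 2 * S.δ ^ 2 * Real.pi ^ 2) := by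
        gcongr; linarith
      _ = _ := by field_simp
  · have hg : S.g0 = 8 * Real.pi * S.a := by rw [hg0, scale, fluxConst]; norm_num; ring
    rw [hg, errorSize, vol]
    simp only [show (3 : ℕ) ≠ 2 by norm_num, if_false]
    have e1 : Real.sqrt (r * (8 * Real.pi * S.a)) = Real.sqrt (8 * Real.pi) * Real.sqrt (r * S.a) := by
      rw [← Real.sqrt_mul (by positivity)]; congr 1; ring
    have e2 : (r * S.a ^ 3) ^ (1 / 2 : ℝ) = S.a * Real.sqrt (r * S.a) := by
      rw [← Real.sqrt_eq_rpow, show r * S.a ^ 3 = S.a ^ 2 * (r * S.a) by ring,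
        Real.sqrt_mul (by positivity), Real.sqrt_sq ha.le]
    have e3 : Real.sqrt (8 * Real.pi) ≤ 3 * Real.pi := by
      rw [Real.sqrt_le_left (by positivity)]; nlinarith
    have sr := Real.sq_sqrt (mul_pos hr ha).le
    have s8 := Real.sq_sqrt (show 0 ≤ 8 * Real.pi by positivity)
    have pr := Real.sqrt_pos.2 (mul_pos hr ha)
    rw [e1, e2]
    generalize Real.sqrt (r * S.a) = q at *
    generalize Real.sqrt (8 * Real.pi) = w at *
    calc r * (8 * Real.pi * S.a) * (S.ell * (w * q)) ^ 3 =
        8 * Real.pi * S.ell ^ 3 * (r * S.a) * (w ^ 2 * w) * q * q ^ 2 := by ring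
      _ = 64 * Real.pi ^ 2 * w * (S.ell ^ 3 * r ^ 2 * S.a * (S.a * q)) := by rw [sr, s8]; ring
      _ ≤ 64 * Real.pi ^ 2 * (3 * Real.pi) * (S.ell ^ 3 * r ^ 2 * S.a * (S.a * q)) := by gcongr
      _ = 192 * Real.pi ^ 3 * (S.ell ^ 3 * r ^ 2 * S.a * (S.a * q) * 1) := by ring
      _ ≤ 1000 * Real.pi ^ 3 * (S.ell ^ 3 * r ^ 2 * S.a * (S.a * q) * max 1 |Real.log r|) := by
        gcongr
        · norm_num
        · exact le_max_left _ _
      _ = _ := by field_simp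

theorem errorSize_nonneg (ha : 0 < S.a) (hℓ : 0 < S.ell) (hK : 0 < S.Kl) {r : ℝ} (hr : 0 < r) :
    0 ≤ S.errorSize r := by
  have : 0 < S.vol := pow_pos hℓ d
  unfold errorSize
  split_ifs
  · positivity
  · have : 0 ≤ max 1 |Real.log r| := zero_le_one.trans (le_max_left _ _)
    positivity

/-- In dimension two the constant is `4π (4 + 2)`, the two logarithms being at most `4 / K_ℓ` and `2
/ K_ℓ`; in dimension three the main term is zero. -/
theorem abs_mainTerm_le (hd : d = 2 ∨ d = 3) (ha : 0 < S.a) (hρ : 0 < S.ρ)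
    (hc : S.ρ * S.a ^ d ≤ Real.exp (-1)) (hg0 : S.g0 = S.scale * (2 * fluxConst d S.a))
    (hgH : S.gHat 0 = S.g0) (hℓ : 0 < S.ell) (hK : 100 ≤ S.Kl) (hσK : S.small * S.Kl ^ 26 ≤ 1)
    {r : ℝ} (hr : 0 < r) (hlog : |Real.log (r / S.ρ)| ≤ 2 / S.Kl) :
    |S.mainTerm r| ≤ 24 * Real.pi * S.errorSize r := by
  have hπ := Real.pi_pos
  have hK0 : 0 < S.Kl := by linarith
  have hE := errorSize_nonneg ha hℓ hK0 hr
  rcases hd with rfl | rfl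
  · obtain ⟨hδ, hδX, hX⟩ := S.inv_δ_eq ha hρ hc
    have hg : S.g0 = 8 * Real.pi * S.δ := by rw [hg0, scale, fluxConst]; norm_num; ring
    rw [S.mainTerm_two ha hρ hc hg hgH hr hℓ]
    rw [small, if_pos rfl] at hσK
    have h1 := log_order_le (by linarith) hδ hX hδX hσK
    have h2 := abs_add_le (Real.log (S.δ * (-Real.log (S.ρ * S.a ^ 2)))) (Real.log (r / S.ρ))
    have hvol : 0 < S.vol := pow_pos hℓ 2
    rw [abs_mul, abs_of_pos (by positivity), errorSize, if_pos rfl]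
    calc 4 * Real.pi * (S.vol * r ^ 2 * S.δ ^ 2) *
          |Real.log (S.δ * (-Real.log (S.ρ * S.a ^ 2))) + Real.log (r / S.ρ)|
        ≤ 4 * Real.pi * (S.vol * r ^ 2 * S.δ ^ 2) * (4 / S.Kl + 2 / S.Kl) := by
          gcongr; linarith
      _ = _ := by field_simp; norm_num
  · have hg : S.g0 = 8 * Real.pi * S.a := by rw [hg0, scale, fluxConst]; norm_num; ring
    rw [S.mainTerm_three ha hg hgH hr, abs_zero]
    positivity

set_option maxHeartbeats 1000000 in
/-- The remainder of the Lee-Huang-Yang expansion of the ground state energy, together with the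
facts on the dispersion relation needed to diagonalize. -/
theorem exists_remainder_bound (hd : d = 2 ∨ d = 3) :
    ∃ C : ℝ, 0 < C ∧ ∀ S : Setup d, IsPotential S.v S.R → 0 < S.a →
      IsScatteringSolution S.v S.R S.a S.φ₀ → 0 < S.ρ → S.ρ * S.a ^ d ≤ Real.exp (-1) →
      0 < S.scale → S.R ≤ S.ell / 4 → 0 < S.ell → 0 < S.g0 → 100 ≤ S.Kl →
      S.small * S.Kl ^ 26 ≤ 1 → S.ell ^ 2 * (S.ρ * S.g0) = S.Kl ^ 2 → S.R * S.Kl ^ 6 ≤ S.ell →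
      S.εplus * S.Kl ^ 2 ≤ 1 → ∀ r : ℝ, |S.ρ - r| ≤ S.ρ * S.εplus →
      (∀ k : Mode d, ‖S.momentum k‖ ^ 2 / 2 ≤
        ‖S.momentum k‖ ^ 2 + 2 * (r * S.gHat (S.momentum k))) ∧
      (Summable fun k : Mode d => (r * S.gHat (S.momentum k)) ^ 2 / ‖S.momentum k‖ ^ 2) ∧
      |S.remainder r| ≤ C * S.errorSize r := by
  obtain ⟨C₁, hC₁, hgap⟩ := exists_gap_sum_bound hd
  refine ⟨24 * Real.pi + (1 + 2 * C₁) * (1000 * Real.pi ^ 3),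
    by have := Real.pi_pos; positivity, ?_⟩
  intro S hv ha hs hρ hc hscale hR hℓ hg hK hσK hℓ2 hRK hεK r hrρ
  have hπ := Real.pi_pos
  have hπ4 := Real.pi_lt_four
  have hK0 : 0 < S.Kl := by linarith
  obtain ⟨hr, hr1, hr2, hlog⟩ := abs_log_ratio_le hρ hK hεK hrρ
  have hδ : d = 2 → 0 < S.δ := fun h => by
    rw [scale, if_pos h] at hscale; linarith
  have hg0 := g0_eq hd ha hv hs
  have hgH := gHat_zero hv hs hR hℓ
  have hy₀ : 0 < r * S.g0 := mul_pos hr hg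
  have hq := Real.sqrt_pos.2 hy₀
  have hq2 := Real.sq_sqrt hy₀.le
  -- The box length in units of the healing length at density `r`. At `r = ρ` it equals `K_ℓ`, and
  -- `r / 2 ≤ ρ ≤ 2 r` keeps it comparable to `K_ℓ`.
  obtain ⟨u, hu⟩ : ∃ u, u = S.ell * Real.sqrt (r * S.g0) := ⟨_, rfl⟩
  have hu0 : 0 < u := by rw [hu]; positivity
  have hu2 : u ^ 2 = S.ell ^ 2 * (r * S.g0) := by rw [hu, mul_pow, hq2]
  have hu2l : S.Kl ^ 2 / 2 ≤ u ^ 2 := by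
    rw [hu2, ← hℓ2]
    calc S.ell ^ 2 * (S.ρ * S.g0) / 2 = S.ell ^ 2 * (S.ρ / 2 * S.g0) := by ring
      _ ≤ _ := by gcongr
  have hu2u : u ^ 2 ≤ 2 * S.Kl ^ 2 := by
    rw [hu2, ← hℓ2]
    calc S.ell ^ 2 * (r * S.g0) ≤ S.ell ^ 2 * (2 * S.ρ * S.g0) := by gcongr
      _ = _ := by ring
  have huK : S.Kl / 2 ≤ u := by nlinarith
  have huK2 : u ≤ 2 * S.Kl := by nlinarith
  have huinv : u⁻¹ ≤ 2 / S.Kl := by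
    rw [show 2 / S.Kl = (S.Kl / 2)⁻¹ by rw [inv_div]]
    exact inv_anti₀ (by positivity) huK
  have hRl : S.R / S.ell ≤ (S.Kl ^ 6)⁻¹ := by
    rw [div_le_iff₀ hℓ, inv_mul_eq_div, le_div_iff₀ (by positivity)]; exact hRK
  have hRl0 : 0 < S.R / S.ell := div_pos hv.1 hℓ
  have hRq : S.R * Real.sqrt (r * S.g0) = S.R / S.ell * u := by rw [hu]; field_simp
  have hRu : S.R / S.ell * u ≤ 2 / S.Kl ^ 5 := by
    calc S.R / S.ell * u ≤ (S.Kl ^ 6)⁻¹ * (2 * S.Kl) := by gcongr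
      _ = _ := by field_simp
  have hK5 : 2 / S.Kl ^ 5 ≤ 1 / S.Kl := by
    rw [div_le_div_iff₀ (by positivity) hK0]
    have : (2 : ℝ) ≤ S.Kl ^ 4 := by
      have := pow_le_pow_left₀ (by norm_num) hK 4
      linarith
    nlinarith
  have hK1 : 1 / S.Kl ≤ 1 / 100 := one_div_le_one_div_of_le (by norm_num) hK
  have hT : (0 : ℝ) < (r * S.g0)⁻¹ := by positivity
  have hRT : S.R ^ 2 ≤ 4 * (r * S.g0)⁻¹ := by
    rw [← div_eq_mul_inv, le_div_iff₀ hy₀, ← hq2, ← mul_pow, hRq]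
    exact (pow_le_one₀ (mul_pos hRl0 hu0).le (by linarith)).trans (by norm_num)
  obtain ⟨hP, hgom⟩ := abs_gomHat_zero_sub_le hd ha hv hs hR hℓ hT hRT
  obtain ⟨c1, c2, c3⟩ := hgap S.g S.R S.ell r (r * S.g0) u (integrable_g hv hs)
    (ae_g_nonneg hd ha hv hs hscale.le) (ae_g_even hd hv hs) (fun x hx => g_eq_zero hv hx) hv.1 hR
    hℓ hr rfl hy₀ hu (by linarith) (by rw [mul_assoc, hRq]; linarith) hP
  have hgHk := gHat_eq hv hs hR hℓ
  simp only [← hgHk] at c1 c2 c3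
  refine ⟨c1, c2, ?_⟩
  have hsum : ∑' m : Mode d, (‖latticePoint (2 * Real.pi / S.ell) m.1‖ ^ 2 +
          r * S.gHat (latticePoint (2 * Real.pi / S.ell) m.1) -
          Real.sqrt ((‖latticePoint (2 * Real.pi / S.ell) m.1‖ ^ 2) ^ 2 +
            2 * ‖latticePoint (2 * Real.pi / S.ell) m.1‖ ^ 2 *
              (r * S.gHat (latticePoint (2 * Real.pi / S.ell) m.1)))) =
      ∑' k : Mode d, (‖S.momentum k‖ ^ 2 + r * S.gHat (S.momentum k) -
      Real.sqrt (‖S.momentum k‖ ^ 4 + 2 * ‖S.momentum k‖ ^ 2 * r * S.gHat (S.momentum k))) := by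
    refine tsum_congr fun k => ?_
    rw [show latticePoint (2 * Real.pi / S.ell) k.1 = S.momentum k from rfl]
    congr 2
    ring
  rw [hsum] at c3
  have hM := abs_mainTerm_le hd ha hρ hc hg0 hgH hℓ hK hσK hr hlog
  have hΘ := volume_scale_le hd ha hδ hg0 hℓ hK0 hr
  have hE := errorSize_nonneg ha hℓ hK0 hr
  rw [← hu] at hΘ
  unfold mainTerm at hM
  rw [← hu] at hM
  unfold remainder
  set gaps := ∑' k : Mode d, (‖S.momentum k‖ ^ 2 + r * S.gHat (S.momentum k) -
      Real.sqrt (‖S.momentum k‖ ^ 4 + 2 * ‖S.momentum k‖ ^ 2 * r * S.gHat (S.momentum k)))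
  set P := ∫ t in Ioc 0 (r * S.g0)⁻¹, heatEnergy S.g t
  set J := ∫ x : Space d, bogoliubovProfile ‖x‖
  set Θ := r * S.g0 * u ^ d
  have hvol : 0 < S.vol := pow_pos hℓ d
  have hΘ0 : 0 < Θ := by positivity
  set W := S.g0 * (1 - S.scale * heatLimit d S.a (r * S.g0)⁻¹)
  -- The scattering error is of relative order `R² / T = (u R / ℓ)²`, far below `1 / K_ℓ`.
  have b1 : |1 / 2 * r ^ 2 * S.vol * (S.gomHat 0 - (1 / 2 * P + W))| ≤ Θ / S.Kl := by
    have hmax : heatMax d (r * S.g0)⁻¹ ≤ Real.sqrt (r * S.g0) ^ d := by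
      unfold heatMax
      gcongr
      rw [← Real.sqrt_inv]
      refine Real.sqrt_le_sqrt ?_
      rw [mul_inv, inv_inv]
      exact mul_le_of_le_one_left hy₀.le (inv_le_one_of_one_le₀ (by linarith [Real.pi_gt_three]))
    rw [abs_mul, abs_of_pos (by positivity)]
    calc 1 / 2 * r ^ 2 * S.vol * |S.gomHat 0 - (1 / 2 * P + W)|
        ≤ 1 / 2 * r ^ 2 * S.vol * (S.g0 ^ 2 * S.R ^ 2 * Real.sqrt (r * S.g0) ^ d) := by
          gcongr
          exact hgom.trans (by gcongr)
      _ = 1 / 2 * Θ * (S.R ^ 2 * (r * S.g0)) := by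
          simp only [Θ, vol]; rw [hu, mul_pow]; ring
      _ = 1 / 2 * Θ * (S.R / S.ell * u) ^ 2 := by
          rw [← hRq, mul_pow, hq2]
      _ ≤ 1 / 2 * Θ * (1 / S.Kl) ^ 2 := by
          have := mul_pos hRl0 hu0
          have := hRu.trans hK5
          gcongr
      _ ≤ Θ / S.Kl := by
          rw [div_eq_mul_one_div Θ]
          have h0 : 0 < 1 / S.Kl := by positivity
          nlinarith [mul_pos hΘ0 h0]
  -- This is where six powers of `K_ℓ` in `R K_ℓ⁶ ≤ ℓ` are needed: the square root gives `K_ℓ⁻³`, of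
  -- which `u²` uses two.
  have b2 : C₁ * (Θ * (u⁻¹ + u ^ 2 * Real.sqrt (S.R / S.ell))) ≤ 4 * C₁ * (Θ / S.Kl) := by
    have h1 : Real.sqrt (S.R / S.ell) ≤ (S.Kl ^ 3)⁻¹ := by
      rw [Real.sqrt_le_left (by positivity), inv_pow, ← pow_mul]; exact hRl
    have h2 : u ^ 2 * Real.sqrt (S.R / S.ell) ≤ 2 / S.Kl := by
      calc u ^ 2 * Real.sqrt (S.R / S.ell) ≤ 2 * S.Kl ^ 2 * (S.Kl ^ 3)⁻¹ := by gcongr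
        _ = _ := by field_simp
    calc C₁ * (Θ * (u⁻¹ + u ^ 2 * Real.sqrt (S.R / S.ell))) ≤ C₁ * (Θ * (2 / S.Kl + 2 / S.Kl)) := by
          gcongr
      _ = _ := by ring
  -- The heat energy integral `P` enters through the coefficient of `g ω` and through the gaps with
  -- the same weight, and cancels; the first bracket is the main term.
  have e : 1 / 2 * r ^ 2 * S.vol * S.gomHat 0 - 1 / 2 * gaps - S.lhyEnergy r =
      (1 / 2 * r ^ 2 * S.vol * W + 1 / 2 * (r * S.g0 * (u / (2 * Real.pi)) ^ d * J) -
        S.lhyEnergy r) + (1 / 2 * r ^ 2 * S.vol * (S.gomHat 0 - (1 / 2 * P + W)) +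
      -(1 / 2 * (gaps - (1 / 2 * r ^ 2 * S.ell ^ d * P - r * S.g0 * (u / (2 * Real.pi)) ^ d * J)))) := by
    simp only [vol]; ring
  rw [e]
  have hΘK : Θ / S.Kl ≤ 1000 * Real.pi ^ 3 * S.errorSize r := by
    rw [div_le_iff₀ hK0]; linarith
  refine (abs_add_le _ _).trans ((add_le_add hM ((abs_add_le _ _).trans (add_le_add b1 ?_))).trans
    (b := 24 * Real.pi * S.errorSize r + (Θ / S.Kl + 2 * C₁ * (Θ / S.Kl))) ?_)
  · rw [abs_neg, abs_mul, abs_of_pos (by norm_num : (0 : ℝ) < 1 / 2)]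
    linarith
  · have h1 := mul_le_mul_of_nonneg_left hΘK (show 0 ≤ 1 + 2 * C₁ by positivity)
    linarith

/-- The diagonalized form of the quadratic Hamiltonian. -/
theorem qForm_eq (z : ℂ) {x₀ : ℝ} (hx₀ : 0 < x₀) (hx : ∀ k : Mode d, x₀ ≤ ‖S.momentum k‖ ^ 2)
    (hxy : ∀ k : Mode d, ‖S.momentum k‖ ^ 2 / 2 ≤ ‖S.momentum k‖ ^ 2 + 2 * S.B z k)
    (hs : Summable fun k : Mode d => S.B z k ^ 2 / ‖S.momentum k‖ ^ 2)
    {Φ Ψ : Fock d} (hΦ : S.FiniteKinetic Φ) (hΨ : S.FiniteKinetic Ψ) :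
    Summable (S.termA z Φ Ψ) ∧ Summable (S.termB z Φ Ψ) ∧ Summable (S.termD z Φ Ψ) ∧
      S.qForm z Φ Ψ = ((S.ρz z ^ 2 / 2 * S.vol * S.gHat 0 + S.lhyEnergy (S.ρz z) : ℝ) : ℂ) *
        inner ℂ Φ Ψ + S.kDiag z Φ Ψ + (S.remainder (S.ρz z) : ℂ) * inner ℂ Φ Ψ := by
  obtain ⟨h1, h2, h3, h4⟩ := S.kBog_eq_kDiag z hx₀ hx hxy hs hΦ hΨ
  refine ⟨h1, h2, h3, ?_⟩
  have e : S.remainder (S.ρz z) = 1 / 2 * S.ρz z ^ 2 * S.vol * S.gomHat 0 -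
    1 / 2 * ∑' k : Mode d, (S.A z k - S.D z k) - S.lhyEnergy (S.ρz z) := rfl
  rw [qForm, h4, e]
  push_cast
  ring

end Setup

end BoseGas

/-! ### Choice of the diluteness threshold and conclusion -/

theorem mainTheorem5 (d : ℕ) (hd : d = 2 ∨ d = 3) (C₀ ζ : ℝ) (hC₀ : 0 < C₀) (hζ : 0 < ζ) :
    ∃ c : ℝ, 0 < c ∧ ∀ M : ℝ, ∃ C : ℝ, 0 < C ∧
      ∀ S : BoseGas.Setup d,
        BoseGas.IsPotential S.v S.R →
        eLpNorm S.v 1 volume ≤ ENNReal.ofReal M →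
        eLpNorm S.v 2 volume ≤ ENNReal.ofReal M →
        BoseGas.IsScatteringLength S.v S.R S.a →
        BoseGas.IsScatteringSolution S.v S.R S.a S.φ₀ →
        0 < S.ρ → S.ρ * S.a ^ d ≤ c →
        S.ParameterRelations C₀ ζ →
        ∃ R₁ : ℝ → ℝ, ∀ z : ℂ, |S.ρ - S.ρz z| ≤ S.ρ * S.εplus →
          (∀ k : BoseGas.Mode d, 0 < S.Dsq z k ∧ |S.α z k| < 1) ∧
          |R₁ (S.ρz z)| ≤ C * S.errorSize (S.ρz z) ∧
          (∀ Ψ : BoseGas.Fock d, S.FiniteKinetic Ψ → ∀ k : BoseGas.Mode d,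
            Memℓp (BoseGas.annihilate k Ψ) 2 ∧ Memℓp (BoseGas.create k Ψ) 2) ∧
          ∀ Φ Ψ : BoseGas.Fock d, S.FiniteKinetic Φ → S.FiniteKinetic Ψ →
            Summable (S.termA z Φ Ψ) ∧ Summable (S.termB z Φ Ψ) ∧ Summable (S.termD z Φ Ψ) ∧
            S.qForm z Φ Ψ =
              ((S.ρz z ^ 2 / 2 * S.vol * S.gHat 0 + S.lhyEnergy (S.ρz z) : ℝ) : ℂ) *
                  inner ℂ Φ Ψ +
                S.kDiag z Φ Ψ + (R₁ (S.ρz z) : ℂ) * inner ℂ Φ Ψ := by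
  obtain ⟨C, hC, hbound⟩ := BoseGas.Setup.exists_remainder_bound hd
  -- With `ρ a^d ≤ e^{-Y}` the small parameter is at most `1 / Y`, so `C₀ σ^ζ ≤ 1 / 100`. The
  -- threshold depends on `C₀` and `ζ` only.
  set Y : ℝ := max 1 ((100 * C₀) ^ (1 / ζ)) with hY
  have hY1 : 1 ≤ Y := le_max_left _ _
  have hY0 : 0 < Y := by linarith
  have hYζ : 100 * C₀ ≤ Y ^ ζ := by
    calc 100 * C₀ = ((100 * C₀) ^ (1 / ζ)) ^ ζ := by
          rw [← Real.rpow_mul (by positivity), one_div, inv_mul_cancel₀ hζ.ne', Real.rpow_one]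
      _ ≤ Y ^ ζ := Real.rpow_le_rpow (by positivity) (le_max_right _ _) hζ.le
  refine ⟨Real.exp (-Y), Real.exp_pos _, fun M => ⟨C, hC, fun S hv _ _ hsl hs hρ hc hp => ?_⟩⟩
  have ha := hsl.1
  obtain ⟨hσ, hσY⟩ := S.small_pos_le hd ha hρ hY1 hc
  have hc1 : S.ρ * S.a ^ d ≤ Real.exp (-1) := hc.trans (Real.exp_le_exp.2 (by linarith))
  have hθ : C₀ * S.small ^ ζ ≤ 1 / 100 := by
    calc C₀ * S.small ^ ζ ≤ C₀ * (Y⁻¹) ^ ζ := by gcongr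
      _ = C₀ / Y ^ ζ := by rw [Real.inv_rpow hY0.le, div_eq_mul_inv]
      _ ≤ 1 / 100 := by
        rw [div_le_div_iff₀ (by positivity) (by norm_num)]
        linarith
  have hscale : 0 < S.scale := BoseGas.Setup.scale_pos fun h => by
    rwa [BoseGas.Setup.small, if_pos h] at hσ
  have hg : 0 < S.g0 := by
    rw [BoseGas.Setup.g0_eq hd ha hv hs]
    have := BoseGas.fluxConst_pos d ha
    positivity
  have hℓ : 0 < S.ell := div_pos hp.Kl_pos (Real.sqrt_pos.2 (mul_pos hρ hg))
  have hgH := BoseGas.Setup.gHat_zero hv hs hp.R_le hℓ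
  obtain ⟨hK, hσK, -, hℓ2, hRK, hεK⟩ := S.parameter_bounds hd (by positivity) hθ hσ
    (hσY.trans (inv_le_one_of_one_le₀ hY1)) hg hgH hρ hv.1 hp
  -- The error is taken to be the explicit remainder, a function of the density alone, so it depends
  -- on `z` only through `ρ_z`.
  refine ⟨S.remainder, fun z hz => ?_⟩
  obtain ⟨h1, h2, h3⟩ := hbound S hv ha hs hρ hc1 hscale hp.R_le hℓ hg hK hσK hℓ2 hRK hεK _ hz
  have hπ := Real.pi_pos
  have hx₀ : 0 < (2 * Real.pi / S.ell) ^ 2 := by positivity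
  have hx : ∀ k : BoseGas.Mode d, (2 * Real.pi / S.ell) ^ 2 ≤ ‖S.momentum k‖ ^ 2 := fun k =>
    pow_le_pow_left₀ (by positivity) (BoseGas.one_le_norm_latticePoint (by positivity) k) 2
  have hxpos := fun k => hx₀.trans_le (hx k)
  have hDsq : ∀ k, S.Dsq z k = (‖S.momentum k‖ ^ 2) ^ 2 +
      2 * ‖S.momentum k‖ ^ 2 * (S.ρz z * S.gHat (S.momentum k)) := fun k => by
    rw [BoseGas.Setup.Dsq]; ring
  refine ⟨fun k => ⟨?_, ?_⟩, h3, fun Ψ hΨ k => ?_, fun Φ Ψ hΦ hΨ =>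
    BoseGas.Setup.qForm_eq z hx₀ hx h1 h2 hΦ hΨ⟩
  · rw [hDsq]; exact BoseGas.dispersion_sq_pos (hxpos k) (h1 k)
  · rw [← sq_lt_one_iff_abs_lt_one, BoseGas.Setup.α, BoseGas.Setup.D, hDsq]
    exact BoseGas.angle_sq_lt_one (hxpos k) (h1 k)
  · have hocc := (S.kinetic_summable hΨ hxpos).1 k
    exact ⟨BoseGas.memℓp_two_of_summable (BoseGas.hasSum_normSq_annihilate hocc).summable,
      BoseGas.memℓp_two_of_summable
        (BoseGas.hasSum_normSq_create hocc (BoseGas.summable_normSq Ψ)).summable⟩
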